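/- Let $T>0$ (for instance a critical temperature $T=T_{\mathrm c}>0$) and $\mu\in\mathbb R$. For a continuous vector potential $a:\mathbb R^3\to\mathbb R^3$ let $(-\mathrm i\nabla+a)^2$ be the self-adjoint magnetic Laplacian on $L^2(\mathbb R^3)=L^2(\mathbb R^3;\mathbb C)$, and define by functional calculus $$K_{T,a}:=\frac{(-\mathrm i\nabla+a)^2-\mu}{\tanh\bigl(\frac{(-\mathrm i\nabla+a)^2-\mu}{2T}\bigr)},\qquad K_T:=K_{T,0},$$ where $t/\tanh(t/(2T)):=2T$ at $t=0$. Let $V:\mathbb R^3\to\mathbb R$ satisfy $(1+|\cdot|^2)V\in L^2(\mathbb R^3)\cap L^\infty(\mathbb R^3)$, and let $A\in W^{3,\infty}(\mathbb R^3;\mathbb R^3)$ (continuous representative) with $A(0)=0$. Put $\mathbf A_{e_3}(x):=\frac12 e_3\wedge x$, $\mathbf A:=\mathbf A_{e_3}+A$, $\mathbf A_h(x):=h\mathbf A(hx)$ and $\pi^2:=(-\mathrm i\nabla+\tfrac12h^2e_3\wedge x)^2$ for $h>0$. (a) Let $\lambda$ be an isolated eigenvalue (an eigenvalue that is an isolated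 point of the spectrum) of $K_T-V$ of finite multiplicity $m\ge1$, with spectral projection $P$. Then there are constants $\varepsilon,h_0,C>0$ such that for every $0<h\le h_0$ the spectrum of $K_{T,\mathbf A_h}-V$ in $\{z\in\mathbb C:|z-\lambda|<\varepsilon\}$ consists of $m$ eigenvalues $\lambda_1(h),\dots,\lambda_m(h)$, counted with multiplicity, and, with $P(h)$ the spectral projection of $K_{T,\mathbf A_h}-V$ belonging to them, $$\max_{i=1,\dots,m}|\lambda_i(h)-\lambda|\le Ch^2\qquad\text{and}\qquad\|P(h)-P\|\le Ch^2\quad\text{(operator norm)}.$$ (b) Assume that the lowest eigenvalue of $K_T-V$ exists, is simple and is an isolated point of the spectrum, and let $\alpha_*$ be a normalized eigenfunction for it. Then there are constants $h_0,C>0$ such that for every $0<h\le h_0$ the operator $K_{T,\mathbf A_h}-V$ has a lowest eigenvalue, this eigenvalue is simple, it has a normalized eigenfunction $\alpha_*^{\mathbf A_h}$ with $\langle\alpha_*,\alpha_*^{\mathbf A_h}\rangle\ge0$, and for every such eigenfunction $\alpha_*^{\mathbf A_h}-\alpha_*$ lies in the domain of $\pi^2$ and $$\bigl\|(1+\pi^2)(\alpha_*^{\mathbf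 A_h}-\alpha_*)\bigr\|_{2}\le Ch^2 .$$ The constants may depend on $T,\mu,V,A$ and on the eigenvalue considered. -/

import Mathlib

open MeasureTheory
open scoped ContDiff ENNReal InnerProductSpace

namespace MagneticBCS

/-! ### Unbounded operators on a complex Hilbert space -/

section Operators

variable {H : Type*} [NormedAddCommGroup H] [InnerProductSpace ℂ H]

/-- The bounded operator `R` is the two-sided inverse of the partially defined operator `S`. -/
def IsBoundedInverse (S : H →ₗ.[ℂ] H) (R : H →L[ℂ] H) : Prop :=
  (∀ x : S.domain, R (S x) = x) ∧ ∀ y : H, ∃ x : S.domain, (x : H) = R y ∧ S x = y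

/-- The bounded inverse of `S` (the value is `0` if there is none). -/
noncomputable def boundedInverse (S : H →ₗ.[ℂ] H) : H →L[ℂ] H :=
  open Classical in if h : ∃ R, IsBoundedInverse S R then h.choose else 0

/-- The operator `z - S`, with the domain of `S`. -/
def scalarSub (z : ℂ) (S : H →ₗ.[ℂ] H) : H →ₗ.[ℂ] H :=
  (z • (LinearMap.id : H →ₗ[ℂ] H)) +ᵥ (-S)

/-- The spectrum: all `z` for which `z - S` has no bounded inverse. -/
def opSpectrum (S : H →ₗ.[ℂ] H) : Set ℂ :=
  {z | ¬ ∃ R, IsBoundedInverse (scalarSub z S) R}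

/-- The eigenspace `ker (S - z)`: all `ψ` in the domain of `S` with `S ψ = z ψ`. -/
def opEigenspace (S : H →ₗ.[ℂ] H) (z : ℂ) : Submodule ℂ H :=
  S.graph.comap ((LinearMap.id : H →ₗ[ℂ] H).prod (z • LinearMap.id))

theorem mem_opEigenspace {S : H →ₗ.[ℂ] H} {z : ℂ} {ψ : H} :
    ψ ∈ opEigenspace S z ↔ ∃ hψ : ψ ∈ S.domain, S ⟨ψ, hψ⟩ = z • ψ := by
  simp [opEigenspace, LinearPMap.mem_graph_iff]

/-- The real number `l` is an eigenvalue of `S`. -/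
def IsEigenvalue (S : H →ₗ.[ℂ] H) (l : ℝ) : Prop :=
  opEigenspace S (l : ℂ) ≠ ⊥

/-- The real number `l` is an eigenvalue of `S` and an isolated point of the spectrum. -/
def IsIsolatedEigenvalue (S : H →ₗ.[ℂ] H) (l : ℝ) : Prop :=
  IsEigenvalue S l ∧ ∃ ε : ℝ, 0 < ε ∧ opSpectrum S ∩ Metric.ball (l : ℂ) ε = {(l : ℂ)}

/-- `l` is the lowest eigenvalue of `S`. -/
def IsLowestEigenvalue (S : H →ₗ.[ℂ] H) (l : ℝ) : Prop :=
  IsEigenvalue S l ∧ ∀ l' : ℝ, IsEigenvalue S l' → l ≤ l'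

/-- The spectral projection of a self-adjoint operator `S` belonging to a set `Λ` of isolated
eigenvalues: the orthogonal projection onto the closed span of their eigenspaces. -/
noncomputable def spectralProjection [CompleteSpace H] (S : H →ₗ.[ℂ] H) (Λ : Set ℝ) : H →L[ℂ] H :=
  (⨆ l ∈ Λ, opEigenspace S (l : ℂ)).topologicalClosure.starProjection

/-- The continuous functional calculus of a nonnegative self-adjoint operator `S` for continuous
functions `f : [0, ∞) → ℝ` vanishing at infinity. With `R = (1 + S)⁻¹`, whose spectrum lies in
`[0, 1]`, one has `f(S) = g(R)` for the continuous function `g(r) = f(r⁻¹ - 1)`, `g(0) = 0`. -/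
noncomputable def c0Calculus [CompleteSpace H] (f : ℝ → ℝ) (S : H →ₗ.[ℂ] H) : H →L[ℂ] H :=
  cfc (fun r : ℝ => if r = 0 then 0 else f (r⁻¹ - 1))
    (boundedInverse ((LinearMap.id : H →ₗ[ℂ] H) +ᵥ S))

end Operators

/-! ### Function spaces on `ℝ³` -/

/-- Euclidean three-space. -/
abbrev R3 : Type := EuclideanSpace ℝ (Fin 3)

/-- The Hilbert space `L²(ℝ³; ℂ)`. -/
abbrev L2 : Type := Lp ℂ 2 (volume : Measure R3)

/-- The partial derivative `∂ⱼ φ`. -/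
noncomputable def pderiv {F : Type*} [NormedAddCommGroup F] [NormedSpace ℝ F]
    (j : Fin 3) (φ : R3 → F) (x : R3) : F :=
  fderiv ℝ φ x (EuclideanSpace.single j 1)

/-- `g` is the weak partial derivative `∂ⱼ f` of the (locally integrable) function `f`. -/
def IsWeakPartialDeriv (j : Fin 3) (f g : R3 → ℝ) : Prop :=
  ∀ φ : R3 → ℝ, ContDiff ℝ ∞ φ → HasCompactSupport φ →
    ∫ x, f x * pderiv j φ x = -∫ x, g x * φ x

/-- Membership in the Sobolev space `W^{k,∞}(ℝ³)`: all weak derivatives of order at most `k` exist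
and are essentially bounded. -/
def MemSobolevInfty : ℕ → (R3 → ℝ) → Prop
  | 0, f => MemLp f ∞ volume
  | k + 1, f => MemLp f ∞ volume ∧
      ∀ j : Fin 3, ∃ g : R3 → ℝ, IsWeakPartialDeriv j f g ∧ MemSobolevInfty k g

/-! ### The magnetic Laplacian -/

/-- `χ = (-i ∂ⱼ + aⱼ) ψ` in the sense of distributions, for `ψ, χ ∈ L²(ℝ³)`: one has
`⟨(-i ∂ⱼ + aⱼ) φ, ψ⟩ = ⟨φ, χ⟩` for all test functions `φ ∈ C_c^∞(ℝ³; ℂ)`. The variables `u`, `w`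
are the `L²`-classes of `φ` and of `(-i ∂ⱼ + aⱼ) φ`. -/
def IsMagneticDeriv (a : R3 → R3) (j : Fin 3) (ψ χ : L2) : Prop :=
  ∀ φ : R3 → ℂ, ContDiff ℝ ∞ φ → HasCompactSupport φ → ∀ u w : L2,
    (u : R3 → ℂ) =ᵐ[volume] φ →
    (w : R3 → ℂ) =ᵐ[volume] (fun x => -Complex.I * pderiv j φ x + ((a x j : ℝ) : ℂ) * φ x) →
    ⟪w, ψ⟫_ℂ = ⟪u, χ⟫_ℂ

theorem IsMagneticDeriv.add {a : R3 → R3} {j : Fin 3} {ψ χ ψ' χ' : L2}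
    (h : IsMagneticDeriv a j ψ χ) (h' : IsMagneticDeriv a j ψ' χ') :
    IsMagneticDeriv a j (ψ + ψ') (χ + χ') := fun φ h1 h2 u w hu hw => by
  rw [inner_add_right, inner_add_right, h φ h1 h2 u w hu hw, h' φ h1 h2 u w hu hw]

theorem IsMagneticDeriv.smul {a : R3 → R3} {j : Fin 3} {ψ χ : L2} (c : ℂ)
    (h : IsMagneticDeriv a j ψ χ) : IsMagneticDeriv a j (c • ψ) (c • χ) :=
  fun φ h1 h2 u w hu hw => by
    rw [inner_smul_right, inner_smul_right, h φ h1 h2 u w hu hw]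

theorem IsMagneticDeriv.zero (a : R3 → R3) (j : Fin 3) : IsMagneticDeriv a j 0 0 :=
  fun φ h1 h2 u w hu hw => by rw [inner_zero_right, inner_zero_right]

/-- The graph of the self-adjoint operator associated with the closed quadratic form
`ψ ↦ ∑ⱼ ‖(-i ∂ⱼ + aⱼ) ψ‖²` on the magnetic Sobolev space
`H¹_a = {v ∈ L² : (-i ∂ⱼ + aⱼ) v ∈ L² for all j}`: all pairs `(ψ, f)` with `ψ ∈ H¹_a` and
`∑ⱼ ⟨(-i ∂ⱼ + aⱼ) v, (-i ∂ⱼ + aⱼ) ψ⟩ = ⟨v, f⟩` for all `v ∈ H¹_a`. -/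
def magneticLaplacianGraph (a : R3 → R3) : Submodule ℂ (L2 × L2) where
  carrier := {p | ∃ χ : Fin 3 → L2, (∀ j, IsMagneticDeriv a j p.1 (χ j)) ∧
    ∀ (v : L2) (w : Fin 3 → L2), (∀ j, IsMagneticDeriv a j v (w j)) →
      ∑ j, ⟪w j, χ j⟫_ℂ = ⟪v, p.2⟫_ℂ}
  zero_mem' := ⟨fun _ => 0, fun j => IsMagneticDeriv.zero a j, fun v w _ => by simp⟩
  add_mem' := by
    rintro p q ⟨χ, h1, h2⟩ ⟨χ', h1', h2'⟩
    refine ⟨fun j => χ j + χ' j, fun j => (h1 j).add (h1' j), fun v w hv => ?_⟩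
    simp only [inner_add_right, Finset.sum_add_distrib, Prod.snd_add, h2 v w hv, h2' v w hv]
  smul_mem' := by
    rintro c p ⟨χ, h1, h2⟩
    refine ⟨fun j => c • χ j, fun j => (h1 j).smul c, fun v w hv => ?_⟩
    simp only [inner_smul_right, ← Finset.mul_sum, Prod.smul_snd, h2 v w hv]

/-- The magnetic Laplacian `(-i ∇ + a)²` on `L²(ℝ³)`. -/
noncomputable def magneticLaplacian (a : R3 → R3) : L2 →ₗ.[ℂ] L2 :=
  (magneticLaplacianGraph a).toLinearPMap

/-! ### The operators `K_{T,a} - V` -/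

/-- The function `t ↦ (t - μ) / tanh ((t - μ) / (2T))`, continuously extended by `2T` to `t = μ`.
The symbol of the operator without magnetic field is its value at `t = p²`. -/
noncomputable def bcsSymbol (T μ t : ℝ) : ℝ :=
  if t = μ then 2 * T else (t - μ) / Real.tanh ((t - μ) / (2 * T))

/-- The operator `K_{T,a} = k((-i ∇ + a)²)` with `k(t) = (t - μ) / tanh ((t - μ) / (2T))`. As
`k(t) = (t - μ) + r(t)`, where `r` is continuous and vanishes at infinity, this is
`(-i ∇ + a)² - μ` plus the bounded operator `r((-i ∇ + a)²)`. -/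
noncomputable def bcsKinetic (T μ : ℝ) (a : R3 → R3) : L2 →ₗ.[ℂ] L2 :=
  (-((μ : ℂ) • (LinearMap.id : L2 →ₗ[ℂ] L2)) +
    (c0Calculus (fun t => bcsSymbol T μ t - (t - μ)) (magneticLaplacian a)).toLinearMap) +ᵥ
      magneticLaplacian a

/-- The graph of the multiplication operator by `V`. -/
def mulGraph (V : R3 → ℝ) : Submodule ℂ (L2 × L2) where
  carrier := {p | (p.2 : R3 → ℂ) =ᵐ[volume] fun x => (V x : ℂ) * p.1 x}
  zero_mem' := by
    filter_upwards [Lp.coeFn_zero ℂ 2 (volume : Measure R3)] with x hx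
    simp
  add_mem' := by
    intro p q hp hq
    filter_upwards [hp, hq, Lp.coeFn_add p.1 q.1, Lp.coeFn_add p.2 q.2] with x h1 h2 h3 h4
    simp only [Prod.snd_add, Prod.fst_add, h3, h4, Pi.add_apply, h1, h2]
    ring
  smul_mem' := by
    intro c p hp
    filter_upwards [hp, Lp.coeFn_smul c p.1, Lp.coeFn_smul c p.2] with x h1 h3 h4
    simp only [Prod.smul_snd, Prod.smul_fst, h3, h4, Pi.smul_apply, h1, smul_eq_mul]
    ring

/-- The operator of multiplication by `V` on `L²(ℝ³)`, with its maximal domain. -/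
noncomputable def mulOperator (V : R3 → ℝ) : L2 →ₗ.[ℂ] L2 :=
  (mulGraph V).toLinearPMap

/-- The operator `K_{T,a} - V`. -/
noncomputable def bcsOperator (T μ : ℝ) (a : R3 → R3) (V : R3 → ℝ) : L2 →ₗ.[ℂ] L2 :=
  bcsKinetic T μ a - mulOperator V

/-- The potential `½ e₃ ∧ x` of the constant magnetic field `e₃`. -/
noncomputable def constFieldPotential (x : R3) : R3 :=
  !₂[-(x 1) / 2, x 0 / 2, 0]

/-- The rescaled potential `x ↦ h B(h x)`. -/
def rescale (h : ℝ) (B : R3 → R3) (x : R3) : R3 :=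
  h • B (h • x)

/-- The full magnetic potential `𝐀_h(x) = h 𝐀(h x)` with `𝐀(x) = ½ e₃ ∧ x + A(x)`. -/
noncomputable def fullPotential (A : R3 → R3) (h : ℝ) : R3 → R3 :=
  rescale h (fun x => constFieldPotential x + A x)

/-- The operator `π² = (-i ∇ + ½ h² e₃ ∧ x)²` of the constant field alone. -/
noncomputable def piSq (h : ℝ) : L2 →ₗ.[ℂ] L2 :=
  magneticLaplacian (rescale h constFieldPotential)

end MagneticBCS

open MagneticBCS

namespace MagneticBCS

/-! ### Test functions and multiplication operators -/

/-! The potential `𝐀_h` vanishes at the origin and is Lipschitz with constant O(h²): one power of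
`h` comes from its prefactor and one from its argument. It grows linearly, so resolvents with and
without field are not compared in operator norm. They are compared on functions `f` for which
`(1+|x|²) f` is square integrable. There the perturbation terms `2a·∇u`, `(div a) u` and `|a|² u`
are all O(h²) (`HasMagLaplacian.change`). Multiplication by `V` maps L² into such functions, so
`(X_h - X_0) V = O(h²)` in norm, where `X_h` is the inverse of `K - e` with field
(`exists_norm_kinRes_sub_le`). This is the only smallness used.

The comparison needs `X_0` to preserve weights. The reciprocal of the symbol is a sum of partial
fractions with poles `μ ± iη_n`, so the inverse of `K` is a series of resolvents of the magnetic
Laplacian (`tendsto_sum_resAt`). Commutators of these resolvents with a weight are explicit and of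
size `η^(-1/2)` or better. With coefficients of size `η^(-1)` the series converges.

An isolated eigenvalue `l` lies strictly below the minimum of the symbol, since everything above
that minimum is spectrum (`lt_symbolMin_of_isolated`). Hence `K - l` is invertible, and the
eigenvalue equation becomes the Birman–Schwinger equation `ψ = X(l) V ψ`, in which only `X V`
occurs.

Spectral statements are proved for the bounded self-adjoint operator `G`, the inverse of `K - V +
c`, near `g = 1/(l+c)`. Let `P` be the projection onto the unperturbed eigenspace. Through the
Birman–Schwinger equation, `(G_h - g) P = O(h²)` (`norm_quasimode_le`), and `G_h - g` stays bounded
below on the complement of `P` (`le_norm_of_perturbed_resolvent`). Then the spectrum of `G_h` near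
`g` is within O(h²) of `g`, its spectral projection is within O(h²) of `P`, and so the ranks agree
(`exists_eigenvalues_of_approximate_projection`). Inverting `λ ↦ 1/(λ+c)` gives (a).

For (b), the operator `X_0 V` is compact because `V` is in L². So without field the spectrum below
the minimum of the symbol consists of eigenvalues, and none lies below `l`. A perturbation argument
excludes eigenvalues below `l - ε` with field (`lt_of_isEigenvalue_weak_field`), so the eigenvalue
from (a) is the lowest. The projection estimate gives `β - α = O(h²)` in L². The equations for `α`
and `β` upgrade this to the graph norm of `(-i∇ + 𝐀_h)²`. Passing to `π²` is one more change of
potential by an O(h²)-Lipschitz field, applied to a function with decay. -/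

/-- The `L²`-class of a square-integrable function (the value is `0` for all other functions). -/
noncomputable def toL2 (f : R3 → ℂ) : L2 :=
  open Classical in if h : MemLp f 2 volume then h.toLp f else 0

theorem coeFn_toL2 {f : R3 → ℂ} (h : MemLp f 2 volume) : (toL2 f : R3 → ℂ) =ᵐ[volume] f := by
  rw [toL2, dif_pos h]; exact h.coeFn_toLp

theorem eq_toL2 {f : R3 → ℂ} {u : L2} (h : (u : R3 → ℂ) =ᵐ[volume] f) : u = toL2 f := by
  have hf : MemLp f 2 volume := (Lp.memLp u).ae_eq h
  exact Lp.ext (h.trans (coeFn_toL2 hf).symm)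

/-- Smooth compactly supported complex functions. -/
structure IsTest (φ : R3 → ℂ) : Prop where
  contDiff : ContDiff ℝ ∞ φ
  compact : HasCompactSupport φ

theorem IsTest.memLp {φ : R3 → ℂ} (h : IsTest φ) : MemLp φ 2 volume :=
  h.contDiff.continuous.memLp_of_hasCompactSupport h.compact

theorem contDiff_pderiv {F : Type*} [NormedAddCommGroup F] [NormedSpace ℝ F] {φ : R3 → F}
    (h : ContDiff ℝ ∞ φ) (j : Fin 3) : ContDiff ℝ ∞ (pderiv j φ) :=
  (h.fderiv_right (m := ∞) (by simp)).clm_apply contDiff_const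

theorem continuous_pderiv {F : Type*} [NormedAddCommGroup F] [NormedSpace ℝ F] {φ : R3 → F}
    (h : ContDiff ℝ 1 φ) (j : Fin 3) : Continuous (pderiv j φ) :=
  (h.continuous_fderiv (by simp)).clm_apply continuous_const

theorem hasCompactSupport_pderiv {F : Type*} [NormedAddCommGroup F] [NormedSpace ℝ F] {φ : R3 → F}
    (h : HasCompactSupport φ) (j : Fin 3) : HasCompactSupport (pderiv j φ) := by
  refine (h.fderiv (𝕜 := ℝ)).mono fun x hx => ?_
  simp only [Function.mem_support] at hx ⊢
  contrapose! hx
  simp [pderiv, hx]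

theorem IsTest.pderiv {φ : R3 → ℂ} (h : IsTest φ) (j : Fin 3) : IsTest (pderiv j φ) :=
  ⟨contDiff_pderiv h.contDiff j, hasCompactSupport_pderiv h.compact j⟩

theorem IsTest.smul {φ : R3 → ℂ} (h : IsTest φ) {w : R3 → ℝ} (hw : ContDiff ℝ ∞ w) :
    IsTest (fun x => (w x : ℂ) * φ x) :=
  ⟨(Complex.ofRealCLM.contDiff.comp hw).mul h.contDiff, h.compact.mul_left⟩

/-- The function `(-i ∂ⱼ + aⱼ) φ`. -/
noncomputable def magD (a : R3 → R3) (j : Fin 3) (φ : R3 → ℂ) (x : R3) : ℂ :=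
  -Complex.I * pderiv j φ x + ((a x j : ℝ) : ℂ) * φ x

theorem continuous_apply_R3 {a : R3 → R3} (ha : Continuous a) (j : Fin 3) :
    Continuous fun x => a x j := by fun_prop

theorem continuous_magD {a : R3 → R3} (ha : Continuous a) (j : Fin 3) {φ : R3 → ℂ}
    (h : ContDiff ℝ 1 φ) : Continuous (magD a j φ) := by
  have := continuous_pderiv h j
  have := h.continuous
  have := continuous_apply_R3 ha j
  unfold magD
  fun_prop

theorem IsTest.magD_memLp {a : R3 → R3} (ha : Continuous a) (j : Fin 3) {φ : R3 → ℂ}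
    (h : IsTest φ) : MemLp (magD a j φ) 2 volume := by
  refine (continuous_magD ha j (h.contDiff.of_le (by simp))).memLp_of_hasCompactSupport ?_
  exact ((hasCompactSupport_pderiv h.compact j).mul_left).add h.compact.mul_left

theorem isMagneticDeriv_iff {a : R3 → R3} (ha : Continuous a) {j : Fin 3} {ψ χ : L2} :
    IsMagneticDeriv a j ψ χ ↔
      ∀ φ, IsTest φ → ⟪toL2 (magD a j φ), ψ⟫_ℂ = ⟪toL2 φ, χ⟫_ℂ := by
  constructor
  · intro h φ hφ
    exact h φ hφ.contDiff hφ.compact _ _ (coeFn_toL2 hφ.memLp) (coeFn_toL2 (hφ.magD_memLp ha j))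
  · intro h φ h1 h2 u w hu hw
    rw [eq_toL2 hu, eq_toL2 hw]
    exact h φ ⟨h1, h2⟩

theorem inner_toL2 {f g : R3 → ℂ} {u v : L2} (hu : (u : R3 → ℂ) =ᵐ[volume] f)
    (hv : (v : R3 → ℂ) =ᵐ[volume] g) : ⟪u, v⟫_ℂ = ∫ x, (starRingEnd ℂ) (f x) * g x := by
  rw [L2.inner_def]
  refine integral_congr_ae ?_
  filter_upwards [hu, hv] with x h1 h2
  simp [RCLike.inner_apply, h1, h2, mul_comm]

/-- Test functions are dense in `L²`. -/
theorem eq_zero_of_inner_test {ψ : L2} (h : ∀ φ, IsTest φ → ⟪toL2 φ, ψ⟫_ℂ = 0) : ψ = 0 := by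
  have hloc : LocallyIntegrable (ψ : R3 → ℂ) volume :=
    (Lp.memLp ψ).locallyIntegrable (by norm_num)
  have := ae_eq_zero_of_integral_contDiff_smul_eq_zero hloc fun g hg hc => by
    have hT : IsTest fun x => (g x : ℂ) :=
      ⟨Complex.ofRealCLM.contDiff.comp hg, hc.comp_left (g := fun t : ℝ => (t : ℂ)) (by simp)⟩
    have h1 := h _ hT
    rw [inner_toL2 (coeFn_toL2 hT.memLp) (Filter.EventuallyEq.refl _ _)] at h1
    simpa using h1
  exact Lp.ext (by filter_upwards [this, Lp.coeFn_zero ℂ 2 (volume : Measure R3)] with x h1 h2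
                   simp [h1])

theorem eq_of_inner_test {ψ χ : L2} (h : ∀ φ, IsTest φ → ⟪toL2 φ, ψ⟫_ℂ = ⟪toL2 φ, χ⟫_ℂ) :
    ψ = χ :=
  sub_eq_zero.mp (eq_zero_of_inner_test fun φ hφ => by rw [inner_sub_right, h φ hφ, sub_self])

theorem dense_test : Dense (Submodule.span ℂ {u : L2 | ∃ φ, IsTest φ ∧ u = toL2 φ} : Set L2) := by
  rw [Submodule.dense_iff_topologicalClosure_eq_top, Submodule.topologicalClosure_eq_top_iff,
    Submodule.eq_bot_iff]
  intro ψ hψ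
  exact eq_zero_of_inner_test fun φ hφ =>
    (Submodule.mem_orthogonal _ _).1 hψ _ (Submodule.subset_span ⟨φ, hφ, rfl⟩)

theorem IsMagneticDeriv.unique {a : R3 → R3} (ha : Continuous a) {j : Fin 3} {ψ χ χ' : L2}
    (h : IsMagneticDeriv a j ψ χ) (h' : IsMagneticDeriv a j ψ χ') : χ = χ' :=
  eq_of_inner_test fun φ hφ => by
    rw [← (isMagneticDeriv_iff ha).1 h φ hφ, ← (isMagneticDeriv_iff ha).1 h' φ hφ]

/-- Classical derivatives are weak derivatives. -/
theorem isMagneticDeriv_of_contDiff {a : R3 → R3} (ha : Continuous a) (j : Fin 3) {f : R3 → ℂ}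
    (hf : ContDiff ℝ 1 f) (h1 : MemLp f 2 volume) (h2 : MemLp (magD a j f) 2 volume) :
    IsMagneticDeriv a j (toL2 f) (toL2 (magD a j f)) := by
  rw [isMagneticDeriv_iff ha]
  intro φ hφ
  rw [inner_toL2 (coeFn_toL2 (hφ.magD_memLp ha j)) (coeFn_toL2 h1),
    inner_toL2 (coeFn_toL2 hφ.memLp) (coeFn_toL2 h2)]
  -- With the conjugate of `φ` the inner products become integrals of plain products. Its compact
  -- support makes every integral converge, whatever the growth of `f` and `a`.
  set g : R3 → ℂ := fun x => (starRingEnd ℂ) (φ x) with hg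
  have hgd : ContDiff ℝ ∞ g := Complex.conjCLE.contDiff.comp hφ.contDiff
  have hgs : HasCompactSupport g := hφ.compact.comp_left (g := starRingEnd ℂ) (by simp)
  have hgp : ∀ x, pderiv j g x = (starRingEnd ℂ) (pderiv j φ x) := by
    intro x
    have := Complex.conjCLE.toContinuousLinearMap.hasFDerivAt.comp x
      (hφ.contDiff.differentiable (by simp) x).hasFDerivAt
    simp only [pderiv]
    rw [show g = Complex.conjCLE.toContinuousLinearMap ∘ φ from rfl, this.fderiv]
    rfl
  have hfp := continuous_pderiv hf j
  have hgpc := continuous_pderiv (hgd.of_le (m := 1) (by simp)) j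
  have ha' := continuous_apply_R3 ha j
  have hfc := hf.continuous
  have hgc := hgd.continuous
  have i1 : Integrable (fun x => pderiv j g x * f x) volume :=
    (hgpc.mul hfc).integrable_of_hasCompactSupport (hasCompactSupport_pderiv hgs j).mul_right
  have i2 : Integrable (fun x => g x * pderiv j f x) volume :=
    (hgc.mul hfp).integrable_of_hasCompactSupport hgs.mul_right
  have i3 : Integrable (fun x => g x * f x) volume :=
    (hgc.mul hfc).integrable_of_hasCompactSupport hgs.mul_right
  have i4 : Integrable (fun x => ((a x j : ℝ) : ℂ) * (g x * f x)) volume :=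
    ((Complex.continuous_ofReal.comp ha').mul (hgc.mul hfc)).integrable_of_hasCompactSupport
      (hgs.mul_right.mul_left)
  have key := integral_mul_fderiv_eq_neg_fderiv_mul_of_integrable
    (v := EuclideanSpace.single j (1 : ℝ)) i1 i2 i3
    (fun x _ => hgd.differentiable (by simp) x) (fun x _ => hf.differentiable (by simp) x)
  have e1 : ∀ x, (starRingEnd ℂ) (magD a j φ x) * f x =
      Complex.I * (pderiv j g x * f x) + ((a x j : ℝ) : ℂ) * (g x * f x) := by
    intro x; rw [hgp]; simp [magD, hg]; ring
  have e2 : ∀ x, (starRingEnd ℂ) (φ x) * magD a j f x =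
      -Complex.I * (g x * pderiv j f x) + ((a x j : ℝ) : ℂ) * (g x * f x) := by
    intro x; simp [magD, hg]; ring
  simp_rw [e1, e2]
  rw [integral_add (i1.const_mul _) i4, integral_add (i2.const_mul _) i4, integral_const_mul,
    integral_const_mul]
  change _ = -Complex.I * (∫ x, g x * fderiv ℝ f x _) + _
  rw [key]; simp only [pderiv]; ring

theorem isMagneticDeriv_test {a : R3 → R3} (ha : Continuous a) (j : Fin 3) {φ : R3 → ℂ}
    (h : IsTest φ) : IsMagneticDeriv a j (toL2 φ) (toL2 (magD a j φ)) :=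
  isMagneticDeriv_of_contDiff ha j (h.contDiff.of_le (by simp)) h.memLp (h.magD_memLp ha j)

/-- Essentially bounded real functions. -/
def IsBdd (m : R3 → ℝ) : Prop := MemLp (fun x => (m x : ℂ)) ∞ volume

theorem IsBdd.of_continuous {m : R3 → ℝ} (hm : Continuous m) {C : ℝ} (hC : ∀ x, |m x| ≤ C) :
    IsBdd m :=
  memLp_top_of_bound (Complex.continuous_ofReal.comp hm).aestronglyMeasurable C
    (Filter.Eventually.of_forall fun x => by simpa using hC x)

/-- Multiplication by a bounded real function, as a bounded operator on `L²`. -/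
noncomputable def mulB (m : R3 → ℝ) : L2 →L[ℂ] L2 :=
  open Classical in if h : IsBdd m then
    (ContinuousLinearMap.lsmul ℂ ℂ).holderL volume ∞ 2 2 (h.toLp _) else 0

theorem coeFn_mulB {m : R3 → ℝ} (h : IsBdd m) (u : L2) :
    (mulB m u : R3 → ℂ) =ᵐ[volume] fun x => (m x : ℂ) * u x := by
  rw [mulB, dif_pos h]
  have := (ContinuousLinearMap.lsmul ℂ ℂ (E := ℂ)).coeFn_holder (r := 2) (h.toLp _) u
  filter_upwards [this, h.coeFn_toLp] with x h1 h2
  change ((ContinuousLinearMap.lsmul ℂ ℂ).holder 2 (h.toLp _) u : R3 → ℂ) x = _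
  rw [h1, h2]; rfl

theorem mem_mulGraph {m : R3 → ℝ} {u v : L2} :
    (u, v) ∈ mulGraph m ↔ (v : R3 → ℂ) =ᵐ[volume] fun x => (m x : ℂ) * u x := Iff.rfl

theorem mem_mulGraph_mulB {m : R3 → ℝ} (h : IsBdd m) (u : L2) : (u, mulB m u) ∈ mulGraph m :=
  coeFn_mulB h u

theorem mulB_eq_toL2 {m : R3 → ℝ} (h : IsBdd m) {f : R3 → ℂ} (hf : MemLp f 2 volume) :
    mulB m (toL2 f) = toL2 fun x => (m x : ℂ) * f x := by
  refine eq_toL2 ?_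
  filter_upwards [coeFn_mulB h (toL2 f), coeFn_toL2 hf] with x h1 h2
  rw [h1, h2]

theorem mulGraph_unique {m : R3 → ℝ} {u v v' : L2} (h : (u, v) ∈ mulGraph m)
    (h' : (u, v') ∈ mulGraph m) : v = v' :=
  Lp.ext (Filter.EventuallyEq.trans (show _ =ᵐ[volume] _ from h)
    (Filter.EventuallyEq.symm (show _ =ᵐ[volume] _ from h')))

theorem inner_mulGraph {m : R3 → ℝ} {u u' v v' : L2} (h : (u, u') ∈ mulGraph m)
    (h' : (v, v') ∈ mulGraph m) : ⟪u', v⟫_ℂ = ⟪u, v'⟫_ℂ := by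
  rw [inner_toL2 (show _ =ᵐ[volume] _ from h) (Filter.EventuallyEq.refl _ _),
    inner_toL2 (Filter.EventuallyEq.refl _ _) (show _ =ᵐ[volume] _ from h')]
  refine integral_congr_ae (Filter.Eventually.of_forall fun x => ?_)
  simp; ring

theorem inner_mulB {m : R3 → ℝ} (h : IsBdd m) (u v : L2) :
    ⟪mulB m u, v⟫_ℂ = ⟪u, mulB m v⟫_ℂ :=
  inner_mulGraph (mem_mulGraph_mulB h u) (mem_mulGraph_mulB h v)

theorem norm_le_of_ae {C : ℝ} {u v : L2} (h : ∀ᵐ x, ‖(u : R3 → ℂ) x‖ ≤ C * ‖(v : R3 → ℂ) x‖) :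
    ‖u‖ ≤ C * ‖v‖ := Lp.norm_le_mul_norm_of_ae_le_mul h

theorem mulGraph_mul {m m' m'' : R3 → ℝ} {u v w : L2} (h : (u, v) ∈ mulGraph m)
    (h' : (v, w) ∈ mulGraph m') (e : ∀ x, m'' x = m' x * m x) : (u, w) ∈ mulGraph m'' := by
  rw [mem_mulGraph] at h h' ⊢
  filter_upwards [h, h'] with x h1 h2
  rw [h2, h1, e]; push_cast; ring

theorem norm_le_of_mulGraph {m m' : R3 → ℝ} {u v w : L2} {C : ℝ} (h : (u, v) ∈ mulGraph m)
    (h' : (u, w) ∈ mulGraph m') (hC : ∀ x, |m x| ≤ C * |m' x|) : ‖v‖ ≤ C * ‖w‖ := by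
  refine norm_le_of_ae ?_
  rw [mem_mulGraph] at h h'
  filter_upwards [h, h'] with x h1 h2
  rw [h1, h2, norm_mul, norm_mul, Complex.norm_real, Complex.norm_real, ← mul_assoc]
  exact mul_le_mul_of_nonneg_right (hC x) (norm_nonneg _)

/-- Unbounded multipliers occur only through their graphs; domination is the way to enter the domain
of one from that of another. -/
theorem exists_mulGraph_of_le {m m' : R3 → ℝ} (hm : Measurable m) {u w : L2} {C : ℝ}
    (h' : (u, w) ∈ mulGraph m') (hC : ∀ x, |m x| ≤ C * |m' x|) : ∃ v, (u, v) ∈ mulGraph m := by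
  rw [mem_mulGraph] at h'
  have : MemLp (fun x => (m x : ℂ) * u x) 2 volume := by
    refine MemLp.of_le_mul (c := C) (Lp.memLp w) ?_ ?_
    · exact (Complex.measurable_ofReal.comp hm).aestronglyMeasurable.mul (Lp.aestronglyMeasurable u)
    · filter_upwards [h'] with x h2
      rw [h2, norm_mul, norm_mul, Complex.norm_real, Complex.norm_real, ← mul_assoc]
      exact mul_le_mul_of_nonneg_right (hC x) (norm_nonneg _)
  exact ⟨toL2 _, coeFn_toL2 this⟩

theorem mulGraph_one (u : L2) : (u, u) ∈ mulGraph fun _ => 1 :=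
  mem_mulGraph.2 (Filter.Eventually.of_forall fun x => by simp)

theorem norm_mulB_le {m : R3 → ℝ} (h : IsBdd m) {C : ℝ} (hC : ∀ x, |m x| ≤ C) (u : L2) :
    ‖mulB m u‖ ≤ C * ‖u‖ :=
  norm_le_of_mulGraph (mem_mulGraph_mulB h u) (mulGraph_one u) (by simpa using hC)

/-- Change of the vector potential. -/
theorem IsMagneticDeriv.gauge {a a' : R3 → R3} (ha : Continuous a) (ha' : Continuous a')
    {j : Fin 3} {ψ χ β : L2} (h : IsMagneticDeriv a j ψ χ)
    (hβ : (ψ, β) ∈ mulGraph fun x => a' x j - a x j) : IsMagneticDeriv a' j ψ (χ + β) := by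
  rw [isMagneticDeriv_iff ha'] 
  intro φ hφ
  have hφ1 := hφ.magD_memLp ha j
  have hφ2 := hφ.magD_memLp ha' j
  -- On a test function the two derivatives differ by a real multiplier, which is symmetric and so
  -- moves onto `ψ`.
  have hd : (toL2 φ, toL2 (magD a' j φ) - toL2 (magD a j φ)) ∈ mulGraph fun x => a' x j - a x j := by
    change _ =ᵐ[volume] _
    filter_upwards [Lp.coeFn_sub (toL2 (magD a' j φ)) (toL2 (magD a j φ)), coeFn_toL2 hφ1,
      coeFn_toL2 hφ2, coeFn_toL2 hφ.memLp] with x h1 h2 h3 h4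
    simp only [h1, Pi.sub_apply, h2, h3, h4, magD]
    push_cast; ring
  have := inner_mulGraph hd hβ
  rw [inner_sub_left, (isMagneticDeriv_iff ha).1 h φ hφ] at this
  rw [inner_add_right, ← this]; ring

/-- Leibniz rule for the product with a smooth bounded function. -/
theorem IsMagneticDeriv.mul_smooth {a : R3 → R3} (ha : Continuous a) {j : Fin 3} {ψ χ : L2}
    (h : IsMagneticDeriv a j ψ χ) {w : R3 → ℝ} (hw : ContDiff ℝ ∞ w) (hb : IsBdd w)
    (hb' : IsBdd (pderiv j w)) :
    IsMagneticDeriv a j (mulB w ψ) (mulB w χ - Complex.I • mulB (pderiv j w) ψ) := by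
  rw [isMagneticDeriv_iff ha]
  intro φ hφ
  have hwφ := hφ.smul hw
  have hwφ' := hφ.smul (contDiff_pderiv hw j)
  -- The product rule is classical on the test function; duality then gives it for the weak
  -- derivative.
  have e : mulB w (toL2 (magD a j φ)) = toL2 (magD a j fun x => (w x : ℂ) * φ x) +
      Complex.I • mulB (pderiv j w) (toL2 φ) := by
    refine Lp.ext ?_
    filter_upwards [coeFn_mulB hb (toL2 (magD a j φ)), coeFn_toL2 (hφ.magD_memLp ha j),
      coeFn_toL2 (hwφ.magD_memLp ha j), coeFn_toL2 hφ.memLp, coeFn_mulB hb' (toL2 φ),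
      Lp.coeFn_add (toL2 (magD a j fun x => (w x : ℂ) * φ x))
        (Complex.I • mulB (pderiv j w) (toL2 φ)),
      Lp.coeFn_smul Complex.I (mulB (pderiv j w) (toL2 φ))]
      with x h1 h2 h3 h4 h5 h6 h7
    have hp : pderiv j (fun x => (w x : ℂ) * φ x) x =
        (w x : ℂ) * pderiv j φ x + ((pderiv j w x : ℝ) : ℂ) * φ x := by
      have d1 : HasFDerivAt (fun x => (w x : ℂ)) (Complex.ofRealCLM.comp (fderiv ℝ w x)) x :=
        Complex.ofRealCLM.hasFDerivAt.comp x (hw.differentiable (by simp) x).hasFDerivAt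
      have d2 := (hφ.contDiff.differentiable (by simp) x).hasFDerivAt
      simp only [pderiv]
      rw [show (fun x => (w x : ℂ) * φ x) = (fun x => (w x : ℂ)) * φ from rfl, (d1.mul d2).fderiv]
      simp [mul_comm]
    simp only [h1, h2, h6, h3, Pi.add_apply, h7, Pi.smul_apply, h5, h4, magD, hp, smul_eq_mul]
    ring
  rw [← inner_mulB hb, e, inner_add_left, (isMagneticDeriv_iff ha).1 h _ hwφ,
    ← mulB_eq_toL2 hb hφ.memLp, inner_mulB hb, inner_smul_left, inner_mulB hb', inner_sub_right,
    inner_smul_right]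
  simp; ring

end MagneticBCS

namespace MagneticBCS

/-! ### The resolvent of the magnetic Laplacian at `-1` -/

/-- The Hilbert space `L² ⊕ (L²)³` that contains the graphs of the magnetic gradients. -/
abbrev L2Grad : Type := PiLp 2 fun _ : Fin 4 => L2

/-- The graph of the magnetic gradient on the form domain. -/
def formDomain (a : R3 → R3) : Submodule ℂ L2Grad where
  carrier := {p | ∀ j : Fin 3, IsMagneticDeriv a j (p 0) (p j.succ)}
  zero_mem' := fun j => IsMagneticDeriv.zero a j
  add_mem' := fun h h' j => (h j).add (h' j)
  smul_mem' := fun c _ h j => (h j).smul c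

theorem isClosed_formDomain (a : R3 → R3) : IsClosed (formDomain a : Set L2Grad) := by
  have : (formDomain a : Set L2Grad) = {p | ∀ j : Fin 3, IsMagneticDeriv a j (p 0) (p j.succ)} :=
    rfl
  rw [this]
  simp only [IsMagneticDeriv, Set.ofPred_forall]
  refine isClosed_iInter fun j => isClosed_iInter fun φ => isClosed_iInter fun _ =>
    isClosed_iInter fun _ => isClosed_iInter fun u => isClosed_iInter fun w =>
    isClosed_iInter fun _ => isClosed_iInter fun _ => ?_
  have h (i : Fin 4) : Continuous fun p : L2Grad => p i := PiLp.continuous_apply 2 _ i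
  exact isClosed_eq (continuous_const.inner (h _)) (continuous_const.inner (h _))

instance (a : R3 → R3) : CompleteSpace (formDomain a) :=
  (isClosed_formDomain a).completeSpace_coe

/-- The resolvent `(1 + (-i ∇ + a)²)⁻¹`. -/
noncomputable def magRes (a : R3 → R3) : L2 →L[ℂ] L2 :=
  (PiLp.proj 2 (fun _ : Fin 4 => L2) 0 : L2Grad →L[ℂ] L2) ∘L
    ((formDomain a).starProjection ∘L
      (PiLp.proj 2 (fun _ : Fin 4 => L2) 0 : L2Grad →L[ℂ] L2).adjoint)

/-- In the graph inner product, the form equation for `1 + (-i∇+a)²` says that `(u, χ)` and `(g+u,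
0)` have the same inner product with every element of the closed graph of the gradient. So `(u, χ)`
is the orthogonal projection of `(g+u, 0)` onto that graph, and `magRes` reads off its first
component. -/
theorem mem_magneticLaplacianGraph {a : R3 → R3} {u g : L2} :
    (u, g) ∈ magneticLaplacianGraph a ↔ u = magRes a (g + u) := by
  have key : ∀ p ∈ formDomain a, (∀ q ∈ formDomain a, ⟪q, p⟫_ℂ = ⟪q 0, g + u⟫_ℂ) ↔
      p = (formDomain a).starProjection
        ((PiLp.proj 2 (fun _ : Fin 4 => L2) 0 : L2Grad →L[ℂ] L2).adjoint (g + u)) := by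
    intro p hp
    have e : ∀ q : L2Grad, ⟪q, (PiLp.proj 2 (fun _ : Fin 4 => L2) 0 : L2Grad →L[ℂ] L2).adjoint
        (g + u)⟫_ℂ = ⟪q 0, g + u⟫_ℂ := fun q => ContinuousLinearMap.adjoint_inner_right _ _ _
    constructor
    · intro h
      refine (Submodule.eq_starProjection_of_mem_of_inner_eq_zero hp fun q hq => ?_).symm
      rw [← inner_conj_symm, inner_sub_right, e, h q hq, sub_self, map_zero]
    · intro h q hq
      have := Submodule.starProjection_inner_eq_zero
        ((PiLp.proj 2 (fun _ : Fin 4 => L2) 0 : L2Grad →L[ℂ] L2).adjoint (g + u)) q hq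
      rw [← h, ← inner_conj_symm, inner_sub_right, e, map_eq_zero, sub_eq_zero] at this
      exact this.symm
  constructor
  · rintro ⟨χ, h1, h2⟩
    set p : L2Grad := WithLp.toLp 2 (Fin.cons u χ) with hp
    have hpm : p ∈ formDomain a := fun j => h1 j
    have := (key p hpm).1 fun q hq => by
      rw [PiLp.inner_apply, Fin.sum_univ_succ, inner_add_right, ← h2 (q 0) (fun j => q j.succ) hq,
        add_comm]
      rfl
    exact congrArg (fun p : L2Grad => p 0) this
  · intro h
    set p := (formDomain a).starProjection
        ((PiLp.proj 2 (fun _ : Fin 4 => L2) 0 : L2Grad →L[ℂ] L2).adjoint (g + u)) with hp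
    have hpm : p ∈ formDomain a := Submodule.starProjection_apply_mem _ _
    have h0 : p 0 = u := h.symm
    refine ⟨fun j => p j.succ, fun j => h0 ▸ hpm j, fun v w hv => ?_⟩
    have := (key p hpm).2 rfl (WithLp.toLp 2 (Fin.cons v w)) hv
    rw [PiLp.inner_apply, Fin.sum_univ_succ, inner_add_right] at this
    simp only [Fin.cons_zero, Fin.cons_succ, h0] at this
    rw [add_comm] at this
    exact add_right_cancel this

theorem magRes_isSelfAdjoint (a : R3 → R3) : IsSelfAdjoint (magRes a) := by
  have := (isSelfAdjoint_starProjection (formDomain a)).conj_adjoint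
    (PiLp.proj 2 (fun _ : Fin 4 => L2) 0 : L2Grad →L[ℂ] L2)
  exact this

theorem magRes_isPositive (a : R3 → R3) : (magRes a).IsPositive :=
  (ContinuousLinearMap.IsPositive.of_isStarProjection
    (isStarProjection_starProjection (U := formDomain a))).conj_adjoint
    (PiLp.proj 2 (fun _ : Fin 4 => L2) 0 : L2Grad →L[ℂ] L2)

theorem norm_magRes_le (a : R3 → R3) : ‖magRes a‖ ≤ 1 := by
  have h0 : ‖(PiLp.proj 2 (fun _ : Fin 4 => L2) 0 : L2Grad →L[ℂ] L2)‖ ≤ 1 :=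
    ContinuousLinearMap.opNorm_le_bound _ zero_le_one fun p => by
      rw [one_mul]; exact PiLp.norm_apply_le p 0
  have h1 : ‖(formDomain a).starProjection‖ ≤ 1 := Submodule.starProjection_norm_le _
  calc ‖magRes a‖ ≤ ‖(PiLp.proj 2 (fun _ : Fin 4 => L2) 0 : L2Grad →L[ℂ] L2)‖ *
        (‖(formDomain a).starProjection‖ *
          ‖(PiLp.proj 2 (fun _ : Fin 4 => L2) 0 : L2Grad →L[ℂ] L2).adjoint‖) :=
        (ContinuousLinearMap.opNorm_comp_le _ _).trans
          (mul_le_mul_of_nonneg_left (ContinuousLinearMap.opNorm_comp_le _ _) (norm_nonneg _))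
    _ ≤ 1 * (1 * 1) := by
        rw [LinearIsometryEquiv.norm_map]
        gcongr
    _ = 1 := by norm_num

theorem spectrum_magRes (a : R3 → R3) : spectrum ℝ (magRes a) ⊆ Set.Icc 0 1 := by
  intro x hx
  have h1 : (0 : L2 →L[ℂ] L2) ≤ magRes a :=
    (ContinuousLinearMap.nonneg_iff_isPositive _).2 (magRes_isPositive a)
  refine ⟨spectrum_nonneg_of_nonneg h1 hx, ?_⟩
  have h2 := spectrum.norm_le_norm_mul_of_mem hx
  have h3 : ‖(1 : L2 →L[ℂ] L2)‖ ≤ 1 := ContinuousLinearMap.norm_id_le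
  calc x ≤ ‖x‖ := le_abs_self x
    _ ≤ ‖magRes a‖ * ‖(1 : L2 →L[ℂ] L2)‖ := h2
    _ ≤ 1 * 1 := mul_le_mul (norm_magRes_le a) h3 (norm_nonneg _) zero_le_one
    _ = 1 := one_mul 1

/-- `(u, f)` belongs to the graph of `1 + (-i ∇ + a)²`: weak form. -/
theorem exists_grad_magRes (a : R3 → R3) (f : L2) : ∃ χ : Fin 3 → L2,
    (∀ j, IsMagneticDeriv a j (magRes a f) (χ j)) ∧
    ∀ (v : L2) (w : Fin 3 → L2), (∀ j, IsMagneticDeriv a j v (w j)) →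
      ∑ j, ⟪w j, χ j⟫_ℂ = ⟪v, f - magRes a f⟫_ℂ :=
  mem_magneticLaplacianGraph.2 (by rw [sub_add_cancel])

/-- Single-valuedness makes the operator built from this graph have the graph itself; it holds
because test functions are dense and lie in the form domain. -/
theorem magneticLaplacianGraph_snd_eq_zero {a : R3 → R3} (ha : Continuous a) :
    ∀ x ∈ magneticLaplacianGraph a, x.1 = 0 → x.2 = 0 := by
  rintro ⟨u, g⟩ ⟨χ, h1, h2⟩ (rfl : u = 0)
  refine eq_zero_of_inner_test fun φ hφ => ?_
  rw [← h2 _ _ fun j => isMagneticDeriv_test ha j hφ]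
  refine Finset.sum_eq_zero fun j _ => ?_
  rw [(h1 j).unique ha (IsMagneticDeriv.zero a j), inner_zero_right]

theorem mem_graph_magneticLaplacian {a : R3 → R3} (ha : Continuous a) {u g : L2} :
    (u, g) ∈ (magneticLaplacian a).graph ↔ u = magRes a (g + u) := by
  rw [magneticLaplacian, Submodule.toLinearPMap_graph_eq _ (magneticLaplacianGraph_snd_eq_zero ha),
    mem_magneticLaplacianGraph]

theorem IsBoundedInverse.unique {H : Type*} [NormedAddCommGroup H] [InnerProductSpace ℂ H]
    {S : H →ₗ.[ℂ] H} {R R' : H →L[ℂ] H} (h : IsBoundedInverse S R) (h' : IsBoundedInverse S R') :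
    R = R' := by
  ext y
  obtain ⟨x, hx, rfl⟩ := h.2 y
  rw [h.1, h'.1]

theorem isBoundedInverse_iff_graph {H : Type*} [NormedAddCommGroup H] [InnerProductSpace ℂ H]
    {S : H →ₗ.[ℂ] H} {R : H →L[ℂ] H} :
    IsBoundedInverse S R ↔ (∀ x y, (x, y) ∈ S.graph ↔ x = R y) := by
  constructor
  · rintro ⟨h1, h2⟩ x y
    rw [LinearPMap.mem_graph_iff]
    constructor
    · rintro ⟨z, rfl, rfl⟩; exact (h1 z).symm
    · rintro rfl; exact h2 y
  · intro h
    refine ⟨fun x => ((h _ _).1 (S.mem_graph x)).symm, fun y => ?_⟩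
    exact (LinearPMap.mem_graph_iff _).1 ((h (R y) y).2 rfl)

theorem mem_graph_vadd {H : Type*} [AddCommGroup H] [Module ℂ H]
    {S : H →ₗ.[ℂ] H} {L : H →ₗ[ℂ] H} {x y : H} :
    (x, y) ∈ (L +ᵥ S).graph ↔ (x, y - L x) ∈ S.graph := by
  rw [LinearPMap.mem_graph_iff, LinearPMap.mem_graph_iff]
  constructor
  · rintro ⟨z, rfl, rfl⟩
    exact ⟨z, rfl, by rw [LinearPMap.vadd_apply]; simp⟩
  · rintro ⟨z, rfl, hz⟩
    exact ⟨z, rfl, by rw [LinearPMap.vadd_apply, hz]; simp⟩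

theorem boundedInverse_magneticLaplacian {a : R3 → R3} (ha : Continuous a) :
    boundedInverse ((LinearMap.id : L2 →ₗ[ℂ] L2) +ᵥ magneticLaplacian a) = magRes a := by
  have h : IsBoundedInverse ((LinearMap.id : L2 →ₗ[ℂ] L2) +ᵥ magneticLaplacian a) (magRes a) := by
    rw [isBoundedInverse_iff_graph]
    intro x y
    rw [mem_graph_vadd, mem_graph_magneticLaplacian ha]
    simp
  have hex : ∃ R, IsBoundedInverse ((LinearMap.id : L2 →ₗ[ℂ] L2) +ᵥ magneticLaplacian a) R :=
    ⟨_, h⟩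
  rw [boundedInverse, dif_pos hex]
  exact hex.choose_spec.unique h

end MagneticBCS

namespace MagneticBCS

/-! ### The symbol -/

section Symbol

open Filter Topology

/-- Mittag-Leffler expansion of the cotangent at `z = 1/2 + ix/π`, where `cot(πz) = -i tanh x`. The
expansion pairs `z - (n+1)` with `z + (n+1)`, while the `tanh` summand pairs `z - (n+1)` with `z +
n`. The shift telescopes to `1/z - 1/(z+N)`. -/
theorem tendsto_sum_tanh (x : ℝ) :
    Tendsto (fun N : ℕ => ∑ n ∈ Finset.range N, 2 * x / (x ^ 2 + ((n + 1 / 2) * Real.pi) ^ 2))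
      atTop (𝓝 (Real.tanh x)) := by
  have hπ := Real.pi_pos
  have hπ' : (Real.pi : ℂ) ≠ 0 := by exact_mod_cast hπ.ne'
  set z : ℂ := 1 / 2 + Complex.I * x / Real.pi with hz
  have hre : z.re = 1 / 2 := by
    rw [hz, mul_div_assoc, ← Complex.ofReal_div, Complex.add_re, Complex.I_mul_re]; simp
  have hzc : z ∈ Complex.integerComplement := by
    rw [Complex.mem_integerComplement_iff]
    rintro ⟨n, hn⟩
    have := congrArg Complex.re hn
    rw [hre, Complex.intCast_re] at this
    have h2 : (2 * n : ℝ) = 1 := by linarith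
    have h3 : 2 * n = 1 := by exact_mod_cast h2
    omega
  have hne (c : ℝ) (hc : c ≠ -1 / 2) : z + c ≠ 0 := by
    intro h
    have := congrArg Complex.re h
    rw [Complex.add_re, hre] at this
    simp at this
    exact hc (by linarith)
  have h1 := (summable_cotTerm hzc).hasSum.tendsto_sum_nat
  have h0 := cot_series_rep' hzc
  simp only [cotTerm] at h1
  rw [← h0] at h1
  have hcot : Complex.cot (Real.pi * z) = -Complex.I * Real.tanh x := by
    have e : Real.pi * z = Complex.I * x + Real.pi / 2 := by rw [hz]; field_simp; ring
    rw [Complex.cot, e, Complex.sin_add_pi_div_two, Complex.cos_add_pi_div_two,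
      mul_comm Complex.I, Complex.sin_mul_I, Complex.cos_mul_I, Complex.ofReal_tanh,
      Complex.tanh_eq_sinh_div_cosh]
    ring
  have h2 : Tendsto (fun N : ℕ => 1 / (z + N)) atTop (𝓝 0) := by
    have : Tendsto (fun N : ℕ => (z + N)⁻¹) atTop (𝓝 0) :=
      tendsto_inv₀_cobounded.comp
        ((tendsto_const_add_cobounded z).comp (tendsto_norm_atTop_iff_cobounded.1
          (by simpa using tendsto_natCast_atTop_atTop (R := ℝ))))
    simpa using this
  have key : ∀ N : ℕ, ((∑ n ∈ Finset.range N, 2 * x / (x ^ 2 + ((n + 1 / 2) * Real.pi) ^ 2) : ℝ) : ℂ)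
      = Complex.I / Real.pi * ((∑ n ∈ Finset.range N, (1 / (z - (n + 1)) + 1 / (z + (n + 1))))
        + 1 / z - 1 / (z + N)) := by
    intro N
    induction N with
    | zero => simp
    | succ N ih =>
      rw [Finset.sum_range_succ, Finset.sum_range_succ, Complex.ofReal_add, ih]
      have a1 : z - (N + 1) ≠ 0 := by
        have := hne (-(N + 1)) (by have : (0:ℝ) ≤ N := N.cast_nonneg; intro h; linarith)
        push_cast at this; rwa [sub_eq_add_neg]
      have a2 : z + N ≠ 0 := by
        have := hne N (by have : (0:ℝ) ≤ N := N.cast_nonneg; intro h; linarith)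
        simpa using this
      have a3 : (x : ℂ) ^ 2 + ((N + 1 / 2) * Real.pi) ^ 2 ≠ 0 := by
        have : (0:ℝ) < x ^ 2 + ((N + 1 / 2) * Real.pi) ^ 2 := by positivity
        intro h
        refine this.ne' (Complex.ofReal_injective ?_)
        push_cast; exact h
      have a4 : (z - (N + 1)) * (z + N) * Real.pi ^ 2 =
          -((x : ℂ) ^ 2 + ((N + 1 / 2) * Real.pi) ^ 2) := by
        rw [hz]; field_simp; ring_nf; simp; ring
      have a5 : (z - (N + 1)) + (z + N) = 2 * Complex.I * x / Real.pi := by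
        rw [hz]; ring
      have a6 : 1 / (z - (N + 1)) + 1 / (z + N) =
          -(2 * Complex.I * x * Real.pi / (x ^ 2 + ((N + 1 / 2) * Real.pi) ^ 2)) := by
        rw [div_add_div _ _ a1 a2, one_mul, mul_one, add_comm (z + N), a5, div_eq_iff (mul_ne_zero a1 a2)]
        have : (z - (N + 1)) * (z + N) =
          -((x : ℂ) ^ 2 + ((N + 1 / 2) * Real.pi) ^ 2) / Real.pi ^ 2 := by
          rw [← a4]; field_simp
        rw [this]
        generalize hD : (x : ℂ) ^ 2 + ((N + 1 / 2) * Real.pi) ^ 2 = D at a3 ⊢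
        field_simp
      have a7 : ((2 * x / (x ^ 2 + ((N + 1 / 2) * Real.pi) ^ 2) : ℝ) : ℂ) =
          Complex.I / Real.pi * (1 / (z - (N + 1)) + 1 / (z + N)) := by
        rw [a6]; push_cast; field_simp; ring_nf; simp
      rw [a7]; push_cast; ring
  have h3 : Tendsto (fun N : ℕ => ((∑ n ∈ Finset.range N,
      2 * x / (x ^ 2 + ((n + 1 / 2) * Real.pi) ^ 2) : ℝ) : ℂ)) atTop (𝓝 (Real.tanh x : ℂ)) := by
    simp_rw [key]
    have := ((h1.add_const (1 / z)).sub h2).const_mul (Complex.I / Real.pi)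
    rw [hcot] at this
    convert this using 2
    field_simp; ring_nf; simp
  have h4 := (Complex.continuous_re.tendsto _).comp h3
  simpa only [Function.comp_def, Complex.ofReal_re] using h4

/-- The distance of the poles of the inverse symbol from the real axis. -/
noncomputable def matsubara (T : ℝ) (n : ℕ) : ℝ := (2 * n + 1) * Real.pi * T

theorem matsubara_pos {T : ℝ} (hT : 0 < T) (n : ℕ) : 0 < matsubara T n := by
  have := Real.pi_pos; unfold matsubara; positivity

theorem summable_inv_matsubara {T : ℝ} (hT : 0 < T) {s : ℝ} (hs : 1 < s) :
    Summable fun n => (matsubara T n) ^ (-s) := by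
  have h := (Real.summable_nat_rpow_inv.2 hs)
  have h2 : Summable fun n : ℕ => (Real.pi * T) ^ (-s) * (((n + 1 : ℕ) : ℝ) ^ s)⁻¹ :=
    ((summable_nat_add_iff 1).2 h).mul_left _
  have hpT : 0 < Real.pi * T := mul_pos Real.pi_pos hT
  refine Summable.of_nonneg_of_le (fun n => Real.rpow_nonneg (matsubara_pos hT n).le _)
    (fun n => ?_) h2
  rw [← Real.rpow_neg (by positivity), ← Real.mul_rpow hpT.le (by positivity)]
  refine Real.rpow_le_rpow_of_nonpos (by positivity) ?_ (by linarith)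
  unfold matsubara; push_cast
  have : (0:ℝ) ≤ n := n.cast_nonneg
  nlinarith

/-- The summands of the partial fraction expansion of the inverse symbol. -/
noncomputable def symbolTerm (T μ : ℝ) (n : ℕ) (t : ℝ) : ℝ :=
  4 * T / ((t - μ) ^ 2 + matsubara T n ^ 2)

variable {T μ : ℝ}

theorem symbolTerm_nonneg (hT : 0 < T) (n : ℕ) (t : ℝ) : 0 ≤ symbolTerm T μ n t := by
  unfold symbolTerm; positivity

theorem symbolTerm_le (hT : 0 < T) (n : ℕ) (t : ℝ) :
    symbolTerm T μ n t ≤ 4 * T * matsubara T n ^ (-2 : ℝ) := by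
  have := matsubara_pos hT n
  rw [Real.rpow_neg this.le, ← div_eq_mul_inv]
  unfold symbolTerm
  refine div_le_div_of_nonneg_left (by positivity) (by positivity) ?_
  rw [Real.rpow_two]; nlinarith [sq_nonneg (t - μ)]

theorem continuous_symbolTerm (hT : 0 < T) (n : ℕ) : Continuous (symbolTerm T μ n) := by
  have := matsubara_pos hT n
  unfold symbolTerm
  refine continuous_const.div (by fun_prop) fun t => by positivity

theorem summable_symbolTerm_bound (hT : 0 < T) :
    Summable fun n => 4 * T * matsubara T n ^ (-2 : ℝ) :=
  (summable_inv_matsubara hT (by norm_num)).mul_left _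

theorem summable_symbolTerm (hT : 0 < T) (t : ℝ) : Summable fun n => symbolTerm T μ n t :=
  Summable.of_nonneg_of_le (fun n => symbolTerm_nonneg hT n t) (fun n => symbolTerm_le hT n t)
    (summable_symbolTerm_bound hT)

theorem continuous_tsum_symbolTerm (hT : 0 < T) : Continuous fun t => ∑' n, symbolTerm T μ n t :=
  continuous_tsum (fun n => continuous_symbolTerm hT n) (summable_symbolTerm_bound hT) fun n t => by
    rw [Real.norm_of_nonneg (symbolTerm_nonneg hT n t)]; exact symbolTerm_le hT n t

theorem tsum_symbolTerm_of_ne (hT : 0 < T) {t : ℝ} (ht : t ≠ μ) :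
    ∑' n, symbolTerm T μ n t = Real.tanh ((t - μ) / (2 * T)) / (t - μ) := by
  have h0 : t - μ ≠ 0 := sub_ne_zero.2 ht
  have h1 := (summable_symbolTerm (μ := μ) hT t).hasSum.tendsto_sum_nat
  have h2 := (tendsto_sum_tanh ((t - μ) / (2 * T))).div_const (t - μ)
  refine tendsto_nhds_unique h1 (h2.congr fun N => ?_)
  rw [Finset.sum_div]
  refine Finset.sum_congr rfl fun n _ => ?_
  have := matsubara_pos hT n
  unfold symbolTerm
  rw [div_div, div_eq_div_iff (by unfold matsubara at this; positivity) (by positivity)]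
  unfold matsubara
  field_simp
  ring

theorem tendsto_tanh_div : Tendsto (fun x : ℝ => Real.tanh x / x) (𝓝[≠] 0) (𝓝 1) := by
  have h : HasDerivAt Real.tanh 1 0 := by
    have h1 := (Real.hasDerivAt_sinh 0).div (Real.hasDerivAt_cosh 0) (by simp)
    have e : Real.tanh = Real.sinh / Real.cosh := funext fun x => Real.tanh_eq_sinh_div_cosh x
    rw [e]; simpa using h1
  have := hasDerivAt_iff_tendsto_slope.1 h
  refine this.congr fun x => ?_
  simp [slope, div_eq_inv_mul]

/-- The removable singularity is filled by continuity of the series and the limit of `tanh x / x` at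
`0`. -/
theorem tsum_symbolTerm_self (hT : 0 < T) : ∑' n, symbolTerm T μ n μ = 1 / (2 * T) := by
  have h1 : Tendsto (fun x : ℝ => ∑' n, symbolTerm T μ n (μ + 2 * T * x)) (𝓝[≠] 0)
      (𝓝 (∑' n, symbolTerm T μ n μ)) := by
    have : Continuous fun x : ℝ => ∑' n, symbolTerm T μ n (μ + 2 * T * x) :=
      (continuous_tsum_symbolTerm hT).comp (by fun_prop)
    have := this.tendsto 0
    simp only [mul_zero, add_zero] at this
    exact this.mono_left nhdsWithin_le_nhds
  refine tendsto_nhds_unique h1 ?_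
  have h2 := tendsto_tanh_div.div_const (2 * T)
  refine h2.congr' ?_
  filter_upwards [self_mem_nhdsWithin] with x hx
  rw [tsum_symbolTerm_of_ne hT (by simpa using ⟨hT.ne', hx⟩)]
  rw [add_sub_cancel_left, mul_div_cancel_left₀ _ (by positivity), div_div, mul_comm x]

/-- Positivity, continuity and the minimum of the symbol, as well as the reduction to resolvents,
are all read off this expansion. -/
theorem tsum_symbolTerm (hT : 0 < T) (t : ℝ) :
    ∑' n, symbolTerm T μ n t = (bcsSymbol T μ t)⁻¹ := by
  unfold bcsSymbol
  split_ifs with h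
  · rw [h, tsum_symbolTerm_self hT, one_div]
  · rw [tsum_symbolTerm_of_ne hT h, inv_div]

theorem inv_bcsSymbol_pos (hT : 0 < T) (t : ℝ) : 0 < (bcsSymbol T μ t)⁻¹ := by
  rw [← tsum_symbolTerm hT]
  refine (summable_symbolTerm hT t).tsum_pos (fun n => symbolTerm_nonneg hT n t) 0 ?_
  have := matsubara_pos hT 0
  unfold symbolTerm; positivity

theorem bcsSymbol_pos (hT : 0 < T) (t : ℝ) : 0 < bcsSymbol T μ t := inv_pos.1 (inv_bcsSymbol_pos hT t)

theorem continuous_bcsSymbol (hT : 0 < T) : Continuous (bcsSymbol T μ) := by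
  have : bcsSymbol T μ = fun t => (∑' n, symbolTerm T μ n t)⁻¹ :=
    funext fun t => by rw [tsum_symbolTerm hT, inv_inv]
  rw [this]
  exact (continuous_tsum_symbolTerm hT).inv₀ fun t => by
    rw [tsum_symbolTerm hT]; exact (inv_bcsSymbol_pos hT t).ne'

/-- The minimum of the symbol on `[0, ∞)`. -/
noncomputable def symbolMin (T μ : ℝ) : ℝ := bcsSymbol T μ (max μ 0)

theorem symbolMin_pos (hT : 0 < T) : 0 < symbolMin T μ := bcsSymbol_pos hT _

/-- Every summand of the reciprocal decreases with `|t - μ|`, and `max μ 0` is the point of `[0, ∞)`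
nearest to `μ`. -/
theorem symbolMin_le (hT : 0 < T) {t : ℝ} (ht : 0 ≤ t) : symbolMin T μ ≤ bcsSymbol T μ t := by
  rw [← inv_le_inv₀ (bcsSymbol_pos hT t) (symbolMin_pos hT), symbolMin, ← tsum_symbolTerm hT,
    ← tsum_symbolTerm hT]
  refine (summable_symbolTerm hT t).tsum_le_tsum (fun n => ?_) (summable_symbolTerm hT _)
  have := matsubara_pos hT n
  unfold symbolTerm
  refine div_le_div_of_nonneg_left (by positivity) (by positivity) ?_
  have : (max μ 0 - μ) ^ 2 ≤ (t - μ) ^ 2 := by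
    rcases le_total μ 0 with h | h
    · rw [max_eq_right h]; nlinarith
    · rw [max_eq_left h]; nlinarith [sq_nonneg (t - μ)]
  linarith

/-- With `x = (t-μ)/(2T)` the difference is `2T x (coth x - 1) = 2T x e^(-x) / sinh x`, and `x ≤
sinh x`. -/
theorem bcsSymbol_sub_of_lt (hT : 0 < T) {t : ℝ} (ht : μ < t) :
    0 ≤ bcsSymbol T μ t - (t - μ) ∧
    bcsSymbol T μ t - (t - μ) ≤ 2 * T * Real.exp (-((t - μ) / (2 * T))) := by
  set x := (t - μ) / (2 * T) with hx
  have hx0 : 0 < x := div_pos (sub_pos.2 ht) (by positivity)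
  have e : t - μ = 2 * T * x := by rw [hx]; field_simp
  have hs : x ≤ Real.sinh x := Real.self_le_sinh_iff.2 hx0.le
  have hs0 : 0 < Real.sinh x := hx0.trans_le hs
  have : bcsSymbol T μ t - (t - μ) = 2 * T * (x * (Real.exp (-x) / Real.sinh x)) := by
    rw [bcsSymbol, if_neg ht.ne', ← hx, e, Real.tanh_eq_sinh_div_cosh, ← Real.cosh_sub_sinh]
    have := Real.cosh_pos x
    field_simp
  rw [this]
  refine ⟨by positivity, ?_⟩
  refine mul_le_mul_of_nonneg_left ?_ (by positivity)
  rw [mul_div_assoc', div_le_iff₀ hs0, mul_comm]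
  exact mul_le_mul_of_nonneg_left hs (Real.exp_pos _).le

theorem tendsto_bcsSymbol_sub (hT : 0 < T) :
    Tendsto (fun t => bcsSymbol T μ t - (t - μ)) atTop (𝓝 0) := by
  have h : Tendsto (fun t : ℝ => 2 * T * Real.exp (-((t - μ) / (2 * T)))) atTop (𝓝 (2 * T * 0)) := by
    refine (Real.tendsto_exp_neg_atTop_nhds_zero.comp ?_).const_mul _
    exact (tendsto_atTop_add_const_right _ (-μ) tendsto_id).atTop_div_const (by positivity)
  rw [mul_zero] at h
  refine tendsto_of_tendsto_of_tendsto_of_le_of_le' tendsto_const_nhds h ?_ ?_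
  · filter_upwards [eventually_gt_atTop μ] with t ht using (bcsSymbol_sub_of_lt hT ht).1
  · filter_upwards [eventually_gt_atTop μ] with t ht using (bcsSymbol_sub_of_lt hT ht).2

theorem exists_bcsSymbol_eq (hT : 0 < T) {E : ℝ} (hE : symbolMin T μ ≤ E) :
    ∃ t, 0 ≤ t ∧ bcsSymbol T μ t = E := by
  have hE0 := abs_nonneg E
  have h1 : max μ 0 ≤ max μ 0 + |E| + 1 := by linarith
  have h2 : E ≤ bcsSymbol T μ (max μ 0 + |E| + 1) := by
    have hlt : μ < max μ 0 + |E| + 1 := by linarith [le_max_left μ 0]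
    have := (bcsSymbol_sub_of_lt hT hlt).1
    linarith [le_max_left μ 0, le_abs_self E]
  obtain ⟨t, ht, he⟩ := intermediate_value_Icc h1 (continuous_bcsSymbol hT).continuousOn ⟨hE, h2⟩
  exact ⟨t, (le_max_right _ _).trans ht.1, he⟩

end Symbol

end MagneticBCS

namespace MagneticBCS

/-! ### Functional calculus of the resolvent -/

section Calculus

open Filter Topology

variable {H : Type*} [NormedAddCommGroup H] [InnerProductSpace ℂ H] [CompleteSpace H]
variable {T μ : ℝ} {R : H →L[ℂ] H}

/-- The function `r ↦ f (r⁻¹ - 1)`, extended by `0` to `r = 0`. -/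
noncomputable def invExt (f : ℝ → ℝ) (r : ℝ) : ℝ := if r = 0 then 0 else f (r⁻¹ - 1)

theorem continuousOn_invExt {f : ℝ → ℝ} (hf : Continuous f) (h0 : Tendsto f atTop (𝓝 0)) :
    ContinuousOn (invExt f) (Set.Icc 0 1) := by
  intro r hr
  rcases eq_or_ne r 0 with rfl | hne
  · have h1 : Tendsto (fun r : ℝ => f (r⁻¹ - 1)) (𝓝[>] 0) (𝓝 0) :=
      h0.comp (tendsto_atTop_add_const_right _ (-1) tendsto_inv_nhdsGT_zero)
    have h2 : Tendsto (invExt f) (𝓝[>] 0) (𝓝 (invExt f 0)) := by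
      simp only [invExt, if_true]
      refine h1.congr' ?_
      filter_upwards [self_mem_nhdsWithin] with x hx
      rw [invExt, if_neg (ne_of_gt hx)]
    have h3 : ContinuousWithinAt (invExt f) (Set.Ici 0) 0 := by
      rw [← continuousWithinAt_Ioi_iff_Ici]; exact h2
    exact h3.mono fun x hx => hx.1
  · refine ContinuousAt.continuousWithinAt ?_
    have h1 : ContinuousAt (fun r : ℝ => f (r⁻¹ - 1)) r :=
      hf.continuousAt.comp ((continuousAt_inv₀ hne).sub continuousAt_const)
    refine h1.congr ?_
    filter_upwards [isOpen_ne.mem_nhds hne] with x hx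
    rw [invExt, if_neg hx]

/-- The remainder `k(t) - (t - μ)` as a function of `r = (1 + t)⁻¹`. -/
noncomputable def remExt (T μ : ℝ) : ℝ → ℝ := invExt fun t => bcsSymbol T μ t - (t - μ)

theorem continuousOn_remExt (hT : 0 < T) : ContinuousOn (remExt T μ) (Set.Icc 0 1) :=
  continuousOn_invExt ((continuous_bcsSymbol hT).sub (by fun_prop)) (tendsto_bcsSymbol_sub hT)

/-- The function `(k(t) - e) / (1 + t)` of `r = (1 + t)⁻¹`. -/
noncomputable def shiftQuot (T μ e r : ℝ) : ℝ := 1 - r * (1 + μ + e) + r * remExt T μ r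

theorem continuousOn_shiftQuot (hT : 0 < T) (e : ℝ) :
    ContinuousOn (shiftQuot T μ e) (Set.Icc 0 1) := by
  have := continuousOn_remExt (μ := μ) hT
  unfold shiftQuot
  fun_prop

theorem shiftQuot_of_ne {e r : ℝ} (hr : r ≠ 0) :
    shiftQuot T μ e r = r * (bcsSymbol T μ (r⁻¹ - 1) - e) := by
  rw [shiftQuot, remExt, invExt, if_neg hr]
  field_simp; ring

theorem symbolMin_le_of_mem (hT : 0 < T) {r : ℝ} (hr : r ∈ Set.Icc (0 : ℝ) 1) (h0 : r ≠ 0) :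
    symbolMin T μ ≤ bcsSymbol T μ (r⁻¹ - 1) := by
  refine symbolMin_le hT ?_
  have h1 : 0 < r := lt_of_le_of_ne hr.1 h0.symm
  have := (one_le_inv₀ h1).2 hr.2
  linarith

/-- The value at `r = 0` is `1` because `k(t)` grows like `t`. Hence the reciprocal is continuous on
all of `[0, 1]`, which makes `kinQuot` a bounded operator. -/
theorem shiftQuot_pos (hT : 0 < T) {e r : ℝ} (he : e < symbolMin T μ)
    (hr : r ∈ Set.Icc (0 : ℝ) 1) : 0 < shiftQuot T μ e r := by
  rcases eq_or_ne r 0 with rfl | hne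
  · simp [shiftQuot]
  · rw [shiftQuot_of_ne hne]
    have h1 : 0 < r := lt_of_le_of_ne hr.1 hne.symm
    exact mul_pos h1 (sub_pos.2 (he.trans_le (symbolMin_le_of_mem hT hr hne)))

/-- The function `(k(t) - e)⁻¹` of `r = (1 + t)⁻¹`. -/
noncomputable def shiftInv (T μ e r : ℝ) : ℝ := r * (shiftQuot T μ e r)⁻¹

theorem continuousOn_inv_shiftQuot (hT : 0 < T) {e : ℝ} (he : e < symbolMin T μ) :
    ContinuousOn (fun r => (shiftQuot T μ e r)⁻¹) (Set.Icc 0 1) :=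
  (continuousOn_shiftQuot hT e).inv₀ fun _ hr => (shiftQuot_pos hT he hr).ne'

theorem continuousOn_shiftInv (hT : 0 < T) {e : ℝ} (he : e < symbolMin T μ) :
    ContinuousOn (shiftInv T μ e) (Set.Icc 0 1) :=
  continuousOn_id.mul (continuousOn_inv_shiftQuot hT he)

theorem shiftInv_of_ne {e r : ℝ} (hr : r ≠ 0) :
    shiftInv T μ e r = (bcsSymbol T μ (r⁻¹ - 1) - e)⁻¹ := by
  rw [shiftInv, shiftQuot_of_ne hr, mul_inv, ← mul_assoc, mul_inv_cancel₀ hr, one_mul]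

theorem shiftInv_zero {e : ℝ} : shiftInv T μ e 0 = 0 := by simp [shiftInv]

/-- The operator `(K - e)⁻¹`, where `K = k(S)` and `R = (1 + S)⁻¹`. -/
noncomputable def kinRes (T μ e : ℝ) (R : H →L[ℂ] H) : H →L[ℂ] H := cfc (shiftInv T μ e) R

/-- The operator `(1 + S) (K - e)⁻¹`, where `K = k(S)` and `R = (1 + S)⁻¹`. -/
noncomputable def kinQuot (T μ e : ℝ) (R : H →L[ℂ] H) : H →L[ℂ] H :=
  cfc (fun r => (shiftQuot T μ e r)⁻¹) R

theorem kinRes_isSelfAdjoint (e : ℝ) : IsSelfAdjoint (kinRes T μ e R) := cfc_predicate _ _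

theorem kinRes_nonneg_bound (hT : 0 < T) {e r : ℝ} (he : e < symbolMin T μ)
    (hr : r ∈ Set.Icc (0 : ℝ) 1) :
    0 ≤ shiftInv T μ e r ∧ shiftInv T μ e r ≤ (symbolMin T μ - e)⁻¹ := by
  have h0 : 0 < symbolMin T μ - e := sub_pos.2 he
  rcases eq_or_ne r 0 with rfl | hne
  · rw [shiftInv_zero]; exact ⟨le_rfl, by positivity⟩
  · rw [shiftInv_of_ne hne]
    have h1 := symbolMin_le_of_mem (μ := μ) hT hr hne
    have h2 : 0 < bcsSymbol T μ (r⁻¹ - 1) - e := by linarith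
    exact ⟨by positivity, inv_anti₀ h0 (by linarith)⟩

theorem norm_kinRes_le (hT : 0 < T) {e : ℝ} (he : e < symbolMin T μ)
    (hs : spectrum ℝ R ⊆ Set.Icc 0 1) : ‖kinRes T μ e R‖ ≤ (symbolMin T μ - e)⁻¹ := by
  refine norm_cfc_le (inv_nonneg.2 (sub_nonneg.2 he.le)) fun r hr => ?_
  have := kinRes_nonneg_bound hT he (hs hr)
  rw [Real.norm_of_nonneg this.1]; exact this.2

theorem exists_norm_kinQuot_le (hT : 0 < T) {e : ℝ} (he : e < symbolMin T μ) :
    ∃ C, 0 < C ∧ ∀ R : H →L[ℂ] H, spectrum ℝ R ⊆ Set.Icc 0 1 → ‖kinQuot T μ e R‖ ≤ C := by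
  obtain ⟨C, hC⟩ := isCompact_Icc.exists_bound_of_continuousOn (continuousOn_inv_shiftQuot hT he)
  have : (0:ℝ) ∈ Set.Icc (0:ℝ) 1 := by simp
  have h0 : 0 ≤ C := (norm_nonneg _).trans (hC 0 this)
  exact ⟨C + 1, by linarith, fun R hs => norm_cfc_le (by linarith) fun r hr =>
    (hC r (hs hr)).trans (by linarith)⟩

theorem kinRes_eq_mul (hT : 0 < T) {e : ℝ} (he : e < symbolMin T μ) (hR : IsSelfAdjoint R)
    (hs : spectrum ℝ R ⊆ Set.Icc 0 1) : kinRes T μ e R = R * kinQuot T μ e R := by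
  have := cfc_mul (fun r : ℝ => r) (fun r => (shiftQuot T μ e r)⁻¹) R continuousOn_id
    ((continuousOn_inv_shiftQuot hT he).mono hs)
  rw [cfc_id' ℝ R] at this
  exact this

theorem kinQuot_mul_shift (hT : 0 < T) {e : ℝ} (he : e < symbolMin T μ) (hR : IsSelfAdjoint R)
    (hs : spectrum ℝ R ⊆ Set.Icc 0 1) :
    kinQuot T μ e R * cfc (shiftQuot T μ e) R = 1 := by
  rw [kinQuot, ← cfc_mul _ _ R ((continuousOn_inv_shiftQuot hT he).mono hs)
    ((continuousOn_shiftQuot hT e).mono hs), ← cfc_one ℝ R]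
  exact cfc_congr fun r hr => inv_mul_cancel₀ (shiftQuot_pos hT he (hs hr)).ne'

theorem cfc_shiftQuot (hT : 0 < T) {e : ℝ} (hR : IsSelfAdjoint R)
    (hs : spectrum ℝ R ⊆ Set.Icc 0 1) :
    cfc (shiftQuot T μ e) R = 1 - ((1 + μ + e : ℝ) : ℂ) • R + R * cfc (remExt T μ) R := by
  have h1 := (continuousOn_remExt (μ := μ) hT).mono hs
  have e1 : shiftQuot T μ e = fun r => (1 - (1 + μ + e) * r) + r * remExt T μ r := by
    funext r; rw [shiftQuot]; ring
  rw [e1, cfc_add R _ _ (by fun_prop) (by fun_prop), cfc_sub _ _ R (by fun_prop) (by fun_prop),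
    cfc_mul _ _ R (by fun_prop) h1, cfc_const_mul _ _ R (by fun_prop), cfc_id' ℝ R,
    cfc_const_one ℝ R, Complex.coe_smul]

/-- Since `K - e = (1+S) - (1+μ+e) + r(S)`, the left equation is `(K-e)ψ = f` multiplied by `R`. It
rearranges to `shiftQuot(R) ψ = R f`, and `shiftQuot(R)` is invertible. -/
theorem eq_kinRes_iff (hT : 0 < T) {e : ℝ} (he : e < symbolMin T μ) (hR : IsSelfAdjoint R)
    (hs : spectrum ℝ R ⊆ Set.Icc 0 1) {ψ f : H} :
    ψ = R (f + (1 + μ + e : ℝ) • ψ - cfc (remExt T μ) R ψ) ↔ ψ = kinRes T μ e R f := by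
  have h1 := kinQuot_mul_shift hT he hR hs
  have hc1 : kinQuot T μ e R * R = R * kinQuot T μ e R :=
    (((Commute.refl R).cfc_real _ : Commute (kinQuot T μ e R) R)).eq
  have h2 : cfc (shiftQuot T μ e) R * kinQuot T μ e R = 1 := by
    rw [← h1]; exact (cfc_commute_cfc _ _ R).eq
  rw [cfc_shiftQuot hT hR hs] at h1 h2
  have e1 : ∀ φ, (1 - ((1 + μ + e : ℝ) : ℂ) • R + R * cfc (remExt T μ) R) φ =
      φ - R ((1 + μ + e : ℝ) • φ - cfc (remExt T μ) R φ) := by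
    intro φ
    rw [map_sub, ← Complex.coe_smul, map_smul]
    simp only [add_apply, sub_apply, one_apply_eq_self, smul_apply, mul_apply_eq_comp]
    abel
  rw [kinRes_eq_mul hT he hR hs]
  constructor
  · intro h
    have : (1 - ((1 + μ + e : ℝ) : ℂ) • R + R * cfc (remExt T μ) R) ψ = R f := by
      rw [e1, sub_eq_iff_eq_add, ← map_add]
      rwa [add_sub_assoc] at h
    have h3 := congrArg (kinQuot T μ e R) this
    rw [← mul_apply_eq_comp, h1] at h3
    rw [← hc1]; exact h3
  · intro h
    have : (1 - ((1 + μ + e : ℝ) : ℂ) • R + R * cfc (remExt T μ) R) ψ = R f := by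
      rw [h, ← hc1]
      change ((1 - ((1 + μ + e : ℝ) : ℂ) • R + R * cfc (remExt T μ) R) * kinQuot T μ e R) (R f) = _
      rw [h2]; rfl
    rw [e1, sub_eq_iff_eq_add, ← map_add] at this
    rwa [add_sub_assoc]

theorem kinRes_sub_kinRes (hT : 0 < T) {e e' : ℝ} (he : e < symbolMin T μ)
    (he' : e' < symbolMin T μ) (hs : spectrum ℝ R ⊆ Set.Icc 0 1) :
    kinRes T μ e R - kinRes T μ e' R =
      ((e - e' : ℝ) : ℂ) • (kinRes T μ e R * kinRes T μ e' R) := by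
  have c1 := (continuousOn_shiftInv hT he).mono hs
  have c2 := (continuousOn_shiftInv hT he').mono hs
  rw [kinRes, kinRes, ← cfc_sub _ _ R c1 c2, ← cfc_mul _ _ R c1 c2, Complex.coe_smul,
    ← cfc_smul (e - e') (fun r => shiftInv T μ e r * shiftInv T μ e' r) R (c1.mul c2)]
  refine cfc_congr fun r hr => ?_
  rcases eq_or_ne r 0 with rfl | hne
  · simp [shiftInv_zero]
  · simp only [shiftInv_of_ne hne, smul_eq_mul]
    have h1 := symbolMin_le_of_mem (μ := μ) hT (hs hr) hne
    have h2 : bcsSymbol T μ (r⁻¹ - 1) - e ≠ 0 := by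
      have : 0 < bcsSymbol T μ (r⁻¹ - 1) - e := by linarith
      exact this.ne'
    have h3 : bcsSymbol T μ (r⁻¹ - 1) - e' ≠ 0 := by
      have : 0 < bcsSymbol T μ (r⁻¹ - 1) - e' := by linarith
      exact this.ne'
    generalize bcsSymbol T μ (r⁻¹ - 1) = k at h2 h3 ⊢
    field_simp; ring

/-! ### Resolvents at non-real points -/

/-- The resolvent `(S - z)⁻¹` in terms of `R = (1 + S)⁻¹`. -/
noncomputable def resAt (R : H →L[ℂ] H) (z : ℂ) : H →L[ℂ] H :=
  R * Ring.inverse (1 - (1 + z) • R)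

theorem isUnit_one_sub_smul (hR : IsSelfAdjoint R) {c : ℂ} (hc : c.im ≠ 0) :
    IsUnit (1 - c • R) := by
  have hc0 : c ≠ 0 := fun h => hc (by simp [h])
  have h1 : c⁻¹ ∉ spectrum ℂ R := by
    intro h
    have := congrArg Complex.im (hR.mem_spectrum_eq_re h)
    simp only [Complex.inv_im, Complex.ofReal_im] at this
    rw [div_eq_zero_iff] at this
    rcases this with h | h
    · exact hc (by linarith)
    · exact hc0 (Complex.normSq_eq_zero.1 h)
  rw [spectrum.notMem_iff] at h1
  have e : 1 - c • R = c • (algebraMap ℂ (H →L[ℂ] H) c⁻¹ - R) := by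
    rw [smul_sub, Algebra.algebraMap_eq_smul_one, smul_smul, mul_inv_cancel₀ hc0, one_smul]
  rw [e]
  exact h1.smul (Units.mk0 c hc0)

theorem resAt_eq (hR : IsSelfAdjoint R) {z : ℂ} (hz : z.im ≠ 0) :
    resAt R z = R * (1 + (1 + z) • resAt R z) := by
  have hu := isUnit_one_sub_smul hR (c := 1 + z) (by simpa using hz)
  have h1 := Ring.mul_inverse_cancel _ hu
  rw [resAt]
  have : Ring.inverse (1 - (1 + z) • R) = 1 + (1 + z) • (R * Ring.inverse (1 - (1 + z) • R)) := by
    rw [sub_mul, one_mul, smul_mul_assoc] at h1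
    exact sub_eq_iff_eq_add.1 h1
  conv_lhs => rw [this]

theorem resAt_apply (hR : IsSelfAdjoint R) {z : ℂ} (hz : z.im ≠ 0) (f : H) :
    resAt R z f = R (f + (1 + z) • resAt R z f) := by
  conv_lhs => rw [resAt_eq hR hz]
  rfl

theorem resAt_mul_sub (hR : IsSelfAdjoint R) {z : ℂ} (hz : z.im ≠ 0) :
    resAt R z * (1 - (1 + z) • R) = R := by
  rw [resAt, mul_assoc, Ring.inverse_mul_cancel _
    (isUnit_one_sub_smul hR (c := 1 + z) (by simpa using hz)), mul_one]

theorem commute_resAt (hR : IsSelfAdjoint R) {z : ℂ} (hz : z.im ≠ 0) : Commute R (resAt R z) := by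
  have hu := isUnit_one_sub_smul hR (c := 1 + z) (by simpa using hz)
  obtain ⟨u, hu⟩ := hu
  have h : Commute R (u : H →L[ℂ] H) := by
    rw [hu]; exact (Commute.one_right R).sub_right ((Commute.refl R).smul_right _)
  rw [resAt, ← hu, Ring.inverse_unit]
  exact (Commute.refl R).mul_right h.units_inv_right

theorem eq_resAt (hR : IsSelfAdjoint R) {z : ℂ} (hz : z.im ≠ 0) {u f : H}
    (h : u = R (f + (1 + z) • u)) : u = resAt R z f := by
  have hd : (1 - (1 + z) • R) (u - resAt R z f) = 0 := by
    have h1 := resAt_apply hR hz f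
    rw [map_add, map_smul] at h h1
    rw [sub_apply, one_apply_eq_self, smul_apply, map_sub, smul_sub]
    nth_rewrite 1 [h]
    nth_rewrite 1 [h1]
    abel
  have hu := isUnit_one_sub_smul hR (c := 1 + z) (by simpa using hz)
  have h3 := congrArg (fun x => (Ring.inverse (1 - (1 + z) • R)) x) hd
  simp only [map_zero] at h3
  rw [← mul_apply_eq_comp, Ring.inverse_mul_cancel _ hu, one_apply_eq_self] at h3
  exact sub_eq_zero.1 h3

theorem adjoint_resAt (hR : IsSelfAdjoint R) {z : ℂ} (hz : z.im ≠ 0) :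
    (resAt R z).adjoint = resAt R (starRingEnd ℂ z) := by
  have hz' : (starRingEnd ℂ z).im ≠ 0 := by simpa using hz
  have h1 : resAt R z = (1 + (1 + z) • resAt R z) * R := by
    conv_lhs => rw [resAt_eq hR hz]
    exact ((Commute.one_right R).add_right ((commute_resAt hR hz).smul_right _)).eq
  have h2 : star (resAt R z) = R * (1 + (1 + starRingEnd ℂ z) • star (resAt R z)) := by
    conv_lhs => rw [h1]
    rw [star_mul, hR.star_eq, star_add, star_one, star_smul, star_add, star_one]
    rfl
  ext f
  refine eq_resAt hR hz' ?_
  exact congrArg (fun L : H →L[ℂ] H => L f) h2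

theorem resAt_sub_resAt (hR : IsSelfAdjoint R) {z w : ℂ} (hz : z.im ≠ 0) (hw : w.im ≠ 0) :
    resAt R z - resAt R w = (z - w) • (resAt R z * resAt R w) := by
  ext f
  have h1 := resAt_apply hR hw f
  have h2 := resAt_apply hR hz (resAt R w f)
  rw [sub_apply, smul_apply, mul_apply_eq_comp, sub_eq_iff_eq_add]
  refine (eq_resAt hR hz ?_).symm
  have h3 : (z - w) • resAt R z (resAt R w f) + resAt R w f =
      R ((z - w) • (resAt R w f + (1 + z) • resAt R z (resAt R w f)) +
        (f + (1 + w) • resAt R w f)) := by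
    rw [map_add, map_smul, ← h1, ← h2]
  refine h3.trans ?_
  congr 1
  module

/-- The function `4 T / ((t - μ)² + η²)` of `r = (1 + t)⁻¹`. -/
noncomputable def termExt (T μ : ℝ) (n : ℕ) (r : ℝ) : ℝ :=
  4 * T * r ^ 2 / ((1 - (1 + μ) * r) ^ 2 + matsubara T n ^ 2 * r ^ 2)

theorem termExt_denom_pos (hT : 0 < T) (n : ℕ) (r : ℝ) :
    0 < (1 - (1 + μ) * r) ^ 2 + matsubara T n ^ 2 * r ^ 2 := by
  have := matsubara_pos hT n
  rcases eq_or_ne r 0 with rfl | h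
  · simp
  · positivity

theorem continuous_termExt (hT : 0 < T) (n : ℕ) : Continuous (termExt T μ n) := by
  unfold termExt
  exact Continuous.div (by fun_prop) (by fun_prop) fun r => (termExt_denom_pos hT n r).ne'

theorem termExt_of_ne {n : ℕ} {r : ℝ} (hr : r ≠ 0) :
    termExt T μ n r = symbolTerm T μ n (r⁻¹ - 1) := by
  have : (r⁻¹ - 1 - μ) = (1 - (1 + μ) * r) / r := by field_simp; ring
  rw [termExt, symbolTerm, this, div_pow, div_add' _ _ _ (pow_ne_zero 2 hr), div_div_eq_mul_div]

/-- The series in `t` converges uniformly by the Weierstrass test, hence so does the series in `r`;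
at `r = 0` all terms and the limit vanish. -/
theorem tendsto_sum_cfc_termExt (hT : 0 < T) :
    Tendsto (fun N => cfc (fun r => ∑ n ∈ Finset.range N, termExt T μ n r) R) atTop
      (𝓝 (kinRes T μ 0 R)) := by
  refine tendsto_cfc_fun ?_ (Eventually.of_forall fun N =>
    (continuous_finsetSum _ fun n _ => continuous_termExt hT n).continuousOn)
  have h1 := tendstoUniformly_tsum_nat (f := fun n t => symbolTerm T μ n t)
    (summable_symbolTerm_bound hT) fun n t => by
      rw [Real.norm_of_nonneg (symbolTerm_nonneg hT n t)]; exact symbolTerm_le hT n t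
  rw [Metric.tendstoUniformly_iff] at h1
  rw [Metric.tendstoUniformlyOn_iff]
  intro ε hε
  filter_upwards [h1 ε hε] with N hN r hr
  rcases eq_or_ne r 0 with rfl | hne
  · simpa [shiftInv_zero, termExt] using hε
  · have := hN (r⁻¹ - 1)
    rw [tsum_symbolTerm hT] at this
    simpa [shiftInv_of_ne hne, termExt_of_ne hne] using this

/-- The points `μ ± i η`. -/
noncomputable def pole (T μ : ℝ) (n : ℕ) : ℂ := μ + matsubara T n * Complex.I

/-- Partial fractions: `4T/((t-μ)²+η²) = (2T/(iη)) (1/(t-z) - 1/(t-z̄))` with `z = μ+iη`. The real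
functional calculus does not contain the single fractions, so both sides are compared after
multiplication by the invertible factors `1-(1+z̄)R` and `1-(1+z)R`. -/
theorem cfc_termExt (hT : 0 < T) (hR : IsSelfAdjoint R) (n : ℕ) :
    cfc (termExt T μ n) R = (2 * T / (Complex.I * matsubara T n)) •
      (resAt R (pole T μ n) - resAt R (starRingEnd ℂ (pole T μ n))) := by
  have hη := matsubara_pos hT n
  have hη' : (matsubara T n : ℂ) ≠ 0 := by exact_mod_cast hη.ne'
  set z := pole T μ n with hz
  have him : z.im = matsubara T n := by simp [hz, pole]
  have hzi : z.im ≠ 0 := by rw [him]; exact hη.ne'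
  have hzi' : (starRingEnd ℂ z).im ≠ 0 := by simpa using hzi
  have hsub : z - starRingEnd ℂ z = 2 * Complex.I * matsubara T n := by
    simp [hz, pole]; ring
  rw [resAt_sub_resAt hR hzi hzi', smul_smul, hsub]
  have hc : 2 * T / (Complex.I * matsubara T n) * (2 * Complex.I * matsubara T n) = 4 * (T : ℂ) := by
    field_simp [Complex.I_ne_zero]; ring
  rw [hc]
  set A : H →L[ℂ] H := 1 - (1 + z) • R with hA
  set A' : H →L[ℂ] H := 1 - (1 + starRingEnd ℂ z) • R with hA'
  have hAu : IsUnit A := isUnit_one_sub_smul hR (by simpa using hzi)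
  have hAu' : IsUnit A' := isUnit_one_sub_smul hR (by simpa using hzi')
  have hRA : Commute R A := (Commute.one_right R).sub_right ((Commute.refl R).smul_right _)
  have e1 : cfc (fun r : ℝ => (1 - (1 + μ) * r) ^ 2 + matsubara T n ^ 2 * r ^ 2) R = A' * A := by
    rw [cfc_add R _ _ (by fun_prop) (by fun_prop), cfc_const_mul _ _ R (by fun_prop),
      cfc_pow _ _ R (by fun_prop), cfc_pow _ _ R (by fun_prop),
      cfc_sub _ _ R (by fun_prop) (by fun_prop), cfc_const_mul _ _ R (by fun_prop), cfc_id' ℝ R,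
      cfc_const_one ℝ R, ← Complex.coe_smul, ← Complex.coe_smul, hA, hA']
    have e3 : (1 + starRingEnd ℂ z) = ((1 + μ : ℝ) : ℂ) - matsubara T n * Complex.I := by
      simp [hz, pole]; ring
    have e4 : (1 + z) = ((1 + μ : ℝ) : ℂ) + matsubara T n * Complex.I := by
      simp [hz, pole]; ring
    have e5 : ∀ p q : ℂ, (1 - (p - q) • R) * (1 - (p + q) • R) =
        1 - (2 * p) • R + (p ^ 2 - q ^ 2) • (R * R) := by
      intro p q
      simp only [sub_mul, mul_sub, one_mul, mul_one, smul_mul_smul_comm]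
      module
    have hI : (matsubara T n * Complex.I) ^ 2 = -(matsubara T n : ℂ) ^ 2 := by
      rw [mul_pow, Complex.I_sq]; ring
    rw [e3, e4, e5, hI]
    simp only [pow_two, sub_mul, mul_sub, one_mul, mul_one, smul_mul_smul_comm]
    push_cast
    module
  have e2 : cfc (termExt T μ n) R * (A' * A) = (4 * (T : ℂ)) • (R * R) := by
    rw [← e1, ← cfc_mul _ _ R (continuous_termExt hT n).continuousOn (by fun_prop)]
    have : (4 * (T : ℂ)) • (R * R) = cfc (fun r : ℝ => 4 * T * r ^ 2) R := by
      rw [cfc_const_mul _ _ R (by fun_prop), cfc_pow _ _ R (by fun_prop), cfc_id' ℝ R, pow_two,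
        ← Complex.coe_smul]
      push_cast; rfl
    rw [this]
    exact cfc_congr fun r _ => div_mul_cancel₀ _ (termExt_denom_pos hT n r).ne'
  have e3 : ((4 * (T : ℂ)) • (resAt R z * resAt R (starRingEnd ℂ z))) * (A' * A) =
      (4 * (T : ℂ)) • (R * R) := by
    rw [smul_mul_assoc, mul_assoc, ← mul_assoc _ A' A, resAt_mul_sub hR hzi', hRA.eq, ← mul_assoc,
      resAt_mul_sub hR hzi]
  exact (hAu'.mul hAu).mul_right_cancel (e2.trans e3.symm)

/-- This passes from a function of the Laplacian to resolvents of a differential operator, for which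
commutators with weights and changes of potential can be computed. -/
theorem tendsto_sum_resAt (hT : 0 < T) (hR : IsSelfAdjoint R) :
    Tendsto (fun N => ∑ n ∈ Finset.range N, (2 * T / (Complex.I * matsubara T n)) •
      (resAt R (pole T μ n) - resAt R (starRingEnd ℂ (pole T μ n)))) atTop
      (𝓝 (kinRes T μ 0 R)) := by
  refine (tendsto_sum_cfc_termExt hT).congr fun N => ?_
  have := cfc_sum (a := R) (fun n => termExt T μ n) (Finset.range N)
    (fun n _ => (continuous_termExt hT n).continuousOn)
  rw [← Finset.sum_congr rfl fun n _ => cfc_termExt hT hR n, ← this]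
  congr 1; funext r; simp

end Calculus

end MagneticBCS

namespace MagneticBCS

/-! ### Weighted estimates for resolvents -/

/-- `u` lies in the form domain with gradient `χ`, and `(-i ∇ + a)² u = g`. -/
def HasMagLaplacian (a : R3 → R3) (u : L2) (χ : Fin 3 → L2) (g : L2) : Prop :=
  (∀ j, IsMagneticDeriv a j u (χ j)) ∧
    ∀ (v : L2) (w : Fin 3 → L2), (∀ j, IsMagneticDeriv a j v (w j)) →
      ∑ j, ⟪w j, χ j⟫_ℂ = ⟪v, g⟫_ℂ

theorem hasMagLaplacian_iff {a : R3 → R3} {u g : L2} :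
    (∃ χ, HasMagLaplacian a u χ g) ↔ u = magRes a (g + u) := mem_magneticLaplacianGraph

theorem exists_hasMagLaplacian_resAt (a : R3 → R3) {z : ℂ} (hz : z.im ≠ 0) (f : L2) :
    ∃ χ, HasMagLaplacian a (resAt (magRes a) z f) χ (f + z • resAt (magRes a) z f) := by
  rw [hasMagLaplacian_iff]
  conv_lhs => rw [resAt_apply (magRes_isSelfAdjoint a) hz]
  congr 1; module

theorem norm_le_of_inner {H : Type*} [NormedAddCommGroup H] [InnerProductSpace ℂ H] {x : H} {C : ℝ}
    (hC : 0 ≤ C) (h : ∀ g, ‖⟪g, x⟫_ℂ‖ ≤ C * ‖g‖) : ‖x‖ ≤ C := by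
  rcases eq_or_ne x 0 with rfl | hx
  · simpa using hC
  · have := h x
    rw [inner_self_eq_norm_sq_to_K] at this
    have h2 : 0 < ‖x‖ := norm_pos_iff.2 hx
    simp at this
    nlinarith

theorem sum_norm_sq_grad {a : R3 → R3} {u g : L2} {χ : Fin 3 → L2} (h : HasMagLaplacian a u χ g) :
    ((∑ j, ‖χ j‖ ^ 2 : ℝ) : ℂ) = ⟪u, g⟫_ℂ := by
  rw [← h.2 u χ h.1]
  push_cast
  exact Finset.sum_congr rfl fun j _ => by rw [inner_self_eq_norm_sq_to_K]; rfl

theorem norm_resAt_le (a : R3 → R3) {z : ℂ} (hz : z.im ≠ 0) (f : L2) :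
    ‖resAt (magRes a) z f‖ ≤ |z.im|⁻¹ * ‖f‖ := by
  obtain ⟨χ, h⟩ := exists_hasMagLaplacian_resAt a hz f
  set u := resAt (magRes a) z f
  -- The gradient energy is real, so the imaginary part of the energy identity isolates `im z *
  -- ‖u‖²`.
  have h1 := congrArg Complex.im (sum_norm_sq_grad h)
  rw [inner_add_right, inner_smul_right, inner_self_eq_norm_sq_to_K] at h1
  have e : (z * ((‖u‖ : ℂ)) ^ 2).im = z.im * ‖u‖ ^ 2 := by
    rw [← Complex.ofReal_pow, Complex.im_mul_ofReal]
  simp only [Complex.ofReal_im, Complex.add_im] at h1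
  have h2 : z.im * ‖u‖ ^ 2 = -(⟪u, f⟫_ℂ).im := by
    have : (z * ((‖u‖ : ℂ)) ^ 2).im = -(⟪u, f⟫_ℂ).im := by
      have h1' : 0 = (⟪u, f⟫_ℂ).im + (z * ((‖u‖ : ℂ)) ^ 2).im := h1
      linarith
    rw [← e, this]
  have h3 : |z.im| * ‖u‖ ^ 2 ≤ ‖u‖ * ‖f‖ := by
    calc |z.im| * ‖u‖ ^ 2 = |z.im * ‖u‖ ^ 2| := by rw [abs_mul, abs_of_nonneg (sq_nonneg ‖u‖)]
      _ = |(⟪u, f⟫_ℂ).im| := by rw [h2, abs_neg]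
      _ ≤ ‖⟪u, f⟫_ℂ‖ := Complex.abs_im_le_norm _
      _ ≤ ‖u‖ * ‖f‖ := norm_inner_le_norm _ _
  have hz' : 0 < |z.im| := abs_pos.2 hz
  rw [inv_mul_eq_div, le_div_iff₀ hz']
  rcases eq_or_lt_of_le (norm_nonneg u) with h0 | h0
  · rw [← h0]; simp
  · nlinarith

/-- The data `re z = μ`, `|im z| = η`, `η ≥ η₀` for the poles of the inverse symbol. -/
structure IsPole (μ η₀ η : ℝ) (z : ℂ) : Prop where
  pos : 0 < η₀
  le : η₀ ≤ η
  re : z.re = μ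
  im : |z.im| = η

namespace IsPole
variable {μ η₀ η : ℝ} {z : ℂ}

theorem eta_pos (h : IsPole μ η₀ η z) : 0 < η := h.pos.trans_le h.le

theorem im_ne (h : IsPole μ η₀ η z) : z.im ≠ 0 := by
  have := h.eta_pos; rw [← h.im] at this; exact abs_pos.1 this

theorem conj (h : IsPole μ η₀ η z) : IsPole μ η₀ η (starRingEnd ℂ z) :=
  ⟨h.pos, h.le, by simpa using h.re, by simpa using h.im⟩

theorem norm_le (h : IsPole μ η₀ η z) : ‖z‖ ≤ (1 + |μ| / η₀) * η := by
  have h1 := Complex.norm_le_abs_re_add_abs_im z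
  rw [h.re, h.im] at h1
  have h2 : |μ| ≤ |μ| / η₀ * η := by
    rw [div_mul_eq_mul_div, le_div_iff₀ h.pos]
    exact mul_le_mul_of_nonneg_left h.le (abs_nonneg _)
  linarith

end IsPole

variable {μ η₀ η : ℝ} {z : ℂ} {a : R3 → R3}

/-- In the energy identity `∑ ‖χ_j‖² = ⟨u, f + z u⟩` the resolvent gives `‖u‖ ≤ η⁻¹‖f‖` and `|z|` is
at most a multiple of `η`. The right side is therefore of order `η⁻¹`, and one gradient costs half a
power of `η`. -/
theorem norm_grad_resAt_le (hz : IsPole μ η₀ η z) {f : L2} {χ : Fin 3 → L2}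
    (h : HasMagLaplacian a (resAt (magRes a) z f) χ (f + z • resAt (magRes a) z f)) (j : Fin 3) :
    ‖χ j‖ ≤ √(2 + |μ| / η₀) * (√η)⁻¹ * ‖f‖ := by
  have hη := hz.eta_pos
  have hη0 := hz.pos
  have h1 := sum_norm_sq_grad h
  have h2 := norm_resAt_le a hz.im_ne f
  rw [hz.im] at h2
  set u := resAt (magRes a) z f
  have h3 : ∑ j, ‖χ j‖ ^ 2 ≤ ‖u‖ * (‖f‖ + ‖z‖ * ‖u‖) := by
    have : ‖((∑ j, ‖χ j‖ ^ 2 : ℝ) : ℂ)‖ ≤ ‖u‖ * ‖f + z • u‖ := by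
      rw [h1]; exact norm_inner_le_norm _ _
    rw [Complex.norm_real] at this
    refine (le_abs_self _).trans (this.trans ?_)
    refine mul_le_mul_of_nonneg_left ((norm_add_le _ _).trans ?_) (norm_nonneg _)
    rw [norm_smul]
  have h4 : ‖χ j‖ ^ 2 ≤ ∑ j, ‖χ j‖ ^ 2 :=
    Finset.single_le_sum (f := fun j => ‖χ j‖ ^ 2) (fun _ _ => sq_nonneg _) (Finset.mem_univ j)
  have h5 : ‖u‖ * (‖f‖ + ‖z‖ * ‖u‖) ≤ (2 + |μ| / η₀) * η⁻¹ * ‖f‖ ^ 2 := by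
    calc ‖u‖ * (‖f‖ + ‖z‖ * ‖u‖)
        ≤ (η⁻¹ * ‖f‖) * (‖f‖ + ((1 + |μ| / η₀) * η) * (η⁻¹ * ‖f‖)) := by
          have := hz.norm_le
          gcongr
      _ = (2 + |μ| / η₀) * η⁻¹ * ‖f‖ ^ 2 := by field_simp; ring
  refine le_of_sq_le_sq ?_ (by positivity)
  rw [mul_pow, mul_pow, inv_pow, Real.sq_sqrt (by positivity), Real.sq_sqrt hη.le]
  linarith

/-- The commutator of a resolvent with a smooth bounded function. -/
theorem inner_commutator_resAt (ha : Continuous a) (hz : z.im ≠ 0) {w : R3 → ℝ}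
    (hw : ContDiff ℝ ∞ w) (hb : IsBdd w) (hb' : ∀ j, IsBdd (pderiv j w)) {f g : L2}
    {χ ξ : Fin 3 → L2}
    (hχ : HasMagLaplacian a (resAt (magRes a) z f) χ (f + z • resAt (magRes a) z f))
    (hξ : HasMagLaplacian a (resAt (magRes a) (starRingEnd ℂ z) g) ξ
      (g + starRingEnd ℂ z • resAt (magRes a) (starRingEnd ℂ z) g)) :
    ⟪g, mulB w (resAt (magRes a) z f) - resAt (magRes a) z (mulB w f)⟫_ℂ =
      -Complex.I * ∑ j, (⟪ξ j, mulB (pderiv j w) (resAt (magRes a) z f)⟫_ℂ +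
        ⟪mulB (pderiv j w) (resAt (magRes a) (starRingEnd ℂ z) g), χ j⟫_ℂ) := by
  have hz' : (starRingEnd ℂ z).im ≠ 0 := by simpa using hz
  have hadj : ⟪g, resAt (magRes a) z (mulB w f)⟫_ℂ =
      ⟪mulB w (resAt (magRes a) (starRingEnd ℂ z) g), f⟫_ℂ := by
    rw [← ContinuousLinearMap.adjoint_inner_left, adjoint_resAt (magRes_isSelfAdjoint a) hz,
      inner_mulB hb]
  rw [inner_sub_right, hadj]
  set u := resAt (magRes a) z f
  set v := resAt (magRes a) (starRingEnd ℂ z) g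
  -- Each weak equation is tested with `w` times the solution of the other. In the difference the
  -- terms with `w` undifferentiated cancel.
  have e1 := hχ.2 (mulB w v) _ fun j => (hξ.1 j).mul_smooth ha hw hb (hb' j)
  have e2 := hξ.2 (mulB w u) _ fun j => (hχ.1 j).mul_smooth ha hw hb (hb' j)
  have e3 := congrArg (starRingEnd ℂ) e2
  rw [map_sum, inner_conj_symm] at e3
  simp only [inner_conj_symm] at e3
  rw [inner_add_left, inner_smul_left, Complex.conj_conj] at e3
  rw [inner_add_right, inner_smul_right] at e1
  have e4 := inner_mulB hb v u
  have e5 : ⟪g, mulB w u⟫_ℂ - ⟪mulB w v, f⟫_ℂ =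
      ∑ j, ⟪ξ j, mulB w (χ j) - Complex.I • mulB (pderiv j w) u⟫_ℂ -
      ∑ j, ⟪mulB w (ξ j) - Complex.I • mulB (pderiv j w) v, χ j⟫_ℂ := by
    rw [e1, e3, e4]; ring
  rw [e5, ← Finset.sum_sub_distrib, Finset.mul_sum]
  refine Finset.sum_congr rfl fun j _ => ?_
  rw [inner_sub_right, inner_sub_left, inner_smul_right, inner_smul_left, inner_mulB hb]
  simp; ring

/-- Smooth bounded functions `p ≥ 1` with partial derivatives bounded by `1`. -/
structure IsWeight (p : R3 → ℝ) : Prop where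
  smooth : ContDiff ℝ ∞ p
  bdd : IsBdd p
  one_le : ∀ x, 1 ≤ p x
  deriv_le : ∀ j x, |pderiv j p x| ≤ 1

namespace IsWeight
variable {p : R3 → ℝ}

theorem bdd_deriv (h : IsWeight p) (j : Fin 3) : IsBdd (pderiv j p) :=
  IsBdd.of_continuous (contDiff_pderiv h.smooth j).continuous (h.deriv_le j)

theorem pderiv_sq (h : IsWeight p) (j : Fin 3) (x : R3) :
    pderiv j (fun x => p x ^ 2) x = 2 * p x * pderiv j p x := by
  have := (h.smooth.differentiable (by simp) x).hasFDerivAt.pow 2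
  simp only [pderiv]
  rw [this.fderiv]
  simp

theorem _root_.MagneticBCS.IsBdd.mul {m m' : R3 → ℝ} (h : IsBdd m) (h' : IsBdd m') :
    IsBdd fun x => m x * m' x := by
  have := MemLp.mul (p := ∞) (q := ∞) (r := ∞) h' h
  unfold IsBdd
  refine this.ae_eq (Filter.Eventually.of_forall fun x => ?_)
  simp

theorem bdd_sq (h : IsWeight p) : IsBdd fun x => p x ^ 2 := by
  simpa only [pow_two] using h.bdd.mul h.bdd

theorem smooth_sq (h : IsWeight p) : ContDiff ℝ ∞ fun x => p x ^ 2 := h.smooth.pow 2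

theorem bdd_deriv_sq (h : IsWeight p) (j : Fin 3) : IsBdd (pderiv j fun x => p x ^ 2) := by
  have e : (pderiv j fun x => p x ^ 2) = fun x => (2 * p x) * pderiv j p x :=
    funext fun x => h.pderiv_sq j x
  rw [e]
  refine IsBdd.mul ?_ (h.bdd_deriv j)
  have h2 : IsBdd fun _ => 2 := IsBdd.of_continuous continuous_const fun _ => le_rfl
  exact h2.mul h.bdd

theorem norm_le (h : IsWeight p) (f : L2) : ‖f‖ ≤ ‖mulB p f‖ := by
  have := norm_le_of_mulGraph (C := 1) (mulGraph_one f) (mem_mulGraph_mulB h.bdd f) fun x => by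
    rw [abs_one, one_mul]; exact (h.one_le x).trans (le_abs_self _)
  rwa [one_mul] at this

theorem norm_le_sq (h : IsWeight p) (f : L2) : ‖mulB p f‖ ≤ ‖mulB (fun x => p x ^ 2) f‖ := by
  have := norm_le_of_mulGraph (C := 1) (mem_mulGraph_mulB h.bdd f) (mem_mulGraph_mulB h.bdd_sq f)
    fun x => by
      have := h.one_le x
      rw [one_mul, abs_of_nonneg (by linarith), abs_of_nonneg (by positivity)]
      nlinarith
  rwa [one_mul] at this

theorem norm_deriv_mul_le (h : IsWeight p) (j : Fin 3) (f : L2) : ‖mulB (pderiv j p) f‖ ≤ ‖f‖ := by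
  have := norm_mulB_le (h.bdd_deriv j) (h.deriv_le j) f
  rwa [one_mul] at this

theorem norm_deriv_sq_mul_le (h : IsWeight p) (j : Fin 3) (f : L2) :
    ‖mulB (pderiv j fun x => p x ^ 2) f‖ ≤ 2 * ‖mulB p f‖ := by
  refine norm_le_of_mulGraph (mem_mulGraph_mulB (h.bdd_deriv_sq j) f) (mem_mulGraph_mulB h.bdd f)
    fun x => ?_
  rw [h.pderiv_sq, abs_mul, abs_mul, abs_two]
  have := mul_le_mul_of_nonneg_left (h.deriv_le j x) (by positivity : 0 ≤ 2 * |p x|)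
  linarith

theorem mulB_sq (h : IsWeight p) (f : L2) : mulB (fun x => p x ^ 2) f = mulB p (mulB p f) :=
  mulGraph_unique (mem_mulGraph_mulB h.bdd_sq f)
    (mulGraph_mul (mem_mulGraph_mulB h.bdd f) (mem_mulGraph_mulB h.bdd _) fun _ => pow_two _)

theorem inner_sq (h : IsWeight p) (u v : L2) :
    ⟪mulB (fun x => p x ^ 2) u, v⟫_ℂ = ⟪mulB p u, mulB p v⟫_ℂ := by
  rw [h.mulB_sq, inner_mulB h.bdd]

/-- Weighted energy estimate. -/
theorem sum_norm_sq_grad_le (h : IsWeight p) (ha : Continuous a) {u g : L2} {χ : Fin 3 → L2}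
    (hu : HasMagLaplacian a u χ g) :
    ∑ j, ‖mulB p (χ j)‖ ^ 2 ≤ 2 * ‖⟪mulB (fun x => p x ^ 2) u, g⟫_ℂ‖ + 12 * ‖u‖ ^ 2 := by
  -- Testing with `p² u` gives the weighted energy plus a term with `∂(p²) = 2p ∂p`; one factor `p`
  -- of it is put on the gradient.
  have e1 := hu.2 (mulB (fun x => p x ^ 2) u) _ fun j =>
    (hu.1 j).mul_smooth ha h.smooth_sq h.bdd_sq (h.bdd_deriv_sq j)
  have e2 : ((∑ j, ‖mulB p (χ j)‖ ^ 2 : ℝ) : ℂ) = ⟪mulB (fun x => p x ^ 2) u, g⟫_ℂ -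
      Complex.I * ∑ j, ⟪mulB (pderiv j fun x => p x ^ 2) u, χ j⟫_ℂ := by
    rw [← e1, Finset.mul_sum, ← Finset.sum_sub_distrib]
    push_cast
    refine Finset.sum_congr rfl fun j _ => ?_
    rw [inner_sub_left, inner_smul_left, h.inner_sq, inner_self_eq_norm_sq_to_K]
    simp
  have e3 : ∀ j, ‖⟪mulB (pderiv j fun x => p x ^ 2) u, χ j⟫_ℂ‖ ≤ 2 * ‖u‖ * ‖mulB p (χ j)‖ := by
    intro j
    have hm : mulB (pderiv j fun x => p x ^ 2) u = (2 : ℂ) • mulB p (mulB (pderiv j p) u) := by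
      have h1 := mem_mulGraph_mulB (h.bdd_deriv_sq j) u
      have h2 := mulGraph_mul (m'' := fun x => p x * pderiv j p x)
        (mem_mulGraph_mulB (h.bdd_deriv j) u) (mem_mulGraph_mulB h.bdd _) fun _ => rfl
      refine mulGraph_unique h1 ?_
      rw [mem_mulGraph] at h2 ⊢
      filter_upwards [h2, Lp.coeFn_smul (2 : ℂ) (mulB p (mulB (pderiv j p) u))] with x h3 h4
      rw [h4, Pi.smul_apply, h3, h.pderiv_sq]
      simp; ring
    rw [hm, inner_smul_left, norm_mul, inner_mulB h.bdd]
    have := (norm_inner_le_norm (𝕜 := ℂ) (mulB (pderiv j p) u) (mulB p (χ j))).trans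
      (mul_le_mul_of_nonneg_right (h.norm_deriv_mul_le j u) (norm_nonneg _))
    simp only [Complex.norm_conj, Complex.norm_ofNat]
    linarith
  have e4 : ∑ j, ‖mulB p (χ j)‖ ^ 2 ≤ ‖⟪mulB (fun x => p x ^ 2) u, g⟫_ℂ‖ +
      ∑ j, 2 * ‖u‖ * ‖mulB p (χ j)‖ := by
    have h1 : ‖((∑ j, ‖mulB p (χ j)‖ ^ 2 : ℝ) : ℂ)‖ ≤ ‖⟪mulB (fun x => p x ^ 2) u, g⟫_ℂ‖ +
      ∑ j, 2 * ‖u‖ * ‖mulB p (χ j)‖ := by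
      rw [e2]
      refine (norm_sub_le _ _).trans (add_le_add le_rfl ?_)
      rw [norm_mul, Complex.norm_I, one_mul]
      exact (norm_sum_le _ _).trans (Finset.sum_le_sum fun j _ => e3 j)
    rw [Complex.norm_real] at h1
    exact (le_abs_self _).trans h1
  rw [Fin.sum_univ_three] at e4 ⊢
  rw [Fin.sum_univ_three] at e4
  -- Young's inequality `2‖u‖x ≤ x²/2 + 2‖u‖²` for each of the three components, then doubling,
  -- produces the constants `2` and `12`.
  nlinarith [sq_nonneg (‖mulB p (χ 0)‖ - 2 * ‖u‖), sq_nonneg (‖mulB p (χ 1)‖ - 2 * ‖u‖),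
    sq_nonneg (‖mulB p (χ 2)‖ - 2 * ‖u‖)]

/-- Every term of the commutator pairs a gradient of one resolvent, of size `η^(-1/2)`, with another
resolvent of size `η⁻¹`. The weight enters only through `|∂p| ≤ 1`, so neither the bound nor the
constant sees the size of `p`. -/
theorem norm_commutator_resAt_le (h : IsWeight p) (ha : Continuous a) (hz : IsPole μ η₀ η z)
    (f : L2) : ‖mulB p (resAt (magRes a) z f) - resAt (magRes a) z (mulB p f)‖ ≤
      6 * √(2 + |μ| / η₀) * (√η)⁻¹ * η⁻¹ * ‖f‖ := by
  have hη := hz.eta_pos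
  refine norm_le_of_inner (by positivity) fun g => ?_
  obtain ⟨χ, hχ⟩ := exists_hasMagLaplacian_resAt a hz.im_ne f
  obtain ⟨ξ, hξ⟩ := exists_hasMagLaplacian_resAt a hz.conj.im_ne g
  rw [inner_commutator_resAt ha hz.im_ne h.smooth h.bdd h.bdd_deriv hχ hξ, norm_mul, norm_neg,
    Complex.norm_I, one_mul]
  have b1 := norm_resAt_le a hz.im_ne f
  have b2 := norm_resAt_le a hz.conj.im_ne g
  rw [hz.im] at b1
  rw [hz.conj.im] at b2
  calc _ ≤ ∑ j : Fin 3, 2 * √(2 + |μ| / η₀) * (√η)⁻¹ * η⁻¹ * ‖f‖ * ‖g‖ := by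
        refine (norm_sum_le _ _).trans (Finset.sum_le_sum fun j _ => ?_)
        have b3 := norm_grad_resAt_le hz hχ j
        have b4 := norm_grad_resAt_le hz.conj hξ j
        refine (norm_add_le _ _).trans ?_
        calc _ ≤ (√(2 + |μ| / η₀) * (√η)⁻¹ * ‖g‖) * (η⁻¹ * ‖f‖) +
              (η⁻¹ * ‖g‖) * (√(2 + |μ| / η₀) * (√η)⁻¹ * ‖f‖) := by
              refine add_le_add ((norm_inner_le_norm _ _).trans ?_)
                ((norm_inner_le_norm _ _).trans ?_)
              · exact mul_le_mul b4 ((h.norm_deriv_mul_le j _).trans b1) (norm_nonneg _)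
                  (by positivity)
              · exact mul_le_mul ((h.norm_deriv_mul_le j _).trans b2) b3 (norm_nonneg _)
                  (by positivity)
          _ = _ := by ring
    _ = _ := by rw [Finset.sum_const, Finset.card_univ, Fintype.card_fin]; simp; ring

end IsWeight

/-- Uniform weighted bounds for the resolvents at the poles. -/
theorem exists_weighted_bounds (μ : ℝ) {η₀ : ℝ} (h0 : 0 < η₀) : ∃ C : ℝ, 0 < C ∧
    ∀ (a : R3 → R3), Continuous a → ∀ (η : ℝ) (z : ℂ), IsPole μ η₀ η z → ∀ p, IsWeight p →
    ∀ (f : L2) (χ : Fin 3 → L2),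
      HasMagLaplacian a (resAt (magRes a) z f) χ (f + z • resAt (magRes a) z f) →
      ‖mulB p (resAt (magRes a) z f) - resAt (magRes a) z (mulB p f)‖ ≤ C * (√η)⁻¹ * ‖f‖ ∧
      ‖mulB p (resAt (magRes a) z f)‖ ≤ C * η⁻¹ * ‖mulB p f‖ ∧
      (∀ j, ‖mulB p (χ j)‖ ≤ C * (√η)⁻¹ * ‖mulB p f‖) ∧
      ‖mulB (fun x => p x ^ 2) (resAt (magRes a) z f) -
        resAt (magRes a) z (mulB (fun x => p x ^ 2) f)‖ ≤ C * (√η)⁻¹ * ‖mulB p f‖ ∧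
      ‖mulB (fun x => p x ^ 2) (resAt (magRes a) z f)‖ ≤
        C * (√η)⁻¹ * ‖mulB (fun x => p x ^ 2) f‖ := by
  set c1 := √(2 + |μ| / η₀) with hc1
  have hc1p : 0 < c1 := Real.sqrt_pos.2 (by positivity)
  set s0 := (√η₀)⁻¹ with hs0
  have hs0p : 0 < s0 := by positivity
  -- `c2` is resolvent plus commutator, `c3` comes from the weighted energy estimate, and `c4` from
  -- the commutator with `p²`. All are independent of `a`, of `p` and of the pole.
  set c2 := 1 + 6 * c1 * s0 with hc2
  set c3 := √(2 * (c2 + (1 + |μ| / η₀) * c2 ^ 2) + 12 * η₀⁻¹) with hc3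
  have hc2p : 0 < c2 := by positivity
  have hc3p : 0 < c3 := Real.sqrt_pos.2 (by positivity)
  set c4 := 6 * (c1 * c2 + c3) * η₀⁻¹ with hc4
  have hc4p : 0 < c4 := by positivity
  refine ⟨6 * c1 * η₀⁻¹ + c2 + c3 + c4 + (s0 + c4), by positivity, ?_⟩
  intro a ha η z hz p hp f χ hχ
  have hη := hz.eta_pos
  have hηi : η⁻¹ ≤ η₀⁻¹ := inv_anti₀ h0 hz.le
  have hsi : (√η)⁻¹ ≤ s0 := inv_anti₀ (Real.sqrt_pos.2 h0) (Real.sqrt_le_sqrt hz.le)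
  have hsp : 0 < (√η)⁻¹ := by have := Real.sqrt_pos.2 hη; positivity
  have hss : (√η)⁻¹ * (√η)⁻¹ = η⁻¹ := by rw [← mul_inv, Real.mul_self_sqrt hη.le]
  have hpf := hp.norm_le f
  have hpq := hp.norm_le_sq f
  have hf0 := norm_nonneg f
  have n1 := norm_resAt_le a hz.im_ne f
  rw [hz.im] at n1
  have n2 := norm_resAt_le a hz.im_ne (mulB p f)
  rw [hz.im] at n2
  have n3 := norm_resAt_le a hz.im_ne (mulB (fun x => p x ^ 2) f)
  rw [hz.im] at n3
  have b1 := hp.norm_commutator_resAt_le ha hz f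
  rw [← hc1] at b1
  set u := resAt (magRes a) z f with hu
  have b2 : ‖mulB p u‖ ≤ c2 * η⁻¹ * ‖mulB p f‖ := by
    have : ‖mulB p u‖ ≤ ‖resAt (magRes a) z (mulB p f)‖ +
        ‖mulB p u - resAt (magRes a) z (mulB p f)‖ := by
      have := norm_add_le (resAt (magRes a) z (mulB p f)) (mulB p u - resAt (magRes a) z (mulB p f))
      rwa [add_sub_cancel] at this
    calc ‖mulB p u‖ ≤ η⁻¹ * ‖mulB p f‖ + 6 * c1 * s0 * η⁻¹ * ‖mulB p f‖ := by
          refine this.trans (add_le_add n2 (b1.trans ?_))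
          gcongr
      _ = c2 * η⁻¹ * ‖mulB p f‖ := by rw [hc2]; ring
  have b3 : ∀ j, ‖mulB p (χ j)‖ ≤ c3 * (√η)⁻¹ * ‖mulB p f‖ := by
    intro j
    have e1 := hp.sum_norm_sq_grad_le ha hχ
    have e2 : ‖mulB p (χ j)‖ ^ 2 ≤ ∑ j, ‖mulB p (χ j)‖ ^ 2 :=
      Finset.single_le_sum (f := fun j => ‖mulB p (χ j)‖ ^ 2) (fun _ _ => sq_nonneg _)
        (Finset.mem_univ j)
    have e3 : ‖⟪mulB (fun x => p x ^ 2) u, f + z • u⟫_ℂ‖ ≤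
        (c2 * η⁻¹ * ‖mulB p f‖) * ‖mulB p f‖ +
          ((1 + |μ| / η₀) * η) * ((c2 * η⁻¹ * ‖mulB p f‖) * (c2 * η⁻¹ * ‖mulB p f‖)) := by
      rw [inner_add_right, inner_smul_right, hp.inner_sq, hp.inner_sq]
      refine (norm_add_le _ _).trans (add_le_add ?_ ?_)
      · exact (norm_inner_le_norm _ _).trans (mul_le_mul_of_nonneg_right b2 (norm_nonneg _))
      · rw [norm_mul]
        refine mul_le_mul hz.norm_le ((norm_inner_le_norm _ _).trans ?_) (norm_nonneg _)
          (by positivity)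
        exact mul_le_mul b2 b2 (norm_nonneg _) (by positivity)
    have e4 : ‖u‖ ^ 2 ≤ η₀⁻¹ * η⁻¹ * ‖mulB p f‖ ^ 2 := by
      calc ‖u‖ ^ 2 ≤ (η⁻¹ * ‖mulB p f‖) ^ 2 := by
            refine pow_le_pow_left₀ (norm_nonneg _) (n1.trans ?_) 2
            gcongr
        _ = η⁻¹ * η⁻¹ * ‖mulB p f‖ ^ 2 := by ring
        _ ≤ _ := by gcongr
    refine le_of_sq_le_sq ?_ (by positivity)
    have e5 : (c3 * (√η)⁻¹ * ‖mulB p f‖) ^ 2 =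
        (2 * (c2 + (1 + |μ| / η₀) * c2 ^ 2) + 12 * η₀⁻¹) * η⁻¹ * ‖mulB p f‖ ^ 2 := by
      rw [mul_pow, mul_pow, hc3, Real.sq_sqrt (by positivity), pow_two (√η)⁻¹, hss]
    have e6 : 2 * ((c2 * η⁻¹ * ‖mulB p f‖) * ‖mulB p f‖ +
          ((1 + |μ| / η₀) * η) * ((c2 * η⁻¹ * ‖mulB p f‖) * (c2 * η⁻¹ * ‖mulB p f‖))) +
          12 * (η₀⁻¹ * η⁻¹ * ‖mulB p f‖ ^ 2) =
        (2 * (c2 + (1 + |μ| / η₀) * c2 ^ 2) + 12 * η₀⁻¹) * η⁻¹ * ‖mulB p f‖ ^ 2 := by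
      field_simp
    rw [e5, ← e6]
    linarith
  -- The derivative of `p²` carries exactly one factor `p`. It falls on `u` or on `χ`, whose bounds
  -- with weight `p` are already known; the dual solution remains unweighted.
  have b4 : ‖mulB (fun x => p x ^ 2) u - resAt (magRes a) z (mulB (fun x => p x ^ 2) f)‖ ≤
      c4 * (√η)⁻¹ * ‖mulB p f‖ := by
    refine norm_le_of_inner (by positivity) fun g => ?_
    obtain ⟨ξ, hξ⟩ := exists_hasMagLaplacian_resAt a hz.conj.im_ne g
    rw [inner_commutator_resAt ha hz.im_ne hp.smooth_sq hp.bdd_sq hp.bdd_deriv_sq hχ hξ, norm_mul,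
      norm_neg, Complex.norm_I, one_mul]
    have m2 := norm_resAt_le a hz.conj.im_ne g
    rw [hz.conj.im] at m2
    calc _ ≤ ∑ j : Fin 3, 2 * (c1 * c2 + c3) * ((√η)⁻¹ * η⁻¹) * ‖mulB p f‖ * ‖g‖ := by
          refine (norm_sum_le _ _).trans (Finset.sum_le_sum fun j _ => ?_)
          have m4 := norm_grad_resAt_le hz.conj hξ j
          rw [← hc1] at m4
          have m5 : ‖⟪mulB (pderiv j fun x => p x ^ 2) (resAt (magRes a) (starRingEnd ℂ z) g), χ j⟫_ℂ‖
              ≤ (η⁻¹ * ‖g‖) * (2 * (c3 * (√η)⁻¹ * ‖mulB p f‖)) := by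
            rw [inner_mulB (hp.bdd_deriv_sq j)]
            refine (norm_inner_le_norm _ _).trans ?_
            refine mul_le_mul m2 ((hp.norm_deriv_sq_mul_le j _).trans ?_) (norm_nonneg _)
              (by positivity)
            linarith [b3 j]
          refine (norm_add_le _ _).trans ?_
          calc _ ≤ (c1 * (√η)⁻¹ * ‖g‖) * (2 * (c2 * η⁻¹ * ‖mulB p f‖)) +
                (η⁻¹ * ‖g‖) * (2 * (c3 * (√η)⁻¹ * ‖mulB p f‖)) := by
                refine add_le_add ((norm_inner_le_norm _ _).trans ?_) m5
                refine mul_le_mul m4 ((hp.norm_deriv_sq_mul_le j _).trans ?_) (norm_nonneg _)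
                  (by positivity)
                linarith
            _ = _ := by ring
      _ = 6 * (c1 * c2 + c3) * ((√η)⁻¹ * η⁻¹) * ‖mulB p f‖ * ‖g‖ := by
          rw [Finset.sum_const, Finset.card_univ, Fintype.card_fin]; simp; ring
      _ ≤ 6 * (c1 * c2 + c3) * ((√η)⁻¹ * η₀⁻¹) * ‖mulB p f‖ * ‖g‖ := by gcongr
      _ = _ := by rw [hc4]; ring
  have b5 : ‖mulB (fun x => p x ^ 2) u‖ ≤ (s0 + c4) * (√η)⁻¹ * ‖mulB (fun x => p x ^ 2) f‖ := by
    have : ‖mulB (fun x => p x ^ 2) u‖ ≤ ‖resAt (magRes a) z (mulB (fun x => p x ^ 2) f)‖ +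
        ‖mulB (fun x => p x ^ 2) u - resAt (magRes a) z (mulB (fun x => p x ^ 2) f)‖ := by
      have := norm_add_le (resAt (magRes a) z (mulB (fun x => p x ^ 2) f))
        (mulB (fun x => p x ^ 2) u - resAt (magRes a) z (mulB (fun x => p x ^ 2) f))
      rwa [add_sub_cancel] at this
    calc _ ≤ ((√η)⁻¹ * (√η)⁻¹) * ‖mulB (fun x => p x ^ 2) f‖ +
          c4 * (√η)⁻¹ * ‖mulB (fun x => p x ^ 2) f‖ := by
          rw [hss]
          refine this.trans (add_le_add n3 (b4.trans ?_))
          gcongr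
      _ ≤ (s0 * (√η)⁻¹) * ‖mulB (fun x => p x ^ 2) f‖ +
          c4 * (√η)⁻¹ * ‖mulB (fun x => p x ^ 2) f‖ := by gcongr
      _ = _ := by ring
  set K := 6 * c1 * η₀⁻¹ + c2 + c3 + c4 + (s0 + c4) with hK
  have k1 : 6 * c1 * η₀⁻¹ ≤ K := by rw [hK]; linarith [mul_pos hc1p (inv_pos.2 h0)]
  have hx : 0 < 6 * c1 * η₀⁻¹ := by positivity
  have k2 : c2 ≤ K := by linarith
  have k3 : c3 ≤ K := by linarith
  have k4 : c4 ≤ K := by linarith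
  have k5 : s0 + c4 ≤ K := by linarith
  refine ⟨b1.trans ?_, b2.trans ?_, fun j => (b3 j).trans ?_, b4.trans ?_, b5.trans ?_⟩
  · calc 6 * c1 * (√η)⁻¹ * η⁻¹ * ‖f‖ ≤ 6 * c1 * (√η)⁻¹ * η₀⁻¹ * ‖f‖ := by gcongr
      _ = (6 * c1 * η₀⁻¹) * (√η)⁻¹ * ‖f‖ := by ring
      _ ≤ K * (√η)⁻¹ * ‖f‖ := by gcongr
  all_goals gcongr

end MagneticBCS

namespace MagneticBCS

/-! ### Weighted estimates for the resolvent of the kinetic operator -/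

section PoleSum

variable {T μ : ℝ}

theorem isPole_pole (hT : 0 < T) (n : ℕ) :
    IsPole μ (Real.pi * T) (matsubara T n) (pole T μ n) where
  pos := mul_pos Real.pi_pos hT
  le := by
    have := mul_pos Real.pi_pos hT
    have h : (0:ℝ) ≤ n := n.cast_nonneg
    unfold matsubara; nlinarith
  re := by simp [pole]
  im := by simpa [pole] using (matsubara_pos hT n).le

/-- The sum of the coefficients of the partial fraction expansion, weighted with `η⁻¹ᐟ²`. -/
noncomputable def poleSum (T : ℝ) : ℝ := ∑' n, 4 * T * matsubara T n ^ (-(3 / 2) : ℝ)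

theorem summable_poleSum (hT : 0 < T) : Summable fun n => 4 * T * matsubara T n ^ (-(3 / 2) : ℝ) :=
  (summable_inv_matsubara hT (by norm_num)).mul_left _

theorem poleSum_pos (hT : 0 < T) : 0 < poleSum T :=
  (summable_poleSum hT).tsum_pos (fun n => by have := matsubara_pos hT n; positivity) 0
    (by have := matsubara_pos hT 0; positivity)

/-- The coefficients are of order `η⁻¹` and alone not summable; the extra `η^(-1/2)` makes the
series converge. -/
theorem norm_pole_term_le {E : Type*} [NormedAddCommGroup E] [NormedSpace ℂ E] (hT : 0 < T) {n : ℕ}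
    {x y : E} {K : ℝ} (hx : ‖x‖ ≤ K * (√(matsubara T n))⁻¹)
    (hy : ‖y‖ ≤ K * (√(matsubara T n))⁻¹) :
    ‖(2 * T / (Complex.I * matsubara T n)) • (x - y)‖ ≤
      4 * T * matsubara T n ^ (-(3 / 2) : ℝ) * K := by
  have hη := matsubara_pos hT n
  have e : matsubara T n ^ (-(3 / 2) : ℝ) = (matsubara T n)⁻¹ * (√(matsubara T n))⁻¹ := by
    rw [Real.rpow_neg hη.le, ← mul_inv, show (3 / 2 : ℝ) = 1 + 1 / 2 by norm_num,
      Real.rpow_add hη, Real.rpow_one, Real.sqrt_eq_rpow]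
  have hc : ‖(2 * T / (Complex.I * matsubara T n) : ℂ)‖ = 2 * T * (matsubara T n)⁻¹ := by
    rw [norm_div, norm_mul, norm_mul, Complex.norm_I, Complex.norm_real, Complex.norm_real,
      Real.norm_of_nonneg hT.le, Real.norm_of_nonneg hη.le]
    simp [div_eq_mul_inv]
  rw [norm_smul, hc, e]
  calc _ ≤ 2 * T * (matsubara T n)⁻¹ * (K * (√(matsubara T n))⁻¹ + K * (√(matsubara T n))⁻¹) := by
        gcongr
        exact (norm_sub_le _ _).trans (add_le_add hx hy)
    _ = _ := by ring

/-- Transfers bounds of order `η^(-1/2)` from the resolvents to the inverse of `K`, for any quantity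
continuous and linear in the operator. It is applied to commutators evaluated at a fixed vector. -/
theorem norm_map_kinRes_le {H E : Type*} [NormedAddCommGroup H] [InnerProductSpace ℂ H]
    [CompleteSpace H] [NormedAddCommGroup E] [NormedSpace ℂ E] (hT : 0 < T) {R : H →L[ℂ] H}
    (hR : IsSelfAdjoint R) (Φ : (H →L[ℂ] H) →L[ℂ] E) {K : ℝ}
    (h : ∀ n, ‖Φ (resAt R (pole T μ n))‖ ≤ K * (√(matsubara T n))⁻¹ ∧
      ‖Φ (resAt R (starRingEnd ℂ (pole T μ n)))‖ ≤ K * (√(matsubara T n))⁻¹) :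
    ‖Φ (kinRes T μ 0 R)‖ ≤ poleSum T * K := by
  have h1 := ((continuous_norm.comp Φ.continuous).tendsto _).comp
    (tendsto_sum_resAt (μ := μ) hT hR)
  refine le_of_tendsto h1 (Filter.Eventually.of_forall fun N => ?_)
  have hK : 0 ≤ K := by
    have h2 := (norm_nonneg _).trans (h 0).1
    have := Real.sqrt_pos.2 (matsubara_pos hT 0)
    exact nonneg_of_mul_nonneg_left h2 (by positivity)
  simp only [Function.comp, map_sum, map_smul, map_sub]
  refine (norm_sum_le _ _).trans ((Finset.sum_le_sum fun n _ =>
    norm_pole_term_le hT (h n).1 (h n).2).trans ?_)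
  rw [← Finset.sum_mul]
  refine mul_le_mul_of_nonneg_right ((summable_poleSum hT).sum_le_tsum _ fun n _ => ?_) hK
  have := matsubara_pos hT n; positivity

end PoleSum

section KinWeight

variable {T μ : ℝ}

/-- Weighted bounds for `(K - e)⁻¹`, uniform in the vector potential and the weight. -/
theorem exists_weighted_kinRes (hT : 0 < T) (μ : ℝ) {M l : ℝ} (hl : l < symbolMin T μ) :
    ∃ C : ℝ, 0 < C ∧ ∀ a : R3 → R3, Continuous a → ∀ p, IsWeight p → ∀ e, -M ≤ e → e ≤ l →
      ∀ f : L2, ‖mulB p (kinRes T μ e (magRes a) f)‖ ≤ C * ‖mulB p f‖ ∧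
        ‖mulB (fun x => p x ^ 2) (kinRes T μ e (magRes a) f)‖ ≤
          C * ‖mulB (fun x => p x ^ 2) f‖ := by
  obtain ⟨C, hC, hb⟩ := exists_weighted_bounds μ (mul_pos Real.pi_pos hT)
  have hS := poleSum_pos hT
  set D := poleSum T * C with hD
  have hDp : 0 < D := mul_pos hS hC
  set x0 := (symbolMin T μ - l)⁻¹ with hx0
  have hx0p : 0 < x0 := inv_pos.2 (sub_pos.2 hl)
  set m := max |M| |l| with hm
  have hm0 : 0 ≤ m := (abs_nonneg _).trans (le_max_left _ _)
  set z0 := 1 + m * x0 with hz0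
  have hz0p : 0 < z0 := by positivity
  set c1 := x0 + z0 ^ 2 * D with hc1
  have hc1p : 0 < c1 := by positivity
  set c2 := x0 + z0 * D * (1 + m * c1) with hc2
  have hc2p : 0 < c2 := by positivity
  refine ⟨c1 + c2, by positivity, ?_⟩
  intro a ha p hp e he1 he2 f
  have hR := magRes_isSelfAdjoint a
  have hs := spectrum_magRes a
  have he : e < symbolMin T μ := he2.trans_lt hl
  have hem : |e| ≤ m := abs_le.2 ⟨by linarith [(le_abs_self M).trans (le_max_left |M| |l|)],
    he2.trans ((le_abs_self _).trans (le_max_right _ _))⟩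
  have hX : ‖kinRes T μ e (magRes a)‖ ≤ x0 :=
    (norm_kinRes_le hT he hs).trans (inv_anti₀ (sub_pos.2 hl) (by linarith))
  set X := kinRes T μ e (magRes a) with hXdef
  set B := kinRes T μ 0 (magRes a) with hB
  -- The expansion over poles is available only for `e = 0`; the resolvent identity links `X` to
  -- `B`, the case `e = 0`.
  have hXB : ∀ g, X g = B g + (e : ℂ) • X (B g) := by
    intro g
    have := congrArg (fun L => L g) (kinRes_sub_kinRes (μ := μ) hT he (symbolMin_pos hT) hs)
    simp only [sub_apply, smul_apply, mul_apply_eq_comp, sub_zero] at this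
    rw [← this]; abel
  have hBX : ∀ g, X g = B g + (e : ℂ) • B (X g) := by
    intro g
    have := congrArg (fun L => L g) (kinRes_sub_kinRes (μ := μ) hT (symbolMin_pos hT) he hs)
    simp only [sub_apply, smul_apply, mul_apply_eq_comp, zero_sub] at this
    calc X g = B g - (B g - X g) := by abel
      _ = B g - ((-e : ℝ) : ℂ) • B (X g) := by rw [this]
      _ = _ := by push_cast; module
  -- Commutator form of the resolvent identity: `[w, X] = (1 + eX) [w, B] (1 + eX)`.
  have hcomm : ∀ (w : R3 → ℝ) (g : L2), mulB w (X g) - X (mulB w g) =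
      (mulB w (B (g + (e : ℂ) • X g)) - B (mulB w (g + (e : ℂ) • X g))) +
      (e : ℂ) • X (mulB w (B (g + (e : ℂ) • X g)) - B (mulB w (g + (e : ℂ) • X g))) := by
    intro w g
    have h1 : B (g + (e : ℂ) • X g) = X g := by rw [map_add, map_smul, ← hBX]
    rw [h1, map_sub X, map_add (mulB w), map_add B, map_smul (mulB w), map_smul B, map_add X, map_smul X]
    have h3 : (e : ℂ) • X (mulB w (X g)) =
      (e : ℂ) • (B (mulB w (X g)) + (e : ℂ) • X (B (mulB w (X g)))) := by rw [← hXB]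
    rw [smul_sub, h3, hXB (mulB w g)]
    module
  have hcX : ∀ (w : R3 → ℝ) (g : L2) (K : ℝ),
      ‖mulB w (B (g + (e : ℂ) • X g)) - B (mulB w (g + (e : ℂ) • X g))‖ ≤ K →
      ‖mulB w (X g)‖ ≤ x0 * ‖mulB w g‖ + z0 * K := by
    intro w g K hK
    have h1 := hcomm w g
    have h2 : mulB w (X g) = X (mulB w g) + (mulB w (X g) - X (mulB w g)) := by abel
    set y := mulB w (B (g + (e : ℂ) • X g)) - B (mulB w (g + (e : ℂ) • X g)) with hy
    rw [h2, h1]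
    have n1 : ‖X (mulB w g)‖ ≤ x0 * ‖mulB w g‖ := X.le_of_opNorm_le hX _
    have n2 : ‖(e : ℂ) • X y‖ ≤ m * (x0 * K) := by
      rw [norm_smul, Complex.norm_real]
      exact mul_le_mul hem ((X.le_of_opNorm_le hX _).trans (by gcongr)) (norm_nonneg _) hm0
    refine (norm_add_le _ _).trans (add_le_add n1 ((norm_add_le _ _).trans ?_))
    rw [hz0]; nlinarith
  have hcB : ∀ g, ‖mulB p (B g) - B (mulB p g)‖ ≤ D * ‖g‖ ∧
      ‖mulB (fun x => p x ^ 2) (B g) - B (mulB (fun x => p x ^ 2) g)‖ ≤ D * ‖mulB p g‖ := by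
    intro g
    constructor
    · have := norm_map_kinRes_le (μ := μ) (K := C * ‖g‖) hT hR
        ((mulB p) ∘L (ContinuousLinearMap.apply ℂ L2 g) -
          ContinuousLinearMap.apply ℂ L2 (mulB p g)) fun n => by
          obtain ⟨χ, hχ⟩ := exists_hasMagLaplacian_resAt a (isPole_pole (μ := μ) hT n).im_ne g
          obtain ⟨ξ, hξ⟩ := exists_hasMagLaplacian_resAt a (isPole_pole (μ := μ) hT n).conj.im_ne g
          have b1 := (hb a ha _ _ (isPole_pole hT n) p hp g χ hχ).1
          have b2 := (hb a ha _ _ (isPole_pole hT n).conj p hp g ξ hξ).1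
          rw [mul_right_comm] at b1 b2
          exact ⟨b1, b2⟩
      rw [hD, mul_assoc]; exact this
    · have := norm_map_kinRes_le (μ := μ) (K := C * ‖mulB p g‖) hT hR
        ((mulB fun x => p x ^ 2) ∘L (ContinuousLinearMap.apply ℂ L2 g) -
          ContinuousLinearMap.apply ℂ L2 (mulB (fun x => p x ^ 2) g)) fun n => by
          obtain ⟨χ, hχ⟩ := exists_hasMagLaplacian_resAt a (isPole_pole (μ := μ) hT n).im_ne g
          obtain ⟨ξ, hξ⟩ := exists_hasMagLaplacian_resAt a (isPole_pole (μ := μ) hT n).conj.im_ne g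
          have b1 := (hb a ha _ _ (isPole_pole hT n) p hp g χ hχ).2.2.2.1
          have b2 := (hb a ha _ _ (isPole_pole hT n).conj p hp g ξ hξ).2.2.2.1
          rw [mul_right_comm] at b1 b2
          exact ⟨b1, b2⟩
      rw [hD, mul_assoc]; exact this
  have hz : ‖f + (e : ℂ) • X f‖ ≤ z0 * ‖f‖ := by
    refine (norm_add_le _ _).trans ?_
    have : ‖(e : ℂ) • X f‖ ≤ m * (x0 * ‖f‖) := by
      rw [norm_smul, Complex.norm_real]
      exact mul_le_mul hem (X.le_of_opNorm_le hX _) (norm_nonneg _) hm0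
    rw [hz0]; linarith
  have hpf := hp.norm_le f
  have hpq := hp.norm_le_sq f
  have b1 : ‖mulB p (X f)‖ ≤ c1 * ‖mulB p f‖ := by
    have h1 := hcX p f _ ((hcB _).1.trans (mul_le_mul_of_nonneg_left hz hDp.le))
    have h2 : z0 * (D * (z0 * ‖f‖)) ≤ z0 ^ 2 * D * ‖mulB p f‖ := by
      calc _ = z0 ^ 2 * D * ‖f‖ := by ring
        _ ≤ _ := by gcongr
    rw [hc1, add_mul]; linarith
  -- The commutator with `p²` loses one factor `p`, which the bound `b1` already controls through
  -- `X`.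
  have b2 : ‖mulB (fun x => p x ^ 2) (X f)‖ ≤ c2 * ‖mulB (fun x => p x ^ 2) f‖ := by
    have h0 : ‖mulB p (f + (e : ℂ) • X f)‖ ≤ (1 + m * c1) * ‖mulB p f‖ := by
      rw [map_add, map_smul]
      refine (norm_add_le _ _).trans ?_
      have : ‖(e : ℂ) • mulB p (X f)‖ ≤ m * (c1 * ‖mulB p f‖) := by
        rw [norm_smul, Complex.norm_real]
        exact mul_le_mul hem b1 (norm_nonneg _) hm0
      linarith
    have h1 := hcX _ f _ ((hcB _).2.trans (mul_le_mul_of_nonneg_left h0 hDp.le))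
    have h2 : z0 * (D * ((1 + m * c1) * ‖mulB p f‖)) ≤
        z0 * D * (1 + m * c1) * ‖mulB (fun x => p x ^ 2) f‖ := by
      calc _ = z0 * D * (1 + m * c1) * ‖mulB p f‖ := by ring
        _ ≤ _ := by gcongr
    rw [hc2, add_mul]; linarith
  refine ⟨b1.trans ?_, b2.trans ?_⟩ <;> gcongr <;> linarith

end KinWeight

/-! ### Regularized quadratic weights and the removal of the regularization. -/

section Polynomial

/-- The regularized weight `(1 + |x|² / (1 + ε |x|²))¹ᐟ²`. -/
noncomputable def polyWeight (ε : ℝ) (x : R3) : ℝ := √(1 + ‖x‖ ^ 2 / (1 + ε * ‖x‖ ^ 2))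

theorem polyWeight_sq {ε : ℝ} (hε : 0 < ε) (x : R3) :
    polyWeight ε x ^ 2 = 1 + ‖x‖ ^ 2 / (1 + ε * ‖x‖ ^ 2) :=
  Real.sq_sqrt (by positivity)

theorem polyWeight_sq_le {ε : ℝ} (hε : 0 < ε) (x : R3) : polyWeight ε x ^ 2 ≤ 1 + ‖x‖ ^ 2 := by
  rw [polyWeight_sq hε]
  gcongr
  exact div_le_self (by positivity) (by nlinarith [sq_nonneg ‖x‖])

/-- The parameter `ε` makes the weight bounded, so that it acts on L² and on form domains, while the
derivative bound `1` does not depend on `ε`. Constants from the weighted estimates therefore survive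
`ε → 0`. -/
theorem isWeight_polyWeight {ε : ℝ} (hε : 0 < ε) : IsWeight (polyWeight ε) := by
  have hden : ∀ x : R3, 0 < 1 + ε * ‖x‖ ^ 2 := fun x => by positivity
  have hin : ∀ x : R3, 1 ≤ 1 + ‖x‖ ^ 2 / (1 + ε * ‖x‖ ^ 2) := fun x => by
    have := hden x; have : 0 ≤ ‖x‖ ^ 2 / (1 + ε * ‖x‖ ^ 2) := by positivity
    linarith
  have hsm : ContDiff ℝ ∞ (polyWeight ε) := by
    unfold polyWeight
    refine ContDiff.sqrt ?_ fun x => (zero_lt_one.trans_le (hin x)).ne'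
    refine contDiff_const.add ((contDiff_norm_sq ℝ).div ?_ fun x => (hden x).ne')
    exact contDiff_const.add (contDiff_const.mul (contDiff_norm_sq ℝ))
  have hone : ∀ x, 1 ≤ polyWeight ε x := fun x => Real.one_le_sqrt.2 (hin x)
  refine ⟨hsm, ?_, hone, ?_⟩
  · refine IsBdd.of_continuous hsm.continuous (C := √(1 + ε⁻¹)) fun x => ?_
    rw [abs_of_nonneg (zero_le_one.trans (hone x))]
    refine Real.sqrt_le_sqrt ?_
    gcongr
    rw [div_le_iff₀ (hden x)]
    field_simp; linarith [hε]
  · intro j x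
    have h1 : HasFDerivAt (fun y : R3 => ‖y‖ ^ 2) (2 • innerSL ℝ x) x :=
      (hasStrictFDerivAt_norm_sq x).hasFDerivAt
    set s := ‖x‖ ^ 2 with hs
    have hs0 : 0 ≤ s := sq_nonneg _
    have hd : 0 < 1 + ε * s := hden x
    have hi : 1 ≤ 1 + s / (1 + ε * s) := hin x
    have h2 : HasDerivAt (fun s : ℝ => √(1 + s / (1 + ε * s)))
        ((1 / (1 + ε * s) ^ 2) / (2 * √(1 + s / (1 + ε * s)))) s := by
      have d1 : HasDerivAt (fun s : ℝ => 1 + ε * s) ε s := by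
        simpa using ((hasDerivAt_id s).const_mul ε).const_add 1
      have d2 := ((hasDerivAt_id s).div d1 hd.ne').const_add 1
      have d3 := d2.sqrt (zero_lt_one.trans_le hi).ne'
      have e : (1 / (1 + ε * s) ^ 2) = (1 * (1 + ε * s) - s * ε) / (1 + ε * s) ^ 2 := by ring
      rw [e]
      exact d3
    have h3 := h2.comp_hasFDerivAt x h1
    change HasFDerivAt (polyWeight ε) _ x at h3
    rw [pderiv, h3.fderiv]
    simp only [smul_apply, innerSL_apply_apply, EuclideanSpace.inner_single_right, nsmul_eq_mul, smul_eq_mul]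
    simp only [Nat.cast_ofNat, one_mul, conj_trivial]
    have hx : |x j| ≤ ‖x‖ := by simpa using PiLp.norm_apply_le x j
    -- With `s = |x|²` the derivative is `x_j` divided by `(1+εs)²` and by the square root below.
    -- The bound thus reduces to `s ≤ (1+εs)⁴ + s(1+εs)³`.
    have hq : ‖x‖ ≤ √(1 + s / (1 + ε * s)) * (1 + ε * s) ^ 2 := by
      rw [← Real.sqrt_sq (norm_nonneg x), ← hs, ← Real.sqrt_sq (pow_pos hd 2).le,
        ← Real.sqrt_mul (by linarith)]
      refine Real.sqrt_le_sqrt ?_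
      have : (1 + s / (1 + ε * s)) * ((1 + ε * s) ^ 2) ^ 2 =
          (1 + ε * s) ^ 4 + s * (1 + ε * s) ^ 3 := by field_simp
      rw [this]
      have h1 : 1 ≤ (1 + ε * s) ^ 3 := one_le_pow₀ (by nlinarith)
      nlinarith [pow_pos hd 4]
    have hsq : 0 < √(1 + s / (1 + ε * s)) := Real.sqrt_pos.2 (by linarith)
    rw [abs_mul, abs_mul, abs_two, abs_of_pos (by positivity), div_mul_eq_mul_div,
      div_mul_eq_mul_div, div_div, one_mul, div_le_one (by positivity)]
    nlinarith

theorem tendsto_polyWeight_sq (x : R3) :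
    Filter.Tendsto (fun n : ℕ => polyWeight (1 / ((n : ℝ) + 1)) x ^ 2) Filter.atTop
      (nhds (1 + ‖x‖ ^ 2)) := by
  have h1 : Filter.Tendsto (fun n : ℕ => 1 + ‖x‖ ^ 2 / (1 + (1 / ((n : ℝ) + 1)) * ‖x‖ ^ 2))
      Filter.atTop (nhds (1 + ‖x‖ ^ 2 / (1 + 0 * ‖x‖ ^ 2))) :=
    ((tendsto_const_nhds.div ((tendsto_one_div_add_atTop_nhds_zero_nat.mul_const _).const_add 1)
      (by simp)).const_add 1)
  simp only [zero_mul, add_zero, div_one] at h1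
  refine h1.congr fun n => ?_
  rw [polyWeight_sq (by positivity)]

/-- A function whose products with an approximating sequence of weights are bounded in `L²`
belongs to the domain of the limit weight. -/
theorem exists_mulGraph_of_tendsto {m : ℕ → R3 → ℝ} {w : R3 → ℝ} {u : L2} {C : ℝ}
    (hb : ∀ n, IsBdd (m n)) (hlim : ∀ x, Filter.Tendsto (fun n => m n x) Filter.atTop (nhds (w x)))
    (hC : ∀ n, ‖mulB (m n) u‖ ≤ C) : ∃ v, (u, v) ∈ mulGraph w ∧ ‖v‖ ≤ C := by
  have hC0 : 0 ≤ C := (norm_nonneg _).trans (hC 0)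
  have hm : ∀ n, AEStronglyMeasurable (fun x => (m n x : ℂ) * u x) volume := fun n =>
    (hb n).aestronglyMeasurable.mul (Lp.aestronglyMeasurable u)
  have hae : ∀ᵐ x : R3, Filter.Tendsto (fun n => (m n x : ℂ) * u x) Filter.atTop
      (nhds ((w x : ℂ) * u x)) := Filter.Eventually.of_forall fun x =>
    ((Complex.continuous_ofReal.tendsto _).comp (hlim x)).mul_const _
  have hmw : AEStronglyMeasurable (fun x => (w x : ℂ) * u x) volume :=
    aestronglyMeasurable_of_tendsto_ae _ hm hae
  have he : ∀ n, eLpNorm (fun x => (m n x : ℂ) * u x) 2 volume ≤ ENNReal.ofReal C := fun n => by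
    rw [← eLpNorm_congr_ae (coeFn_mulB (hb n) u), ← Lp.enorm_def, ← ofReal_norm]
    exact ENNReal.ofReal_le_ofReal (hC n)
  -- Fatou's lemma for the L² norm.
  have hle : eLpNorm (fun x => (w x : ℂ) * u x) 2 volume ≤ ENNReal.ofReal C := by
    refine (Lp.eLpNorm_lim_le_liminf_eLpNorm hm _ hae).trans ?_
    refine Filter.liminf_le_of_le (by isBoundedDefault) fun b hb' => ?_
    obtain ⟨n, hn⟩ := hb'.exists
    exact hn.trans (he n)
  have hmem : MemLp (fun x => (w x : ℂ) * u x) 2 volume := ⟨hmw, hle.trans_lt ENNReal.ofReal_lt_top⟩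
  refine ⟨toL2 _, coeFn_toL2 hmem, ?_⟩
  rw [Lp.norm_def, eLpNorm_congr_ae (coeFn_toL2 hmem)]
  exact ENNReal.toReal_le_of_le_ofReal hC0 hle

theorem norm_polyWeight_sq_le {ε : ℝ} (hε : 0 < ε) {u v : L2}
    (h : (u, v) ∈ mulGraph fun x => 1 + ‖x‖ ^ 2) :
    ‖mulB (fun x => polyWeight ε x ^ 2) u‖ ≤ ‖v‖ := by
  have := norm_le_of_mulGraph (C := 1)
    (mem_mulGraph_mulB (isWeight_polyWeight hε).bdd_sq u) h fun x => by
      rw [abs_of_nonneg (sq_nonneg _), abs_of_nonneg (by positivity), one_mul]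
      exact polyWeight_sq_le hε x
  rwa [one_mul] at this

/-- An operator which is bounded uniformly with respect to the regularized weights is bounded with
respect to the weight `1 + |x|²`. -/
theorem exists_mulGraph_quadratic {u f v : L2} {C : ℝ} (hC : 0 ≤ C)
    (h : ∀ ε, 0 < ε → ‖mulB (fun x => polyWeight ε x ^ 2) u‖ ≤
      C * ‖mulB (fun x => polyWeight ε x ^ 2) f‖)
    (hf : (f, v) ∈ mulGraph fun x => 1 + ‖x‖ ^ 2) :
    ∃ w, (u, w) ∈ mulGraph (fun x => 1 + ‖x‖ ^ 2) ∧ ‖w‖ ≤ C * ‖v‖ :=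
  exists_mulGraph_of_tendsto (fun _ => (isWeight_polyWeight Nat.one_div_pos_of_nat).bdd_sq)
    tendsto_polyWeight_sq fun _ => (h _ Nat.one_div_pos_of_nat).trans
      (mul_le_mul_of_nonneg_left (norm_polyWeight_sq_le Nat.one_div_pos_of_nat hf) hC)

end Polynomial
end MagneticBCS

namespace MagneticBCS

/-! ### Translations and difference quotients -/

section Translation

open Filter Topology

/-- The translation `u ↦ u(· + c)`. -/
noncomputable def transl (c : R3) : L2 →ₗᵢ[ℂ] L2 :=
  Lp.compMeasurePreservingₗᵢ ℂ (fun x => x + c) (measurePreserving_add_right volume c)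

theorem coeFn_transl (c : R3) (u : L2) :
    (transl c u : R3 → ℂ) =ᵐ[volume] fun x => (u : R3 → ℂ) (x + c) :=
  Lp.coeFn_compMeasurePreserving u (measurePreserving_add_right volume c)

theorem ae_comp_add {p : R3 → Prop} (c : R3) (h : ∀ᵐ x, p x) : ∀ᵐ x, p (x + c) :=
  (measurePreserving_add_right volume c).quasiMeasurePreserving.ae h

theorem transl_toL2 (c : R3) {φ : R3 → ℂ} (h : MemLp φ 2 volume) :
    transl c (toL2 φ) = toL2 fun x => φ (x + c) := by
  refine eq_toL2 ?_
  filter_upwards [coeFn_transl c (toL2 φ), ae_comp_add c (coeFn_toL2 h)] with x h1 h2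
  rw [h1, h2]

theorem inner_transl (c : R3) (u v : L2) : ⟪transl c u, v⟫_ℂ = ⟪u, transl (-c) v⟫_ℂ := by
  rw [inner_toL2 (coeFn_transl c u) (EventuallyEq.refl _ _),
    inner_toL2 (EventuallyEq.refl _ _) (coeFn_transl (-c) v),
    ← integral_add_right_eq_self (fun x => (starRingEnd ℂ) (u x) * v (x + -c)) c]
  simp

theorem mulGraph_transl {m : R3 → ℝ} {u v : L2} (c : R3) (h : (u, v) ∈ mulGraph m) :
    (transl c u, transl c v) ∈ mulGraph fun x => m (x + c) := by
  rw [mem_mulGraph] at h ⊢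
  filter_upwards [coeFn_transl c u, coeFn_transl c v, ae_comp_add c h] with x h1 h2 h3
  rw [h1, h2, h3]

theorem IsTest.comp_add {φ : R3 → ℂ} (h : IsTest φ) (c : R3) : IsTest fun x => φ (x + c) :=
  ⟨h.contDiff.comp (contDiff_id.add contDiff_const),
    h.compact.comp_homeomorph (Homeomorph.addRight c)⟩

theorem exists_test_of_mem_span {u : L2}
    (hu : u ∈ Submodule.span ℂ {u : L2 | ∃ φ, IsTest φ ∧ u = toL2 φ}) :
    ∃ φ, IsTest φ ∧ u = toL2 φ := by
  induction hu using Submodule.span_induction with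
  | mem u hu => exact hu
  | zero => exact ⟨0, ⟨contDiff_const, HasCompactSupport.zero⟩, eq_toL2 (Lp.coeFn_zero _ _ _)⟩
  | add u v _ _ hu hv =>
    obtain ⟨φ, hφ, rfl⟩ := hu
    obtain ⟨ψ, hψ, rfl⟩ := hv
    refine ⟨φ + ψ, ⟨hφ.contDiff.add hψ.contDiff, hφ.compact.add hψ.compact⟩, eq_toL2 ?_⟩
    filter_upwards [Lp.coeFn_add (toL2 φ) (toL2 ψ), coeFn_toL2 hφ.memLp, coeFn_toL2 hψ.memLp]
      with x h1 h2 h3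
    rw [h1, Pi.add_apply, h2, h3, Pi.add_apply]
  | smul c u _ hu =>
    obtain ⟨φ, hφ, rfl⟩ := hu
    refine ⟨fun x => c * φ x, ⟨contDiff_const.mul hφ.contDiff, hφ.compact.mul_left⟩, eq_toL2 ?_⟩
    filter_upwards [Lp.coeFn_smul c (toL2 φ), coeFn_toL2 hφ.memLp] with x h1 h2
    simp [h1, h2]

theorem norm_le_of_inner_test {ψ : L2} {C : ℝ} (hC : 0 ≤ C)
    (h : ∀ φ, IsTest φ → ‖⟪toL2 φ, ψ⟫_ℂ‖ ≤ C * ‖toL2 φ‖) : ‖ψ‖ ≤ C := by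
  refine norm_le_of_inner hC fun g => ?_
  have hcl : IsClosed {g : L2 | ‖⟪g, ψ⟫_ℂ‖ ≤ C * ‖g‖} :=
    isClosed_le (by fun_prop) (by fun_prop)
  have : closure (Submodule.span ℂ {u : L2 | ∃ φ, IsTest φ ∧ u = toL2 φ} : Set L2) ⊆
      {g : L2 | ‖⟪g, ψ⟫_ℂ‖ ≤ C * ‖g‖} := hcl.closure_subset_iff.2 fun u hu => by
    obtain ⟨φ, hφ, rfl⟩ := exists_test_of_mem_span hu
    exact h φ hφ
  exact this (dense_test g)

/-- The `j`-th unit vector. -/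
noncomputable abbrev unitVec (j : Fin 3) : R3 := EuclideanSpace.single j 1

/-- The translation is put on the test function and differentiated under the integral. For `|t| < 1`
all translates of the derivative live in the 1-thickening of its support, where `u` is integrable.
-/
theorem hasDerivAt_inner_transl_zero {j : Fin 3} {u χ : L2} (h : IsMagneticDeriv 0 j u χ)
    {φ : R3 → ℂ} (hφ : IsTest φ) :
    HasDerivAt (fun t : ℝ => ⟪transl (t • unitVec j) (toL2 φ), u⟫_ℂ)
      (-Complex.I * ⟪toL2 φ, χ⟫_ℂ) 0 := by
  have hpc : Continuous (pderiv j φ) := (contDiff_pderiv hφ.contDiff j).continuous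
  have hps : HasCompactSupport (pderiv j φ) := hasCompactSupport_pderiv hφ.compact j
  obtain ⟨M, hM⟩ := hps.exists_bound_of_continuous hpc
  set K := Metric.cthickening 1 (tsupport (pderiv j φ)) with hK
  have hKc : IsCompact K := hps.isCompact.cthickening
  have hb : Integrable (K.indicator fun x => M * ‖(u : R3 → ℂ) x‖) volume := by
    rw [integrable_indicator_iff hKc.measurableSet]
    have : LocallyIntegrable (u : R3 → ℂ) volume := (Lp.memLp u).locallyIntegrable (by norm_num)
    exact ((this.integrableOn_isCompact hKc).norm).const_mul M
  have hF : ∀ t : ℝ, ⟪transl (t • unitVec j) (toL2 φ), u⟫_ℂ =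
      ∫ x, (starRingEnd ℂ) (φ (x + t • unitVec j)) * u x := fun t => by
    rw [transl_toL2 _ hφ.memLp]
    exact inner_toL2 (coeFn_toL2 (hφ.comp_add _).memLp) (EventuallyEq.refl _ _)
  have hint : ∀ t : ℝ, Integrable (fun x => (starRingEnd ℂ) (φ (x + t • unitVec j)) * u x)
      volume := fun t => by
    have h1 : MemLp (fun x => (starRingEnd ℂ) (φ (x + t • unitVec j))) 2 volume :=
      (hφ.comp_add (t • unitVec j)).memLp.star
    exact h1.integrable_mul (Lp.memLp u)
  have key := (hasDerivAt_integral_of_dominated_loc_of_deriv_le (μ := volume)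
    (F := fun t x => (starRingEnd ℂ) (φ (x + t • unitVec j)) * (u : R3 → ℂ) x)
    (F' := fun t x => (starRingEnd ℂ) (pderiv j φ (x + t • unitVec j)) * (u : R3 → ℂ) x)
    (x₀ := (0 : ℝ)) (s := Metric.ball 0 1) (bound := K.indicator fun x => M * ‖(u : R3 → ℂ) x‖)
    (Metric.ball_mem_nhds _ one_pos) (Eventually.of_forall fun t => (hint t).aestronglyMeasurable)
    (hint 0) ?_ (Eventually.of_forall fun x t ht => ?_) hb
    (Eventually.of_forall fun x t _ => ?_)).2
  · simp only [← hF] at key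
    refine key.congr_deriv ?_
    have h1 := (isMagneticDeriv_iff continuous_zero).1 h φ hφ
    rw [inner_toL2 (coeFn_toL2 (hφ.magD_memLp continuous_zero j)) (EventuallyEq.refl _ _)] at h1
    rw [← h1, ← integral_const_mul]
    refine integral_congr_ae (Eventually.of_forall fun x => ?_)
    simp only [magD, zero_smul, add_zero]
    simp
    rw [← mul_assoc, ← mul_assoc, Complex.I_mul_I]; ring
  · exact ((Complex.continuous_conj.comp (hpc.comp (by fun_prop))).aestronglyMeasurable).mul
      (Lp.aestronglyMeasurable u)
  · by_cases hx : x ∈ K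
    · rw [Set.indicator_of_mem hx, norm_mul, RCLike.norm_conj]
      exact mul_le_mul_of_nonneg_right (hM _) (norm_nonneg _)
    · rw [Set.indicator_of_notMem hx]
      have : pderiv j φ (x + t • unitVec j) = 0 := by
        by_contra hne
        refine hx (Metric.mem_cthickening_of_dist_le x (x + t • unitVec j) 1 _
          (subset_tsupport _ hne) ?_)
        rw [dist_eq_norm, show x - (x + t • unitVec j) = -(t • unitVec j) by abel, norm_neg,
          norm_smul]
        simpa using (mem_ball_zero_iff.1 ht).le
      simp [this]
  · have d1 : HasDerivAt (fun t : ℝ => x + t • unitVec j) (unitVec j) t := by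
      simpa using ((hasDerivAt_id t).smul_const (unitVec j)).const_add x
    have d2 := ((hφ.contDiff.differentiable (by simp) (x + t • unitVec j)).hasFDerivAt).comp_hasDerivAt t d1
    have d3 := (Complex.conjCLE.toContinuousLinearMap.hasFDerivAt).comp_hasDerivAt t d2
    exact d3.mul_const _

theorem transl_add (c d : R3) (u : L2) : transl (c + d) u = transl c (transl d u) := by
  refine Lp.ext ?_
  filter_upwards [coeFn_transl (c + d) u, coeFn_transl c (transl d u),
    ae_comp_add c (coeFn_transl d u)] with x h1 h2 h3
  rw [h1, h2, h3, add_assoc]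

theorem hasDerivAt_inner_transl {j : Fin 3} {u χ : L2} (h : IsMagneticDeriv 0 j u χ)
    {φ : R3 → ℂ} (hφ : IsTest φ) (t : ℝ) :
    HasDerivAt (fun t : ℝ => ⟪transl (t • unitVec j) (toL2 φ), u⟫_ℂ)
      (-Complex.I * ⟪transl (t • unitVec j) (toL2 φ), χ⟫_ℂ) t := by
  have h1 := hasDerivAt_inner_transl_zero h (hφ.comp_add (t • unitVec j))
  rw [← transl_toL2 _ hφ.memLp] at h1
  have h2 := HasDerivAt.comp_sub_const t t (by rw [sub_self]; exact h1)
  refine h2.congr_of_eventuallyEq (Eventually.of_forall fun s => ?_)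
  simp only [← transl_add, ← add_smul, sub_add_cancel]

theorem transl_zero (u : L2) : transl 0 u = u := by
  refine Lp.ext ?_
  filter_upwards [coeFn_transl 0 u] with x h1
  rw [h1, add_zero]

/-- Mean value inequality for `t ↦ ⟨τ_t φ, u⟩` with `φ` a test function, followed by density of test
functions. -/
theorem norm_transl_sub_le {j : Fin 3} {u χ : L2} (h : IsMagneticDeriv 0 j u χ) (t : ℝ) :
    ‖transl (t • unitVec j) u - u‖ ≤ |t| * ‖χ‖ := by
  refine norm_le_of_inner_test (by positivity) fun φ hφ => ?_
  have h1 := convex_univ.norm_image_sub_le_of_norm_hasDerivWithin_le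
    (f := fun t : ℝ => ⟪transl (t • unitVec j) (toL2 φ), u⟫_ℂ) (C := ‖toL2 φ‖ * ‖χ‖)
    (fun s _ => (hasDerivAt_inner_transl h hφ s).hasDerivWithinAt)
    (fun s _ => by
      rw [norm_mul, norm_neg, Complex.norm_I, one_mul]
      refine (norm_inner_le_norm _ _).trans ?_
      rw [LinearIsometry.norm_map]) (Set.mem_univ 0) (Set.mem_univ (-t))
  have e : ⟪toL2 φ, transl (t • unitVec j) u - u⟫_ℂ =
      ⟪transl ((-t) • unitVec j) (toL2 φ), u⟫_ℂ - ⟪transl ((0:ℝ) • unitVec j) (toL2 φ), u⟫_ℂ := by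
    rw [inner_sub_right, inner_transl, zero_smul, transl_zero, neg_smul, neg_neg]
  rw [e]
  refine h1.trans (le_of_eq ?_)
  simp; ring

theorem tendsto_inner_transl_test {j : Fin 3} {u χ : L2} (h : IsMagneticDeriv 0 j u χ)
    {φ : R3 → ℂ} (hφ : IsTest φ) :
    Tendsto (fun t : ℝ => (t : ℂ)⁻¹ * ⟪toL2 φ, transl (t • unitVec j) u - u⟫_ℂ) (𝓝[≠] 0)
      (𝓝 (Complex.I * ⟪toL2 φ, χ⟫_ℂ)) := by
  have h1 := HasDerivAt.scomp (h := fun t : ℝ => -t) (0 : ℝ)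
    (by rw [neg_zero]; exact hasDerivAt_inner_transl_zero h hφ) (hasDerivAt_neg (0 : ℝ))
  have h2 := hasDerivAt_iff_tendsto_slope.1 h1
  simp only [neg_smul, one_smul, neg_mul, neg_neg] at h2
  refine h2.congr fun t => ?_
  rw [slope_def_module, inner_sub_right]
  simp [inner_transl, transl_zero, neg_smul]

/-- Weak convergence of the difference quotients. They are bounded by `‖χ‖`, so convergence against
the dense test functions extends to every `g`. -/
theorem tendsto_inner_transl {j : Fin 3} {u χ : L2} (h : IsMagneticDeriv 0 j u χ) (g : L2) :
    Tendsto (fun t : ℝ => (t : ℂ)⁻¹ * ⟪g, transl (t • unitVec j) u - u⟫_ℂ) (𝓝[≠] 0)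
      (𝓝 (Complex.I * ⟪g, χ⟫_ℂ)) := by
  set P : L2 → Prop := fun g => Tendsto (fun t : ℝ => (t : ℂ)⁻¹ *
    ⟪g, transl (t • unitVec j) u - u⟫_ℂ) (𝓝[≠] 0) (𝓝 (Complex.I * ⟪g, χ⟫_ℂ)) with hP
  have hspan : ∀ v ∈ Submodule.span ℂ {u : L2 | ∃ φ, IsTest φ ∧ u = toL2 φ}, P v := by
    intro v hv
    induction hv using Submodule.span_induction with
    | mem v hv =>
      obtain ⟨φ, hφ, rfl⟩ := hv
      exact tendsto_inner_transl_test h hφ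
    | zero => simp only [hP, inner_zero_left, mul_zero]; exact tendsto_const_nhds
    | add v w _ _ h1 h2 =>
      simp only [hP, inner_add_left, mul_add]; exact h1.add h2
    | smul c v _ h1 =>
      simp only [hP, inner_smul_left, mul_left_comm _ (starRingEnd ℂ c)]; exact h1.const_mul _
  refine Metric.tendsto_nhds.2 ?_
  intro ε hε
  have hχ : 0 < ‖χ‖ + 1 := by positivity
  obtain ⟨v, hv, hd⟩ := Metric.dense_iff.1 dense_test g (ε / (3 * (‖χ‖ + 1))) (by positivity)
  have hd' : ‖g - v‖ < ε / (3 * (‖χ‖ + 1)) := by rw [← dist_eq_norm, dist_comm]; exact hv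
  have hd'' : ‖g - v‖ * ‖χ‖ ≤ ε / 3 := by
    have := mul_le_mul hd'.le (by linarith : ‖χ‖ ≤ ‖χ‖ + 1) (norm_nonneg _) (by positivity)
    refine this.trans (le_of_eq ?_)
    field_simp
  filter_upwards [Metric.tendsto_nhds.1 (hspan v hd) (ε / 3) (by positivity),
    self_mem_nhdsWithin] with t ht ht0
  have ht0' : 0 < |t| := abs_pos.2 ht0
  have e : (t : ℂ)⁻¹ * ⟪g, transl (t • unitVec j) u - u⟫_ℂ - Complex.I * ⟪g, χ⟫_ℂ =
      (t : ℂ)⁻¹ * ⟪g - v, transl (t • unitVec j) u - u⟫_ℂ +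
      ((t : ℂ)⁻¹ * ⟪v, transl (t • unitVec j) u - u⟫_ℂ - Complex.I * ⟪v, χ⟫_ℂ) -
      Complex.I * ⟪g - v, χ⟫_ℂ := by
    simp only [inner_sub_left]; ring
  rw [dist_eq_norm] at ht ⊢
  rw [e]
  have n1 : ‖(t : ℂ)⁻¹ * ⟪g - v, transl (t • unitVec j) u - u⟫_ℂ‖ ≤ ε / 3 := by
    rw [norm_mul, norm_inv, Complex.norm_real, Real.norm_eq_abs, inv_mul_le_iff₀ ht0']
    refine (norm_inner_le_norm _ _).trans ?_
    have := mul_le_mul_of_nonneg_left (norm_transl_sub_le h t) (norm_nonneg (g - v))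
    nlinarith
  have n2 : ‖Complex.I * ⟪g - v, χ⟫_ℂ‖ ≤ ε / 3 := by
    rw [norm_mul, Complex.norm_I, one_mul]
    exact (norm_inner_le_norm _ _).trans hd''
  calc _ ≤ _ := norm_sub_le _ _
    _ ≤ _ := add_le_add (norm_add_le _ _) n2
    _ < ε := by linarith

/-- Integration by parts against a Lipschitz function. -/
theorem norm_inner_deriv_sub_le {j : Fin 3} {u χ v ζ bu bv : L2} (hu : IsMagneticDeriv 0 j u χ)
    (hv : IsMagneticDeriv 0 j v ζ) {b : R3 → ℝ} (hb : Continuous b) {L : ℝ}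
    (hL : ∀ x y, |b x - b y| ≤ L * ‖x - y‖) (hbu : (u, bu) ∈ mulGraph b)
    (hbv : (v, bv) ∈ mulGraph b) : ‖⟪ζ, bu⟫_ℂ - ⟪bv, χ⟫_ℂ‖ ≤ L * (‖v‖ * ‖u‖) := by
  -- The products `b u` and `b v` need not lie in the form domain, so derivatives are replaced by
  -- difference quotients: forward for `v`, backward for `u`.
  have t1 := (Complex.continuous_conj.tendsto _).comp (tendsto_inner_transl hv bu)
  have t2 := tendsto_inner_transl hu bv
  have hneg : Tendsto (fun t : ℝ => -t) (𝓝[≠] 0) (𝓝[≠] 0) := by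
    refine tendsto_nhdsWithin_of_tendsto_nhds_of_eventually_within _ ?_ ?_
    · have := (continuous_neg (G := ℝ)).tendsto 0
      rw [neg_zero] at this
      exact this.mono_left nhdsWithin_le_nhds
    · filter_upwards [self_mem_nhdsWithin] with t ht
      simpa using ht
  have t3 := (t1.add (t2.comp hneg)).norm
  have e3 : ‖(starRingEnd ℂ) (Complex.I * ⟪bu, ζ⟫_ℂ) + Complex.I * ⟪bv, χ⟫_ℂ‖ =
      ‖⟪ζ, bu⟫_ℂ - ⟪bv, χ⟫_ℂ‖ := by
    rw [map_mul, inner_conj_symm, Complex.conj_I, ← norm_neg,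
      show -(-Complex.I * ⟪ζ, bu⟫_ℂ + Complex.I * ⟪bv, χ⟫_ℂ) =
        Complex.I * (⟪ζ, bu⟫_ℂ - ⟪bv, χ⟫_ℂ) by ring, norm_mul, Complex.norm_I, one_mul]
  rw [e3] at t3
  refine le_of_tendsto t3 ?_
  filter_upwards [self_mem_nhdsWithin] with t ht
  have ht0 : t ≠ 0 := ht
  set c := t • unitVec j with hc
  have hcn : ‖c‖ = |t| := by rw [hc, norm_smul]; simp
  set m : R3 → ℝ := fun x => b x - b (x + c) with hm
  have hmb : ∀ x, |m x| ≤ L * |t| := fun x => by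
    have := hL x (x + c)
    rwa [show x - (x + c) = -c by abel, norm_neg, hcn] at this
  have hmB : IsBdd m := IsBdd.of_continuous (hb.sub (hb.comp (by fun_prop))) hmb
  have e1 : (u, bu - mulB m u) ∈ mulGraph fun x => b (x + c) := by
    rw [mem_mulGraph] at hbu ⊢
    filter_upwards [hbu, coeFn_mulB hmB u, Lp.coeFn_sub bu (mulB m u)] with x h1 h2 h3
    rw [h3, Pi.sub_apply, h1, h2, hm]; push_cast; ring
  have e2 := inner_mulGraph (mulGraph_transl c hbv) e1
  rw [inner_sub_right] at e2
  -- Discrete product rule: the two quotients combine into multiplication by `b(x) - b(x+c)`, of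
  -- size at most `L|t|`, which cancels the division by `t`.
  have e4 : ⟪transl c v - v, bu⟫_ℂ + ⟪bv, u - transl (-c) u⟫_ℂ = ⟪transl c v, mulB m u⟫_ℂ := by
    have h1 := inner_mulGraph hbv hbu
    have h2 := inner_transl c bv u
    rw [inner_sub_left, inner_sub_right, h1, ← h2, e2]; ring
  have e5 : (starRingEnd ℂ) ((t : ℂ)⁻¹ * ⟪bu, transl c v - v⟫_ℂ) +
      (((-t : ℝ) : ℂ)⁻¹ * ⟪bv, transl ((-t) • unitVec j) u - u⟫_ℂ) =
      (t : ℂ)⁻¹ * ⟪transl c v, mulB m u⟫_ℂ := by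
    rw [← e4, map_mul, inner_conj_symm, neg_smul, ← hc, ← neg_sub u, inner_neg_right]
    simp only [map_inv₀, Complex.conj_ofReal, Complex.ofReal_neg, inv_neg]
    ring
  simp only [Function.comp]
  rw [e5, norm_mul, norm_inv, Complex.norm_real, Real.norm_eq_abs, inv_mul_le_iff₀ (abs_pos.2 ht0)]
  refine (norm_inner_le_norm _ _).trans ?_
  rw [LinearIsometry.norm_map]
  have := mul_le_mul_of_nonneg_left (norm_mulB_le hmB hmb u) (norm_nonneg v)
  linarith

end Translation

/-! ### Lipschitz continuity from bounded weak derivatives. -/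

section Lipschitz

open Convolution Filter Topology

/-- Continuous functions with essentially bounded weak derivatives are Lipschitz. -/
theorem exists_lipschitz_of_weak_deriv {f : R3 → ℝ} (hf : Continuous f) {g : Fin 3 → R3 → ℝ}
    (hg : ∀ j, IsWeakPartialDeriv j f (g j)) (hb : ∀ j, MemLp (g j) ∞ volume) :
    ∃ L, 0 ≤ L ∧ ∀ x y, |f x - f y| ≤ L * ‖x - y‖ := by
  set G : Fin 3 → ℝ := fun j => (eLpNormEssSup (g j) volume).toReal with hG
  have hGae : ∀ j, ∀ᵐ x, ‖g j x‖ ≤ G j := fun j => by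
    have hlt : eLpNormEssSup (g j) volume < ⊤ := by simpa using (hb j).2
    filter_upwards [ae_le_eLpNormEssSup (f := g j) (μ := (volume : Measure R3))] with x hx
    rw [← ofReal_norm] at hx
    exact (ENNReal.ofReal_le_iff_le_toReal hlt.ne).1 hx
  have hG0 : ∀ j, 0 ≤ G j := fun j => ENNReal.toReal_nonneg
  refine ⟨∑ j, G j, Finset.sum_nonneg fun j _ => hG0 j, fun x y => ?_⟩
  set φ : ℕ → ContDiffBump (0 : R3) := fun n =>
    ⟨1 / ((n : ℝ) + 2), 1 / ((n : ℝ) + 1), by positivity,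
      one_div_lt_one_div_of_lt (by positivity) (by linarith)⟩ with hφ
  -- The mollifications have classical derivatives bounded by the essential suprema of the weak
  -- ones. They converge pointwise because `f` is continuous, so their common Lipschitz bound passes
  -- to `f` everywhere.
  set F : ℕ → R3 → ℝ := fun n =>
    (φ n).normed volume ⋆[ContinuousLinearMap.lsmul ℝ ℝ, volume] f with hF
  have hlim : ∀ x, Tendsto (fun n => F n x) atTop (𝓝 (f x)) := fun x =>
    ContDiffBump.convolution_tendsto_right_of_continuous
      tendsto_one_div_add_atTop_nhds_zero_nat hf x
  have hder : ∀ n x, ∃ D : R3 →L[ℝ] ℝ, HasFDerivAt (F n) D x ∧ ∀ j, |D (unitVec j)| ≤ G j := by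
    intro n x
    set ρ := (φ n).normed volume with hρ
    have hρs : HasCompactSupport ρ := (φ n).hasCompactSupport_normed
    have hρc : ContDiff ℝ ∞ ρ := (φ n).contDiff_normed (n := ⊤)
    refine ⟨_, hρs.hasFDerivAt_convolution_left (ContinuousLinearMap.lsmul ℝ ℝ)
      (hρc.of_le (by simp)) hf.locallyIntegrable x, fun j => ?_⟩
    have hex := ((hρs.fderiv ℝ).convolutionExists_left
      ((ContinuousLinearMap.lsmul ℝ ℝ : ℝ →L[ℝ] ℝ →L[ℝ] ℝ).precompL R3)
      (hρc.continuous_fderiv (by simp)) (hf.locallyIntegrable (μ := volume)) x).integrable_swap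
    rw [convolution_eq_swap, ContinuousLinearMap.integral_apply hex]
    have hψc : ContDiff ℝ ∞ fun t => ρ (x - t) := hρc.comp (contDiff_const.sub contDiff_id)
    have hψs : HasCompactSupport fun t => ρ (x - t) := hρs.comp_homeomorph (Homeomorph.subLeft x)
    have hψd : ∀ t, pderiv j (fun t => ρ (x - t)) t = -fderiv ℝ ρ (x - t) (unitVec j) := by
      intro t
      have h1 : HasFDerivAt (fun t : R3 => x - t) (-ContinuousLinearMap.id ℝ R3) t :=
        (hasFDerivAt_id t).const_sub x
      have h2 := ((hρc.differentiable (by simp) (x - t)).hasFDerivAt).comp t h1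
      rw [pderiv, show (fun t => ρ (x - t)) = ρ ∘ fun t => x - t from rfl, h2.fderiv]
      simp
    have hw := hg j _ hψc hψs
    have e1 : ∫ t, (((ContinuousLinearMap.lsmul ℝ ℝ : ℝ →L[ℝ] ℝ →L[ℝ] ℝ).precompL R3)
        (fderiv ℝ ρ (x - t))) (f t) (unitVec j) = ∫ t, g j t * ρ (x - t) := by
      rw [← neg_neg (∫ t, g j t * ρ (x - t)), ← hw, ← integral_neg]
      refine integral_congr_ae (Eventually.of_forall fun t => ?_)
      simp only [hψd, ContinuousLinearMap.precompL_apply, ContinuousLinearMap.lsmul_apply,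
        smul_eq_mul]
      ring
    rw [e1, ← Real.norm_eq_abs]
    have hρi : Integrable (fun t => ρ (x - t)) volume :=
      hψc.continuous.integrable_of_hasCompactSupport hψs
    calc _ ≤ ∫ t, G j * ρ (x - t) := by
          refine norm_integral_le_of_norm_le (hρi.const_mul _) ?_
          filter_upwards [hGae j] with t ht
          rw [norm_mul, Real.norm_of_nonneg ((φ n).nonneg_normed _)]
          exact mul_le_mul_of_nonneg_right ht ((φ n).nonneg_normed _)
      _ = G j := by
          rw [integral_const_mul, integral_sub_left_eq_self (fun t => ρ t) volume x,
            (φ n).integral_normed, mul_one]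
  have hLip : ∀ n, |F n x - F n y| ≤ (∑ j, G j) * ‖x - y‖ := by
    intro n
    choose D hD hDj using hder n
    have hbound : ∀ z, ‖D z‖ ≤ ∑ j, G j := fun z => by
      refine ContinuousLinearMap.opNorm_le_bound _ (Finset.sum_nonneg fun j _ => hG0 j) fun v => ?_
      have hv : v = ∑ j, v j • unitVec j := by
        ext i; simp [Finset.sum_apply, Pi.single_apply]
      conv_lhs => rw [hv]
      rw [map_sum, Finset.sum_mul]
      refine (norm_sum_le _ _).trans (Finset.sum_le_sum fun j _ => ?_)
      rw [map_smul, norm_smul, mul_comm, Real.norm_eq_abs]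
      exact mul_le_mul (hDj z j) (PiLp.norm_apply_le v j) (norm_nonneg _) (hG0 j)
    exact convex_univ.norm_image_sub_le_of_norm_hasFDerivWithin_le
      (fun z _ => (hD z).hasFDerivWithinAt) (fun z _ => hbound z) (Set.mem_univ y) (Set.mem_univ x)
  exact le_of_tendsto ((hlim x).sub (hlim y)).abs (Eventually.of_forall hLip)

end Lipschitz

end MagneticBCS

namespace MagneticBCS

/-! ### Comparison of magnetic Laplacians with different vector potentials -/

section Cutoff

open Filter Topology

/-- The cutoff function `1 / (1 + ε |x|²)`. -/
noncomputable def cutoff (ε : ℝ) (x : R3) : ℝ := 1 + ε - ε * polyWeight ε x ^ 2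

theorem cutoff_eq {ε : ℝ} (hε : 0 < ε) (x : R3) : cutoff ε x = (1 + ε * ‖x‖ ^ 2)⁻¹ := by
  have : 0 < 1 + ε * ‖x‖ ^ 2 := by positivity
  rw [cutoff, polyWeight_sq hε]; field_simp; ring

theorem cutoff_pos {ε : ℝ} (hε : 0 < ε) (x : R3) : 0 < cutoff ε x := by
  rw [cutoff_eq hε]; positivity

theorem cutoff_le_one {ε : ℝ} (hε : 0 < ε) (x : R3) : cutoff ε x ≤ 1 := by
  rw [cutoff_eq hε]
  exact inv_le_one_of_one_le₀ (by nlinarith [sq_nonneg ‖x‖])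

theorem contDiff_cutoff {ε : ℝ} (hε : 0 < ε) : ContDiff ℝ ∞ (cutoff ε) :=
  contDiff_const.sub (contDiff_const.mul (isWeight_polyWeight hε).smooth_sq)

theorem abs_cutoff_le {ε : ℝ} (hε : 0 < ε) (x : R3) : |cutoff ε x| ≤ 1 := by
  rw [abs_of_pos (cutoff_pos hε x)]; exact cutoff_le_one hε x

theorem isBdd_cutoff {ε : ℝ} (hε : 0 < ε) : IsBdd (cutoff ε) :=
  IsBdd.of_continuous (contDiff_cutoff hε).continuous (abs_cutoff_le hε)

/-- The derivative is `-2ε p ∂p`, and `εp ≤ √(ε²+ε)`. The bound vanishes with `ε`, so derivatives of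
the cutoff disappear in the limit. -/
theorem abs_pderiv_cutoff_le {ε : ℝ} (hε : 0 < ε) (j : Fin 3) (x : R3) :
    |pderiv j (cutoff ε) x| ≤ 2 * √(ε ^ 2 + ε) := by
  have hw := isWeight_polyWeight hε
  have h1 : pderiv j (cutoff ε) x = -(ε * pderiv j (fun x => polyWeight ε x ^ 2) x) := by
    have d := (hw.smooth_sq.differentiable (by simp) x).hasFDerivAt
    have d2 : HasFDerivAt (cutoff ε) _ x := (d.const_mul ε).const_sub (1 + ε)
    rw [pderiv, d2.fderiv]; simp [pderiv]
  have h3 : polyWeight ε x ^ 2 ≤ 1 + ε⁻¹ := by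
    rw [polyWeight_sq hε]
    have : 0 < 1 + ε * ‖x‖ ^ 2 := by positivity
    gcongr
    rw [div_le_iff₀ this]
    field_simp; linarith
  have h0 : 0 ≤ polyWeight ε x := zero_le_one.trans (hw.one_le x)
  rw [h1, hw.pderiv_sq, abs_neg, abs_mul, abs_mul, abs_mul, abs_two, abs_of_pos hε,
    abs_of_nonneg h0]
  have h4 : ε * polyWeight ε x ≤ √(ε ^ 2 + ε) := by
    refine Real.le_sqrt_of_sq_le ?_
    calc (ε * polyWeight ε x) ^ 2 = ε ^ 2 * polyWeight ε x ^ 2 := by ring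
      _ ≤ ε ^ 2 * (1 + ε⁻¹) := by gcongr
      _ = ε ^ 2 + ε := by field_simp
  have h5 := mul_le_mul_of_nonneg_left (hw.deriv_le j x) (mul_nonneg hε.le h0)
  linarith

theorem continuous_pderiv_cutoff {ε : ℝ} (hε : 0 < ε) (j : Fin 3) :
    Continuous (pderiv j (cutoff ε)) := (contDiff_pderiv (contDiff_cutoff hε) j).continuous

theorem isBdd_pderiv_cutoff {ε : ℝ} (hε : 0 < ε) (j : Fin 3) : IsBdd (pderiv j (cutoff ε)) :=
  IsBdd.of_continuous (continuous_pderiv_cutoff hε j) (abs_pderiv_cutoff_le hε j)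

theorem tendsto_inner_cutoff (u v : L2) :
    Tendsto (fun n : ℕ => ⟪mulB (cutoff (1 / ((n : ℝ) + 1))) u, v⟫_ℂ) atTop (𝓝 ⟪u, v⟫_ℂ) := by
  have hint : Integrable (fun x => ‖(u : R3 → ℂ) x‖ * ‖(v : R3 → ℂ) x‖) volume :=
    (Lp.memLp u).norm.integrable_mul (Lp.memLp v).norm
  have h0 : ∀ n : ℕ, (0 : ℝ) < 1 / ((n : ℝ) + 1) := fun n => Nat.one_div_pos_of_nat
  have key := tendsto_integral_of_dominated_convergence (μ := (volume : Measure R3))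
    (F := fun (n : ℕ) x => (starRingEnd ℂ) ((cutoff (1 / ((n : ℝ) + 1)) x : ℂ) * u x) * v x)
    (f := fun x => (starRingEnd ℂ) ((u : R3 → ℂ) x) * v x) _ (fun n => ?_) hint (fun n => ?_) ?_
  · rw [inner_toL2 (EventuallyEq.refl _ _) (EventuallyEq.refl _ _)]
    refine key.congr fun n => ?_
    rw [inner_toL2 (coeFn_mulB (isBdd_cutoff (h0 n)) u) (EventuallyEq.refl _ _)]
  · refine (Complex.continuous_conj.comp_aestronglyMeasurable ?_).mul (Lp.aestronglyMeasurable v)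
    exact (isBdd_cutoff (h0 n)).aestronglyMeasurable.mul (Lp.aestronglyMeasurable u)
  · refine Eventually.of_forall fun x => ?_
    rw [norm_mul, RCLike.norm_conj, norm_mul, Complex.norm_real]
    refine mul_le_mul_of_nonneg_right ?_ (norm_nonneg _)
    exact mul_le_of_le_one_left (norm_nonneg _) (abs_cutoff_le (h0 n) x)
  · refine Eventually.of_forall fun x => ?_
    have h1 : Tendsto (fun n : ℕ => cutoff (1 / ((n : ℝ) + 1)) x) atTop (𝓝 1) := by
      have h2 : Tendsto (fun n : ℕ => (1 + (1 / ((n : ℝ) + 1)) * ‖x‖ ^ 2)⁻¹) atTop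
          (𝓝 (1 + 0 * ‖x‖ ^ 2)⁻¹) :=
        ((tendsto_one_div_add_atTop_nhds_zero_nat.mul_const _).const_add 1).inv₀ (by simp)
      simp only [zero_mul, add_zero, inv_one] at h2
      exact h2.congr fun n => (cutoff_eq (h0 n) x).symm
    have h3 := (Complex.continuous_ofReal.tendsto _).comp h1
    have h4 := ((Complex.continuous_conj.tendsto _).comp (h3.mul_const ((u : R3 → ℂ) x))).mul_const
      ((v : R3 → ℂ) x)
    simpa using h4

/-- A linear functional bounded by `‖π x‖` is represented by a vector. -/
theorem exists_inner_eq_of_le {E H : Type*} [AddCommGroup E] [Module ℂ E] [NormedAddCommGroup H]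
    [InnerProductSpace ℂ H] [CompleteSpace H] (p : E →ₗ[ℂ] H) (Λ : E →ₗ[ℂ] ℂ) {K : ℝ} (hK : 0 ≤ K)
    (h : ∀ x, ‖Λ x‖ ≤ K * ‖p x‖) : ∃ k : H, ‖k‖ ≤ K ∧ ∀ x, Λ x = ⟪k, p x⟫_ℂ := by
  have hker : LinearMap.ker p ≤ LinearMap.ker Λ := fun x hx => by
    have := h x
    rw [LinearMap.mem_ker] at hx ⊢
    rw [hx, norm_zero, mul_zero] at this
    exact norm_le_zero_iff.1 this
  -- The bound forces `Λ` to vanish on the kernel of `p`, so it factors through `p`; Hahn–Banach and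
  -- Riesz then give the vector.
  obtain ⟨f, hf⟩ : ∃ f : Module.Dual ℂ H, p.dualMap f = Λ := by
    rw [← LinearMap.mem_range, LinearMap.range_dualMap_eq_dualAnnihilator_ker,
      Submodule.mem_dualAnnihilator]
    exact fun x hx => hker hx
  have hfx : ∀ x, f (p x) = Λ x := fun x => by rw [← hf]; rfl
  set F : LinearMap.range p →L[ℂ] ℂ := (f.comp (LinearMap.range p).subtype).mkContinuous K (by
    rintro ⟨_, x, rfl⟩
    change ‖f (p x)‖ ≤ K * ‖p x‖
    rw [hfx]; exact h x) with hF
  obtain ⟨G, hG, hGn⟩ := exists_extension_norm_eq (LinearMap.range p) F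
  refine ⟨(InnerProductSpace.toDual ℂ H).symm G, ?_, fun x => ?_⟩
  · rw [LinearIsometryEquiv.norm_map, hGn]
    exact LinearMap.mkContinuous_norm_le _ hK _
  · rw [InnerProductSpace.toDual_symm_apply, ← hfx]
    exact (hG ⟨p x, x, rfl⟩).symm

end Cutoff

/-! ### Change of the vector potential. -/

section Compare

open Filter Topology

/-- Integration by parts against a Lipschitz function, with a vector potential. -/
theorem norm_inner_magDeriv_sub_le {a : R3 → R3} (ha : Continuous a) {j : Fin 3}
    {u χ v ζ bu bv au av : L2} (hu : IsMagneticDeriv a j u χ) (hv : IsMagneticDeriv a j v ζ)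
    (hau : (u, au) ∈ mulGraph fun x => a x j) (hav : (v, av) ∈ mulGraph fun x => a x j)
    {b : R3 → ℝ} (hb : Continuous b) {L : ℝ} (hL : ∀ x y, |b x - b y| ≤ L * ‖x - y‖)
    (hbu : (u, bu) ∈ mulGraph b) (hbv : (v, bv) ∈ mulGraph b) :
    ‖⟪ζ, bu⟫_ℂ - ⟪bv, χ⟫_ℂ‖ ≤ L * (‖v‖ * ‖u‖) := by
  have hneg : ∀ {f g : L2}, (f, g) ∈ mulGraph (fun x => a x j) →
      (f, -g) ∈ mulGraph fun x => (0 : R3 → R3) x j - a x j := by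
    intro f g h
    rw [mem_mulGraph] at h ⊢
    filter_upwards [h, Lp.coeFn_neg g] with x h1 h2
    rw [h2, Pi.neg_apply, h1]; simp
  -- The potential is removed from both derivatives. The extra terms `⟨av, bu⟩` and `⟨bv, au⟩` agree
  -- because `a` and `b` are real multipliers, so they cancel.
  have h1 := norm_inner_deriv_sub_le (hu.gauge ha continuous_zero (hneg hau))
    (hv.gauge ha continuous_zero (hneg hav)) hb hL hbu hbv
  have h2 : ⟪av, bu⟫_ℂ = ⟪bv, au⟫_ℂ := by
    rw [inner_toL2 (show _ =ᵐ[volume] _ from hav) (show _ =ᵐ[volume] _ from hbu),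
      inner_toL2 (show _ =ᵐ[volume] _ from hbv) (show _ =ᵐ[volume] _ from hau)]
    refine integral_congr_ae (Eventually.of_forall fun x => ?_)
    simp; ring
  rw [inner_add_left, inner_add_right, inner_neg_left, inner_neg_right, h2] at h1
  rwa [show ⟪ζ, bu⟫_ℂ - ⟪bv, χ⟫_ℂ = ⟪ζ, bu⟫_ℂ + -⟪bv, au⟫_ℂ - (⟪bv, χ⟫_ℂ + -⟪bv, au⟫_ℂ) by ring]

theorem continuous_coord {a : R3 → R3} (ha : Continuous a) (j : Fin 3) :
    Continuous fun x => a x j :=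
  continuous_apply_R3 ha j

/-- Change of the vector potential in the magnetic Laplacian. -/
theorem HasMagLaplacian.change {a a' : R3 → R3} (ha : Continuous a) (ha' : Continuous a')
    {L κ : ℝ} (hL : 0 ≤ L) (hκ : 0 ≤ κ)
    (hLip : ∀ j x y, |(a' x j - a x j) - (a' y j - a y j)| ≤ L * ‖x - y‖)
    (hb : ∀ j x, |a' x j - a x j| ≤ L * ‖x‖)
    (hgr : ∀ j x, |a x j| ≤ κ * (1 + ‖x‖))
    {u g : L2} {χ : Fin 3 → L2} (h : HasMagLaplacian a u χ g) {u₂ : L2}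
    (hu₂ : (u, u₂) ∈ mulGraph fun x => 1 + ‖x‖ ^ 2) {χ₁ : Fin 3 → L2}
    (hχ₁ : ∀ j, (χ j, χ₁ j) ∈ mulGraph fun x => ‖x‖) :
    ∃ χ' g', HasMagLaplacian a' u χ' g' ∧
      ‖g' - g‖ ≤ 2 * L * ∑ j, ‖χ₁ j‖ + 3 * L ^ 2 * ‖u₂‖ + 3 * L * ‖u‖ := by
  have hx2 : ∀ x : R3, ‖x‖ ≤ 1 + ‖x‖ ^ 2 := fun x => by nlinarith [sq_nonneg (‖x‖ - 1)]
  have habs : ∀ x : R3, |1 + ‖x‖ ^ 2| = 1 + ‖x‖ ^ 2 := fun x => abs_of_pos (by positivity)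
  set b : Fin 3 → R3 → ℝ := fun j x => a' x j - a x j with hbdef
  have hbc : ∀ j, Continuous (b j) := fun j => (continuous_coord ha' j).sub (continuous_coord ha j)
  have ex1 : ∀ j, ∃ v, (u, v) ∈ mulGraph (b j) := fun j =>
    exists_mulGraph_of_le (C := L) (hbc j).measurable hu₂ fun x => by
      rw [habs]; exact (hb j x).trans (mul_le_mul_of_nonneg_left (hx2 x) hL)
  have ex2 : ∀ j, ∃ v, (χ j, v) ∈ mulGraph (b j) := fun j =>
    exists_mulGraph_of_le (C := L) (hbc j).measurable (hχ₁ j) fun x => by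
      rw [abs_norm]; exact hb j x
  have hb2 : ∀ j x, |b j x ^ 2| ≤ L ^ 2 * |1 + ‖x‖ ^ 2| := fun j x => by
    rw [abs_pow, habs]
    have := pow_le_pow_left₀ (abs_nonneg _) (hb j x) 2
    rw [mul_pow] at this
    nlinarith [sq_nonneg L]
  have ex3 : ∀ j, ∃ v, (u, v) ∈ mulGraph fun x => b j x ^ 2 := fun j =>
    exists_mulGraph_of_le (C := L ^ 2) ((hbc j).pow 2).measurable hu₂ (hb2 j)
  have ex4 : ∀ j, ∃ v, (u, v) ∈ mulGraph fun x => a x j := fun j =>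
    exists_mulGraph_of_le (C := 2 * κ) (continuous_coord ha j).measurable hu₂ fun x => by
      rw [habs]
      refine (hgr j x).trans ?_
      have := mul_le_mul_of_nonneg_left (hx2 x) hκ
      nlinarith [sq_nonneg ‖x‖, mul_nonneg hκ (sq_nonneg ‖x‖)]
  choose β hβ using ex1
  choose γ hγ using ex2
  choose δ hδ using ex3
  choose α hα using ex4
  have hβδ : ∀ j, (β j, δ j) ∈ mulGraph (b j) := fun j => by
    have h1 := hβ j
    have h2 := hδ j
    rw [mem_mulGraph] at h1 h2 ⊢
    filter_upwards [h1, h2] with x h3 h4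
    rw [h4, h3]; push_cast; ring
  have hγn : ∀ j, ‖γ j‖ ≤ L * ‖χ₁ j‖ := fun j =>
    norm_le_of_mulGraph (hγ j) (hχ₁ j) fun x => by rw [abs_norm]; exact hb j x
  have hδn : ∀ j, ‖δ j‖ ≤ L ^ 2 * ‖u₂‖ := fun j => norm_le_of_mulGraph (hδ j) hu₂ (hb2 j)
  -- The three summands bound `2b·∇u`, `b²u` and the weak form of `(div b)u`, summed over three
  -- components, with `b = a' - a`.
  set K := 2 * L * ∑ j, ‖χ₁ j‖ + 3 * L ^ 2 * ‖u₂‖ + 3 * L * ‖u‖ with hK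
  have hK0 : 0 ≤ K := by positivity
  set χ' : Fin 3 → L2 := fun j => χ j + β j with hχ'
  have hχ'D : ∀ j, IsMagneticDeriv a' j u (χ' j) := fun j => (h.1 j).gauge ha ha' (hβ j)
  -- the bound on functions for which all products are square-integrable
  have nice : ∀ (v : L2) (w bv av : Fin 3 → L2), (∀ j, IsMagneticDeriv a' j v (w j)) →
      (∀ j, (v, bv j) ∈ mulGraph (b j)) → (∀ j, (v, av j) ∈ mulGraph fun x => a x j) →
      ‖∑ j, ⟪w j, χ' j⟫_ℂ - ⟪v, g⟫_ℂ‖ ≤ K * ‖v‖ := by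
    intro v w bv av hw hbv hav
    have hD : ∀ j, IsMagneticDeriv a j v (w j - bv j) := fun j => by
      have h1 : (v, -bv j) ∈ mulGraph fun x => a x j - a' x j := by
        have h2 := hbv j
        rw [mem_mulGraph] at h2 ⊢
        filter_upwards [h2, Lp.coeFn_neg (bv j)] with x h3 h4
        rw [h4, Pi.neg_apply, h3, hbdef]; push_cast; ring
      have := (hw j).gauge ha' ha h1
      rwa [← sub_eq_add_neg] at this
    have hg := h.2 v _ hD
    -- Weak form of `(D+b)² - D² = 2b·D + b² + [D, b]`; the last bracket is estimated by the
    -- Lipschitz constant alone.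
    have key : ∑ j, ⟪w j, χ' j⟫_ℂ - ⟪v, g⟫_ℂ = ∑ j, (2 * ⟪v, γ j⟫_ℂ + ⟪v, δ j⟫_ℂ +
        (⟪w j - bv j, β j⟫_ℂ - ⟪bv j, χ j⟫_ℂ)) := by
      rw [← hg, ← Finset.sum_sub_distrib]
      refine Finset.sum_congr rfl fun j _ => ?_
      have e1 := inner_mulGraph (hbv j) (hγ j)
      have e2 := inner_mulGraph (hbv j) (hβδ j)
      rw [← e1, ← e2, hχ']
      simp only [inner_add_right, inner_sub_left]
      ring
    rw [key]
    calc _ ≤ ∑ j, (2 * (‖v‖ * (L * ‖χ₁ j‖)) + ‖v‖ * (L ^ 2 * ‖u₂‖) + L * (‖v‖ * ‖u‖)) := by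
          refine (norm_sum_le _ _).trans (Finset.sum_le_sum fun j _ => ?_)
          refine (norm_add_le _ _).trans (add_le_add ((norm_add_le _ _).trans (add_le_add ?_ ?_)) ?_)
          · rw [norm_mul, Complex.norm_ofNat]
            refine mul_le_mul_of_nonneg_left ((norm_inner_le_norm _ _).trans ?_) (by norm_num)
            exact mul_le_mul_of_nonneg_left (hγn j) (norm_nonneg _)
          · exact (norm_inner_le_norm _ _).trans
              (mul_le_mul_of_nonneg_left (hδn j) (norm_nonneg _))
          · exact norm_inner_magDeriv_sub_le ha (h.1 j) (hD j) (hα j) (hav j) (hbc j) (hLip j)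
              (hβ j) (hbv j)
      _ = K * ‖v‖ := by
          rw [Finset.sum_add_distrib, Finset.sum_add_distrib, hK]
          simp only [Finset.sum_const, Finset.card_univ, Fintype.card_fin, nsmul_eq_mul]
          rw [← Finset.mul_sum, ← Finset.mul_sum, ← Finset.mul_sum]
          push_cast; ring
  -- The decay `1/(1+ε|x|²)` of the cutoff turns multipliers of linear growth into bounded ones. So
  -- the estimate holds for the cut-off function, and the cutoff is then removed.
  have all : ∀ (v : L2) (w : Fin 3 → L2), (∀ j, IsMagneticDeriv a' j v (w j)) →
      ‖∑ j, ⟪w j, χ' j⟫_ℂ - ⟪v, g⟫_ℂ‖ ≤ K * ‖v‖ := by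
    intro v w hw
    have h0 : ∀ n : ℕ, (0 : ℝ) < 1 / ((n : ℝ) + 1) := fun n => Nat.one_div_pos_of_nat
    have hprod : ∀ (m : R3 → ℝ) (n : ℕ) (c : ℝ), 0 ≤ c → Continuous m →
        (∀ x, |m x| ≤ c * (1 + ‖x‖)) → ∃ v', (mulB (cutoff (1 / ((n : ℝ) + 1))) v, v') ∈ mulGraph m := by
      intro m n c hc hm hmc
      set ε := 1 / ((n : ℝ) + 1) with hε
      have hε0 : 0 < ε := h0 n
      have hB : IsBdd fun x => m x * cutoff ε x := by
        refine IsBdd.of_continuous (hm.mul (contDiff_cutoff hε0).continuous)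
          (C := c * (2 * (1 + ε⁻¹))) fun x => ?_
        rw [abs_mul, abs_of_pos (cutoff_pos hε0 x)]
        have h1 : (1 + ‖x‖) * cutoff ε x ≤ 2 * (1 + ε⁻¹) := by
          rw [cutoff_eq hε0, ← div_eq_mul_inv, div_le_iff₀ (by positivity)]
          have h2 : 0 < ε⁻¹ := by positivity
          have h3 : ε⁻¹ * (ε * ‖x‖ ^ 2) = ‖x‖ ^ 2 := by field_simp
          nlinarith [hx2 x, mul_nonneg hε0.le (sq_nonneg ‖x‖), sq_nonneg ‖x‖]
        calc _ ≤ c * (1 + ‖x‖) * cutoff ε x :=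
              mul_le_mul_of_nonneg_right (hmc x) (cutoff_pos hε0 x).le
          _ = c * ((1 + ‖x‖) * cutoff ε x) := by ring
          _ ≤ _ := mul_le_mul_of_nonneg_left h1 hc
      refine ⟨mulB (fun x => m x * cutoff ε x) v, ?_⟩
      rw [mem_mulGraph]
      filter_upwards [coeFn_mulB hB v, coeFn_mulB (isBdd_cutoff hε0) v] with x h1 h2
      rw [h1, h2]; push_cast; ring
    have step : ∀ n : ℕ, ‖∑ j, ⟪mulB (cutoff (1 / ((n : ℝ) + 1))) (w j) -
        Complex.I • mulB (pderiv j (cutoff (1 / ((n : ℝ) + 1)))) v, χ' j⟫_ℂ -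
        ⟪mulB (cutoff (1 / ((n : ℝ) + 1))) v, g⟫_ℂ‖ ≤ K * ‖v‖ := by
      intro n
      choose bv hbv using fun j => hprod (b j) n L hL (hbc j) fun x =>
        (hb j x).trans (mul_le_mul_of_nonneg_left (by linarith) hL)
      choose av hav using fun j => hprod (fun x => a x j) n κ hκ (continuous_coord ha j) (hgr j)
      refine (nice _ _ bv av (fun j => (hw j).mul_smooth ha' (contDiff_cutoff (h0 n))
        (isBdd_cutoff (h0 n)) (isBdd_pderiv_cutoff (h0 n) j)) hbv hav).trans ?_
      refine mul_le_mul_of_nonneg_left ?_ hK0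
      have := norm_mulB_le (isBdd_cutoff (h0 n)) (abs_cutoff_le (h0 n)) v
      rwa [one_mul] at this
    have hz : Tendsto (fun n : ℕ => 2 * √((1 / ((n : ℝ) + 1)) ^ 2 + 1 / ((n : ℝ) + 1)) * ‖v‖)
        atTop (𝓝 0) := by
      have h1 := tendsto_one_div_add_atTop_nhds_zero_nat (𝕜 := ℝ)
      have h2 := ((((h1.pow 2).add h1).sqrt).const_mul 2).mul_const ‖v‖
      simpa using h2
    have hlim : Tendsto (fun n : ℕ => ∑ j, ⟪mulB (cutoff (1 / ((n : ℝ) + 1))) (w j) -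
        Complex.I • mulB (pderiv j (cutoff (1 / ((n : ℝ) + 1)))) v, χ' j⟫_ℂ -
        ⟪mulB (cutoff (1 / ((n : ℝ) + 1))) v, g⟫_ℂ) atTop
        (𝓝 (∑ j, ⟪w j, χ' j⟫_ℂ - ⟪v, g⟫_ℂ)) := by
      refine Tendsto.sub (tendsto_finsetSum _ fun j _ => ?_) (tendsto_inner_cutoff v g)
      have h1 : Tendsto (fun n : ℕ => ⟪Complex.I • mulB (pderiv j (cutoff (1 / ((n : ℝ) + 1)))) v,
          χ' j⟫_ℂ) atTop (𝓝 0) := by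
        refine squeeze_zero_norm (a := fun n : ℕ =>
          2 * √((1 / ((n : ℝ) + 1)) ^ 2 + 1 / ((n : ℝ) + 1)) * ‖v‖ * ‖χ' j‖) (fun n => ?_) ?_
        · refine (norm_inner_le_norm _ _).trans (mul_le_mul_of_nonneg_right ?_ (norm_nonneg _))
          rw [norm_smul, Complex.norm_I, one_mul]
          exact norm_mulB_le (isBdd_pderiv_cutoff (h0 n) j) (abs_pderiv_cutoff_le (h0 n) j) v
        · simpa using hz.mul_const ‖χ' j‖
      have h2 := (tendsto_inner_cutoff (w j) (χ' j)).sub h1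
      simp only [sub_zero] at h2
      exact h2.congr fun n => by rw [inner_sub_left]
    exact le_of_tendsto hlim.norm (Eventually.of_forall step)
  set q : L2Grad := WithLp.toLp 2 (Fin.cons (-g) χ') with hq
  -- The defect of the weak equation is a functional bounded by `K‖v‖`; its representing vector is
  -- the correction `g' - g`.
  obtain ⟨k, hk, hkx⟩ := exists_inner_eq_of_le
    (((PiLp.proj 2 (fun _ : Fin 4 => L2) 0 : L2Grad →L[ℂ] L2).toLinearMap).comp
      (formDomain a').subtype)
    ((innerSL ℂ q).toLinearMap.comp (formDomain a').subtype) hK0 (by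
      rintro ⟨p, hp⟩
      have h1 := all (p 0) (fun j => p j.succ) hp
      change ‖⟪q, p⟫_ℂ‖ ≤ K * ‖p 0‖
      rw [PiLp.inner_apply, Fin.sum_univ_succ]
      rw [← Complex.norm_conj] at h1
      convert h1 using 2
      rw [map_sub, map_sum, inner_conj_symm]
      simp only [inner_conj_symm, hq, Fin.cons_zero, Fin.cons_succ, inner_neg_left]
      ring)
  refine ⟨χ', g + k, ⟨hχ'D, fun v w hw => ?_⟩, by rwa [add_sub_cancel_left]⟩
  have h1 := hkx ⟨WithLp.toLp 2 (Fin.cons v w), fun j => hw j⟩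
  change ⟪q, WithLp.toLp 2 (Fin.cons v w)⟫_ℂ = ⟪k, v⟫_ℂ at h1
  rw [PiLp.inner_apply, Fin.sum_univ_succ] at h1
  simp only [hq, Fin.cons_zero, Fin.cons_succ, inner_neg_left] at h1
  have h2 := congrArg (starRingEnd ℂ) h1
  rw [map_add, map_sum, map_neg, inner_conj_symm, inner_conj_symm] at h2
  simp only [inner_conj_symm] at h2
  rw [inner_add_right, ← h2]; ring

end Compare

end MagneticBCS

namespace MagneticBCS

/-! ### Comparison of the resolvents -/

section CompareRes

open Filter Topology

/-- Lipschitz vector potentials vanishing at the origin. -/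
structure IsLipPotential (a : R3 → R3) (L : ℝ) : Prop where
  cont : Continuous a
  nonneg : 0 ≤ L
  lip : ∀ j x y, |a x j - a y j| ≤ L * ‖x - y‖
  le : ∀ j x, |a x j| ≤ L * ‖x‖

variable {T μ : ℝ}

theorem norm_le_quadratic {u v : L2} (h : (u, v) ∈ mulGraph fun x => 1 + ‖x‖ ^ 2) : ‖u‖ ≤ ‖v‖ := by
  have := norm_le_of_mulGraph (C := 1) (mulGraph_one u) h fun x => by
    rw [abs_one, one_mul, abs_of_pos (by positivity)]; nlinarith [sq_nonneg ‖x‖]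
  rwa [one_mul] at this

theorem tendsto_polyWeight (x : R3) :
    Tendsto (fun n : ℕ => polyWeight (1 / ((n : ℝ) + 1)) x) atTop (𝓝 (√(1 + ‖x‖ ^ 2))) := by
  refine (tendsto_polyWeight_sq x).sqrt.congr fun n => ?_
  exact Real.sqrt_sq (Real.sqrt_nonneg _)

/-- Bounds uniform with respect to the regularized weights yield bounds for the weight `|x|`. -/
theorem exists_mulGraph_norm {u : L2} {C : ℝ} (h : ∀ ε, 0 < ε → ‖mulB (polyWeight ε) u‖ ≤ C) :
    ∃ v, (u, v) ∈ mulGraph (fun x => ‖x‖) ∧ ‖v‖ ≤ C := by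
  obtain ⟨w, hw, hwC⟩ := exists_mulGraph_of_tendsto
    (fun n => (isWeight_polyWeight (Nat.one_div_pos_of_nat (n := n))).bdd) tendsto_polyWeight
    fun n => h _ (Nat.one_div_pos_of_nat (n := n))
  have hle : ∀ x : R3, |‖x‖| ≤ 1 * |√(1 + ‖x‖ ^ 2)| := fun x => by
    rw [abs_norm, one_mul, abs_of_nonneg (Real.sqrt_nonneg _)]
    exact Real.le_sqrt_of_sq_le (by linarith)
  obtain ⟨v, hv⟩ := exists_mulGraph_of_le continuous_norm.measurable hw hle
  have := norm_le_of_mulGraph hv hw hle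
  exact ⟨v, hv, this.trans (by rwa [one_mul])⟩

theorem norm_polyWeight_le {ε : ℝ} (hε : 0 < ε) {u v : L2}
    (h : (u, v) ∈ mulGraph fun x => 1 + ‖x‖ ^ 2) : ‖mulB (polyWeight ε) u‖ ≤ ‖v‖ :=
  ((isWeight_polyWeight hε).norm_le_sq u).trans (norm_polyWeight_sq_le hε h)

/-- The free solution `u` and its gradient inherit decay from `f`, so changing the potential in its
equation costs only a source `Φ` of order `L`. The difference is thus the resolvent of `a` applied
to `Φ`. Writing it as `magRes a Ψ` loses the factor `|1+z|`, which the resolvent bound `η⁻¹`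
compensates. This form keeps control of the graph norm. -/
theorem exists_resAt_sub (μ : ℝ) {η₀ : ℝ} (h0 : 0 < η₀) (L₀ : ℝ) : ∃ C : ℝ, 0 < C ∧
    ∀ (a : R3 → R3) (L : ℝ), IsLipPotential a L → L ≤ L₀ → ∀ (η : ℝ) (z : ℂ), IsPole μ η₀ η z →
    ∀ f f₂ : L2, (f, f₂) ∈ mulGraph (fun x => 1 + ‖x‖ ^ 2) →
      ∃ Ψ : L2, resAt (magRes 0) z f - resAt (magRes a) z f = magRes a Ψ ∧
        ‖Ψ‖ ≤ C * L * ‖f₂‖ * (√η)⁻¹ := by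
  obtain ⟨C, hC, hb⟩ := exists_weighted_bounds μ h0
  set c := η₀⁻¹ + 2 + |μ| / η₀ with hc
  have hcp : 0 < c := by positivity
  refine ⟨c * (C * (9 + 3 * |L₀|)), by positivity, ?_⟩
  intro a L ha hL η z hz f f₂ hf
  have hη := hz.eta_pos
  have hLn := ha.nonneg
  have hsp : 0 ≤ (√η)⁻¹ := by positivity
  obtain ⟨χ, hχ⟩ := exists_hasMagLaplacian_resAt (0 : R3 → R3) hz.im_ne f
  set u := resAt (magRes 0) z f with hu
  obtain ⟨u₂, hu₂, hu₂n⟩ := exists_mulGraph_quadratic (u := u) (f := f) (C := C * (√η)⁻¹)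
    (by positivity) (fun ε hε =>
      (hb 0 continuous_zero η z hz _ (isWeight_polyWeight hε) f χ hχ).2.2.2.2) hf
  have hgrad : ∀ j, ∃ v, (χ j, v) ∈ mulGraph (fun x => ‖x‖) ∧ ‖v‖ ≤ C * (√η)⁻¹ * ‖f₂‖ := fun j =>
    exists_mulGraph_norm fun ε hε =>
      ((hb 0 continuous_zero η z hz _ (isWeight_polyWeight hε) f χ hχ).2.2.1 j).trans
        (mul_le_mul_of_nonneg_left (norm_polyWeight_le hε hf) (by positivity))
  choose χ₁ hχ₁ hχ₁n using hgrad
  obtain ⟨χ', g', hg', hgn⟩ := hχ.change continuous_zero ha.cont hLn le_rfl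
    (fun j x y => by simpa using ha.lip j x y) (fun j x => by simpa using ha.le j x)
    (fun j x => by simp) hu₂ hχ₁
  set Φ := g' - (f + z • u) with hΦ
  have hun := norm_le_quadratic hu₂
  have hΦn : ‖Φ‖ ≤ C * (9 + 3 * |L₀|) * L * ‖f₂‖ * (√η)⁻¹ := by
    refine hgn.trans ?_
    have hsum : ∑ j, ‖χ₁ j‖ ≤ 3 * (C * (√η)⁻¹ * ‖f₂‖) := by
      refine (Finset.sum_le_sum fun j _ => hχ₁n j).trans ?_
      simp
    have hL2 : L ^ 2 ≤ L * |L₀| := by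
      rw [pow_two]; exact mul_le_mul_of_nonneg_left (hL.trans (le_abs_self _)) hLn
    have hu2 := hun.trans hu₂n
    calc _ ≤ 2 * L * (3 * (C * (√η)⁻¹ * ‖f₂‖)) + 3 * (L * |L₀|) * (C * (√η)⁻¹ * ‖f₂‖) +
          3 * L * (C * (√η)⁻¹ * ‖f₂‖) := by gcongr
      _ = _ := by ring
  have hR := magRes_isSelfAdjoint a
  have hu' : u = resAt (magRes a) z (f + Φ) := by
    refine eq_resAt hR hz.im_ne ?_
    have := hasMagLaplacian_iff.1 ⟨χ', hg'⟩
    rw [show f + Φ + (1 + z) • u = g' + u by rw [hΦ]; module]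
    exact this
  refine ⟨Φ + (1 + z) • resAt (magRes a) z Φ, ?_, ?_⟩
  · rw [← resAt_apply hR hz.im_ne, hu', map_add, add_sub_cancel_left]
  · have n1 := norm_resAt_le a hz.im_ne Φ
    rw [hz.im] at n1
    have n2 : ‖(1 + z : ℂ)‖ ≤ 1 + (1 + |μ| / η₀) * η :=
      (norm_add_le _ _).trans (by rw [norm_one]; exact add_le_add le_rfl hz.norm_le)
    have hηi : η⁻¹ ≤ η₀⁻¹ := inv_anti₀ h0 hz.le
    calc ‖Φ + (1 + z) • resAt (magRes a) z Φ‖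
        ≤ ‖Φ‖ + (1 + (1 + |μ| / η₀) * η) * (η⁻¹ * ‖Φ‖) := by
          refine (norm_add_le _ _).trans (add_le_add le_rfl ?_)
          rw [norm_smul]
          have := hz.pos
          exact mul_le_mul n2 n1 (norm_nonneg _) (by positivity)
      _ = (η⁻¹ + 2 + |μ| / η₀) * ‖Φ‖ := by field_simp; ring
      _ ≤ c * ‖Φ‖ := by rw [hc]; gcongr
      _ ≤ c * (C * (9 + 3 * |L₀|) * L * ‖f₂‖ * (√η)⁻¹) := by gcongr
      _ = _ := by ring

/-- The vectors `Ψ` of the single poles are summed with the coefficients of the expansion. The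
series converges absolutely and `magRes a` is pulled out of it. -/
theorem exists_kinRes_sub (hT : 0 < T) (μ L₀ : ℝ) : ∃ C : ℝ, 0 < C ∧
    ∀ (a : R3 → R3) (L : ℝ), IsLipPotential a L → L ≤ L₀ →
    ∀ f f₂ : L2, (f, f₂) ∈ mulGraph (fun x => 1 + ‖x‖ ^ 2) →
      ∃ Ψ : L2, kinRes T μ 0 (magRes 0) f - kinRes T μ 0 (magRes a) f = magRes a Ψ ∧
        ‖Ψ‖ ≤ C * L * ‖f₂‖ := by
  obtain ⟨C, hC, hb⟩ := exists_resAt_sub μ (mul_pos Real.pi_pos hT) L₀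
  have hS := poleSum_pos hT
  refine ⟨poleSum T * C, by positivity, ?_⟩
  intro a L ha hL f f₂ hf
  have hp := fun n => isPole_pole (μ := μ) hT n
  choose Ψ hΨ hΨn using fun n => hb a L ha hL _ _ (hp n) f f₂ hf
  choose Ξ hΞ hΞn using fun n => hb a L ha hL _ _ (hp n).conj f f₂ hf
  set t : ℕ → L2 := fun n => (2 * T / (Complex.I * matsubara T n) : ℂ) • (Ψ n - Ξ n) with ht
  have hbound : ∀ n, ‖t n‖ ≤ 4 * T * matsubara T n ^ (-(3 / 2) : ℝ) * (C * L * ‖f₂‖) := fun n =>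
    norm_pole_term_le hT (hΨn n) (hΞn n)
  have hsb := (summable_poleSum hT).mul_right (C * L * ‖f₂‖)
  have hsum : Summable t := Summable.of_norm_bounded hsb hbound
  refine ⟨∑' n, t n, ?_, ?_⟩
  · have h1 := ((magRes a).continuous.tendsto _).comp hsum.hasSum.tendsto_sum_nat
    have h2 : ∀ b : R3 → R3, Tendsto (fun N => (∑ n ∈ Finset.range N,
        (2 * T / (Complex.I * matsubara T n) : ℂ) • (resAt (magRes b) (pole T μ n) -
          resAt (magRes b) (starRingEnd ℂ (pole T μ n)))) f) atTop
        (𝓝 (kinRes T μ 0 (magRes b) f)) := fun b =>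
      ((ContinuousLinearMap.apply ℂ L2 f).continuous.tendsto _).comp
        (tendsto_sum_resAt (μ := μ) hT (magRes_isSelfAdjoint b))
    refine tendsto_nhds_unique ((h2 0).sub (h2 a)) (h1.congr fun N => ?_)
    simp only [Function.comp, map_sum, sum_apply, smul_apply, sub_apply, ← Finset.sum_sub_distrib,
      ht, map_smul, map_sub, ← hΨ, ← hΞ]
    refine Finset.sum_congr rfl fun n _ => ?_
    module
  · have := tsum_of_norm_bounded hsb.hasSum hbound
    rw [tsum_mul_right] at this
    calc _ ≤ _ := this
      _ = _ := by rw [poleSum]; ring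

theorem mulGraph_add {m : R3 → ℝ} {u v u' v' : L2} (h : (u, v) ∈ mulGraph m)
    (h' : (u', v') ∈ mulGraph m) : (u + u', v + v') ∈ mulGraph m := add_mem h h'

theorem mulGraph_smul {m : R3 → ℝ} {u v : L2} (c : ℂ) (h : (u, v) ∈ mulGraph m) :
    (c • u, c • v) ∈ mulGraph m := Submodule.smul_mem _ c h

theorem exists_kinRes_quadratic (hT : 0 < T) (μ : ℝ) {M l : ℝ} (hl : l < symbolMin T μ) :
    ∃ C : ℝ, 0 < C ∧ ∀ a : R3 → R3, Continuous a → ∀ e, -M ≤ e → e ≤ l →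
      ∀ f f₂ : L2, (f, f₂) ∈ mulGraph (fun x => 1 + ‖x‖ ^ 2) →
        ∃ w, (kinRes T μ e (magRes a) f, w) ∈ mulGraph (fun x => 1 + ‖x‖ ^ 2) ∧
          ‖w‖ ≤ C * ‖f₂‖ := by
  obtain ⟨C, hC, hb⟩ := exists_weighted_kinRes hT μ (M := M) hl
  exact ⟨C, hC, fun a ha e he1 he2 f f₂ hf => exists_mulGraph_quadratic hC.le
    (fun ε hε => (hb a ha _ (isWeight_polyWeight hε) e he1 he2 f).2) hf⟩

theorem kinRes_apply_eq (hT : 0 < T) {e : ℝ} (he : e < symbolMin T μ) {H : Type*}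
    [NormedAddCommGroup H] [InnerProductSpace ℂ H] [CompleteSpace H] {R : H →L[ℂ] H}
    (hs : spectrum ℝ R ⊆ Set.Icc 0 1) (f : H) :
    kinRes T μ e R f = kinRes T μ 0 R (f + (e : ℂ) • kinRes T μ e R f) ∧
      kinRes T μ e R f = kinRes T μ 0 R f + (e : ℂ) • kinRes T μ e R (kinRes T μ 0 R f) := by
  have h1 := congrArg (fun L => L f) (kinRes_sub_kinRes (μ := μ) hT (symbolMin_pos hT) he hs)
  have h2 := congrArg (fun L => L f) (kinRes_sub_kinRes (μ := μ) hT he (symbolMin_pos hT) hs)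
  simp only [sub_apply, smul_apply, mul_apply_eq_comp, zero_sub, sub_zero] at h1 h2
  constructor
  · rw [map_add, map_smul]
    calc kinRes T μ e R f = kinRes T μ 0 R f - (kinRes T μ 0 R f - kinRes T μ e R f) := by abel
      _ = _ := by rw [h1]; push_cast; module
  · rw [← h2]; abel

/-- The difference of the operators `(K - e)⁻¹` is of the order of the vector potential on
functions with sufficient decay. -/
theorem exists_norm_kinRes_sub_le (hT : 0 < T) (μ L₀ : ℝ) {M l : ℝ} (hl : l < symbolMin T μ) :
    ∃ C : ℝ, 0 < C ∧ ∀ (a : R3 → R3) (L : ℝ), IsLipPotential a L → L ≤ L₀ → ∀ e, -M ≤ e → e ≤ l →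
      ∀ f f₂ : L2, (f, f₂) ∈ mulGraph (fun x => 1 + ‖x‖ ^ 2) →
        ‖kinRes T μ e (magRes a) f - kinRes T μ e (magRes 0) f‖ ≤ C * L * ‖f₂‖ := by
  obtain ⟨C, hC, hb⟩ := exists_kinRes_sub hT μ L₀
  obtain ⟨D, hD, hd⟩ := exists_kinRes_quadratic hT μ (M := M) hl
  set m := max |M| |l| with hm
  have hm0 : 0 ≤ m := (abs_nonneg _).trans (le_max_left _ _)
  set x0 := (symbolMin T μ - l)⁻¹ with hx0
  have hx0p : 0 < x0 := inv_pos.2 (sub_pos.2 hl)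
  refine ⟨(1 + m * x0) * (C * (1 + m * D)), by positivity, ?_⟩
  intro a L ha hL e he1 he2 f f₂ hf
  have he : e < symbolMin T μ := he2.trans_lt hl
  have hLn := ha.nonneg
  have hem : ‖(e : ℂ)‖ ≤ m := by
    rw [Complex.norm_real]
    exact abs_le.2 ⟨by linarith [(le_abs_self M).trans (le_max_left |M| |l|)],
      he2.trans ((le_abs_self _).trans (le_max_right _ _))⟩
  obtain ⟨w, hw, hwn⟩ := hd 0 continuous_zero e he1 he2 f f₂ hf
  have hg := mulGraph_add hf (mulGraph_smul (e : ℂ) hw)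
  set g := f + (e : ℂ) • kinRes T μ e (magRes 0) f with hgdef
  obtain ⟨Ψ, hΨ, hΨn⟩ := hb a L ha hL g _ hg
  have e0 := (kinRes_apply_eq (μ := μ) hT he (spectrum_magRes 0) f).1
  have e1 := (kinRes_apply_eq (μ := μ) hT he (spectrum_magRes a) g).2
  have e2 := (kinRes_apply_eq (μ := μ) hT he (spectrum_magRes a) (kinRes T μ e (magRes 0) f)).2
  have hX : ‖kinRes T μ e (magRes a)‖ ≤ x0 :=
    (norm_kinRes_le hT he (spectrum_magRes a)).trans (inv_anti₀ (sub_pos.2 hl) (by linarith))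
  -- Two uses of the resolvent identity: `X_a - X_0 = -(1 + eX_a)(B_0 - B_a)(1 + eX_0)`, with `B`
  -- the case `e = 0`. The weight is preserved by the rightmost factor.
  have key : kinRes T μ e (magRes a) f - kinRes T μ e (magRes 0) f =
      -(magRes a Ψ + (e : ℂ) • kinRes T μ e (magRes a) (magRes a Ψ)) := by
    rw [← hΨ, map_sub, ← e0]
    rw [hgdef, map_add, map_smul, ← hgdef] at e1
    have : kinRes T μ e (magRes a) f = kinRes T μ 0 (magRes a) g +
        (e : ℂ) • kinRes T μ e (magRes a) (kinRes T μ 0 (magRes a) g) -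
        (e : ℂ) • kinRes T μ e (magRes a) (kinRes T μ e (magRes 0) f) := by
      rw [← e1]; abel
    rw [this]; module
  have hRn : ‖magRes a Ψ‖ ≤ ‖Ψ‖ := by
    have := (magRes a).le_of_opNorm_le (norm_magRes_le a) Ψ
    rwa [one_mul] at this
  have hg2 : ‖f₂ + (e : ℂ) • w‖ ≤ (1 + m * D) * ‖f₂‖ := by
    refine (norm_add_le _ _).trans ?_
    rw [norm_smul]
    have := mul_le_mul hem hwn (norm_nonneg _) hm0
    linarith
  rw [key, norm_neg]
  calc _ ≤ ‖magRes a Ψ‖ + m * (x0 * ‖magRes a Ψ‖) := by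
        refine (norm_add_le _ _).trans (add_le_add le_rfl ?_)
        rw [norm_smul]
        exact mul_le_mul hem (ContinuousLinearMap.le_of_opNorm_le _ hX _) (norm_nonneg _) hm0
    _ = (1 + m * x0) * ‖magRes a Ψ‖ := by ring
    _ ≤ (1 + m * x0) * (C * L * ((1 + m * D) * ‖f₂‖)) := by
        gcongr
        exact hRn.trans (hΨn.trans (by gcongr))
    _ = _ := by ring

end CompareRes

/-! ### The rescaled vector potential. -/

section Potential

/-- The rescaled full potential is Lipschitz with constant of order `h²`. -/
theorem exists_isLipPotential {A : R3 → R3} (hAcont : Continuous A) (hA0 : A 0 = 0)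
    (hA : ∀ j : Fin 3, MemSobolevInfty 3 (fun x => A x j)) :
    ∃ L, 0 < L ∧ (∀ h, 0 < h → IsLipPotential (fullPotential A h) (L * h ^ 2)) ∧
      ∀ h, 0 < h → Continuous (rescale h constFieldPotential) ∧
        (∀ j x y, |(rescale h constFieldPotential x j - fullPotential A h x j) -
          (rescale h constFieldPotential y j - fullPotential A h y j)| ≤ L * h ^ 2 * ‖x - y‖) ∧
        ∀ j x, |rescale h constFieldPotential x j - fullPotential A h x j| ≤ L * h ^ 2 * ‖x‖ := by
  have hex : ∀ j, ∃ L, 0 ≤ L ∧ ∀ x y, |A x j - A y j| ≤ L * ‖x - y‖ := fun j => by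
    choose g hg hg' using (hA j).2
    exact exists_lipschitz_of_weak_deriv (continuous_coord hAcont j) hg fun i => (hg' i).1
  choose L hL0 hL using hex
  set K := ∑ j, L j with hK
  have hK0 : 0 ≤ K := Finset.sum_nonneg fun j _ => hL0 j
  have hLK : ∀ j, L j ≤ K := fun j => Finset.single_le_sum (fun j _ => hL0 j) (Finset.mem_univ j)
  have hcont : Continuous constFieldPotential := by
    unfold constFieldPotential
    fun_prop
  have hlin : ∀ (j : Fin 3) (x y : R3),
      |constFieldPotential x j - constFieldPotential y j| ≤ ‖x - y‖ := by
    intro j x y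
    have h0 : |x 0 - y 0| ≤ ‖x - y‖ := by simpa using PiLp.norm_apply_le (x - y) 0
    have h1 : |x 1 - y 1| ≤ ‖x - y‖ := by simpa using PiLp.norm_apply_le (x - y) 1
    have hn := norm_nonneg (x - y)
    rw [abs_le] at h0 h1
    fin_cases j <;> simp [constFieldPotential] <;> rw [abs_le] <;> constructor <;> linarith
  have hsm : ∀ (h : ℝ) (x y : R3), 0 < h → ‖h • x - h • y‖ = h * ‖x - y‖ := fun h x y hh => by
    rw [← smul_sub, norm_smul, Real.norm_of_nonneg hh.le]
  have hfull : ∀ h x j, fullPotential A h x j =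
      h * (constFieldPotential (h • x) j + A (h • x) j) := fun h x j => rfl
  have hres : ∀ h x j, rescale h constFieldPotential x j = h * constFieldPotential (h • x) j :=
    fun h x j => rfl
  -- The summand `1` belongs to the constant field and `K` to `A`.
  have lip1 : ∀ h, 0 < h → ∀ j x y, |fullPotential A h x j - fullPotential A h y j| ≤
      (1 + K) * h ^ 2 * ‖x - y‖ := by
    intro h hh j x y
    have h1 := hlin j (h • x) (h • y)
    have h2 := (hL j (h • x) (h • y)).trans (mul_le_mul_of_nonneg_right (hLK j) (norm_nonneg _))
    rw [hsm h x y hh] at h1 h2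
    rw [hfull, hfull, ← mul_sub, abs_mul, abs_of_pos hh]
    have h3 : |constFieldPotential (h • x) j + A (h • x) j -
        (constFieldPotential (h • y) j + A (h • y) j)| ≤ (1 + K) * (h * ‖x - y‖) := by
      rw [add_sub_add_comm]
      refine (abs_add_le _ _).trans ?_
      linarith
    calc _ ≤ h * ((1 + K) * (h * ‖x - y‖)) := mul_le_mul_of_nonneg_left h3 hh.le
      _ = _ := by ring
  have lip2 : ∀ h, 0 < h → ∀ j x y, |(rescale h constFieldPotential x j - fullPotential A h x j) -
      (rescale h constFieldPotential y j - fullPotential A h y j)| ≤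
      (1 + K) * h ^ 2 * ‖x - y‖ := by
    intro h hh j x y
    have h2 := (hL j (h • x) (h • y)).trans (mul_le_mul_of_nonneg_right (hLK j) (norm_nonneg _))
    rw [hsm h x y hh] at h2
    rw [hfull, hfull, hres, hres, show h * constFieldPotential (h • x) j -
      h * (constFieldPotential (h • x) j + A (h • x) j) - (h * constFieldPotential (h • y) j -
      h * (constFieldPotential (h • y) j + A (h • y) j)) = -(h * (A (h • x) j - A (h • y) j)) by ring,
      abs_neg, abs_mul, abs_of_pos hh]
    have := norm_nonneg (x - y)
    calc _ ≤ h * (K * (h * ‖x - y‖)) := mul_le_mul_of_nonneg_left h2 hh.le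
      _ ≤ h * ((1 + K) * (h * ‖x - y‖)) := by gcongr; linarith
      _ = _ := by ring
  have z1 : ∀ h j, fullPotential A h 0 j = 0 := fun h j => by
    rw [hfull, smul_zero, hA0]
    fin_cases j <;> simp [constFieldPotential]
  have z2 : ∀ h j, rescale h constFieldPotential 0 j = 0 := fun h j => by
    rw [hres, smul_zero]
    fin_cases j <;> simp [constFieldPotential]
  have hcr : ∀ h (B : R3 → R3), Continuous B → Continuous (rescale h B) := fun h B hB => by
    unfold rescale; fun_prop
  refine ⟨1 + K, by positivity, fun h hh => ⟨hcr h _ (hcont.add hAcont), by positivity, lip1 h hh,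
    fun j x => ?_⟩, fun h hh => ⟨hcr h _ hcont, lip2 h hh, fun j x => ?_⟩⟩
  · simpa [z1] using lip1 h hh j x 0
  · simpa [z1, z2] using lip2 h hh j x 0

end Potential

end MagneticBCS

namespace MagneticBCS

/-! ### The operators `K - V` through their bounded resolvents -/

section AbstractRes

variable {H : Type*} [NormedAddCommGroup H] [InnerProductSpace ℂ H]

/-- The bounded operator `G` is `(S + c)⁻¹`. -/
def IsShiftInverse (S : H →ₗ.[ℂ] H) (c : ℝ) (G : H →L[ℂ] H) : Prop :=
  ∀ x f, (x, f) ∈ S.graph ↔ x = G (f + (c : ℂ) • x)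

variable {S : H →ₗ.[ℂ] H} {c : ℝ} {G : H →L[ℂ] H}

theorem mem_graph_neg {x y : H} : (x, y) ∈ (-S).graph ↔ (x, -y) ∈ S.graph := by
  rw [LinearPMap.mem_graph_iff, LinearPMap.mem_graph_iff]
  constructor
  · rintro ⟨v, h1, h2⟩
    exact ⟨v, h1, eq_neg_of_add_eq_zero_left (by rw [← show _ = y from h2, LinearPMap.neg_apply, add_neg_cancel])⟩
  · rintro ⟨v, h1, h2⟩
    exact ⟨v, h1, by rw [LinearPMap.neg_apply, show S v = -y from h2, neg_neg]⟩

theorem mem_graph_scalarSub {z : ℂ} {x y : H} :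
    (x, y) ∈ (scalarSub z S).graph ↔ (x, z • x - y) ∈ S.graph := by
  rw [scalarSub, mem_graph_vadd, mem_graph_neg]
  simp

/-- With `w = z + c` one has `z - S = w - (S+c)`, so a bounded inverse exists exactly when `1 - wG`
is invertible. If `R` is the inverse of `z - S`, then `1 - wR` is the inverse of `1 - wG`. The point
`z = -c` is never in the spectrum, since there `-G` is the inverse. -/
theorem IsShiftInverse.mem_opSpectrum_iff (h : IsShiftInverse S c G) {z : ℂ} :
    z ∈ opSpectrum S ↔ z + c ≠ 0 ∧ (z + c)⁻¹ ∈ spectrum ℂ G := by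
  have key : ∀ R : H →L[ℂ] H, IsBoundedInverse (scalarSub z S) R ↔
      ∀ x y, x = G ((z + c) • x - y) ↔ x = R y := fun R => by
    rw [isBoundedInverse_iff_graph]
    refine forall₂_congr fun x y => ?_
    rw [mem_graph_scalarSub, h, show z • x - y + (c : ℂ) • x = (z + c) • x - y by module]
  have hspec : z + c ≠ 0 → ((z + c)⁻¹ ∈ spectrum ℂ G ↔ ¬ IsUnit (1 - (z + c) • G)) := by
    intro hw
    rw [spectrum.mem_iff, not_iff_not]
    have e : algebraMap ℂ (H →L[ℂ] H) (z + c)⁻¹ - G =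
        Units.mk0 (z + c)⁻¹ (inv_ne_zero hw) • (1 - (z + c) • G) := by
      rw [Units.smul_mk0, smul_sub, smul_smul, inv_mul_cancel₀ hw, one_smul, Algebra.algebraMap_eq_smul_one]
    rw [e, isUnit_smul_iff]
  change ¬ (∃ R, IsBoundedInverse (scalarSub z S) R) ↔ _
  by_cases hw : z + c = 0
  · refine iff_of_false ?_ fun h => h.1 hw
    rw [not_not]
    refine ⟨-G, (key _).2 fun x y => ?_⟩
    rw [hw, zero_smul, zero_sub, map_neg]; rfl
  · rw [hspec hw]
    simp only [ne_eq, hw, not_false_eq_true, true_and, not_iff_not]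
    constructor
    · rintro ⟨R, hR⟩
      rw [key] at hR
      set w := z + c
      have h1 : R - w • (G * R) = -G := by
        ext y
        have := (hR (R y) y).2 rfl
        rw [map_sub, map_smul] at this
        simp only [sub_apply, smul_apply, mul_apply_eq_comp, neg_apply]
        nth_rewrite 1 [this]; abel
      have h2 : w • (R * G) - R = G := by
        ext y
        have := (hR (G y) (w • G y - y)).1 (by rw [sub_sub_cancel])
        rw [map_sub, map_smul] at this
        exact this.symm
      refine ⟨⟨1 - w • G, 1 - w • R, ?_, ?_⟩, rfl⟩
      · have : (1 - w • G) * (1 - w • R) = 1 - w • G - w • (R - w • (G * R)) := by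
          simp only [sub_mul, mul_sub, one_mul, mul_one, smul_mul_assoc, mul_smul_comm, smul_sub]
        rw [this, h1]; simp
      · have : (1 - w • R) * (1 - w • G) = 1 - w • G + w • (w • (R * G) - R) := by
          simp only [sub_mul, mul_sub, one_mul, mul_one, smul_mul_assoc, mul_smul_comm, smul_sub]
          abel
        rw [this, h2]; simp
    · rintro ⟨u, hu⟩
      refine ⟨-((↑u⁻¹ : H →L[ℂ] H) * G), (key _).2 fun x y => ?_⟩
      have e : x = G ((z + c) • x - y) ↔ (u : H →L[ℂ] H) x = -G y := by
        rw [hu, sub_apply, one_apply_eq_self, smul_apply, map_sub, map_smul, sub_eq_iff_eq_add]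
        rw [sub_eq_add_neg, add_comm]
      rw [e]
      constructor
      · intro h'
        rw [neg_apply, mul_apply_eq_comp, ← map_neg, ← h', ← mul_apply_eq_comp, Units.inv_mul,
          one_apply_eq_self]
      · rintro rfl
        rw [neg_apply, map_neg, mul_apply_eq_comp, ← mul_apply_eq_comp, Units.mul_inv,
          one_apply_eq_self]

theorem mem_opEigenspace_iff {z : ℂ} {ψ : H} : ψ ∈ opEigenspace S z ↔ (ψ, z • ψ) ∈ S.graph :=
  Iff.rfl

theorem IsShiftInverse.mem_opEigenspace_iff (h : IsShiftInverse S c G) {z : ℂ} (hz : z + c ≠ 0)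
    {ψ : H} : ψ ∈ opEigenspace S z ↔ G ψ = (z + c)⁻¹ • ψ := by
  rw [MagneticBCS.mem_opEigenspace_iff, h, ← add_smul, map_smul, eq_comm, ← eq_inv_smul_iff₀ hz]

theorem IsShiftInverse.opEigenspace_eq (h : IsShiftInverse S c G) {z : ℂ} (hz : z + c ≠ 0) :
    opEigenspace S z = Module.End.eigenspace (G : H →ₗ[ℂ] H) (z + c)⁻¹ := by
  ext ψ
  rw [h.mem_opEigenspace_iff hz, Module.End.mem_eigenspace_iff]
  rfl

end AbstractRes

/-! ### Resolvents of `K - V`. -/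

section BCS

variable {T μ : ℝ} {V : R3 → ℝ} {a : R3 → R3}

theorem mem_graph_mulOperator (hV : IsBdd V) {u v : L2} :
    (u, v) ∈ (mulOperator V).graph ↔ v = mulB V u := by
  rw [mulOperator, Submodule.toLinearPMap_graph_eq]
  · exact ⟨fun h => mulGraph_unique h (mem_mulGraph_mulB hV u), fun h => h ▸ mem_mulGraph_mulB hV u⟩
  · rintro ⟨x, y⟩ h1 (rfl : x = 0)
    exact mulGraph_unique h1 (zero_mem (mulGraph V))

theorem mem_graph_sub_mulOperator (hV : IsBdd V) (S : L2 →ₗ.[ℂ] L2) {u f : L2} :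
    (u, f) ∈ (S - mulOperator V).graph ↔ (u, f + mulB V u) ∈ S.graph := by
  have hdom : u ∈ (mulOperator V).domain :=
    LinearPMap.mem_domain_iff.2 ⟨mulB V u, (mem_graph_mulOperator hV).2 rfl⟩
  have hval : mulOperator V ⟨u, hdom⟩ = mulB V u :=
    (mem_graph_mulOperator hV).1 (LinearPMap.mem_graph _ ⟨u, hdom⟩)
  rw [LinearPMap.mem_graph_iff, LinearPMap.mem_graph_iff]
  constructor
  · rintro ⟨⟨v, hv⟩, h1, h2⟩
    obtain rfl : v = u := h1
    refine ⟨⟨v, hv.1⟩, rfl, ?_⟩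
    rw [LinearPMap.sub_apply] at h2
    exact (sub_eq_iff_eq_add.1 h2).trans (by rw [← hval])
  · rintro ⟨⟨v, hv⟩, h1, h2⟩
    obtain rfl : v = u := h1
    refine ⟨⟨v, hv, hdom⟩, rfl, ?_⟩
    rw [LinearPMap.sub_apply]
    exact sub_eq_iff_eq_add.2 (Eq.trans h2 (by rw [← hval]))

/-- Birman–Schwinger form of `(K - V)ψ = f`: below the minimum of the symbol `K - e` can be
inverted, and all remaining operators are bounded. -/
theorem mem_graph_bcsOperator (hT : 0 < T) (ha : Continuous a) (hV : IsBdd V) {e : ℝ}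
    (he : e < symbolMin T μ) {ψ f : L2} : (ψ, f) ∈ (bcsOperator T μ a V).graph ↔
      ψ = kinRes T μ e (magRes a) (f + mulB V ψ - (e : ℂ) • ψ) := by
  have h0 := eq_kinRes_iff (ψ := ψ) (f := f + mulB V ψ - (e : ℂ) • ψ) hT he
    (magRes_isSelfAdjoint a) (spectrum_magRes a)
  rw [← Complex.coe_smul] at h0
  rw [← h0, bcsOperator,
    mem_graph_sub_mulOperator hV, bcsKinetic, mem_graph_vadd, mem_graph_magneticLaplacian ha,
    c0Calculus, boundedInverse_magneticLaplacian ha]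
  have key : ∀ D : L2 →L[ℂ] L2, f + mulB V ψ - (-((μ : ℂ) • (LinearMap.id : L2 →ₗ[ℂ] L2)) +
      D.toLinearMap) ψ + ψ = f + mulB V ψ - (e : ℂ) • ψ +
        ((1 + μ + e : ℝ) : ℂ) • ψ - D ψ := fun D => by
    simp only [LinearMap.add_apply, LinearMap.neg_apply, LinearMap.smul_apply, LinearMap.id_apply,
      ContinuousLinearMap.coe_coe]
    push_cast; module
  rw [key]
  rfl

/-- The choice `c ≥ 2‖V‖` makes the product of `V` with the inverse `F` of `K + c` have norm at most
`1/2`. Then `1 - FV` is invertible and `G` is its inverse times `F`. The factor `2` in the bound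
comes from absorbing half of `‖Gx‖`. The norm bound is the same for every potential. -/
theorem exists_isShiftInverse (hT : 0 < T) (ha : Continuous a) (hV : IsBdd V) {c : ℝ}
    (hc : 2 * ‖mulB V‖ ≤ c) : ∃ G : L2 →L[ℂ] L2, IsSelfAdjoint G ∧
      ‖G‖ ≤ 2 / (symbolMin T μ + c) ∧ IsShiftInverse (bcsOperator T μ a V) c G := by
  have hS : 0 < symbolMin T μ := symbolMin_pos hT
  have hv : 0 ≤ ‖mulB V‖ := norm_nonneg _
  have hc0 : 0 ≤ c := by linarith
  have hcS : 0 < symbolMin T μ + c := by linarith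
  have he : -c < symbolMin T μ := by linarith
  set F := kinRes T μ (-c) (magRes a) with hF
  set W := mulB V with hW
  have hFn : ‖F‖ ≤ (symbolMin T μ + c)⁻¹ := by
    have := norm_kinRes_le (μ := μ) hT he (spectrum_magRes a)
    rwa [sub_neg_eq_add] at this
  have hFW : ‖F * W‖ ≤ 1 / 2 := by
    refine (norm_mul_le _ _).trans ((mul_le_mul_of_nonneg_right hFn hv).trans ?_)
    rw [inv_mul_le_iff₀ hcS]; linarith
  obtain ⟨u, hu⟩ := isUnit_one_sub_of_norm_lt_one (hFW.trans_lt (by norm_num))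
  have hFs : F.adjoint = F := kinRes_isSelfAdjoint _
  set G := (↑u⁻¹ : L2 →L[ℂ] L2) * F with hG
  have huG : ∀ x, G x = F x + F (W (G x)) := fun x => by
    have h1 : (u : L2 →L[ℂ] L2) (G x) = F x := by
      rw [hG, ← mul_apply_eq_comp, ← mul_assoc, Units.mul_inv, one_mul]
    rw [hu] at h1
    rw [← h1]; simp
  have hGu : ∀ x y, x = F (y + W x) ↔ x = G y := fun x y => by
    constructor
    · intro h
      have h1 : (u : L2 →L[ℂ] L2) x = F y := by
        rw [hu, sub_apply, one_apply_eq_self, mul_apply_eq_comp]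
        nth_rewrite 1 [h]
        rw [map_add, add_sub_cancel_right]
      rw [hG, mul_apply_eq_comp, ← h1, ← mul_apply_eq_comp, Units.inv_mul, one_apply_eq_self]
    · rintro rfl
      rw [map_add]; exact huG y
  refine ⟨G, ?_, ?_, fun x f => ?_⟩
  · refine (ContinuousLinearMap.isSelfAdjoint_iff_isSymmetric).2 fun x y => ?_
    change ⟪G x, y⟫_ℂ = ⟪x, G y⟫_ℂ
    have h1 : ∀ x y, ⟪F x, y⟫_ℂ = ⟪x, F y⟫_ℂ := fun x y => by
      conv_lhs => rw [← hFs, ContinuousLinearMap.adjoint_inner_left]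
    have h2 : ⟪G x, y + W (G y)⟫_ℂ = ⟪x + W (G x), G y⟫_ℂ := by
      have e1 := (hGu (G x) x).2 rfl
      have e2 := (hGu (G y) y).2 rfl
      nth_rewrite 1 [e1]
      rw [h1]
      conv_rhs => rw [e2]
    rw [inner_add_right, inner_add_left, ← inner_mulB hV] at h2
    exact add_right_cancel h2
  · refine ContinuousLinearMap.opNorm_le_bound _ (by positivity) fun x => ?_
    have h1 : ‖G x‖ ≤ (symbolMin T μ + c)⁻¹ * ‖x‖ + 1 / 2 * ‖G x‖ := by
      conv_lhs => rw [huG]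
      refine (norm_add_le _ _).trans (add_le_add (F.le_of_opNorm_le hFn x) ?_)
      exact (F * W).le_of_opNorm_le hFW (G x)
    rw [div_eq_mul_inv]; linarith
  · rw [mem_graph_bcsOperator hT ha hV he, ← hGu]
    rw [show f + (c : ℂ) • x + W x = f + W x - ((-c : ℝ) : ℂ) • x by push_cast; module]

end BCS

end MagneticBCS

namespace MagneticBCS

/-! ### Isolated parts of the spectrum of a bounded self-adjoint operator -/

section Window

variable {H : Type*} [NormedAddCommGroup H] [InnerProductSpace ℂ H] [CompleteSpace H]
  {G : H →L[ℂ] H}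

theorem isUnit_of_le_norm {A : H →L[ℂ] H} (hA : IsSelfAdjoint A) {c : ℝ} (hc : 0 < c)
    (h : ∀ ψ, c * ‖ψ‖ ≤ ‖A ψ‖) : IsUnit A := by
  have hanti : AntilipschitzWith (Real.toNNReal c⁻¹) A :=
    AddMonoidHomClass.antilipschitz_of_bound _ fun ψ => by
      rw [Real.coe_toNNReal _ (inv_nonneg.2 hc.le), ← div_eq_inv_mul, le_div_iff₀ hc, mul_comm]
      exact h ψ
  have hcl : IsClosed (Set.range A) := hanti.isClosed_range A.uniformContinuous
  have hker : LinearMap.ker (A : H →ₗ[ℂ] H) = ⊥ := LinearMap.ker_eq_bot.2 hanti.injective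
  have hrange : LinearMap.range (A : H →ₗ[ℂ] H) = ⊤ := by
    have h1 : (LinearMap.range (A : H →ₗ[ℂ] H))ᗮ = ⊥ := by
      rw [Submodule.eq_bot_iff]
      intro x hx
      rw [Submodule.mem_orthogonal] at hx
      refine hanti.injective ?_
      rw [map_zero, ← inner_self_eq_zero (𝕜 := ℂ)]
      have h2 := hx (A (A x)) ⟨A x, rfl⟩
      have h3 := (ContinuousLinearMap.isSelfAdjoint_iff_isSymmetric.1 hA) (A x) x
      exact h3.symm.trans h2
    have h2 : IsClosed (LinearMap.range (A : H →ₗ[ℂ] H) : Set H) := hcl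
    rw [← h2.submodule_topologicalClosure_eq, Submodule.topologicalClosure_eq_top_iff, h1]
  exact ⟨(ContinuousLinearEquiv.ofBijective A hker hrange).toUnit, by ext; rfl⟩

theorem isSelfAdjoint_sub_smul (hG : IsSelfAdjoint G) (t : ℝ) :
    IsSelfAdjoint (G - (t : ℂ) • (1 : H →L[ℂ] H)) := by
  refine hG.sub ?_
  rw [Complex.coe_smul]
  exact IsSelfAdjoint.smul (by rw [isSelfAdjoint_iff]; simp) (IsSelfAdjoint.one _)

theorem notMem_spectrum_of_le_norm (hG : IsSelfAdjoint G) {t c : ℝ} (hc : 0 < c)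
    (h : ∀ ψ, c * ‖ψ‖ ≤ ‖G ψ - (t : ℂ) • ψ‖) : t ∉ spectrum ℝ G := by
  rw [spectrum.notMem_iff, ← IsUnit.neg_iff, neg_sub]
  have := isUnit_of_le_norm (isSelfAdjoint_sub_smul hG t) hc fun ψ => by
    rw [sub_apply, smul_apply, one_apply_eq_self]; exact h ψ
  convert this using 2
  rw [Algebra.algebraMap_eq_smul_one, Complex.coe_smul]

theorem exists_le_norm_of_notMem_spectrum {t : ℝ} (h : t ∉ spectrum ℝ G) :
    ∃ c, 0 < c ∧ ∀ ψ, c * ‖ψ‖ ≤ ‖G ψ - (t : ℂ) • ψ‖ := by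
  rw [spectrum.notMem_iff, ← IsUnit.neg_iff, neg_sub] at h
  obtain ⟨u, hu⟩ := h
  refine ⟨(‖(↑u⁻¹ : H →L[ℂ] H)‖ + 1)⁻¹, by positivity, fun ψ => ?_⟩
  have e : (u : H →L[ℂ] H) ψ = G ψ - (t : ℂ) • ψ := by
    rw [hu, Algebra.algebraMap_eq_smul_one, sub_apply, smul_apply, one_apply_eq_self,
      Complex.coe_smul]
  rw [← e, inv_mul_le_iff₀ (by positivity)]
  have h1 : ψ = (↑u⁻¹ : H →L[ℂ] H) ((u : H →L[ℂ] H) ψ) := by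
    rw [← mul_apply_eq_comp, Units.inv_mul, one_apply_eq_self]
  conv_lhs => rw [h1]
  refine (ContinuousLinearMap.le_opNorm _ _).trans ?_
  exact mul_le_mul_of_nonneg_right (by linarith) (norm_nonneg _)

/-- The spectral projection of a window whose interior part of the spectrum is concentrated near
its centre. -/
theorem exists_window_projection (hG : IsSelfAdjoint G) {g r ρ : ℝ} (hr : 0 < r)
    (hρ0 : 0 ≤ ρ) (hρ : ρ ≤ r / 2)
    (hs : ∀ t ∈ spectrum ℝ G, |t - g| < r → |t - g| ≤ ρ) :
    ∃ E : H →L[ℂ] H, IsSelfAdjoint E ∧ E * E = E ∧ E * G = G * E ∧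
      (∀ ψ, ‖G (E ψ) - (g : ℂ) • E ψ‖ ≤ ρ * ‖E ψ‖) ∧
      ∀ ψ, r * ‖ψ - E ψ‖ ≤ ‖G (ψ - E ψ) - (g : ℂ) • (ψ - E ψ)‖ := by
  -- A continuous plateau: `1` up to distance `r/2` from `g`, `0` beyond `r`. The spectrum avoids
  -- the transition zone, so `f(G)` is a projection.
  set f : ℝ → ℝ := fun t => max 0 (min 1 (2 - 2 * |t - g| / r)) with hf
  have hfc : Continuous f := by rw [hf]; fun_prop
  have f1 : ∀ t, |t - g| ≤ ρ → f t = 1 := fun t ht => by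
    have : 2 * |t - g| / r ≤ 1 := by rw [div_le_one hr]; linarith
    rw [hf]; simp only
    rw [min_eq_left (by linarith), max_eq_right zero_le_one]
  have f0 : ∀ t, r ≤ |t - g| → f t = 0 := fun t ht => by
    have : 2 ≤ 2 * |t - g| / r := by rw [le_div_iff₀ hr]; linarith
    rw [hf]; simp only
    exact max_eq_left ((min_le_right _ _).trans (by linarith))
  have fs : ∀ t ∈ spectrum ℝ G, (|t - g| ≤ ρ ∧ f t = 1) ∨ (r ≤ |t - g| ∧ f t = 0) := fun t ht => by
    rcases lt_or_ge |t - g| r with h | h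
    · exact Or.inl ⟨hs t ht h, f1 t (hs t ht h)⟩
    · exact Or.inr ⟨h, f0 t h⟩
  -- On the spectrum `k` is `(1-f)/(t-g)`; the floor `(r/2)²` in the denominator only serves
  -- continuity at `g`.
  set k : ℝ → ℝ := fun t => (1 - f t) * (t - g) / max ((t - g) ^ 2) ((r / 2) ^ 2) with hk
  have hmax : ∀ t, 0 < max ((t - g) ^ 2) ((r / 2) ^ 2) := fun t =>
    lt_max_of_lt_right (by positivity)
  have hkc : Continuous k := by
    rw [hk]
    exact Continuous.div (by fun_prop) (by fun_prop) fun t => (hmax t).ne'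
  have hkmul : ∀ t ∈ spectrum ℝ G, k t * (t - g) = 1 - f t := fun t ht => by
    rcases fs t ht with ⟨_, h⟩ | ⟨h1, h⟩
    · simp [hk, h]
    · have h2 : 0 < |t - g| := hr.trans_le h1
      have h3 : max ((t - g) ^ 2) ((r / 2) ^ 2) = (t - g) ^ 2 := by
        refine max_eq_left ?_
        rw [← sq_abs (t - g)]
        exact pow_le_pow_left₀ (by positivity) (by linarith) 2
      have h4 : t - g ≠ 0 := abs_pos.1 h2
      simp only [hk, h, h3]; field_simp
  have hkn : ∀ t ∈ spectrum ℝ G, ‖k t‖ ≤ r⁻¹ := fun t ht => by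
    rcases fs t ht with ⟨_, h⟩ | ⟨h1, h⟩
    · simp [hk, h, hr.le]
    · have h2 : 0 < |t - g| := hr.trans_le h1
      have := congrArg abs (hkmul t ht)
      rw [h, abs_mul, sub_zero, abs_one] at this
      rw [Real.norm_eq_abs, eq_inv_of_mul_eq_one_left this]
      exact inv_anti₀ hr h1
  have hsub : cfc (fun t : ℝ => t - g) G = G - (g : ℂ) • 1 := by
    rw [cfc_sub _ _ G (by fun_prop) (by fun_prop), cfc_id' ℝ G, cfc_const _ _ hG,
      Algebra.algebraMap_eq_smul_one, Complex.coe_smul]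
  have hsubψ : ∀ ψ, (G - (g : ℂ) • (1 : H →L[ℂ] H)) ψ = G ψ - (g : ℂ) • ψ := fun ψ => by
    rw [sub_apply, smul_apply, one_apply_eq_self]
  set E := cfc f G with hE
  have hEE : E * E = E := by
    rw [hE, ← cfc_mul _ _ G hfc.continuousOn hfc.continuousOn]
    exact cfc_congr fun t ht => by rcases fs t ht with ⟨_, h⟩ | ⟨_, h⟩ <;> simp [h]
  have h1E : cfc (fun t => 1 - f t) G = 1 - E := by
    rw [cfc_sub _ _ G (by fun_prop) hfc.continuousOn, cfc_const _ _ hG, map_one]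
  refine ⟨E, cfc_predicate _ _, hEE, ((Commute.refl G).cfc_real f).eq, fun ψ => ?_, fun ψ => ?_⟩
  · have h1 : ‖(G - (g : ℂ) • (1 : H →L[ℂ] H)) * E‖ ≤ ρ := by
      rw [← hsub, hE, ← cfc_mul _ _ G (by fun_prop) hfc.continuousOn]
      refine norm_cfc_le hρ0 fun t ht => ?_
      rcases fs t ht with ⟨h1, h⟩ | ⟨_, h⟩
      · simpa [h] using h1
      · simpa [h] using hρ0
    have h2 := ContinuousLinearMap.le_of_opNorm_le _ h1 (E ψ)
    rwa [mul_apply_eq_comp, ← mul_apply_eq_comp E E, hEE, hsubψ] at h2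
  · have h1 : cfc k G * (G - (g : ℂ) • 1) = 1 - E := by
      rw [← h1E, ← hsub, ← cfc_mul _ _ G hkc.continuousOn (by fun_prop)]
      exact cfc_congr hkmul
    have h2 : ‖cfc k G‖ ≤ r⁻¹ := norm_cfc_le (by positivity) hkn
    have h3 : ψ - E ψ = cfc k G (G (ψ - E ψ) - (g : ℂ) • (ψ - E ψ)) := by
      rw [← hsubψ, ← mul_apply_eq_comp, h1]
      simp only [sub_apply, one_apply_eq_self, map_sub]
      rw [← mul_apply_eq_comp E E, hEE]; simp
    have h4 := ContinuousLinearMap.le_of_opNorm_le _ h2 (G (ψ - E ψ) - (g : ℂ) • (ψ - E ψ))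
    rw [← h3] at h4
    rwa [← div_eq_inv_mul, le_div_iff₀ hr, mul_comm] at h4

theorem inner_of_isSelfAdjoint {A : H →L[ℂ] H} (hA : IsSelfAdjoint A) (x y : H) :
    ⟪A x, y⟫_ℂ = ⟪x, A y⟫_ℂ := ContinuousLinearMap.isSelfAdjoint_iff_isSymmetric.1 hA x y

theorem norm_sq_eq_add {E : H →L[ℂ] H} (hE : IsSelfAdjoint E) (hEE : E * E = E) (ψ : H) :
    ‖ψ‖ ^ 2 = ‖E ψ‖ ^ 2 + ‖ψ - E ψ‖ ^ 2 := by
  have h0 : ⟪E ψ, ψ - E ψ⟫_ℂ = 0 := by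
    rw [inner_of_isSelfAdjoint hE, map_sub, ← mul_apply_eq_comp E E, hEE, sub_self, inner_zero_right]
  have := norm_add_sq_eq_norm_sq_add_norm_sq_of_inner_eq_zero (E ψ) (ψ - E ψ) h0
  rw [add_sub_cancel] at this
  nlinarith

/-- The eigenvalues in a window with a spectral projection of finite rank. -/
theorem exists_window_eigenvalues (hG : IsSelfAdjoint G) {g r ρ : ℝ} (hρ : ρ < r) {m : ℕ}
    {E : H →L[ℂ] H} (hE : IsSelfAdjoint E) (hEE : E * E = E) (hEG : E * G = G * E)
    (hin : ∀ ψ, ‖G (E ψ) - (g : ℂ) • E ψ‖ ≤ ρ * ‖E ψ‖)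
    (hout : ∀ ψ, r * ‖ψ - E ψ‖ ≤ ‖G (ψ - E ψ) - (g : ℂ) • (ψ - E ψ)‖)
    [FiniteDimensional ℂ (LinearMap.range (E : H →ₗ[ℂ] H))]
    (hm : Module.finrank ℂ (LinearMap.range (E : H →ₗ[ℂ] H)) = m) :
    ∃ lam : Fin m → ℝ, (∀ i, |lam i - g| ≤ ρ) ∧
      (∀ t, |t - g| < r → (t ∈ spectrum ℝ G ↔ t ∈ Set.range lam)) ∧
      (∀ i, Module.finrank ℂ (Module.End.eigenspace (G : H →ₗ[ℂ] H) (lam i : ℂ)) =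
        (Finset.univ.filter fun j => lam j = lam i).card) ∧
      (⨆ t ∈ Set.range lam, Module.End.eigenspace (G : H →ₗ[ℂ] H) (t : ℂ)) =
        LinearMap.range (E : H →ₗ[ℂ] H) := by
  set W := LinearMap.range (E : H →ₗ[ℂ] H) with hW
  have hWE : ∀ {x}, x ∈ W ↔ E x = x := fun {x} => by
    constructor
    · rintro ⟨y, rfl⟩
      change E (E y) = E y
      rw [← mul_apply_eq_comp, hEE]
    · exact fun h => ⟨x, h⟩
  have hGW : ∀ x ∈ W, (G : H →ₗ[ℂ] H) x ∈ W := fun x hx => by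
    rw [hWE] at hx ⊢
    change E (G x) = G x
    rw [← mul_apply_eq_comp, hEG, mul_apply_eq_comp, hx]
  set B : W →ₗ[ℂ] W := (G : H →ₗ[ℂ] H).restrict hGW with hB
  have hBs : B.IsSymmetric := fun x y =>
    ContinuousLinearMap.isSelfAdjoint_iff_isSymmetric.1 hG (x : H) (y : H)
  set lam := hBs.eigenvalues hm with hlam
  set b := hBs.eigenvectorBasis hm with hb
  have hGb : ∀ i, G (b i : H) = (lam i : ℂ) • (b i : H) := fun i =>
    congrArg Subtype.val (hBs.apply_eigenvectorBasis hm i)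
  have hbn : ∀ i, ‖(b i : H)‖ = 1 := fun i => b.orthonormal.1 i
  have hlamρ : ∀ i, |lam i - g| ≤ ρ := fun i => by
    have h1 := hin (b i : H)
    rw [hWE.1 (b i).2, hGb, ← sub_smul, norm_smul, hbn, mul_one, mul_one, ← Complex.ofReal_sub,
      Complex.norm_real] at h1
    exact h1
  have hcomp : ∀ t, ∀ ψ, (r - |t - g|) * ‖ψ - E ψ‖ ≤ ‖G (ψ - E ψ) - (t : ℂ) • (ψ - E ψ)‖ := by
    intro t ψ
    have h1 := hout ψ
    have h2 : G (ψ - E ψ) - (g : ℂ) • (ψ - E ψ) = (G (ψ - E ψ) - (t : ℂ) • (ψ - E ψ)) +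
        ((t - g : ℝ) : ℂ) • (ψ - E ψ) := by push_cast; module
    have h3 := norm_add_le (G (ψ - E ψ) - (t : ℂ) • (ψ - E ψ)) (((t - g : ℝ) : ℂ) • (ψ - E ψ))
    rw [← h2, norm_smul, Complex.norm_real, Real.norm_eq_abs] at h3
    linarith
  have heig : ∀ t : ℝ, |t - g| < r → ∀ ψ, G ψ = (t : ℂ) • ψ → ψ ∈ W := fun t ht ψ hψ => by
    have h1 := hcomp t ψ
    have h2 : G (ψ - E ψ) - (t : ℂ) • (ψ - E ψ) = 0 := by
      rw [map_sub, ← mul_apply_eq_comp G E, ← hEG, mul_apply_eq_comp, hψ, map_smul]; module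
    rw [h2, norm_zero] at h1
    have h3 : ‖ψ - E ψ‖ ≤ 0 := nonpos_of_mul_nonpos_right h1 (sub_pos.2 ht)
    rw [hWE]
    exact (sub_eq_zero.1 (norm_le_zero_iff.1 h3)).symm
  have heigmap : ∀ t : ℝ, |t - g| < r → Module.End.eigenspace (G : H →ₗ[ℂ] H) (t : ℂ) =
      (Module.End.eigenspace B (t : ℂ)).map W.subtype := fun t ht => by
    ext ψ
    rw [Module.End.mem_eigenspace_iff, Submodule.mem_map]
    constructor
    · intro h
      exact ⟨⟨ψ, heig t ht ψ h⟩, Module.End.mem_eigenspace_iff.2 (Subtype.ext h), rfl⟩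
    · rintro ⟨x, hx, rfl⟩
      exact congrArg Subtype.val (Module.End.mem_eigenspace_iff.1 hx)
  refine ⟨lam, hlamρ, fun t ht => ⟨fun hts => ?_, ?_⟩, fun i => ?_, ?_⟩
  · by_contra hne
    have hnev : ¬ Module.End.HasEigenvalue B (t : ℂ) := fun h => by
      obtain ⟨i, hi⟩ := hBs.exists_eigenvalues_eq hm h
      exact hne ⟨i, Complex.ofReal_injective hi⟩
    have hker : LinearMap.ker (B - (t : ℂ) • (1 : Module.End ℂ W)) = ⊥ := by
      rw [LinearMap.ker_eq_bot']
      intro x hx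
      by_contra hx0
      exact hnev (Module.End.hasEigenvalue_of_hasEigenvector
        ⟨Module.End.mem_eigenspace_iff.2 (sub_eq_zero.1 hx), hx0⟩)
    obtain ⟨K, hK0, hK⟩ := LinearMap.exists_antilipschitzWith _ hker
    have hlow : ∀ x : W, (K : ℝ)⁻¹ * ‖x‖ ≤ ‖B x - (t : ℂ) • x‖ := fun x => by
      have h1 := hK.le_mul_dist x 0
      rw [map_zero, dist_zero_right, dist_zero_right] at h1
      rw [inv_mul_le_iff₀ (by exact_mod_cast hK0)]
      exact h1
    -- When `t` is not an eigenvalue of the finite-dimensional block, `G - t` is bounded below on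
    -- the range of `E` and on its complement. Both are invariant, so Pythagoras combines the
    -- bounds.
    set c := min (K : ℝ)⁻¹ (r - |t - g|) with hc
    have hc0 : 0 < c := lt_min (by positivity) (sub_pos.2 ht)
    refine notMem_spectrum_of_le_norm hG hc0 (fun ψ => ?_) hts
    have e1 := norm_sq_eq_add hE hEE ψ
    have e2 := norm_sq_eq_add hE hEE (G ψ - (t : ℂ) • ψ)
    have e3 : E (G ψ - (t : ℂ) • ψ) = G (E ψ) - (t : ℂ) • E ψ := by
      rw [map_sub, map_smul, ← mul_apply_eq_comp E G, hEG, mul_apply_eq_comp]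
    have e4 : G ψ - (t : ℂ) • ψ - E (G ψ - (t : ℂ) • ψ) =
        G (ψ - E ψ) - (t : ℂ) • (ψ - E ψ) := by
      rw [e3, map_sub]; module
    rw [e4, e3] at e2
    have b1 : c * ‖E ψ‖ ≤ ‖G (E ψ) - (t : ℂ) • E ψ‖ :=
      (mul_le_mul_of_nonneg_right (min_le_left _ _) (norm_nonneg _)).trans
        (hlow ⟨E ψ, ⟨ψ, rfl⟩⟩)
    have b2 : c * ‖ψ - E ψ‖ ≤ ‖G (ψ - E ψ) - (t : ℂ) • (ψ - E ψ)‖ :=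
      (mul_le_mul_of_nonneg_right (min_le_right _ _) (norm_nonneg _)).trans (hcomp t ψ)
    refine le_of_sq_le_sq ?_ (norm_nonneg _)
    rw [mul_pow, e1, e2, mul_add, ← mul_pow, ← mul_pow]
    exact add_le_add (pow_le_pow_left₀ (by positivity) b1 2) (pow_le_pow_left₀ (by positivity) b2 2)
  · rintro ⟨i, rfl⟩
    by_contra hns
    obtain ⟨c, hc, h⟩ := exists_le_norm_of_notMem_spectrum hns
    have := h (b i : H)
    rw [hGb, sub_self, norm_zero, hbn, mul_one] at this
    linarith
  · rw [heigmap _ ((hlamρ i).trans_lt hρ),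
      Submodule.finrank_map_subtype_eq,
      ← hBs.card_filter_eigenvalues_eq hm]
    congr 1; ext j; simp [hlam]
  · refine le_antisymm (iSup₂_le ?_) ?_
    · rintro _ ⟨i, rfl⟩ ψ hψ
      exact heig _ ((hlamρ i).trans_lt hρ) ψ (Module.End.mem_eigenspace_iff.1 hψ)
    · intro x hx
      have h1 := congrArg Subtype.val (b.sum_repr ⟨x, hx⟩)
      rw [Submodule.coe_sum] at h1
      rw [← show _ = x from h1]
      refine Submodule.sum_mem _ fun i _ => Submodule.smul_mem _ _ ?_
      exact Submodule.mem_iSup_of_mem (lam i) (Submodule.mem_iSup_of_mem ⟨i, rfl⟩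
        (Module.End.mem_eigenspace_iff.2 (hGb i)))

end Window

end MagneticBCS

namespace MagneticBCS

/-! ### Stability of isolated eigenvalues -/

section Stability

variable {H : Type*} [NormedAddCommGroup H] [InnerProductSpace ℂ H] [CompleteSpace H]
  {G P : H →L[ℂ] H}

theorem norm_apply_le_of_projection {E : H →L[ℂ] H} (hE : IsSelfAdjoint E) (hEE : E * E = E)
    (ψ : H) : ‖E ψ‖ ≤ ‖ψ‖ :=
  le_of_sq_le_sq (by rw [norm_sq_eq_add hE hEE ψ]; nlinarith [sq_nonneg ‖ψ - E ψ‖]) (norm_nonneg _)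

theorem norm_sub_apply_le_of_projection {E : H →L[ℂ] H} (hE : IsSelfAdjoint E) (hEE : E * E = E)
    (ψ : H) : ‖ψ - E ψ‖ ≤ ‖ψ‖ :=
  le_of_sq_le_sq (by rw [norm_sq_eq_add hE hEE ψ]; nlinarith [sq_nonneg ‖E ψ‖]) (norm_nonneg _)

theorem inner_sub_smul {A : H →L[ℂ] H} (hA : IsSelfAdjoint A) (t : ℝ) (x y : H) :
    ⟪A x - (t : ℂ) • x, y⟫_ℂ = ⟪x, A y - (t : ℂ) • y⟫_ℂ := by
  have := inner_of_isSelfAdjoint (isSelfAdjoint_sub_smul hA t) x y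
  simpa only [sub_apply, smul_apply, one_apply_eq_self] using this

/-- Near `g` the spectrum is confined to the width of an approximate spectral projection. -/
theorem abs_sub_le_of_mem_spectrum (hG : IsSelfAdjoint G) {g κ δ : ℝ} (hκ : 0 < κ) (hδ0 : 0 ≤ δ)
    (hδ : δ ≤ κ / 8) (hP : IsSelfAdjoint P) (hPP : P * P = P)
    (hin : ∀ ψ, ‖G (P ψ) - (g : ℂ) • P ψ‖ ≤ δ * ‖P ψ‖)
    (hout : ∀ ψ, κ * ‖ψ - P ψ‖ ≤ ‖G (ψ - P ψ) - (g : ℂ) • (ψ - P ψ)‖) :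
    ∀ t ∈ spectrum ℝ G, |t - g| < κ / 2 → |t - g| ≤ 2 * δ := by
  intro t hts ht
  by_contra! hlt
  set s := |t - g| with hs
  -- Adding `b1` and `b2` below gives `(s-2δ)‖p‖ + (κ-2δ-s)‖q‖ ≤ 2N`, and the second coefficient is
  -- at least `κ/4`. So `c`, half the smaller of `s-2δ` and `κ/4`, bounds `G - t` from below and `t`
  -- cannot be in the spectrum.
  set c := min (s - 2 * δ) (κ / 4) / 2 with hc
  have hc0 : 0 < c := half_pos (lt_min (by linarith) (by linarith))
  refine notMem_spectrum_of_le_norm hG hc0 (fun ψ => ?_) hts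
  have hPPx : ∀ x, P (P x) = P x := fun x => by rw [← mul_apply_eq_comp, hPP]
  set p := P ψ with hp
  set q := ψ - p with hq
  set N := ‖G ψ - (t : ℂ) • ψ‖ with hN
  set Q : H → H := fun x => G x - (g : ℂ) • x with hQ
  have hPq : P q = 0 := by rw [hq, map_sub, hp, hPPx, sub_self]
  have hpq : ⟪p, q⟫_ℂ = 0 := by rw [hp, inner_of_isSelfAdjoint hP, hPq, inner_zero_right]
  have hψ : ψ = p + q := by rw [hq]; abel
  have hdec : G ψ - (t : ℂ) • ψ = Q p + Q q + ((g - t : ℝ) : ℂ) • p + ((g - t : ℝ) : ℂ) • q := by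
    rw [hψ, map_add]; simp only [hQ]; push_cast; module
  have hin1 : ‖Q p‖ ≤ δ * ‖p‖ := hin ψ
  have hsd : ‖((g - t : ℝ) : ℂ)‖ = s := by rw [Complex.norm_real, Real.norm_eq_abs, abs_sub_comm]
  -- Pairing `(G-t)ψ` with `p`; the coupling to `q` is moved onto `p`, where `G - g` is small.
  have b1 : s * ‖p‖ ≤ N + δ * (‖p‖ + ‖q‖) := by
    rcases eq_or_ne ‖p‖ 0 with h0 | h0
    · rw [h0]; simp only [mul_zero, zero_add]; positivity
    have h1 : ((g - t : ℝ) : ℂ) * ⟪p, p⟫_ℂ =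
        ⟪p, G ψ - (t : ℂ) • ψ⟫_ℂ - ⟪p, Q p⟫_ℂ - ⟪Q p, q⟫_ℂ := by
      rw [hdec, inner_add_right, inner_add_right, inner_add_right, inner_smul_right,
        inner_smul_right, hpq, ← show ⟪Q p, q⟫_ℂ = ⟪p, Q q⟫_ℂ from inner_sub_smul hG g p q]
      ring
    have h2 := congrArg norm h1
    rw [norm_mul, hsd, inner_self_eq_norm_sq_to_K, norm_pow, RCLike.norm_ofReal, abs_norm] at h2
    have h3 : s * ‖p‖ ^ 2 ≤ ‖p‖ * N + ‖p‖ * (δ * ‖p‖) + δ * ‖p‖ * ‖q‖ := by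
      rw [h2]
      refine (norm_sub_le _ _).trans (add_le_add ((norm_sub_le _ _).trans (add_le_add
        (norm_inner_le_norm _ _) ((norm_inner_le_norm _ _).trans ?_)))
        ((norm_inner_le_norm _ _).trans ?_))
      · exact mul_le_mul_of_nonneg_left hin1 (norm_nonneg _)
      · exact mul_le_mul_of_nonneg_right hin1 (norm_nonneg _)
    have h4 : 0 < ‖p‖ := lt_of_le_of_ne (norm_nonneg _) h0.symm
    nlinarith
  have b2 : (κ - δ - s) * ‖q‖ ≤ N + δ * ‖p‖ := by
    -- `P(G-g)` is the adjoint of `(G-g)P` and hence equally small.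
    have h1 : ‖P (Q q)‖ ≤ δ * ‖q‖ := by
      have e : ⟪P (Q q), P (Q q)⟫_ℂ = ⟪Q (P (Q q)), q⟫_ℂ := by
        rw [show ⟪Q (P (Q q)), q⟫_ℂ = ⟪P (Q q), Q q⟫_ℂ from inner_sub_smul hG g _ q,
          inner_of_isSelfAdjoint hP, hPPx, inner_of_isSelfAdjoint hP]
      have h2 := congrArg norm e
      rw [inner_self_eq_norm_sq_to_K, norm_pow, RCLike.norm_ofReal, abs_norm] at h2
      have h3 : ‖P (Q q)‖ ^ 2 ≤ δ * ‖P (Q q)‖ * ‖q‖ := h2.le.trans ((norm_inner_le_norm _ _).trans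
        (mul_le_mul_of_nonneg_right (hin (Q q)) (norm_nonneg q)))
      rcases eq_or_ne ‖P (Q q)‖ 0 with h0 | h0
      · rw [h0]; positivity
      · have h4 : 0 < ‖P (Q q)‖ := lt_of_le_of_ne (norm_nonneg _) h0.symm
        nlinarith
    have h2 : Q q = (G ψ - (t : ℂ) • ψ - P (G ψ - (t : ℂ) • ψ)) - (Q p - P (Q p)) + P (Q q) -
        ((g - t : ℝ) : ℂ) • q := by
      rw [hdec]
      simp only [map_add, map_smul, hPq, smul_zero]
      rw [show P p = p from hPPx ψ]
      abel
    have h3 : ‖Q q‖ ≤ N + δ * ‖p‖ + δ * ‖q‖ + s * ‖q‖ := by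
      rw [h2]
      refine (norm_sub_le _ _).trans (add_le_add ((norm_add_le _ _).trans (add_le_add
        ((norm_sub_le _ _).trans (add_le_add ?_ ?_)) h1)) ?_)
      · exact norm_sub_apply_le_of_projection hP hPP _
      · exact (norm_sub_apply_le_of_projection hP hPP _).trans hin1
      · rw [norm_smul, hsd]
    have h4 : κ * ‖q‖ ≤ ‖Q q‖ := hout ψ
    linarith
  have hnp := norm_nonneg p
  have hnq := norm_nonneg q
  have h5 : ‖ψ‖ ≤ ‖p‖ + ‖q‖ := by conv_lhs => rw [hψ]
                                  exact norm_add_le _ _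
  have h6 : 2 * c ≤ s - 2 * δ := by rw [hc]; linarith [min_le_left (s - 2 * δ) (κ / 4)]
  have h7 : 2 * c ≤ κ / 4 := by rw [hc]; linarith [min_le_right (s - 2 * δ) (κ / 4)]
  have h8 : 2 * c * ‖p‖ ≤ (s - 2 * δ) * ‖p‖ := mul_le_mul_of_nonneg_right h6 hnp
  have h9 : 2 * c * ‖q‖ ≤ (κ - 2 * δ - s) * ‖q‖ := mul_le_mul_of_nonneg_right (by linarith) hnq
  have h10 : c * ‖ψ‖ ≤ c * (‖p‖ + ‖q‖) := mul_le_mul_of_nonneg_left h5 hc0.le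
  nlinarith

/-- Projections at distance less than one have equal rank. -/
theorem finrank_range_eq_of_norm_sub_lt {E : H →L[ℂ] H} (hPP : P * P = P) (hEE : E * E = E)
    (h : ‖E - P‖ < 1) [FiniteDimensional ℂ (LinearMap.range (P : H →ₗ[ℂ] H))] :
    FiniteDimensional ℂ (LinearMap.range (E : H →ₗ[ℂ] H)) ∧
      Module.finrank ℂ (LinearMap.range (E : H →ₗ[ℂ] H)) =
        Module.finrank ℂ (LinearMap.range (P : H →ₗ[ℂ] H)) := by
  have key : ∀ A B : H →L[ℂ] H, A * A = A → ‖A - B‖ < 1 →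
      ∃ f : LinearMap.range (A : H →ₗ[ℂ] H) →ₗ[ℂ] LinearMap.range (B : H →ₗ[ℂ] H),
        Function.Injective f := by
    intro A B hA hAB
    -- If `Bx = 0` for some `x` in the range of `A`, then `x = (A-B)x`, which forces `x = 0`. So `B`
    -- embeds the range of `A` into its own.
    refine ⟨(B : H →ₗ[ℂ] H).rangeRestrict ∘ₗ (LinearMap.range (A : H →ₗ[ℂ] H)).subtype, ?_⟩
    rw [← LinearMap.ker_eq_bot, LinearMap.ker_eq_bot']
    rintro ⟨_, y, rfl⟩ hx
    have h1 : B (A y) = 0 := congrArg Subtype.val hx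
    have h2 : (A - B) (A y) = A y := by
      rw [sub_apply, h1, ← mul_apply_eq_comp, hA, sub_zero]
    have h3 := (A - B).le_opNorm (A y)
    rw [h2] at h3
    have h4 : A y = 0 := by
      by_contra hne
      have := norm_pos_iff.2 hne
      nlinarith
    exact Subtype.ext h4
  obtain ⟨f, hf⟩ := key E P hEE h
  obtain ⟨k, hk⟩ := key P E hPP (by rwa [norm_sub_rev])
  have hfin : FiniteDimensional ℂ (LinearMap.range (E : H →ₗ[ℂ] H)) :=
    FiniteDimensional.of_injective f hf
  exact ⟨hfin, le_antisymm (LinearMap.finrank_le_finrank_of_injective hf)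
    (LinearMap.finrank_le_finrank_of_injective hk)⟩

/-- An approximate spectral projection of finite rank determines the eigenvalues near `g`. -/
theorem exists_eigenvalues_of_approximate_projection (hG : IsSelfAdjoint G) {g κ δ : ℝ}
    (hκ : 0 < κ) (hδ0 : 0 ≤ δ) (hδ : δ ≤ κ / 16) (hP : IsSelfAdjoint P) (hPP : P * P = P)
    (hin : ∀ ψ, ‖G (P ψ) - (g : ℂ) • P ψ‖ ≤ δ * ‖P ψ‖)
    (hout : ∀ ψ, κ * ‖ψ - P ψ‖ ≤ ‖G (ψ - P ψ) - (g : ℂ) • (ψ - P ψ)‖)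
    [FiniteDimensional ℂ (LinearMap.range (P : H →ₗ[ℂ] H))] {m : ℕ}
    (hm : Module.finrank ℂ (LinearMap.range (P : H →ₗ[ℂ] H)) = m) :
    ∃ (lam : Fin m → ℝ) (E : H →L[ℂ] H), (∀ i, |lam i - g| ≤ 2 * δ) ∧
      (∀ t, |t - g| < κ / 2 → (t ∈ spectrum ℝ G ↔ t ∈ Set.range lam)) ∧
      (∀ i, Module.finrank ℂ (Module.End.eigenspace (G : H →ₗ[ℂ] H) (lam i : ℂ)) =
        (Finset.univ.filter fun j => lam j = lam i).card) ∧
      IsSelfAdjoint E ∧ E * E = E ∧ FiniteDimensional ℂ (LinearMap.range (E : H →ₗ[ℂ] H)) ∧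
      (⨆ t ∈ Set.range lam, Module.End.eigenspace (G : H →ₗ[ℂ] H) (t : ℂ)) =
        LinearMap.range (E : H →ₗ[ℂ] H) ∧ ‖E - P‖ ≤ 5 * δ / κ := by
  obtain ⟨E, hE, hEE, hEG, hEin, hEout⟩ := exists_window_projection hG (g := g) (r := κ / 2)
    (ρ := 2 * δ) (by positivity) (by positivity) (by linarith)
    (abs_sub_le_of_mem_spectrum hG hκ hδ0 (by linarith) hP hPP hin hout)
  have h1 : ∀ ψ, ‖P ψ - E (P ψ)‖ ≤ 2 * δ / κ * ‖ψ‖ := fun ψ => by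
    have h := hEout (P ψ)
    have e : G (P ψ - E (P ψ)) - (g : ℂ) • (P ψ - E (P ψ)) =
        (G (P ψ) - (g : ℂ) • P ψ) - E (G (P ψ) - (g : ℂ) • P ψ) := by
      simp only [map_sub, map_smul]
      rw [← mul_apply_eq_comp E G, hEG, mul_apply_eq_comp]; module
    rw [e] at h
    have h2 := (norm_sub_apply_le_of_projection hE hEE _).trans (hin ψ)
    have h3 := mul_le_mul_of_nonneg_left (norm_apply_le_of_projection hP hPP ψ) hδ0
    rw [div_mul_eq_mul_div, le_div_iff₀ hκ]
    linarith
  have h2 : ∀ ψ, ‖E ψ - P (E ψ)‖ ≤ 3 * δ / κ * ‖ψ‖ := fun ψ => by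
    have h := hout (E ψ)
    have e : G (E ψ - P (E ψ)) - (g : ℂ) • (E ψ - P (E ψ)) =
        (G (E ψ) - (g : ℂ) • E ψ) - (G (P (E ψ)) - (g : ℂ) • P (E ψ)) := by
      simp only [map_sub]; module
    rw [e] at h
    have h3 := h.trans ((norm_sub_le _ _).trans (add_le_add (hEin ψ) (hin (E ψ))))
    have h4 := mul_le_mul_of_nonneg_left (norm_apply_le_of_projection hP hPP (E ψ)) hδ0
    have h5 := mul_le_mul_of_nonneg_left (norm_apply_le_of_projection hE hEE ψ) hδ0
    rw [div_mul_eq_mul_div, le_div_iff₀ hκ]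
    linarith
  -- Taking adjoints turns `‖E - PE‖` into `‖E - EP‖`; the claim then follows from `E - P = (E - EP)
  -- - (P - EP)`.
  have h3 : ‖E - E * P‖ ≤ 3 * δ / κ := by
    have e : ‖E - P * E‖ ≤ 3 * δ / κ :=
      ContinuousLinearMap.opNorm_le_bound _ (by positivity) fun ψ => h2 ψ
    rw [← norm_star, star_sub, star_mul, hE.star_eq, hP.star_eq] at e
    exact e
  have h4 : ‖P - E * P‖ ≤ 2 * δ / κ :=
    ContinuousLinearMap.opNorm_le_bound _ (by positivity) fun ψ => h1 ψ
  have h5 : ‖E - P‖ ≤ 5 * δ / κ := by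
    rw [← sub_sub_sub_cancel_right E P (E * P)]
    refine (norm_sub_le _ _).trans ((add_le_add h3 h4).trans (le_of_eq ?_))
    ring
  have h6 : ‖E - P‖ < 1 := h5.trans_lt (by rw [div_lt_one hκ]; linarith)
  obtain ⟨hfin, hrank⟩ := finrank_range_eq_of_norm_sub_lt hPP hEE h6
  obtain ⟨lam, l1, l2, l3, l4⟩ := exists_window_eigenvalues hG (g := g) (r := κ / 2)
    (ρ := 2 * δ) (by linarith) hE hEE hEG hEin hEout (hrank.trans hm)
  exact ⟨lam, E, l1, l2, l3, hE, hEE, hfin, l4, h5⟩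

theorem mem_spectrum_complex_iff (hG : IsSelfAdjoint G) {z : ℂ} :
    z ∈ spectrum ℂ G ↔ ∃ t ∈ spectrum ℝ G, (t : ℂ) = z := by
  rw [← hG.spectrumRestricts.algebraMap_image]
  rfl

theorem eq_starProjection_range {E : H →L[ℂ] H} (hE : IsSelfAdjoint E) (hEE : E * E = E)
    (K : Submodule ℂ H) [K.HasOrthogonalProjection]
    (hK : K = LinearMap.range (E : H →ₗ[ℂ] H)) : K.starProjection = E := by
  ext ψ
  refine Submodule.eq_starProjection_of_mem_of_inner_eq_zero (hK ▸ ⟨ψ, rfl⟩) ?_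
  intro w hw
  rw [hK] at hw
  obtain ⟨y, rfl⟩ := hw
  change ⟪ψ - E ψ, E y⟫_ℂ = 0
  rw [← inner_of_isSelfAdjoint hE, map_sub, ← mul_apply_eq_comp, hEE, sub_self, inner_zero_left]

theorem spectralProjection_eq {S : H →ₗ.[ℂ] H} {Λ : Set ℝ} {E : H →L[ℂ] H} (hE : IsSelfAdjoint E)
    (hEE : E * E = E) [FiniteDimensional ℂ (LinearMap.range (E : H →ₗ[ℂ] H))]
    (hΛ : (⨆ l ∈ Λ, opEigenspace S (l : ℂ)) = LinearMap.range (E : H →ₗ[ℂ] H)) :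
    spectralProjection S Λ = E := by
  rw [spectralProjection]
  refine eq_starProjection_range hE hEE _ ?_
  rw [hΛ]
  exact (Submodule.closed_of_finiteDimensional _).submodule_topologicalClosure_eq

/-- The eigenvalues of `S` near `l`, and their spectral projection, from an approximate spectral
projection of `(S + c)⁻¹` near `(l + c)⁻¹`. -/
theorem exists_eigenvalues_of_isShiftInverse {l c κ : ℝ} (hb : 0 < l + c) (hκ : 0 < κ)
    (hP : IsSelfAdjoint P) (hPP : P * P = P)
    [FiniteDimensional ℂ (LinearMap.range (P : H →ₗ[ℂ] H))] {m : ℕ}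
    (hm : Module.finrank ℂ (LinearMap.range (P : H →ₗ[ℂ] H)) = m) :
    ∃ ε δ₀ C : ℝ, 0 < ε ∧ 0 < δ₀ ∧ 0 < C ∧ ∀ (S : H →ₗ.[ℂ] H) (G : H →L[ℂ] H) (δ : ℝ),
      0 ≤ δ → δ ≤ δ₀ → IsSelfAdjoint G → IsShiftInverse S c G →
      (∀ ψ, ‖G (P ψ) - (((l + c)⁻¹ : ℝ) : ℂ) • P ψ‖ ≤ δ * ‖P ψ‖) →
      (∀ ψ, κ * ‖ψ - P ψ‖ ≤ ‖G (ψ - P ψ) - (((l + c)⁻¹ : ℝ) : ℂ) • (ψ - P ψ)‖) →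
      ∃ lam : Fin m → ℝ,
        (∀ i, Module.finrank ℂ (opEigenspace S (lam i : ℂ)) =
          (Finset.univ.filter fun j => lam j = lam i).card) ∧
        opSpectrum S ∩ Metric.ball (l : ℂ) ε = Set.range (fun i => (lam i : ℂ)) ∧
        (∀ i, |lam i - l| ≤ C * δ) ∧ ‖spectralProjection S (Set.range lam) - P‖ ≤ C * δ := by
  set b := l + c with hbdef
  -- The bound `b/2` keeps `1/t` away from `0` for spectral points in the ball. The bound `κb²/4`
  -- places them inside the window of radius `κ/2` around `1/b`.
  set ε := min (b / 2) (κ * b ^ 2 / 4) with hε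
  have hε0 : 0 < ε := lt_min (by positivity) (by positivity)
  -- `κ/16` is required by the bounded problem, `b⁻¹/4` keeps the eigenvalues of `G` above `b⁻¹/2`,
  -- and `ε/(8b²)` puts the transformed eigenvalues inside the ball.
  refine ⟨ε, min (min (κ / 16) (b⁻¹ / 4)) (ε / (8 * b ^ 2)), 4 * b ^ 2 + 5 / κ, hε0,
    lt_min (lt_min (by positivity) (by positivity)) (by positivity), by positivity, ?_⟩
  intro S G δ hδ0 hδ hG hS hin hout
  have hδ1 : δ ≤ κ / 16 := hδ.trans ((min_le_left _ _).trans (min_le_left _ _))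
  have hδ2 : δ ≤ b⁻¹ / 4 := hδ.trans ((min_le_left _ _).trans (min_le_right _ _))
  have hδ3 : 8 * b ^ 2 * δ ≤ ε := by
    have := hδ.trans (min_le_right _ _)
    rw [le_div_iff₀ (by positivity)] at this
    linarith
  obtain ⟨nu, E, n1, n2, n3, hE, hEE, hfin, n4, n5⟩ :=
    exists_eigenvalues_of_approximate_projection hG hκ hδ0 hδ1 hP hPP hin hout hm
  have hnu : ∀ i, b⁻¹ / 2 ≤ nu i := fun i => by
    have := (abs_le.1 (n1 i)).1
    linarith
  have hb1 : 0 < b⁻¹ := inv_pos.2 hb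
  have hnu0 : ∀ i, 0 < nu i := fun i => (half_pos hb1).trans_le (hnu i)
  set lam : Fin m → ℝ := fun i => (nu i)⁻¹ - c with hlam
  have hlc : ∀ i, ((lam i : ℂ) + c) = ((nu i)⁻¹ : ℝ) := fun i => by rw [hlam]; push_cast; ring
  have hlc0 : ∀ i, (lam i : ℂ) + c ≠ 0 := fun i => by
    rw [hlc]; exact_mod_cast (inv_pos.2 (hnu0 i)).ne'
  have hlcinv : ∀ i, ((lam i : ℂ) + c)⁻¹ = (nu i : ℂ) := fun i => by
    rw [hlc]; push_cast; rw [inv_inv]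
  have hinj : ∀ i j, lam i = lam j ↔ nu i = nu j := fun i j => by
    simp only [hlam, sub_left_inj, inv_inj]
  have hlam1 : ∀ i, |lam i - l| ≤ 4 * b ^ 2 * δ := fun i => by
    have e : lam i - l = (b⁻¹ - nu i) * ((nu i)⁻¹ * b) := by
      have := (hnu0 i).ne'
      simp only [hlam]; field_simp; rw [hbdef]; ring
    have h1 : (nu i)⁻¹ ≤ 2 * b := by
      rw [inv_le_comm₀ (hnu0 i) (by positivity), mul_inv]; linarith [hnu i]
    have h2 : 0 < (nu i)⁻¹ := inv_pos.2 (hnu0 i)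
    rw [e, abs_mul, abs_sub_comm, abs_of_pos (mul_pos h2 hb)]
    calc _ ≤ 2 * δ * (2 * b * b) := mul_le_mul (n1 i)
            (mul_le_mul_of_nonneg_right h1 hb.le) (mul_pos h2 hb).le (by positivity)
      _ = _ := by ring
  have heig : ∀ i, opEigenspace S (lam i : ℂ) =
      Module.End.eigenspace (G : H →ₗ[ℂ] H) (nu i : ℂ) := fun i => by
    rw [hS.opEigenspace_eq (hlc0 i), hlcinv]
  refine ⟨lam, fun i => ?_, ?_, fun i => ?_, ?_⟩
  · rw [heig, n3]
    congr 1; ext j; simp [hinj]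
  · ext z
    simp only [Set.mem_inter_iff, Metric.mem_ball, Set.mem_range, hS.mem_opSpectrum_iff]
    constructor
    · rintro ⟨⟨hz0, hz⟩, hball⟩
      obtain ⟨t, ht, htz⟩ := (mem_spectrum_complex_iff hG).1 hz
      have ht0 : t ≠ 0 := by
        rintro rfl
        exact inv_ne_zero hz0 (by rw [← htz]; simp)
      have hzt : z = ((t⁻¹ - c : ℝ) : ℂ) := by
        push_cast; rw [htz, inv_inv]; ring
      rw [hzt, Complex.dist_eq, ← Complex.ofReal_sub, Complex.norm_real, Real.norm_eq_abs] at hball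
      have h1 : |t⁻¹ - b| < ε := by rwa [hbdef, show t⁻¹ - (l + c) = t⁻¹ - c - l by ring]
      have h2 : b / 2 < t⁻¹ := by
        have := (abs_lt.1 h1).1
        have := min_le_left (b / 2) (κ * b ^ 2 / 4)
        linarith
      have htp : 0 < t := inv_pos.1 ((half_pos hb).trans h2)
      have h3 : |t - b⁻¹| < κ / 2 := by
        have e : t - b⁻¹ = (b - t⁻¹) * (t * b⁻¹) := by field_simp
        have h4 : t ≤ 2 * b⁻¹ := by
          rw [lt_inv_comm₀ (half_pos hb) htp] at h2
          exact h2.le.trans (le_of_eq (by field_simp))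
        rw [e, abs_mul, abs_sub_comm, abs_of_pos (mul_pos htp hb1)]
        calc _ < ε * (t * b⁻¹) := mul_lt_mul_of_pos_right h1 (mul_pos htp hb1)
          _ ≤ (κ * b ^ 2 / 4) * (2 * b⁻¹ * b⁻¹) := mul_le_mul (min_le_right _ _)
              (mul_le_mul_of_nonneg_right h4 hb1.le) (mul_pos htp hb1).le (by positivity)
          _ = κ / 2 := by field_simp; ring
      obtain ⟨i, hi⟩ := (n2 t h3).1 ht
      exact ⟨i, by rw [hzt, ← hi]⟩
    · rintro ⟨i, rfl⟩
      refine ⟨⟨hlc0 i, ?_⟩, ?_⟩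
      · rw [hlcinv, mem_spectrum_complex_iff hG]
        exact ⟨nu i, (n2 _ ((n1 i).trans_lt (by linarith))).2 ⟨i, rfl⟩, rfl⟩
      · rw [Complex.dist_eq, ← Complex.ofReal_sub, Complex.norm_real, Real.norm_eq_abs]
        refine (hlam1 i).trans_lt ?_
        linarith
  · refine (hlam1 i).trans (mul_le_mul_of_nonneg_right ?_ hδ0)
    have : 0 < 5 / κ := by positivity
    linarith
  · rw [spectralProjection_eq hE hEE]
    · refine n5.trans (le_of_eq_of_le (by ring : 5 * δ / κ = 5 / κ * δ)
        (mul_le_mul_of_nonneg_right ?_ hδ0))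
      have : 0 < 4 * b ^ 2 := by positivity
      linarith
    · rw [← n4, iSup_range, iSup_range]
      exact iSup_congr heig

/-- The gap above the kernel at an isolated point of the spectrum. -/
theorem exists_gap_of_isolated (hG : IsSelfAdjoint G) {g r : ℝ} (hr : 0 < r)
    (hs : ∀ t ∈ spectrum ℝ G, |t - g| < r → t = g) (hP : IsSelfAdjoint P) (hPP : P * P = P)
    (hker : ∀ ψ, G ψ = (g : ℂ) • ψ → P ψ = ψ) :
    ∀ ψ, r * ‖ψ - P ψ‖ ≤ ‖G (ψ - P ψ) - (g : ℂ) • (ψ - P ψ)‖ := by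
  obtain ⟨E, hE, hEE, -, hin, hout⟩ := exists_window_projection hG (g := g) (r := r) (ρ := 0) hr
    le_rfl (by positivity) fun t ht h => by rw [hs t ht h]; simp
  intro ψ
  set q := ψ - P ψ with hq
  have hPq : P q = 0 := by rw [hq, map_sub, ← mul_apply_eq_comp, hPP, sub_self]
  -- With window width `ρ = 0` the projection `E` maps into the kernel of `G - g`, hence into the
  -- range of `P`. As `q` is orthogonal to that range, `E q = 0`.
  have h1 : P (E q) = E q := hker _ (by
    have := hin q
    rw [zero_mul] at this
    exact sub_eq_zero.1 (norm_le_zero_iff.1 this))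
  have h2 : E q = 0 := by
    rw [← inner_self_eq_zero (𝕜 := ℂ), ← inner_of_isSelfAdjoint hE, ← mul_apply_eq_comp, hEE,
      ← h1, inner_of_isSelfAdjoint hP, hPq, inner_zero_right]
  have := hout q
  rwa [h2, sub_zero] at this

/-! ### The Birman–Schwinger form of the perturbation -/

/-- The lower bound off the kernel is stable under perturbations of the kinetic resolvent. -/
theorem le_norm_of_perturbed_resolvent {X₀ X W G₀ G : H →L[ℂ] H} {b κ η x : ℝ} (hb : 0 < b)
    (hκ : 0 < κ) (hx : ‖X‖ ≤ x)
    (hG₀ : ∀ φ ψ, φ = G₀ ψ ↔ φ = X₀ (ψ + W φ - (b : ℂ) • φ))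
    (hG : ∀ φ ψ, φ = G ψ ↔ φ = X (ψ + W φ - (b : ℂ) • φ))
    (hXX : ∀ φ, ‖X (W φ) - X₀ (W φ)‖ ≤ η * ‖φ‖) (hP : IsSelfAdjoint P) (hPP : P * P = P)
    (hPG : ∀ ψ, G₀ (P ψ) = ((b⁻¹ : ℝ) : ℂ) • P ψ)
    (hgap : ∀ ψ, κ * ‖ψ - P ψ‖ ≤ ‖G₀ (ψ - P ψ) - ((b⁻¹ : ℝ) : ℂ) • (ψ - P ψ)‖)
    (hsmall : (b⁻¹ * ‖G₀ * W‖ / κ + 1) * η ≤ 1 / 2) (ψ : H) :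
    b⁻¹ / 2 / (2 + (b⁻¹ * ‖G₀ * W‖ / κ + 1) * b * x) * ‖ψ - P ψ‖ ≤
      ‖G (ψ - P ψ) - ((b⁻¹ : ℝ) : ℂ) • (ψ - P ψ)‖ := by
  set q := ψ - P ψ with hq
  set g := b⁻¹ with hg
  have hg0 : 0 < g := inv_pos.2 hb
  have hbg : (b : ℂ) * (g : ℂ) = 1 := by
    rw [hg]; push_cast; exact mul_inv_cancel₀ (by exact_mod_cast hb.ne')
  have hPq : P q = 0 := by rw [hq, map_sub, ← mul_apply_eq_comp, hPP, sub_self]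
  -- If `d = (G-g)q` were small, `φ` would almost solve `φ = X₀Wφ` with residual `r`. Then `y =
  -- X₀Wφ` is almost in the kernel of `G₀ - g`, and the gap puts it near the range of `P`. But `φ`
  -- is close to `gq`, which is orthogonal to that range.
  set φ := G q with hφ
  set d := φ - (g : ℂ) • q with hd
  set K := g * ‖G₀ * W‖ / κ with hK
  have hK0 : 0 ≤ K := by positivity
  set r := φ - X₀ (W φ) with hr
  have h1 : φ = X (W φ) - (b : ℂ) • X d := by
    have e : q + W φ - (b : ℂ) • φ = W φ - (b : ℂ) • d := by
      rw [hd, smul_sub, smul_smul, hbg, one_smul]; abel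
    have := (hG φ q).1 rfl
    rw [e, map_sub, map_smul] at this
    exact this
  have h2 : ‖r‖ ≤ b * x * ‖d‖ + η * ‖φ‖ := by
    have e : r = (X (W φ) - X₀ (W φ)) - (b : ℂ) • X d := by
      rw [hr]; nth_rewrite 1 [h1]; abel
    rw [e, add_comm (b * x * ‖d‖)]
    refine (norm_sub_le _ _).trans (add_le_add (hXX φ) ?_)
    rw [norm_smul, Complex.norm_real, Real.norm_of_nonneg hb.le, mul_assoc]
    exact mul_le_mul_of_nonneg_left (X.le_of_opNorm_le hx d) hb.le
  set y := φ - r with hy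
  have hy1 : y = X₀ (W φ) := by rw [hy, hr]; abel
  have h3 : G₀ y - (g : ℂ) • y = -((g : ℂ) • G₀ (W r)) := by
    have : y = G₀ (W r + (b : ℂ) • y) := by
      rw [hG₀]
      rw [show W r + (b : ℂ) • y + W y - (b : ℂ) • y = W r + W y by abel, ← map_add,
        show r + y = φ by rw [hy]; abel, hy1]
    have h4 := congrArg (fun v => (g : ℂ) • v) this
    simp only [map_add, map_smul, smul_add, smul_smul, mul_comm (g : ℂ) (b : ℂ), hbg, one_smul] at h4
    rw [h4]; abel
  have h4 : ‖y - P y‖ ≤ K * ‖r‖ := by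
    have h := hgap y
    have e : G₀ (y - P y) - (g : ℂ) • (y - P y) = G₀ y - (g : ℂ) • y := by
      rw [map_sub, hPG]; module
    rw [e, h3, norm_neg, norm_smul, Complex.norm_real, Real.norm_of_nonneg hg0.le] at h
    have h5 : ‖G₀ (W r)‖ ≤ ‖G₀ * W‖ * ‖r‖ := (G₀ * W).le_opNorm r
    rw [hK, div_mul_eq_mul_div, le_div_iff₀ hκ]
    nlinarith
  have h5 : (g : ℂ) • q = (y - P y) + (r - P r) - (d - P d) := by
    have e1 : φ = (g : ℂ) • q + d := by rw [hd]; abel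
    have e2 : y + r = (g : ℂ) • q + d := by rw [← e1, hy]; abel
    have e3 : P y + P r = P d := by
      rw [← map_add, e2, map_add, map_smul, hPq, smul_zero, zero_add]
    calc (g : ℂ) • q = (y + r) - d := by rw [e2]; abel
      _ = _ := by rw [← e3]; abel
  have h6 : g * ‖q‖ ≤ K * ‖r‖ + ‖r‖ + ‖d‖ := by
    have := congrArg norm h5
    rw [norm_smul, Complex.norm_real, Real.norm_of_nonneg hg0.le] at this
    rw [this]
    exact (norm_sub_le _ _).trans (add_le_add ((norm_add_le _ _).trans (add_le_add h4
      (norm_sub_apply_le_of_projection hP hPP r))) (norm_sub_apply_le_of_projection hP hPP d))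
  have h7 : ‖φ‖ ≤ g * ‖q‖ + ‖d‖ := by
    have e1 : φ = (g : ℂ) • q + d := by rw [hd]; abel
    rw [e1]
    refine (norm_add_le _ _).trans (le_of_eq ?_)
    rw [norm_smul, Complex.norm_real, Real.norm_of_nonneg hg0.le]
  have hx0 : 0 ≤ x := (norm_nonneg _).trans hx
  have h8 : (K + 1) * ‖r‖ ≤ (K + 1) * b * x * ‖d‖ + 1 / 2 * (g * ‖q‖ + ‖d‖) := by
    have i1 := mul_le_mul_of_nonneg_left h2 (by positivity : 0 ≤ K + 1)
    have i2 := mul_le_mul_of_nonneg_right hsmall (norm_nonneg φ)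
    nlinarith
  -- The smallness assumption absorbs half of `g‖q‖`, leaving `g‖q‖/2 ≤ (3/2 + (K+1)bx)‖d‖`.
  rw [div_mul_eq_mul_div, div_le_iff₀ (by positivity)]
  have := norm_nonneg d
  nlinarith

/-- The unperturbed eigenfunctions are approximate eigenfunctions of the perturbed resolvent. -/
theorem norm_quasimode_le {X₀ X W G₀ G : H →L[ℂ] H} {b η : ℝ} (hb : 0 < b)
    (hG₀ : ∀ φ ψ, φ = G₀ ψ ↔ φ = X₀ (ψ + W φ - (b : ℂ) • φ))
    (hG : ∀ φ ψ, φ = G ψ ↔ φ = X (ψ + W φ - (b : ℂ) • φ))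
    (hXX : ∀ φ, ‖X (W φ) - X₀ (W φ)‖ ≤ η * ‖φ‖) {α : H}
    (hα : G₀ α = ((b⁻¹ : ℝ) : ℂ) • α) :
    ‖G α - ((b⁻¹ : ℝ) : ℂ) • α‖ ≤ (b⁻¹ * ‖G * W‖ + ‖G‖ + b⁻¹) * η * ‖α‖ := by
  set g := b⁻¹ with hg
  have hg0 : 0 < g := inv_pos.2 hb
  have hbg : (b : ℂ) * (g : ℂ) = 1 := by
    rw [hg]; push_cast; exact mul_inv_cancel₀ (by exact_mod_cast hb.ne')
  have h1 : α = X₀ (W α) := by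
    have : α = G₀ ((b : ℂ) • α) := by rw [map_smul, hα, smul_smul, hbg, one_smul]
    rw [hG₀] at this
    rwa [show (b : ℂ) • α + W α - (b : ℂ) • α = W α by abel] at this
  -- One Birman–Schwinger step with the perturbed operator corrects `α` to `β`. The error of `β` in
  -- the equation for `G` involves only `α - β`, which is O(η).
  set β := X (W α) with hβ
  have h2 : ‖α - β‖ ≤ η * ‖α‖ := by
    rw [norm_sub_rev]
    have := hXX α
    rwa [← h1] at this
  have h3 : G β - (g : ℂ) • β = -((g : ℂ) • G (W (α - β))) := by
    have : β = G (W (α - β) + (b : ℂ) • β) := by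
      rw [hG]
      rw [show W (α - β) + (b : ℂ) • β + W β - (b : ℂ) • β = W (α - β) + W β by abel, ← map_add,
        sub_add_cancel]
    have h4 := congrArg (fun v => (g : ℂ) • v) this
    simp only [map_add, map_smul, smul_add, smul_smul, mul_comm (g : ℂ) (b : ℂ), hbg, one_smul] at h4
    rw [h4, map_sub]; abel
  have e : G α - (g : ℂ) • α = -((g : ℂ) • G (W (α - β))) + G (α - β) - (g : ℂ) • (α - β) := by
    rw [← h3, map_sub]; module
  rw [e]
  have n1 : ‖(g : ℂ) • G (W (α - β))‖ ≤ g * ‖G * W‖ * ‖α - β‖ := by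
    rw [norm_smul, Complex.norm_real, Real.norm_of_nonneg hg0.le, mul_assoc]
    exact mul_le_mul_of_nonneg_left ((G * W).le_opNorm _) hg0.le
  have n2 := G.le_opNorm (α - β)
  have n3 : ‖(g : ℂ) • (α - β)‖ = g * ‖α - β‖ := by
    rw [norm_smul, Complex.norm_real, Real.norm_of_nonneg hg0.le]
  calc _ ≤ g * ‖G * W‖ * ‖α - β‖ + ‖G‖ * ‖α - β‖ + g * ‖α - β‖ := by
        refine (norm_sub_le _ _).trans (add_le_add ((norm_add_le _ _).trans (add_le_add ?_ n2))
          n3.le)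
        rw [norm_neg]; exact n1
    _ = (g * ‖G * W‖ + ‖G‖ + g) * ‖α - β‖ := by ring
    _ ≤ (g * ‖G * W‖ + ‖G‖ + g) * (η * ‖α‖) := mul_le_mul_of_nonneg_left h2 (by positivity)
    _ = _ := by ring

end Stability

end MagneticBCS

namespace MagneticBCS

/-! ### The spectrum of the free Laplacian -/

section FreeSpectrum

open Filter Topology

theorem pderiv_comp_add (j : Fin 3) (φ : R3 → ℂ) (c x : R3) :
    pderiv j (fun y => φ (y + c)) x = pderiv j φ (x + c) := by
  rw [pderiv, fderiv_comp_add_right]; rfl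

theorem magD_zero (j : Fin 3) (φ : R3 → ℂ) (x : R3) :
    magD 0 j φ x = -Complex.I * pderiv j φ x := by simp [magD]

theorem IsTest.magD_zero {φ : R3 → ℂ} (h : IsTest φ) (j : Fin 3) : IsTest (magD 0 j φ) := by
  have : magD 0 j φ = fun x => -Complex.I * MagneticBCS.pderiv j φ x :=
    funext fun x => MagneticBCS.magD_zero j φ x
  rw [this]
  exact ⟨contDiff_const.mul (h.pderiv j).contDiff, (h.pderiv j).compact.mul_left⟩

theorem IsMagneticDeriv.transl {j : Fin 3} {u χ : L2} (h : IsMagneticDeriv 0 j u χ) (c : R3) :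
    IsMagneticDeriv 0 j (transl c u) (transl c χ) := by
  rw [isMagneticDeriv_iff continuous_zero] at h ⊢
  intro φ hφ
  have h1 := h _ (hφ.comp_add (-c))
  have h2 : (fun x => magD 0 j φ (x + -c)) = magD 0 j fun x => φ (x + -c) := by
    ext x; rw [magD_zero, magD_zero, pderiv_comp_add]
  have h3 : ∀ u v : L2, ⟪u, MagneticBCS.transl c v⟫_ℂ = ⟪MagneticBCS.transl (-c) u, v⟫_ℂ :=
    fun u v => by rw [inner_transl, neg_neg]
  rw [h3, h3, transl_toL2 _ (hφ.magD_zero j).memLp, transl_toL2 _ hφ.memLp, h2]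
  exact h1

/-- Translation invariance of the free operator lets test functions escape to infinity, where `V` is
not felt. -/
theorem transl_magRes (c : R3) (f : L2) : transl c (magRes 0 f) = magRes 0 (transl c f) := by
  obtain ⟨χ, h1, h2⟩ := exists_grad_magRes 0 f
  have h3 : ∀ u v : L2, ⟪u, transl c v⟫_ℂ = ⟪transl (-c) u, v⟫_ℂ :=
    fun u v => by rw [inner_transl, neg_neg]
  have : ∃ χ, HasMagLaplacian 0 (transl c (magRes 0 f)) χ (transl c (f - magRes 0 f)) :=
    ⟨fun j => transl c (χ j), fun j => (h1 j).transl c, fun v w hw => by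
      simp only [h3]
      exact h2 _ _ fun j => (hw j).transl (-c)⟩
  rw [hasMagLaplacian_iff, map_sub, sub_add_cancel] at this
  exact this

theorem commute_kinRes {H : Type*} [NormedAddCommGroup H] [InnerProductSpace ℂ H] [CompleteSpace H]
    (T μ e : ℝ) {R A : H →L[ℂ] H} (h : Commute R A) : Commute (kinRes T μ e R) A :=
  h.cfc_real (shiftInv T μ e)

theorem spectrum_kinRes {H : Type*} [NormedAddCommGroup H] [InnerProductSpace ℂ H]
    [CompleteSpace H] {T μ e : ℝ} (hT : 0 < T) (he : e < symbolMin T μ) {R : H →L[ℂ] H}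
    (hR : IsSelfAdjoint R) (hs : spectrum ℝ R ⊆ Set.Icc 0 1) :
    spectrum ℝ (kinRes T μ e R) = shiftInv T μ e '' spectrum ℝ R :=
  cfc_map_spectrum (shiftInv T μ e) R hR ((continuousOn_shiftInv hT he).mono hs)

theorem transl_kinRes (T μ e : ℝ) (c : R3) (f : L2) :
    transl c (kinRes T μ e (magRes 0) f) = kinRes T μ e (magRes 0) (transl c f) := by
  have h : Commute (magRes 0) (transl c).toContinuousLinearMap := by
    ext1 f; exact (transl_magRes c f).symm
  exact (DFunLike.congr_fun (commute_kinRes T μ e h).eq f).symm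

theorem hasMagLaplacian_test {φ : R3 → ℂ} (h : IsTest φ) :
    HasMagLaplacian 0 (toL2 φ) (fun j => toL2 (magD 0 j φ))
      (∑ j, toL2 (magD 0 j (magD 0 j φ))) :=
  ⟨fun j => isMagneticDeriv_test continuous_zero j h, fun v w hw => by
    rw [inner_sum]
    refine Finset.sum_congr rfl fun j _ => ?_
    have := (isMagneticDeriv_iff continuous_zero).1 (hw j) _ (h.magD_zero j)
    rw [← inner_conj_symm, ← this, inner_conj_symm]⟩

/-- The plane wave with wave vector `κ e₀`. -/
noncomputable def planeWave (κ : ℝ) (x : R3) : ℂ := Complex.exp (Complex.I * (κ * x 0 : ℝ))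

theorem norm_planeWave (κ : ℝ) (x : R3) : ‖planeWave κ x‖ = 1 := by
  rw [planeWave, mul_comm, Complex.norm_exp_ofReal_mul_I]

theorem contDiff_planeWave (κ : ℝ) : ContDiff ℝ ∞ (planeWave κ) := by
  have : ContDiff ℝ ∞ fun x : R3 => κ * x 0 :=
    contDiff_const.mul (EuclideanSpace.proj (𝕜 := ℝ) (0 : Fin 3)).contDiff
  exact (contDiff_const.mul (Complex.ofRealCLM.contDiff.comp this)).cexp

theorem IsTest.planeWave_mul {φ : R3 → ℂ} (h : IsTest φ) (κ : ℝ) :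
    IsTest fun x => planeWave κ x * φ x :=
  ⟨(contDiff_planeWave κ).mul h.contDiff, h.compact.mul_left⟩

theorem magD_planeWave_mul (κ : ℝ) (j : Fin 3) {φ : R3 → ℂ} (h : IsTest φ) (x : R3) :
    magD 0 j (fun x => planeWave κ x * φ x) x =
      planeWave κ x * (magD 0 j φ x + (if j = 0 then (κ : ℂ) else 0) * φ x) := by
  have h1 : HasFDerivAt (fun x : R3 => ((κ * x 0 : ℝ) : ℂ))
      (Complex.ofRealCLM ∘L (κ • (EuclideanSpace.proj (𝕜 := ℝ) (0 : Fin 3) : R3 →L[ℝ] ℝ))) x :=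
    Complex.ofRealCLM.hasFDerivAt.comp x
      ((EuclideanSpace.proj (𝕜 := ℝ) (0 : Fin 3) : R3 →L[ℝ] ℝ).hasFDerivAt.const_mul κ)
  have h2 := (h1.const_mul Complex.I).cexp
  have h3 := (h.contDiff.differentiable (by simp) x).hasFDerivAt
  have h4 : HasFDerivAt (fun x => planeWave κ x * φ x) _ x := h2.mul h3
  rw [magD_zero, magD_zero, pderiv, h4.fderiv, pderiv]
  have h5 : (EuclideanSpace.proj (𝕜 := ℝ) (0 : Fin 3) : R3 →L[ℝ] ℝ)
      (EuclideanSpace.single j (1 : ℝ)) = if j = 0 then 1 else 0 := by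
    simp [eq_comm]
  simp only [add_apply, smul_apply, smul_eq_mul, ContinuousLinearMap.comp_apply, h5,
    Complex.ofRealCLM_apply]
  rw [← show Complex.exp (Complex.I * (κ * x 0 : ℝ)) = planeWave κ x from rfl]
  split_ifs
  · push_cast; linear_combination (-Complex.exp (Complex.I * (κ * x 0)) * φ x * κ) * Complex.I_sq
  · simp; ring

theorem magD_add_mul (j : Fin 3) {φ φ' : R3 → ℂ} (h : IsTest φ) (h' : IsTest φ') (c : ℂ) (x : R3) :
    magD 0 j (fun x => φ x + c * φ' x) x = magD 0 j φ x + c * magD 0 j φ' x := by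
  have h1 := (h.contDiff.differentiable (by simp) x).hasFDerivAt
  have h2 := (h'.contDiff.differentiable (by simp) x).hasFDerivAt
  have h3 : HasFDerivAt (fun x => φ x + c * φ' x) _ x := h1.add (h2.const_mul c)
  rw [magD_zero, magD_zero, magD_zero, pderiv, h3.fderiv, pderiv, pderiv]
  simp; ring

theorem magD_comp_smul (j : Fin 3) {φ : R3 → ℂ} (h : IsTest φ) (s : ℝ) (x : R3) :
    magD 0 j (fun x => φ (s • x)) x = s * magD 0 j φ (s • x) := by
  have h1 := (h.contDiff.differentiable (by simp) (s • x)).hasFDerivAt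
  have h2 : HasFDerivAt (fun x => φ (s • x)) _ x :=
    h1.comp x ((hasFDerivAt_id x).const_smul s)
  rw [magD_zero, magD_zero, pderiv, h2.fderiv, pderiv]
  simp; ring

theorem IsTest.comp_smul {φ : R3 → ℂ} (h : IsTest φ) {s : ℝ} (hs : s ≠ 0) :
    IsTest fun x => φ (s • x) :=
  ⟨h.contDiff.comp (contDiff_const_smul s),
    h.compact.comp_homeomorph (Homeomorph.smulOfNeZero s hs)⟩

/-- What matters is that one factor serves all functions, so that it cancels from the Weyl estimate;
its value is never needed. -/
theorem exists_norm_toL2_comp_smul {s : ℝ} (hs : s ≠ 0) : ∃ N : ℝ, 0 < N ∧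
    ∀ f : R3 → ℂ, MemLp f 2 volume → ‖toL2 fun x => f (s • x)‖ = N * ‖toL2 f‖ := by
  set c : ℝ≥0∞ := ENNReal.ofReal |(s ^ Module.finrank ℝ R3)⁻¹| with hc
  have hc0 : c ≠ 0 := by
    rw [hc, ne_eq, ENNReal.ofReal_eq_zero, not_le]
    exact abs_pos.2 (inv_ne_zero (pow_ne_zero _ hs))
  have key : ∀ f : R3 → ℂ, eLpNorm (fun x => f (s • x)) 2 volume =
      c ^ (1 / (2 : ℝ≥0∞)).toReal • eLpNorm f 2 volume := fun f => by
    have h1 := (Homeomorph.smulOfNeZero s hs : R3 ≃ₜ R3).measurableEmbedding.eLpNorm_map_measure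
      (g := f) (p := 2) (μ := volume)
    have h2 : Measure.map (⇑(Homeomorph.smulOfNeZero s hs : R3 ≃ₜ R3)) volume = c • volume :=
      Measure.map_addHaar_smul volume hs
    rw [h2, eLpNorm_smul_measure_of_ne_top (by norm_num)] at h1
    exact h1.symm
  refine ⟨(c ^ (1 / (2 : ℝ≥0∞)).toReal).toReal, ?_, fun f hf => ?_⟩
  · refine ENNReal.toReal_pos ?_ ?_
    · exact (ENNReal.rpow_pos (pos_iff_ne_zero.2 hc0) ENNReal.ofReal_ne_top).ne'
    · exact ENNReal.rpow_ne_top_of_nonneg (by positivity) ENNReal.ofReal_ne_top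
  · have hfs : MemLp (fun x => f (s • x)) 2 volume := by
      refine ⟨?_, ?_⟩
      · exact hf.1.comp_quasiMeasurePreserving
          ⟨measurable_const_smul s, by
            rw [Measure.map_addHaar_smul volume hs]
            exact Measure.smul_absolutelyContinuous⟩
      · rw [key, smul_eq_mul]
        exact ENNReal.mul_lt_top
          (ENNReal.rpow_ne_top_of_nonneg (by positivity) ENNReal.ofReal_ne_top).lt_top hf.2
    rw [Lp.norm_def, Lp.norm_def, eLpNorm_congr_ae (coeFn_toL2 hfs), eLpNorm_congr_ae (coeFn_toL2 hf),
      key, smul_eq_mul, ENNReal.toReal_mul]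

theorem exists_test_ne_zero : ∃ φ, IsTest φ ∧ 0 < ‖toL2 φ‖ := by
  obtain ⟨b⟩ : Nonempty (ContDiffBump (0 : R3)) := inferInstance
  have hb : IsTest fun x => ((b x : ℝ) : ℂ) :=
    ⟨Complex.ofRealCLM.contDiff.comp b.contDiff, b.hasCompactSupport.comp_left (g := fun t : ℝ => (t : ℂ)) (by simp)⟩
  refine ⟨_, hb, norm_pos_iff.2 fun h => ?_⟩
  have h1 : (fun x => ((b x : ℝ) : ℂ)) =ᵐ[volume] fun _ => 0 := by
    have h2 := coeFn_toL2 hb.memLp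
    rw [h] at h2
    exact h2.symm.trans (Lp.coeFn_zero ℂ 2 volume)
  have h3 := congrFun ((hb.contDiff.continuous.ae_eq_iff_eq volume continuous_const).1 h1) 0
  have h4 : b 0 = 1 := b.one_of_mem_closedBall (by simp [b.rIn_pos.le])
  simp [h4] at h3

theorem norm_toL2_planeWave_mul (κ : ℝ) {f : R3 → ℂ} (hf : IsTest f) :
    ‖toL2 fun x => planeWave κ x * f x‖ = ‖toL2 f‖ := by
  rw [Lp.norm_def, Lp.norm_def, eLpNorm_congr_ae (coeFn_toL2 (hf.planeWave_mul κ).memLp),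
    eLpNorm_congr_ae (coeFn_toL2 hf.memLp)]
  congr 1
  exact eLpNorm_congr_norm_ae (Eventually.of_forall fun x => by
    rw [norm_mul, norm_planeWave, one_mul])

/-- Weyl sequence: a plane wave of frequency `√t` times a test function stretched by `1/s`. Applying
`-Δ - t` leaves only terms with derivatives of the envelope, of relative size `s` and `s²`. As `s →
0` this contradicts a lower bound for the resolvent minus `(1+t)⁻¹`. -/
theorem mem_spectrum_magRes_zero {t : ℝ} (ht : 0 ≤ t) : (1 + t)⁻¹ ∈ spectrum ℝ (magRes 0) := by
  by_contra hns
  obtain ⟨d, hd, hlow⟩ := exists_le_norm_of_notMem_spectrum hns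
  obtain ⟨w, hw, hw0⟩ := exists_test_ne_zero
  set κ := √t with hκ
  have hκt : κ ^ 2 = t := Real.sq_sqrt ht
  have hκ0 : 0 ≤ κ := Real.sqrt_nonneg t
  set A := ∑ j, ‖toL2 (magD 0 j (magD 0 j w))‖ with hA
  set B := ∑ j, ‖toL2 (magD 0 j w)‖ with hB
  have key : ∀ s : ℝ, 0 < s → d * ‖toL2 w‖ ≤ s ^ 2 * A + 2 * κ * s * B := by
    intro s hs
    obtain ⟨N, hN, hNs⟩ := exists_norm_toL2_comp_smul hs.ne'
    have hws := hw.comp_smul hs.ne'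
    have hφ := hws.planeWave_mul κ
    set φ : R3 → ℂ := fun x => planeWave κ x * w (s • x) with hφdef
    set k : Fin 3 → ℂ := fun j => if j = 0 then (κ : ℂ) else 0 with hk
    have hkn : ∀ j, ‖k j‖ ≤ κ := fun j => by
      simp only [hk]; split_ifs
      · rw [Complex.norm_real, Real.norm_of_nonneg hκ0]
      · simpa using hκ0
    have d1 : ∀ j, magD 0 j φ = fun x => planeWave κ x *
        (magD 0 j (fun x => w (s • x)) x + k j * w (s • x)) := fun j =>
      funext fun x => magD_planeWave_mul κ j hws x
    have t1 : ∀ j, IsTest fun x => magD 0 j (fun x => w (s • x)) x + k j * w (s • x) := fun j =>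
      ⟨(hws.magD_zero j).contDiff.add (contDiff_const.mul hws.contDiff),
        (hws.magD_zero j).compact.add hws.compact.mul_left⟩
    have d2 : ∀ j x, magD 0 j (magD 0 j φ) x = planeWave κ x *
        ((s : ℂ) ^ 2 * magD 0 j (magD 0 j w) (s • x)) +
        planeWave κ x * (2 * k j * s * magD 0 j w (s • x)) + k j ^ 2 * φ x := fun j x => by
      have e1 : magD 0 j (fun x => w (s • x)) =
          fun x => 0 * w (s • x) + (s : ℂ) * (fun x => magD 0 j w (s • x)) x :=
        funext fun x => by rw [zero_mul, zero_add]; exact magD_comp_smul j hw s x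
      have e2 : magD 0 j (magD 0 j fun x => w (s • x)) x =
          (s : ℂ) ^ 2 * magD 0 j (magD 0 j w) (s • x) := by
        have z : IsTest fun x => (0 : ℂ) * w (s • x) :=
          ⟨contDiff_const.mul hws.contDiff, hws.compact.mul_left⟩
        rw [e1, magD_add_mul j z ((hw.magD_zero j).comp_smul hs.ne') _ x,
          magD_comp_smul j (hw.magD_zero j) s x]
        simp only [zero_mul]
        rw [magD_zero j (fun _ => 0)]
        simp [pderiv]; ring
      rw [d1 j, magD_planeWave_mul κ j (t1 j) x, magD_add_mul j (hws.magD_zero j) hws _ x, e2,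
        magD_comp_smul j hw s x, hφdef]
      ring
    set u := toL2 φ with hu
    set g := ∑ j, toL2 (magD 0 j (magD 0 j φ)) with hg
    have hug : u = magRes 0 (g + u) := hasMagLaplacian_iff.1 ⟨_, hasMagLaplacian_test hφ⟩
    have hun : ‖u‖ = N * ‖toL2 w‖ := by
      rw [hu, hφdef, norm_toL2_planeWave_mul κ hws, hNs w hw.memLp]
    have hsumk : ∑ j, k j ^ 2 = (t : ℂ) := by
      rw [← hκt, Fin.sum_univ_three]; simp [hk]
    have hgt : ‖g - (t : ℂ) • u‖ ≤ N * (s ^ 2 * A + 2 * κ * s * B) := by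
      have e1 : g - (t : ℂ) • u = ∑ j, (toL2 (magD 0 j (magD 0 j φ)) - k j ^ 2 • u) := by
        rw [Finset.sum_sub_distrib, ← Finset.sum_smul, hsumk]
      rw [e1]
      refine (norm_sum_le _ _).trans ?_
      rw [hA, hB, Finset.mul_sum, Finset.mul_sum, ← Finset.sum_add_distrib, Finset.mul_sum]
      refine Finset.sum_le_sum fun j _ => ?_
      have c1 : IsTest fun x => planeWave κ x * magD 0 j (magD 0 j w) (s • x) :=
        (((hw.magD_zero j).magD_zero j).comp_smul hs.ne').planeWave_mul κ
      have c2 : IsTest fun x => planeWave κ x * magD 0 j w (s • x) :=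
        ((hw.magD_zero j).comp_smul hs.ne').planeWave_mul κ
      have e2 : toL2 (magD 0 j (magD 0 j φ)) - k j ^ 2 • u =
          (s : ℂ) ^ 2 • toL2 (fun x => planeWave κ x * magD 0 j (magD 0 j w) (s • x)) +
          (2 * k j * s) • toL2 fun x => planeWave κ x * magD 0 j w (s • x) := by
        refine Lp.ext ?_
        filter_upwards [Lp.coeFn_sub (toL2 (magD 0 j (magD 0 j φ))) (k j ^ 2 • u),
          Lp.coeFn_smul (k j ^ 2) u, coeFn_toL2 ((hφ.magD_zero j).magD_zero j).memLp,
          coeFn_toL2 hφ.memLp, coeFn_toL2 c1.memLp, coeFn_toL2 c2.memLp,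
          Lp.coeFn_add ((s : ℂ) ^ 2 • toL2 fun x =>
            planeWave κ x * magD 0 j (magD 0 j w) (s • x))
            ((2 * k j * s) • toL2 fun x => planeWave κ x * magD 0 j w (s • x)),
          Lp.coeFn_smul ((s : ℂ) ^ 2)
            (toL2 fun x => planeWave κ x * magD 0 j (magD 0 j w) (s • x)),
          Lp.coeFn_smul (2 * k j * s) (toL2 fun x => planeWave κ x * magD 0 j w (s • x))]
          with x h1 h2 h3 h4 h5 h6 h7 h8 h9
        rw [h1, Pi.sub_apply, h2, Pi.smul_apply, h3, h4, h7, Pi.add_apply, h8, h9, Pi.smul_apply,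
          Pi.smul_apply, h5, h6, d2 j x]
        simp only [smul_eq_mul]; ring
      rw [e2]
      refine (norm_add_le _ _).trans ?_
      rw [norm_smul, norm_smul, norm_toL2_planeWave_mul κ (((hw.magD_zero j).magD_zero j).comp_smul
        hs.ne'), norm_toL2_planeWave_mul κ ((hw.magD_zero j).comp_smul hs.ne'),
        hNs _ ((hw.magD_zero j).magD_zero j).memLp, hNs _ (hw.magD_zero j).memLp, norm_pow,
        norm_mul, norm_mul, Complex.norm_real, Real.norm_of_nonneg hs.le, Complex.norm_ofNat]
      have := mul_le_mul_of_nonneg_right (hkn j)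
        (by positivity : 0 ≤ 2 * s * (N * ‖toL2 (magD 0 j w)‖))
      nlinarith
    have h1 := hlow (g + u)
    have e : magRes 0 (g + u) - (((1 + t)⁻¹ : ℝ) : ℂ) • (g + u) =
        -((((1 + t)⁻¹ : ℝ) : ℂ) • (g - (t : ℂ) • u)) := by
      have hne : (1 + (t : ℂ)) ≠ 0 := by exact_mod_cast (by positivity : (1 + t) ≠ 0)
      have h3 : u = (((1 + t)⁻¹ : ℝ) : ℂ) • ((1 + (t : ℂ)) • u) := by
        rw [smul_smul]; push_cast; rw [inv_mul_cancel₀ hne, one_smul]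
      rw [← hug]
      nth_rewrite 1 [h3]
      module
    rw [e, norm_neg, norm_smul, Complex.norm_real, Real.norm_of_nonneg (by positivity)] at h1
    have h2 : ‖u‖ ≤ ‖g + u‖ := by
      conv_lhs => rw [hug]
      simpa using (magRes 0).le_of_opNorm_le (norm_magRes_le 0) (g + u)
    have h3 : (1 + t)⁻¹ * ‖g - (t : ℂ) • u‖ ≤ ‖g - (t : ℂ) • u‖ :=
      mul_le_of_le_one_left (norm_nonneg _) (inv_le_one_of_one_le₀ (by linarith))
    have h4 : d * (N * ‖toL2 w‖) ≤ N * (s ^ 2 * A + 2 * κ * s * B) := by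
      rw [← hun]
      exact (mul_le_mul_of_nonneg_left h2 hd.le).trans (h1.trans (h3.trans hgt))
    refine le_of_mul_le_mul_left ?_ hN
    linarith
  have hlim : Tendsto (fun s : ℝ => s ^ 2 * A + 2 * κ * s * B) (𝓝[>] 0) (𝓝 0) := by
    have : Continuous fun s : ℝ => s ^ 2 * A + 2 * κ * s * B := by fun_prop
    have h := (this.tendsto 0).mono_left (nhdsWithin_le_nhds (s := Set.Ioi 0))
    simpa using h
  have := ge_of_tendsto hlim (by filter_upwards [self_mem_nhdsWithin] with s hs using key s hs)
  have := mul_pos hd hw0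
  linarith

/-- Translates of a test function to infinity do not see a decaying potential. -/
theorem exists_norm_mulB_transl_le {V : R3 → ℝ} (hV : IsBdd V)
    (hV' : IsBdd fun x => (1 + ‖x‖ ^ 2) * V x) {φ : R3 → ℂ} (hφ : IsTest φ) {η : ℝ} (hη : 0 < η) :
    ∃ y, ‖mulB V (transl y (toL2 φ))‖ ≤ η := by
  obtain ⟨R, hR⟩ := hφ.compact.isBounded.subset_closedBall 0
  set M := ‖mulB fun x => (1 + ‖x‖ ^ 2) * V x‖ with hM
  -- The translate lives at distance at least `n` from the origin, where `|V| ≤ n⁻¹ |(1+|x|²)V|`;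
  -- this `n` makes the result at most `η`.
  set n := M * ‖toL2 φ‖ / η + 1 with hn
  have hn1 : 0 < n := by positivity
  refine ⟨(|R| + n) • unitVec 0, ?_⟩
  set y : R3 := (|R| + n) • unitVec 0 with hy
  have hyn : ‖y‖ = |R| + n := by
    rw [hy, norm_smul, Real.norm_of_nonneg (by positivity)]
    simp [unitVec]
  have h1 : ‖mulB V (transl y (toL2 φ))‖ ≤
      n⁻¹ * ‖mulB (fun x => (1 + ‖x‖ ^ 2) * V x) (transl y (toL2 φ))‖ := by
    refine norm_le_of_ae ?_
    filter_upwards [coeFn_mulB hV (transl y (toL2 φ)), coeFn_mulB hV' (transl y (toL2 φ)),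
      coeFn_transl y (toL2 φ), ae_comp_add y (coeFn_toL2 hφ.memLp)] with x h1 h2 h3 h4
    rw [h1, h2, h3, h4]
    by_cases h0 : φ (x + y) = 0
    · simp [h0]
    have h5 : ‖x + y‖ ≤ R := by simpa using hR (subset_tsupport _ h0)
    have h6 : n ≤ ‖x‖ := by
      have := norm_sub_norm_le y (-x)
      rw [norm_neg, sub_neg_eq_add, add_comm y x, hyn] at this
      linarith [le_abs_self R]
    have h7 : n ≤ 1 + ‖x‖ ^ 2 := by nlinarith [sq_nonneg (‖x‖ - 1)]
    rw [norm_mul, norm_mul, Complex.norm_real, Complex.norm_real, norm_mul,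
      Real.norm_of_nonneg (by positivity : 0 ≤ 1 + ‖x‖ ^ 2), ← mul_assoc, ← mul_assoc]
    refine mul_le_mul_of_nonneg_right ?_ (norm_nonneg _)
    refine le_mul_of_one_le_left (norm_nonneg _) ?_
    rw [← div_eq_inv_mul, one_le_div hn1]
    exact h7
  have h2 := (mulB fun x => (1 + ‖x‖ ^ 2) * V x).le_opNorm (transl y (toL2 φ))
  rw [LinearIsometry.norm_map] at h2
  refine h1.trans ?_
  rw [inv_mul_le_iff₀ hn1]
  refine h2.trans ?_
  rw [hn, add_mul, div_mul_cancel₀ _ hη.ne']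
  linarith

theorem mem_spectrum_kinRes {T μ : ℝ} (hT : 0 < T) {e E : ℝ} (he : e < symbolMin T μ)
    (hE : symbolMin T μ ≤ E) : (E - e)⁻¹ ∈ spectrum ℝ (kinRes T μ e (magRes 0)) := by
  obtain ⟨t, ht, hkt⟩ := exists_bcsSymbol_eq hT hE
  refine (spectrum_kinRes hT he (magRes_isSelfAdjoint 0) (spectrum_magRes 0)).ge ?_
  refine ⟨_, mem_spectrum_magRes_zero ht, ?_⟩
  rw [shiftInv_of_ne (by positivity), inv_inv, add_sub_cancel_left, hkt]

theorem isBdd_of_weighted {V : R3 → ℝ} (h : MemLp (fun x => (1 + ‖x‖ ^ 2) * V x) ∞ volume) :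
    IsBdd V ∧ IsBdd fun x => (1 + ‖x‖ ^ 2) * V x := by
  have h1 : IsBdd fun x => (1 + ‖x‖ ^ 2) * V x := h.ofReal
  refine ⟨?_, h1⟩
  have h2 : IsBdd fun x : R3 => (1 + ‖x‖ ^ 2)⁻¹ := by
    refine IsBdd.of_continuous (C := 1) ?_ fun x => ?_
    · exact Continuous.inv₀ (by fun_prop) fun x => by positivity
    · rw [abs_of_pos (by positivity)]
      exact inv_le_one_of_one_le₀ (by nlinarith [sq_nonneg ‖x‖])
  have h3 := MemLp.mul (r := ∞) h1 h2
  refine (memLp_congr_ae (Eventually.of_forall fun x => ?_)).1 h3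
  have : (1 + ‖x‖ ^ 2) ≠ 0 := by positivity
  simp only [Pi.mul_apply]
  rw [← Complex.ofReal_mul, ← mul_assoc, inv_mul_cancel₀ this, one_mul]

/-- An isolated point of the spectrum lies below the minimum of the symbol. -/
theorem lt_symbolMin_of_isolated {T μ : ℝ} (hT : 0 < T) {V : R3 → ℝ} (hV : IsBdd V)
    (hV' : IsBdd fun x => (1 + ‖x‖ ^ 2) * V x) {l ε : ℝ} (hε : 0 < ε)
    (hl : opSpectrum (bcsOperator T μ 0 V) ∩ Metric.ball (l : ℂ) ε = {(l : ℂ)}) :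
    l < symbolMin T μ := by
  by_contra! hle
  -- If `l` were at least the minimum of the symbol, then so would `E`, while isolation of `l` puts
  -- `E` outside the spectrum of `K - V`. The lower bound this gives for `G` is transferred to `X`,
  -- the inverse of `K + c`, contradicting that `E` is in the range of the symbol.
  set E := l + ε / 2 with hE
  set c := 2 * ‖mulB V‖ with hc
  have hv := norm_nonneg (mulB V)
  have hS := symbolMin_pos (μ := μ) hT
  obtain ⟨G, hG, -, hSI⟩ := exists_isShiftInverse (μ := μ) hT continuous_zero hV le_rfl
  have hEc : 0 < E + c := by linarith
  have hns : (E + c)⁻¹ ∉ spectrum ℝ G := fun h => by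
    have h1 : (E : ℂ) ∈ opSpectrum (bcsOperator T μ 0 V) := by
      rw [hSI.mem_opSpectrum_iff]
      refine ⟨by exact_mod_cast hEc.ne', ?_⟩
      rw [mem_spectrum_complex_iff hG]
      exact ⟨_, h, by push_cast [hc]; rfl⟩
    have h2 : (E : ℂ) ∈ ({(l : ℂ)} : Set ℂ) := by
      rw [← hl]
      refine ⟨h1, ?_⟩
      rw [Metric.mem_ball, Complex.dist_eq, ← Complex.ofReal_sub, Complex.norm_real,
        Real.norm_eq_abs, hE, add_sub_cancel_left, abs_of_pos (half_pos hε)]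
      exact half_lt_self hε
    have h3 : E = l := Complex.ofReal_injective h2
    linarith
  obtain ⟨d, hd, hlow⟩ := exists_le_norm_of_notMem_spectrum hns
  set X := kinRes T μ (-c) (magRes 0) with hX
  have he : -c < symbolMin T μ := by linarith
  set w := (E + c)⁻¹ with hw
  have hres : ∀ ψ, G ψ = X ψ + G (mulB V (X ψ)) := fun ψ => by
    have h1 : X ψ = G (ψ - mulB V (X ψ)) := by
      have h2 := (hSI (X ψ) (ψ - mulB V (X ψ) - (c : ℂ) • X ψ)).1 (by
        rw [mem_graph_bcsOperator hT continuous_zero hV he]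
        have e : ψ - mulB V (X ψ) - (c : ℂ) • X ψ + mulB V (X ψ) - ((-c : ℝ) : ℂ) • X ψ = ψ := by
          push_cast; module
        rw [e])
      rwa [sub_add_cancel] at h2
    rw [map_sub] at h1
    nth_rewrite 1 [h1]; abel
  set K := 1 + ‖G‖ * ‖mulB V‖ with hK
  have hK1 : 0 < K := by positivity
  -- From `G = X + GVX` one gets `(G-w)ψ = (1+GV)(X-w)ψ + wGVψ`. For a far translate the last term
  -- is negligible, and `‖(X-w)ψ‖` does not depend on the translation.
  have htest : ∀ φ, IsTest φ → d * ‖toL2 φ‖ ≤ K * ‖X (toL2 φ) - (w : ℂ) • toL2 φ‖ := by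
    intro φ hφ
    refine le_of_forall_pos_le_add fun η hη => ?_
    obtain ⟨y, hy⟩ := exists_norm_mulB_transl_le hV hV' hφ (η := η / (‖G‖ * |w| + 1)) (by positivity)
    set ψ := transl y (toL2 φ) with hψ
    have h1 := hlow ψ
    have h2 : X ψ - (w : ℂ) • ψ = transl y (X (toL2 φ) - (w : ℂ) • toL2 φ) := by
      rw [map_sub, map_smul, hX, transl_kinRes]
    have h3 : ‖X ψ - (w : ℂ) • ψ‖ = ‖X (toL2 φ) - (w : ℂ) • toL2 φ‖ := by
      rw [h2, LinearIsometry.norm_map]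
    have h4 : G ψ - (w : ℂ) • ψ = (X ψ - (w : ℂ) • ψ) + G (mulB V (X ψ - (w : ℂ) • ψ)) +
        (w : ℂ) • G (mulB V ψ) := by
      rw [hres]; simp only [map_sub, map_smul]; abel
    have h5 : ‖G (mulB V (X ψ - (w : ℂ) • ψ))‖ ≤ ‖G‖ * ‖mulB V‖ * ‖X ψ - (w : ℂ) • ψ‖ := by
      refine (G.le_opNorm _).trans ?_
      rw [mul_assoc]
      exact mul_le_mul_of_nonneg_left ((mulB V).le_opNorm _) (norm_nonneg _)
    have h6 : ‖(w : ℂ) • G (mulB V ψ)‖ ≤ η := by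
      rw [norm_smul, Complex.norm_real, Real.norm_eq_abs]
      have h7 : ‖G (mulB V ψ)‖ ≤ ‖G‖ * (η / (‖G‖ * |w| + 1)) :=
        (G.le_opNorm _).trans (mul_le_mul_of_nonneg_left hy (norm_nonneg _))
      refine (mul_le_mul_of_nonneg_left h7 (abs_nonneg w)).trans ?_
      rw [← mul_assoc, ← mul_div_assoc, div_le_iff₀ (by positivity)]
      nlinarith
    rw [h4, hψ, LinearIsometry.norm_map] at h1
    refine h1.trans ((norm_add_le _ _).trans (add_le_add ((norm_add_le _ _).trans ?_) h6))
    rw [hK, add_mul, one_mul, ← h3]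
    exact add_le_add le_rfl h5
  have hall : ∀ u, d * ‖u‖ ≤ K * ‖X u - (w : ℂ) • u‖ := by
    intro u
    refine dense_test.induction (P := fun u => d * ‖u‖ ≤ K * ‖X u - (w : ℂ) • u‖) ?_ ?_ u
    · intro u hu
      obtain ⟨φ, hφ, rfl⟩ := exists_test_of_mem_span hu
      exact htest φ hφ
    · exact isClosed_le (by fun_prop) (by fun_prop)
  refine notMem_spectrum_of_le_norm (kinRes_isSelfAdjoint (-c)) (div_pos hd hK1) (fun ψ => ?_)
    (show w ∈ spectrum ℝ X from ?_)
  · rw [div_mul_eq_mul_div, div_le_iff₀ hK1, mul_comm _ K]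
    exact hall ψ
  · have := mem_spectrum_kinRes hT he (E := E) (by linarith)
    rwa [sub_neg_eq_add] at this

end FreeSpectrum

end MagneticBCS

namespace MagneticBCS

/-! ### Isolated eigenvalues in a weak magnetic field -/

section WeakField

variable {T μ : ℝ} {V : R3 → ℝ}

theorem mem_mulGraph_weighted_potential (hV : IsBdd V) (hV' : IsBdd fun x => (1 + ‖x‖ ^ 2) * V x)
    (u : L2) : (mulB V u, mulB (fun x => (1 + ‖x‖ ^ 2) * V x) u) ∈
      mulGraph (fun x => 1 + ‖x‖ ^ 2) := by
  rw [mem_mulGraph]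
  filter_upwards [coeFn_mulB hV u, coeFn_mulB hV' u] with x h1 h2
  rw [h1, h2]; push_cast; ring

/-- The resolvent equation at `-c` rewritten around the spectral parameter `l`; the field enters
only through the kinetic inverse at `l`. -/
theorem IsShiftInverse.eq_apply_iff {a : R3 → R3} (hT : 0 < T) (ha : Continuous a) (hV : IsBdd V)
    {l c : ℝ} (hl : l < symbolMin T μ) {G : L2 →L[ℂ] L2}
    (hG : IsShiftInverse (bcsOperator T μ a V) c G) (φ ψ : L2) :
    φ = G ψ ↔ φ = kinRes T μ l (magRes a) (ψ + mulB V φ - ((l + c : ℝ) : ℂ) • φ) := by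
  have h1 := hG φ (ψ - (c : ℂ) • φ)
  rw [sub_add_cancel, mem_graph_bcsOperator hT ha hV hl] at h1
  rw [← h1, show ψ - (c : ℂ) • φ + mulB V φ - (l : ℂ) • φ =
    ψ + mulB V φ - ((l + c : ℝ) : ℂ) • φ by push_cast; module]

theorem IsShiftInverse.eq_of_isolated {H : Type*} [NormedAddCommGroup H] [InnerProductSpace ℂ H]
    [CompleteSpace H] {S : H →ₗ.[ℂ] H} {c l ε : ℝ} (hb : 0 < l + c) (hε : 0 < ε)
    (hS : opSpectrum S ∩ Metric.ball (l : ℂ) ε = {(l : ℂ)}) {G : H →L[ℂ] H} (hG : IsSelfAdjoint G)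
    (hSG : IsShiftInverse S c G) : ∃ r, 0 < r ∧
      ∀ t ∈ spectrum ℝ G, |t - (l + c)⁻¹| < r → t = (l + c)⁻¹ := by
  set b := l + c with hbdef
  have hb1 : 0 < b⁻¹ := inv_pos.2 hb
  refine ⟨min (b⁻¹ / 2) (ε / (2 * b ^ 2)), lt_min (by positivity) (by positivity), ?_⟩
  intro t ht hlt
  have h1 : |t - b⁻¹| < b⁻¹ / 2 := hlt.trans_le (min_le_left _ _)
  have h2 : |t - b⁻¹| < ε / (2 * b ^ 2) := hlt.trans_le (min_le_right _ _)
  have ht2 : b⁻¹ / 2 < t := by linarith [(abs_lt.1 h1).1]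
  have ht0 : 0 < t := (half_pos hb1).trans ht2
  have hz : ((t⁻¹ - c : ℝ) : ℂ) ∈ opSpectrum S ∩ Metric.ball (l : ℂ) ε := by
    have e1 : ((t⁻¹ - c : ℝ) : ℂ) + c = ((t⁻¹ : ℝ) : ℂ) := by push_cast; ring
    refine ⟨?_, ?_⟩
    · rw [hSG.mem_opSpectrum_iff, e1]
      refine ⟨by exact_mod_cast (inv_pos.2 ht0).ne', ?_⟩
      rw [mem_spectrum_complex_iff hG]
      exact ⟨t, ht, by push_cast; rw [inv_inv]⟩
    · rw [Metric.mem_ball, Complex.dist_eq, ← Complex.ofReal_sub, Complex.norm_real,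
        Real.norm_eq_abs]
      have e2 : t⁻¹ - c - l = (b⁻¹ - t) * (t⁻¹ * b) := by
        field_simp; rw [hbdef]; ring
      have h3 : t⁻¹ ≤ 2 * b := by
        rw [inv_le_comm₀ ht0 (by positivity), mul_inv]; linarith
      have h4 : 0 < t⁻¹ * b := mul_pos (inv_pos.2 ht0) hb
      rw [e2, abs_mul, abs_sub_comm, abs_of_pos h4]
      calc _ < ε / (2 * b ^ 2) * (t⁻¹ * b) := mul_lt_mul_of_pos_right h2 h4
        _ ≤ ε / (2 * b ^ 2) * (2 * b * b) := mul_le_mul_of_nonneg_left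
            (mul_le_mul_of_nonneg_right h3 hb.le) (by positivity)
        _ = ε := by field_simp
  rw [hS] at hz
  have h5 : t⁻¹ - c = l := Complex.ofReal_injective hz
  rw [hbdef, ← h5, sub_add_cancel, inv_inv]

-- Part (a) for any family of potentials with Lipschitz constant O(h²). The decay of `V` gives the
-- O(h²) comparison, which feeds both the quasimode bound and the lower bound on the complement of
-- the eigenspace.
set_option maxHeartbeats 800000 in
theorem exists_eigenvalues_weak_field (hT : 0 < T) (hV : IsBdd V)
    (hV' : IsBdd fun x => (1 + ‖x‖ ^ 2) * V x) {a : ℝ → R3 → R3} {L : ℝ} (hL : 0 < L)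
    (ha : ∀ h, 0 < h → IsLipPotential (a h) (L * h ^ 2)) {l : ℝ} {m : ℕ} (hm : 0 < m)
    (hl : IsIsolatedEigenvalue (bcsOperator T μ 0 V) l)
    (hlm : Module.finrank ℂ (opEigenspace (bcsOperator T μ 0 V) (l : ℂ)) = m) :
    ∃ ε h₀ C : ℝ, 0 < ε ∧ 0 < h₀ ∧ 0 < C ∧ ∀ h : ℝ, 0 < h → h ≤ h₀ →
      ∃ lam : Fin m → ℝ,
        (∀ i, Module.finrank ℂ (opEigenspace (bcsOperator T μ (a h) V) (lam i : ℂ)) =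
          (Finset.univ.filter fun j => lam j = lam i).card) ∧
        opSpectrum (bcsOperator T μ (a h) V) ∩ Metric.ball (l : ℂ) ε =
          Set.range (fun i => (lam i : ℂ)) ∧
        (∀ i, |lam i - l| ≤ C * h ^ 2) ∧
        ‖spectralProjection (bcsOperator T μ (a h) V) (Set.range lam) -
          spectralProjection (bcsOperator T μ 0 V) {l}‖ ≤ C * h ^ 2 := by
  obtain ⟨-, ε₀, hε₀, hiso⟩ := hl
  have hls := lt_symbolMin_of_isolated hT hV hV' hε₀ hiso
  have hs0 := symbolMin_pos (μ := μ) hT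
  set W := mulB V with hW
  set W₂ := mulB fun x => (1 + ‖x‖ ^ 2) * V x with hW₂
  have hv := norm_nonneg W
  -- Large enough for the Neumann argument and for `l + c > 0`; it does not depend on `h`.
  set c := 2 * ‖W‖ + |l| + 1 with hc
  have hcW : 2 * ‖W‖ ≤ c := by linarith [abs_nonneg l]
  have hb : 0 < l + c := by linarith [neg_abs_le l]
  have hcs : 0 < symbolMin T μ + c := by linarith [abs_nonneg l]
  obtain ⟨G₀, hG₀, -, hS₀⟩ := exists_isShiftInverse (μ := μ) hT continuous_zero hV hcW
  set b := l + c with hbdef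
  have hb1 : 0 < b⁻¹ := inv_pos.2 hb
  have hlc : (((l : ℂ) + c)⁻¹) = ((b⁻¹ : ℝ) : ℂ) := by rw [hbdef]; push_cast; rfl
  have hlc0 : (l : ℂ) + c ≠ 0 := by exact_mod_cast hb.ne'
  set K := opEigenspace (bcsOperator T μ 0 V) (l : ℂ) with hK
  have : FiniteDimensional ℂ K := FiniteDimensional.of_finrank_pos (by rw [hlm]; exact hm)
  have hKmem : ∀ ψ, ψ ∈ K ↔ G₀ ψ = ((b⁻¹ : ℝ) : ℂ) • ψ := fun ψ => by
    rw [hK, hS₀.mem_opEigenspace_iff hlc0, hlc]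
  set P : L2 →L[ℂ] L2 := K.starProjection with hP
  have hPs : IsSelfAdjoint P := isSelfAdjoint_starProjection K
  have hPP : P * P = P := K.isIdempotentElem_starProjection
  have hPr : LinearMap.range (P : L2 →ₗ[ℂ] L2) = K := Submodule.range_starProjection K
  have hPG : ∀ ψ, G₀ (P ψ) = ((b⁻¹ : ℝ) : ℂ) • P ψ := fun ψ =>
    (hKmem _).1 (Submodule.starProjection_apply_mem K ψ)
  have : FiniteDimensional ℂ (LinearMap.range (P : L2 →ₗ[ℂ] L2)) := by rw [hPr]; infer_instance
  have hPproj : spectralProjection (bcsOperator T μ 0 V) {l} = P := by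
    refine spectralProjection_eq hPs hPP ?_
    rw [hPr]; simp [hK]
  obtain ⟨κ, hκ, hκs⟩ := hS₀.eq_of_isolated hb hε₀ hiso hG₀
  have hgap := exists_gap_of_isolated hG₀ hκ hκs hPs hPP fun ψ hψ =>
    Submodule.starProjection_eq_self_iff.2 ((hKmem ψ).2 hψ)
  obtain ⟨C₁, hC₁, hres⟩ := exists_norm_kinRes_sub_le hT μ L (M := -l) hls
  set x := (symbolMin T μ - l)⁻¹ with hx
  have hx0 : 0 < x := inv_pos.2 (sub_pos.2 hls)
  set η := C₁ * L * ‖W₂‖ with hη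
  have hη0 : 0 ≤ η := by positivity
  set q := b⁻¹ * ‖G₀ * W‖ / κ + 1 with hq
  have hq0 : 0 < q := by positivity
  set κ' := b⁻¹ / 2 / (2 + q * b * x) with hκ'
  have hκ'0 : 0 < κ' := by positivity
  obtain ⟨ε, δ₀, C, hε, hδ₀, hC, hmain⟩ := exists_eigenvalues_of_isShiftInverse (c := c) hb hκ'0
    hPs hPP (by rw [hPr]; exact hlm : _ = m)
  set γ := 2 / (symbolMin T μ + c) with hγ
  have hγ0 : 0 < γ := by positivity
  set D := (b⁻¹ * (γ * ‖W‖) + γ + b⁻¹) * η with hD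
  have hD0 : 0 ≤ D := by positivity
  -- The two fractions ensure `D h² ≤ δ₀`, as needed for the eigenvalue count, and `q η h² ≤ 1/2`,
  -- as needed for the lower bound.
  refine ⟨ε, min 1 (min (δ₀ / (D + 1)) (1 / (2 * (q * η + 1)))), C * D + 1, hε,
    lt_min one_pos (lt_min (by positivity) (by positivity)), by positivity, fun h hh hle => ?_⟩
  have h1 : h ≤ 1 := hle.trans (min_le_left _ _)
  have hsq : h ^ 2 ≤ h := by nlinarith
  have h2 : D * h ^ 2 ≤ δ₀ := by
    have := hle.trans ((min_le_right _ _).trans (min_le_left _ _))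
    rw [le_div_iff₀ (by positivity)] at this
    nlinarith
  have h3 : q * (η * h ^ 2) ≤ 1 / 2 := by
    have := hle.trans ((min_le_right _ _).trans (min_le_right _ _))
    rw [le_div_iff₀ (by positivity)] at this
    have := mul_le_mul_of_nonneg_left hsq (mul_nonneg hq0.le hη0)
    nlinarith
  have hah := ha h hh
  obtain ⟨G, hG, hGn, hS⟩ := exists_isShiftInverse (μ := μ) hT hah.cont hV hcW
  have hXX : ∀ φ, ‖kinRes T μ l (magRes (a h)) (W φ) - kinRes T μ l (magRes 0) (W φ)‖ ≤
      η * h ^ 2 * ‖φ‖ := fun φ => by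
    have h4 := hres (a h) (L * h ^ 2) hah (mul_le_of_le_one_right hL.le (hsq.trans h1)) l
      (neg_neg l).le le_rfl (W φ) (W₂ φ) (mem_mulGraph_weighted_potential hV hV' φ)
    have h5 := mul_le_mul_of_nonneg_left (W₂.le_opNorm φ) (by positivity : 0 ≤ C₁ * (L * h ^ 2))
    have h6 : C₁ * (L * h ^ 2) * (‖W₂‖ * ‖φ‖) = η * h ^ 2 * ‖φ‖ := by rw [hη]; ring
    exact h4.trans (h5.trans h6.le)
  have e₀ := hS₀.eq_apply_iff hT continuous_zero hV hls
  have e₁ := hS.eq_apply_iff hT hah.cont hV hls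
  have hin : ∀ ψ, ‖G (P ψ) - ((b⁻¹ : ℝ) : ℂ) • P ψ‖ ≤ D * h ^ 2 * ‖P ψ‖ := fun ψ => by
    refine (norm_quasimode_le hb e₀ e₁ hXX (hPG ψ)).trans ?_
    refine mul_le_mul_of_nonneg_right ?_ (norm_nonneg _)
    rw [hD, mul_assoc _ η]
    refine mul_le_mul_of_nonneg_right ?_ (by positivity)
    have i1 : ‖G * W‖ ≤ γ * ‖W‖ :=
      (norm_mul_le _ _).trans (mul_le_mul_of_nonneg_right hGn (norm_nonneg _))
    have i2 := mul_le_mul_of_nonneg_left i1 hb1.le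
    linarith
  have hout : ∀ ψ, κ' * ‖ψ - P ψ‖ ≤ ‖G (ψ - P ψ) - ((b⁻¹ : ℝ) : ℂ) • (ψ - P ψ)‖ :=
    le_norm_of_perturbed_resolvent hb hκ
      (norm_kinRes_le hT hls (spectrum_magRes (a h))) e₀ e₁ hXX hPs hPP hPG hgap h3
  obtain ⟨lam, l1, l2, l3, l4⟩ := hmain (bcsOperator T μ (a h) V) G (D * h ^ 2) (by positivity) h2
    hG hS hin hout
  have hle1 : C * (D * h ^ 2) ≤ (C * D + 1) * h ^ 2 := by nlinarith [sq_nonneg h]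
  exact ⟨lam, l1, l2, fun i => (l3 i).trans hle1, by rw [hPproj]; exact l4.trans hle1⟩

end WeakField

end MagneticBCS

namespace MagneticBCS

/-! ### Compactness of the resolvent times a decaying potential -/

section Kernel

open Filter Topology

variable {α : Type*} [MeasurableSpace α] {μ : Measure α} {E : Type*} [NormedAddCommGroup E]
  [NormedSpace ℂ E] [CompleteSpace E]

/-- The operator `g ↦ ∫ g(x) k(x) dx` with a vector-valued square-integrable kernel. -/
noncomputable def kernelOp : Lp E 2 μ →L[ℂ] Lp ℂ 2 μ →L[ℂ] E :=
  (ContinuousLinearMap.compL ℂ (Lp ℂ 2 μ) (Lp E 1 μ) E (L1.integralCLM' ℂ)) ∘L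
    ((ContinuousLinearMap.lsmul ℂ ℂ (E := E)).holderL μ 2 2 1).flip

theorem kernelOp_apply (k : Lp E 2 μ) (g : Lp ℂ 2 μ) : kernelOp k g = ∫ x, g x • k x ∂μ := by
  have h1 : kernelOp k g =
      L1.integral ((ContinuousLinearMap.lsmul ℂ ℂ (E := E)).holder (r := 1) g k) := by
    rw [L1.integral_eq' ℂ]; rfl
  rw [h1, L1.integral_eq_integral]
  exact integral_congr_ae ((ContinuousLinearMap.lsmul ℂ ℂ (E := E)).coeFn_holder (r := 1) g k)

/-- An indicator times a fixed vector gives an operator of rank at most one. Such kernels span a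
dense set, the operator depends continuously on its kernel, and compact operators are closed in
norm. -/
theorem isCompactOperator_kernelOp (k : Lp E 2 μ) : IsCompactOperator (kernelOp k) := by
  refine Lp.induction (by norm_num) (fun k => IsCompactOperator (kernelOp (k : Lp E 2 μ)))
    (fun c s hs hμs => ?_) (fun f g hf hg _ h1 h2 => ?_) ?_ k
  · have hl : ∀ g : Lp ℂ 2 μ, kernelOp (indicatorConstLp 2 hs hμs.ne c) g =
        (∫ x in s, g x ∂μ) • c := fun g => by
      rw [kernelOp_apply, ← integral_smul_const, ← integral_indicator hs]
      refine integral_congr_ae ?_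
      filter_upwards [indicatorConstLp_coeFn (p := 2) (hs := hs) (hμs := hμs.ne) (c := c)] with x hx
      rw [hx]
      by_cases h : x ∈ s <;> simp [h]
    have h1 : ⇑(kernelOp (indicatorConstLp 2 hs hμs.ne c) : Lp ℂ 2 μ →L[ℂ] E) =
        (ContinuousLinearMap.toSpanSingleton ℂ c) ∘
          (kernelOp (indicatorConstLp 2 hs hμs.ne (1 : ℂ)) : Lp ℂ 2 μ →L[ℂ] ℂ) := by
      ext g
      rw [hl, Function.comp_apply, kernelOp_apply, ContinuousLinearMap.toSpanSingleton_apply,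
        ← integral_indicator hs]
      congr 1
      refine integral_congr_ae ?_
      filter_upwards [indicatorConstLp_coeFn (p := 2) (hs := hs) (hμs := hμs.ne) (c := (1 : ℂ))]
        with x hx
      rw [hx]
      by_cases h : x ∈ s <;> simp [h]
    change IsCompactOperator (kernelOp (indicatorConstLp 2 hs hμs.ne c) : Lp ℂ 2 μ →L[ℂ] E)
    rw [h1]
    exact (isCompactOperator_of_locallyCompactSpace_dom (kernelOp (indicatorConstLp 2 hs hμs.ne
      (1 : ℂ)) : Lp ℂ 2 μ →L[ℂ] ℂ)).clm_comp _
  · rw [map_add]; exact h1.add h2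
  · exact isClosed_setOfPred_isCompactOperator.preimage
      (kernelOp : Lp E 2 μ →L[ℂ] Lp ℂ 2 μ →L[ℂ] E).continuous

end Kernel

section Compact

open Filter Topology

theorem norm_transl_sub_le_sum {u : L2} {χ : Fin 3 → L2} (h : ∀ j, IsMagneticDeriv 0 j u (χ j))
    (c : R3) : ‖transl c u - u‖ ≤ ∑ j, ‖c‖ * ‖χ j‖ := by
  have hc : c = c 0 • unitVec 0 + (c 1 • unitVec 1 + c 2 • unitVec 2) := by
    ext i; fin_cases i <;> simp
  have key : ∀ (v : L2) (d e : R3), ‖transl (d + e) v - v‖ ≤ ‖transl d v - v‖ + ‖transl e v - v‖ :=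
    fun v d e => by
      have e1 : transl (d + e) v - v = transl d (transl e v - v) + (transl d v - v) := by
        rw [transl_add, map_sub]; abel
      rw [e1, add_comm]
      refine (norm_add_le _ _).trans (le_of_eq ?_)
      rw [LinearIsometry.norm_map]
  have hj : ∀ j, ‖transl (c j • unitVec j) u - u‖ ≤ ‖c‖ * ‖χ j‖ := fun j =>
    (norm_transl_sub_le (h j) _).trans (mul_le_mul_of_nonneg_right
      (PiLp.norm_apply_le c j) (norm_nonneg _))
  rw [Fin.sum_univ_three]
  conv_lhs => rw [hc]
  refine (key _ _ _).trans ?_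
  have := key u (c 1 • unitVec 1) (c 2 • unitVec 2)
  linarith [hj 0, hj 1, hj 2]

theorem continuous_transl {u : L2} {χ : Fin 3 → L2} (h : ∀ j, IsMagneticDeriv 0 j u (χ j)) :
    Continuous fun c => transl c u := by
  set K := ∑ j, ‖χ j‖ with hK
  have hlip : ∀ x y : R3, ‖transl x u - transl y u‖ ≤ K * ‖x - y‖ := fun x y => by
    have e : transl x u - transl y u = transl y (transl (x - y) u - u) := by
      rw [map_sub, ← transl_add, add_sub_cancel]
    rw [e, LinearIsometry.norm_map]
    refine (norm_transl_sub_le_sum h _).trans (le_of_eq ?_)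
    rw [hK, Finset.sum_mul]
    exact Finset.sum_congr rfl fun j _ => mul_comm _ _
  have hK0 : 0 ≤ K := Finset.sum_nonneg fun j _ => norm_nonneg _
  exact (LipschitzWith.of_dist_le_mul (K := ⟨K, hK0⟩) fun x y => by
    rw [dist_eq_norm, dist_eq_norm]; exact hlip x y).continuous

theorem continuous_transl_test {φ : R3 → ℂ} (hφ : IsTest φ) :
    Continuous fun c => transl c (toL2 φ) :=
  continuous_transl fun j => isMagneticDeriv_test continuous_zero j hφ

/-- Averaging over translations. -/
theorem inner_integral_transl {f : R3 → ℂ} (hf : Integrable f) {fL u : L2}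
    (hfL : (fL : R3 → ℂ) =ᵐ[volume] f) {ρ : R3 → ℂ} (hρ : IsTest ρ)
    (hint : Integrable fun x => f x • transl (-x) (toL2 ρ)) :
    ⟪u, ∫ x, f x • transl (-x) (toL2 ρ)⟫_ℂ = ∫ z, ρ z * ⟪transl z u, fL⟫_ℂ := by
  set F : R3 → R3 → ℂ := fun x z => f x * (ρ z * (starRingEnd ℂ) (u (x + z))) with hF
  have hin : ∀ x, ⟪u, f x • transl (-x) (toL2 ρ)⟫_ℂ = ∫ z, F x z := fun x => by
    have e1 : ⟪u, transl (-x) (toL2 ρ)⟫_ℂ = ∫ z, (starRingEnd ℂ) (u (x + z)) * ρ z := by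
      have h := inner_transl x u (toL2 ρ)
      rw [← h, inner_toL2 (coeFn_transl x u) (coeFn_toL2 hρ.memLp)]
      refine integral_congr_ae (Eventually.of_forall fun z => ?_)
      simp only [add_comm]
    rw [inner_smul_right, e1, ← integral_const_mul]
    refine integral_congr_ae (Eventually.of_forall fun z => ?_)
    simp only [hF]; ring
  have hL2 : ∀ x, MemLp (fun z => (starRingEnd ℂ) (u (x + z))) 2 volume := fun x => by
    have h1 : MemLp (fun z => u (x + z)) 2 volume :=
      (Lp.memLp u).comp_measurePreserving (measurePreserving_add_left volume x)
    exact h1.star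
  -- Absolute integrability for Fubini, from integrability of `f` and Cauchy–Schwarz in `z`.
  have hFint : Integrable (Function.uncurry F) (volume.prod volume) := by
    have hmeas : AEStronglyMeasurable (Function.uncurry F) (volume.prod volume) := by
      refine (hf.1.comp_fst).mul ((hρ.contDiff.continuous.aestronglyMeasurable.comp_snd).mul ?_)
      have h1 : AEStronglyMeasurable (fun p : R3 × R3 => (u : R3 → ℂ) (p.1 + p.2))
          (volume.prod volume) :=
        (Lp.aestronglyMeasurable u).comp_quasiMeasurePreserving
          (quasiMeasurePreserving_add volume volume)
      exact Complex.continuous_conj.comp_aestronglyMeasurable h1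
    rw [integrable_prod_iff hmeas]
    have hx : ∀ x, Integrable (fun z => ρ z * (starRingEnd ℂ) (u (x + z))) volume := fun x =>
      hρ.memLp.integrable_mul (hL2 x)
    refine ⟨Eventually.of_forall fun x => (hx x).const_mul (f x), ?_⟩
    refine Integrable.mono' (hf.norm.mul_const ((∫ z, ‖ρ z‖ ^ 2) + ∫ z, ‖(u : R3 → ℂ) z‖ ^ 2)) hmeas.norm.integral_prod_right'
      (Eventually.of_forall fun x => ?_)
    have h1 : ∫ z, ‖F x z‖ = ‖f x‖ * ∫ z, ‖ρ z * (starRingEnd ℂ) (u (x + z))‖ := by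
      rw [← integral_const_mul]
      refine integral_congr_ae (Eventually.of_forall fun z => ?_)
      simp only [hF, norm_mul]
    change ‖∫ z, ‖F x z‖‖ ≤ _
    rw [Real.norm_of_nonneg (integral_nonneg fun z => norm_nonneg _), h1]
    refine mul_le_mul_of_nonneg_left ?_ (norm_nonneg _)
    have h2 : Integrable (fun z => ‖ρ z‖ ^ 2) := hρ.memLp.integrable_norm_pow (by norm_num)
    have h3 : Integrable (fun z => ‖(u : R3 → ℂ) (x + z)‖ ^ 2) := by
      simpa using (hL2 x).integrable_norm_pow (by norm_num)
    rw [← integral_add_left_eq_self (fun z => ‖(u : R3 → ℂ) z‖ ^ 2) x, ← integral_add h2 h3]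
    refine integral_mono (hx x).norm (h2.add h3) fun z => ?_
    simp only [norm_mul, RCLike.norm_conj]
    nlinarith [sq_nonneg (‖ρ z‖ - ‖(u : R3 → ℂ) (x + z)‖), sq_nonneg (‖ρ z‖),
      sq_nonneg ‖(u : R3 → ℂ) (x + z)‖]
  have h1 : ∫ x, ⟪u, f x • transl (-x) (toL2 ρ)⟫_ℂ = ∫ z, ρ z * ⟪transl z u, fL⟫_ℂ := by
    simp_rw [hin]
    rw [integral_integral_swap hFint]
    refine integral_congr_ae (Eventually.of_forall fun z => ?_)
    simp only
    rw [inner_toL2 (coeFn_transl z u) hfL, ← integral_const_mul]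
    refine integral_congr_ae (Eventually.of_forall fun x => ?_)
    simp only [hF]; ring
  rw [← h1]
  exact ((innerSL ℂ u).integral_comp_comm hint).symm

theorem exists_mollifier {r : ℝ} (hr : 0 < r) : ∃ ρ : R3 → ℝ, IsTest (fun x => (ρ x : ℂ)) ∧
    (∀ x, 0 ≤ ρ x) ∧ ∫ x, ρ x = 1 ∧ ∀ x, ρ x ≠ 0 → ‖x‖ ≤ r := by
  set b : ContDiffBump (0 : R3) := ⟨r / 2, r, half_pos hr, half_lt_self hr⟩ with hb
  refine ⟨b.normed volume, ⟨Complex.ofRealCLM.contDiff.comp b.contDiff_normed, ?_⟩,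
    fun x => b.nonneg_normed x, b.integral_normed, fun x hx => ?_⟩
  · exact (b.hasCompactSupport_normed (μ := volume)).comp_left (g := fun t : ℝ => (t : ℂ)) (by simp)
  · have h1 : x ∈ Function.support (b.normed volume) := hx
    rw [b.support_normed_eq, mem_ball_zero_iff] at h1
    exact h1.le

theorem norm_grad_magRes_le {a : R3 → R3} {w : L2} {χ : Fin 3 → L2}
    (h : HasMagLaplacian a (magRes a w) χ (w - magRes a w)) (j : Fin 3) : ‖χ j‖ ≤ 2 * ‖w‖ := by
  have h1 := congrArg norm (sum_norm_sq_grad h)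
  have h2 : ‖magRes a w‖ ≤ ‖w‖ := by
    simpa using (magRes a).le_of_opNorm_le (norm_magRes_le a) w
  have h3 : ‖w - magRes a w‖ ≤ 2 * ‖w‖ := (norm_sub_le _ _).trans (by linarith)
  rw [Complex.norm_real, Real.norm_of_nonneg (Finset.sum_nonneg fun j _ => sq_nonneg _)] at h1
  have h4 : ‖χ j‖ ^ 2 ≤ ‖w‖ * (2 * ‖w‖) :=
    (Finset.single_le_sum (f := fun j => ‖χ j‖ ^ 2) (fun j _ => sq_nonneg _)
      (Finset.mem_univ j)).trans (h1.le.trans ((norm_inner_le_norm _ _).trans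
        (mul_le_mul h2 h3 (norm_nonneg _) (norm_nonneg _))))
  nlinarith [norm_nonneg w, norm_nonneg (χ j)]

/-- `B` is multiplication by `V` followed by mollification at scale `r`. Its kernel `V(x) ρ(· - x)`
is square integrable with values in L² because `V` is. The mollification costs O(r) once the
resolvent is applied, since translating an element of its range by `z` changes it by O(|z|). -/
theorem exists_compact_approx {V : R3 → ℝ} (hV : IsBdd V)
    (hV2 : MemLp (fun x => (V x : ℂ)) 2 volume) {r : ℝ} (hr : 0 < r) : ∃ B : L2 →L[ℂ] L2,
      IsCompactOperator B ∧ ‖magRes 0 * B - magRes 0 * mulB V‖ ≤ 6 * r * ‖mulB V‖ := by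
  obtain ⟨ρ, hρ, hρ0, hρ1, hρr⟩ := exists_mollifier hr
  set ρc : R3 → ℂ := fun x => (ρ x : ℂ) with hρc
  have hk : MemLp (fun x => (V x : ℂ) • transl (-x) (toL2 ρc)) 2 volume := by
    have hm : AEStronglyMeasurable (fun x => (V x : ℂ) • transl (-x) (toL2 ρc)) volume :=
      hV2.1.smul ((continuous_transl_test hρ).comp continuous_neg).aestronglyMeasurable
    refine MemLp.of_le_mul (c := ‖toL2 ρc‖) hV2 hm (Eventually.of_forall fun x => ?_)
    rw [norm_smul, LinearIsometry.norm_map, mul_comm]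
  refine ⟨kernelOp (hk.toLp _), isCompactOperator_kernelOp _, ?_⟩
  refine ContinuousLinearMap.opNorm_le_bound _ (by positivity) fun g => ?_
  have hf : Integrable (fun x => (V x : ℂ) * (g : R3 → ℂ) x) := hV2.integrable_mul (Lp.memLp g)
  have hB : kernelOp (hk.toLp _) g =
      ∫ x, ((V x : ℂ) * (g : R3 → ℂ) x) • transl (-x) (toL2 ρc) := by
    rw [kernelOp_apply]
    refine integral_congr_ae ?_
    filter_upwards [hk.coeFn_toLp] with x hx
    rw [hx, smul_smul, mul_comm]
  have hint : Integrable fun x => ((V x : ℂ) * (g : R3 → ℂ) x) • transl (-x) (toL2 ρc) := by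
    refine (hf.norm.mul_const ‖toL2 ρc‖).mono' ?_ (Eventually.of_forall fun x => ?_)
    · exact hf.1.smul ((continuous_transl_test hρ).comp continuous_neg).aestronglyMeasurable
    · rw [norm_smul, LinearIsometry.norm_map]
  refine norm_le_of_inner (by positivity) fun w => ?_
  obtain ⟨χ, hχ⟩ := exists_grad_magRes 0 w
  set u := magRes 0 w with hu
  have e1 : ⟪w, (magRes 0 * kernelOp (hk.toLp _) - magRes 0 * mulB V) g⟫_ℂ =
      ⟪u, kernelOp (hk.toLp _) g⟫_ℂ - ⟪u, mulB V g⟫_ℂ := by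
    rw [sub_apply, inner_sub_right, mul_apply_eq_comp, mul_apply_eq_comp,
      ← inner_of_isSelfAdjoint (magRes_isSelfAdjoint 0),
      ← inner_of_isSelfAdjoint (magRes_isSelfAdjoint 0)]
  have e2 : ⟪u, kernelOp (hk.toLp _) g⟫_ℂ = ∫ z, ρc z * ⟪transl z u, mulB V g⟫_ℂ := by
    rw [hB]; exact inner_integral_transl hf (coeFn_mulB hV g) hρ hint
  have hρi : Integrable ρ volume :=
    (hρ.contDiff.continuous.integrable_of_hasCompactSupport (μ := volume) hρ.compact).re
  have e3 : ⟪u, mulB V g⟫_ℂ = ∫ z, ρc z * ⟪u, mulB V g⟫_ℂ := by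
    rw [integral_mul_const, show ∫ z, ρc z = ((∫ z, ρ z : ℝ) : ℂ) from integral_ofReal, hρ1]; simp
  have hbound : ∀ z, ‖ρc z * (⟪transl z u, mulB V g⟫_ℂ - ⟪u, mulB V g⟫_ℂ)‖ ≤
      ρ z * (6 * r * ‖w‖ * ‖mulB V g‖) := fun z => by
    rw [← inner_sub_left, norm_mul, hρc, Complex.norm_real, Real.norm_of_nonneg (hρ0 z)]
    by_cases h0 : ρ z = 0
    · rw [h0, zero_mul, zero_mul]
    refine mul_le_mul_of_nonneg_left ((norm_inner_le_norm _ _).trans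
      (mul_le_mul_of_nonneg_right ?_ (norm_nonneg _))) (hρ0 z)
    refine (norm_transl_sub_le_sum hχ.1 z).trans ?_
    have : ∀ j, ‖z‖ * ‖χ j‖ ≤ r * (2 * ‖w‖) := fun j =>
      mul_le_mul (hρr z h0) (norm_grad_magRes_le hχ j) (norm_nonneg _) hr.le
    refine (Finset.sum_le_sum fun j _ => this j).trans (le_of_eq ?_)
    simp; ring
  have hz1 : Integrable fun z => ρc z * ⟪transl z u, mulB V g⟫_ℂ := by
    refine Continuous.integrable_of_hasCompactSupport ?_ hρ.compact.mul_right
    exact hρ.contDiff.continuous.mul ((continuous_transl hχ.1).inner continuous_const)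
  have hz2 : Integrable fun z => ρc z * ⟪u, mulB V g⟫_ℂ := hρi.ofReal.mul_const _
  rw [e1, e2, e3, ← integral_sub hz1 hz2]
  simp_rw [← mul_sub]
  refine (norm_integral_le_of_norm_le (hρi.mul_const _) (Eventually.of_forall hbound)).trans ?_
  rw [integral_mul_const, hρ1, one_mul]
  have := mul_le_mul_of_nonneg_left ((mulB V).le_opNorm g) (by positivity : 0 ≤ 6 * r * ‖w‖)
  nlinarith

theorem isCompactOperator_magRes_mul {V : R3 → ℝ} (hV : IsBdd V)
    (hV2 : MemLp (fun x => (V x : ℂ)) 2 volume) : IsCompactOperator (magRes 0 * mulB V) := by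
  choose B hB hBn using fun n : ℕ =>
    exists_compact_approx hV hV2 (Nat.one_div_pos_of_nat (α := ℝ) (n := n))
  refine isCompactOperator_of_tendsto (l := atTop) (F := fun n => magRes 0 * B n) ?_
    (Eventually.of_forall fun n => (hB n).clm_comp (magRes 0))
  rw [tendsto_iff_norm_sub_tendsto_zero]
  refine squeeze_zero (fun n => norm_nonneg _) hBn ?_
  have := (tendsto_one_div_add_atTop_nhds_zero_nat (𝕜 := ℝ)).const_mul (6 * ‖mulB V‖)
  rw [mul_zero] at this
  exact this.congr fun n => by ring

end Compact

end MagneticBCS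

namespace MagneticBCS

/-! ### The bottom of the spectrum -/

section Abstract

variable {H : Type*} [NormedAddCommGroup H] [InnerProductSpace ℂ H] [CompleteSpace H]

theorem kinRes_eq_mul_magRes {T μ e : ℝ} (hT : 0 < T) (he : e < symbolMin T μ) {R : H →L[ℂ] H}
    (hR : IsSelfAdjoint R) (hs : spectrum ℝ R ⊆ Set.Icc 0 1) :
    kinRes T μ e R = kinQuot T μ e R * R := by
  rw [kinRes_eq_mul hT he hR hs]
  exact (((Commute.refl R).cfc_real _ : Commute (kinQuot T μ e R) R)).eq.symm

/-- Points of the spectrum above the norm of the unperturbed resolvent are eigenvalues. -/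
theorem exists_eigenvector_of_norm_lt {X W G : H →L[ℂ] H} (hXW : IsCompactOperator (X * W))
    (hG : ∀ ψ, G ψ = X (ψ + W (G ψ))) {t : ℝ} (ht : ‖X‖ < t) (hts : (t : ℂ) ∈ spectrum ℂ G) :
    ∃ ψ, ψ ≠ 0 ∧ G ψ = (t : ℂ) • ψ := by
  have ht0 : 0 < t := (norm_nonneg X).trans_lt ht
  have hu : IsUnit (algebraMap ℂ (H →L[ℂ] H) t - X) := by
    have h1 : ‖((t : ℂ)⁻¹) • X‖ < 1 := by
      rw [norm_smul, norm_inv, Complex.norm_real, Real.norm_of_nonneg ht0.le, inv_mul_lt_iff₀ ht0,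
        mul_one]
      exact ht
    have h2 := isUnit_one_sub_of_norm_lt_one h1
    have hne : (t : ℂ) ≠ 0 := by exact_mod_cast ht0.ne'
    have h3 : algebraMap ℂ (H →L[ℂ] H) t - X = Units.mk0 (t : ℂ) hne • (1 - ((t : ℂ)⁻¹) • X) := by
      rw [Units.smul_mk0, smul_sub, smul_smul, mul_inv_cancel₀ hne, one_smul,
        Algebra.algebraMap_eq_smul_one]
    rw [h3, isUnit_smul_iff]; exact h2
  obtain ⟨u, hu⟩ := hu
  have hux : ∀ ψ, (u : H →L[ℂ] H) ψ = (t : ℂ) • ψ - X ψ := fun ψ => by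
    rw [hu, Algebra.algebraMap_eq_smul_one, sub_apply, smul_apply, one_apply_eq_self]
  have hGX : G = X + X * W * G := by
    ext ψ
    conv_lhs => rw [hG, map_add]
    rfl
  -- Factorization `t - G = (t-X)(1-N)` with `t - X` invertible and `N` compact; the Fredholm
  -- alternative for `N` then yields an eigenvector of `G`.
  set N := (↑u⁻¹ : H →L[ℂ] H) * (X * W * G) with hN
  have hNc : IsCompactOperator N := (hXW.comp_clm G).clm_comp (↑u⁻¹ : H →L[ℂ] H)
  have huN : (u : H →L[ℂ] H) * N = X * W * G := by rw [hN, ← mul_assoc, Units.mul_inv, one_mul]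
  rcases hNc.hasEigenvalue_or_mem_resolventSet (one_ne_zero (α := ℂ)) with h | h
  · obtain ⟨ψ, hψ⟩ := h.exists_hasEigenvector
    refine ⟨ψ, hψ.2, ?_⟩
    have h1 : N ψ = ψ := by simpa using hψ.apply_eq_smul
    have h2 := DFunLike.congr_fun huN ψ
    rw [mul_apply_eq_comp, h1, hux] at h2
    rw [hGX, add_apply, ← h2]; abel
  · exfalso
    have h1 : IsUnit (1 - N) := by simpa using (spectrum.mem_resolventSet_iff.1 h)
    refine spectrum.mem_iff.1 hts ?_
    have h2 : algebraMap ℂ (H →L[ℂ] H) t - G = u * (1 - N) := by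
      rw [mul_sub, mul_one, huN, hu]
      nth_rewrite 1 [hGX]; abel
    rw [h2]; exact u.isUnit.mul h1

theorem le_norm_sub_smul_of_spectrum {G : H →L[ℂ] H} (hG : IsSelfAdjoint G) {b d : ℝ} (hd : 0 < d)
    (hs : ∀ t ∈ spectrum ℝ G, d ≤ 1 - b * t) (ψ : H) : d * ‖ψ‖ ≤ ‖ψ - (b : ℂ) • G ψ‖ := by
  have hpos : ∀ t ∈ spectrum ℝ G, 0 < 1 - b * t := fun t ht => hd.trans_le (hs t ht)
  have hc : ContinuousOn (fun t : ℝ => (1 - b * t)⁻¹) (spectrum ℝ G) :=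
    ContinuousOn.inv₀ (by fun_prop) fun t ht => (hpos t ht).ne'
  have hlin : cfc (fun t : ℝ => 1 - b * t) G = 1 - (b : ℂ) • G := by
    rw [cfc_sub _ _ G (by fun_prop) (by fun_prop), cfc_const _ _ hG, cfc_const_mul_id b G hG,
      map_one, Complex.coe_smul]
  have h1 : cfc (fun t : ℝ => (1 - b * t)⁻¹) G * (1 - (b : ℂ) • G) = 1 := by
    rw [← hlin, ← cfc_mul _ _ G hc (by fun_prop), ← cfc_one ℝ G]
    exact cfc_congr fun t ht => inv_mul_cancel₀ (hpos t ht).ne'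
  have h2 : ‖cfc (fun t : ℝ => (1 - b * t)⁻¹) G‖ ≤ d⁻¹ := norm_cfc_le (inv_pos.2 hd).le
    fun t ht => by
      rw [Real.norm_of_nonneg (inv_pos.2 (hpos t ht)).le]
      exact inv_anti₀ hd (hs t ht)
  have h3 := ContinuousLinearMap.le_of_opNorm_le _ h2 (ψ - (b : ℂ) • G ψ)
  have h4 : cfc (fun t : ℝ => (1 - b * t)⁻¹) G (ψ - (b : ℂ) • G ψ) = ψ :=
    DFunLike.congr_fun h1 ψ
  rwa [h4, ← div_eq_inv_mul, le_div_iff₀ hd, mul_comm] at h3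

end Abstract

section Bottom

variable {T μ : ℝ} {V : R3 → ℝ}

theorem isCompactOperator_kinRes_mul (hT : 0 < T) {e : ℝ} (he : e < symbolMin T μ) (hV : IsBdd V)
    (hV2 : MemLp (fun x => (V x : ℂ)) 2 volume) :
    IsCompactOperator (kinRes T μ e (magRes 0) * mulB V) := by
  rw [kinRes_eq_mul_magRes hT he (magRes_isSelfAdjoint 0) (spectrum_magRes 0), mul_assoc]
  exact (isCompactOperator_magRes_mul hV hV2).clm_comp _

/-- Without magnetic field there is no spectrum below the lowest eigenvalue. -/
theorem le_of_mem_spectrum_of_isLowestEigenvalue (hT : 0 < T) (hV : IsBdd V)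
    (hV2 : MemLp (fun x => (V x : ℂ)) 2 volume) {l c : ℝ}
    (hl : IsLowestEigenvalue (bcsOperator T μ 0 V) l) (hls : l < symbolMin T μ) (hb : 0 < l + c)
    {G : L2 →L[ℂ] L2} (hG : IsSelfAdjoint G) (hSG : IsShiftInverse (bcsOperator T μ 0 V) c G) :
    ∀ t ∈ spectrum ℝ G, t ≤ (l + c)⁻¹ := by
  intro t ht
  have he : -c < symbolMin T μ := by linarith
  by_contra! hlt
  have ht0 : 0 < t := (inv_pos.2 hb).trans hlt
  -- As `l` is below the minimum of the symbol, `‖X‖ ≤ 1/(l+c) < t`. So `t` is an eigenvalue of `G`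
  -- and would give an eigenvalue of `K - V` below `l`.
  have hX : ‖kinRes T μ (-c) (magRes 0)‖ < t :=
    (norm_kinRes_le hT he (spectrum_magRes 0)).trans_lt
      ((inv_anti₀ hb (by linarith)).trans_lt hlt)
  have hGX : ∀ ψ, G ψ = kinRes T μ (-c) (magRes 0) (ψ + mulB V (G ψ)) := fun ψ => by
    have := (hSG.eq_apply_iff hT continuous_zero hV he (G ψ) ψ).1 rfl
    rwa [neg_add_cancel, Complex.ofReal_zero, zero_smul, sub_zero] at this
  obtain ⟨ψ, hψ0, hψ⟩ := exists_eigenvector_of_norm_lt (isCompactOperator_kinRes_mul hT he hV hV2)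
    hGX hX ((mem_spectrum_complex_iff hG).2 ⟨t, ht, rfl⟩)
  have e1 : ((t⁻¹ - c : ℝ) : ℂ) + c = ((t⁻¹ : ℝ) : ℂ) := by push_cast; ring
  have h1 : IsEigenvalue (bcsOperator T μ 0 V) (t⁻¹ - c) := by
    intro hbot
    refine hψ0 ((Submodule.mem_bot ℂ).1 (hbot ▸ ?_))
    rw [hSG.mem_opEigenspace_iff (by rw [e1]; exact_mod_cast (inv_pos.2 ht0).ne'), e1, hψ]
    push_cast; rw [inv_inv]
  have h2 := hl.2 _ h1
  have h3 : t ≤ (l + c)⁻¹ := (le_inv_comm₀ ht0 hb).2 (by linarith)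
  linarith

theorem eq_kinRes_of_mem_opEigenspace (hT : 0 < T) (hV : IsBdd V) {a : R3 → R3}
    (ha : Continuous a) {l : ℝ} (hl : l < symbolMin T μ) {ψ : L2} :
    ψ ∈ opEigenspace (bcsOperator T μ a V) (l : ℂ) ↔ ψ = kinRes T μ l (magRes a) (mulB V ψ) := by
  rw [mem_opEigenspace_iff, mem_graph_bcsOperator hT ha hV hl,
    show (l : ℂ) • ψ + mulB V ψ - (l : ℂ) • ψ = mulB V ψ by abel]

/-- The spectral window of part (a) says nothing about eigenvalues far below it. If `l' ≤ l - ε`,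
then up to O(h²) an eigenfunction satisfies the field-free equation at `l'`, where the free operator
has a gap of size at least `ε`. The comparison constant is uniform for `l'` in `[-c, l]`. -/
theorem lt_of_isEigenvalue_weak_field (hT : 0 < T) (hV : IsBdd V)
    (hV' : IsBdd fun x => (1 + ‖x‖ ^ 2) * V x) (hV2 : MemLp (fun x => (V x : ℂ)) 2 volume)
    {a : ℝ → R3 → R3} {L : ℝ} (hL : 0 < L)
    (ha : ∀ h, 0 < h → IsLipPotential (a h) (L * h ^ 2)) {l ε : ℝ}
    (hl : IsLowestEigenvalue (bcsOperator T μ 0 V) l) (hls : l < symbolMin T μ) (hε : 0 < ε) :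
    ∃ h₀, 0 < h₀ ∧ ∀ h, 0 < h → h ≤ h₀ → ∀ l', IsEigenvalue (bcsOperator T μ (a h) V) l' →
      l - ε < l' := by
  set W := mulB V with hW
  set W₂ := mulB fun x => (1 + ‖x‖ ^ 2) * V x with hW₂
  have hv := norm_nonneg W
  have hs0 := symbolMin_pos (μ := μ) hT
  set c := 2 * ‖W‖ + |l| + 1 with hc
  have hcW : 2 * ‖W‖ ≤ c := by linarith [abs_nonneg l]
  have hb : 0 < l + c := by linarith [neg_abs_le l]
  obtain ⟨G, hG, -, hS⟩ := exists_isShiftInverse (μ := μ) hT continuous_zero hV hcW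
  have hspec := le_of_mem_spectrum_of_isLowestEigenvalue hT hV hV2 hl hls hb hG hS
  set g := (l + c)⁻¹ with hg
  have hg0 : 0 < g := inv_pos.2 hb
  obtain ⟨C, hC, hres⟩ := exists_norm_kinRes_sub_le hT μ L (M := c) hls
  set q := ‖G * W‖ / (ε * g) + 1 with hq
  have hq0 : 0 < q := by positivity
  set η := C * L * ‖W₂‖ with hη
  have hη0 : 0 ≤ η := by positivity
  refine ⟨min 1 (1 / (2 * (q * η + 1))), lt_min one_pos (by positivity), fun h hh hle l' hl' => ?_⟩
  have h1 : h ≤ 1 := hle.trans (min_le_left _ _)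
  have hsq : h ^ 2 ≤ h := by nlinarith
  have h3 : q * (η * h ^ 2) ≤ 1 / 2 := by
    have := hle.trans (min_le_right _ _)
    rw [le_div_iff₀ (by positivity)] at this
    have := mul_le_mul_of_nonneg_left hsq (mul_nonneg hq0.le hη0)
    nlinarith
  by_contra! hlt
  have hah := ha h hh
  have hl's : l' < symbolMin T μ := by linarith
  refine hl' ((Submodule.eq_bot_iff _).2 fun ψ hψ => ?_)
  rw [eq_kinRes_of_mem_opEigenspace hT hV hah.cont hl's] at hψ
  rw [← norm_le_zero_iff]
  -- Below `-c` no comparison is needed: there `X V` has norm less than one.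
  rcases lt_or_ge l' (-c) with hcase | hcase
  · have i1 := (kinRes T μ l' (magRes (a h))).le_of_opNorm_le
      (norm_kinRes_le hT hl's (spectrum_magRes (a h))) (W ψ)
    rw [← hψ] at i1
    have hpos : 0 < symbolMin T μ - l' := sub_pos.2 hl's
    rw [← div_eq_inv_mul, le_div_iff₀ hpos] at i1
    have i2 := W.le_opNorm ψ
    have i3 : ‖W‖ + 1 ≤ symbolMin T μ - l' := by linarith [abs_nonneg l]
    have i4 := mul_le_mul_of_nonneg_left i3 (norm_nonneg ψ)
    linarith
  · set X₀ := kinRes T μ l' (magRes 0) with hX₀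
    set r := ψ - X₀ (W ψ) with hr
    have hrn : ‖r‖ ≤ η * h ^ 2 * ‖ψ‖ := by
      have h4 := hres (a h) (L * h ^ 2) hah (mul_le_of_le_one_right hL.le (hsq.trans h1)) l'
        hcase (by linarith) (W ψ) (W₂ ψ) (mem_mulGraph_weighted_potential hV hV' ψ)
      rw [← hψ] at h4
      have h5 := mul_le_mul_of_nonneg_left (W₂.le_opNorm ψ) (by positivity : 0 ≤ C * (L * h ^ 2))
      have h6 : C * (L * h ^ 2) * (‖W₂‖ * ‖ψ‖) = η * h ^ 2 * ‖ψ‖ := by rw [hη]; ring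
      exact h4.trans (h5.trans h6.le)
    set y := ψ - r with hy
    have hy1 : y = X₀ (W ψ) := by rw [hy, hr]; abel
    have hyG : y = G (W r + ((l' + c : ℝ) : ℂ) • y) := by
      rw [hS.eq_apply_iff hT continuous_zero hV hl's, add_sub_right_comm, add_sub_cancel_right,
        ← map_add, show r + y = ψ by rw [hy]; abel]
      exact hy1
    -- For `t ≤ g` one has `(l'+c)t ≤ (l+c-ε)g = 1 - εg`, which is the gap used here.
    have hlow := le_norm_sub_smul_of_spectrum hG (b := l' + c) (mul_pos hε hg0) (fun t ht => by
      have i1 := mul_le_mul_of_nonneg_left (hspec t ht) (by linarith : 0 ≤ l' + c)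
      have i2 : (l + c) * g = 1 := mul_inv_cancel₀ hb.ne'
      have i3 : (l' + c) * g ≤ (l + c - ε) * g := mul_le_mul_of_nonneg_right (by linarith) hg0.le
      linarith) y
    have e1 : y - ((l' + c : ℝ) : ℂ) • G y = G (W r) := by
      nth_rewrite 1 [hyG]
      rw [map_add, map_smul, add_sub_cancel_right]
    rw [e1] at hlow
    have i1 : ‖G (W r)‖ ≤ ‖G * W‖ * ‖r‖ := (G * W).le_opNorm r
    have i2 : ‖y‖ ≤ ‖G * W‖ / (ε * g) * ‖r‖ := by
      rw [div_mul_eq_mul_div, le_div_iff₀ (mul_pos hε hg0), mul_comm]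
      exact hlow.trans i1
    have i3 : ‖ψ‖ ≤ q * ‖r‖ := by
      have e2 : ψ = y + r := by rw [hy]; abel
      rw [hq, add_mul, one_mul]
      conv_lhs => rw [e2]
      exact (norm_add_le _ _).trans (add_le_add i2 le_rfl)
    have i4 := mul_le_mul_of_nonneg_left hrn hq0.le
    have i5 := mul_le_mul_of_nonneg_right h3 (norm_nonneg ψ)
    nlinarith

end Bottom

end MagneticBCS

namespace MagneticBCS

/-! ### The eigenfunction in a weak magnetic field -/

section Eigenfunction

/-- The choice of phase makes `Pβ = sα` with `0 ≤ s ≤ 1`. By Pythagoras `1 - s ≤ 1 - s² = ‖β-Pβ‖² ≤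
‖β-Pβ‖`, so the component along `α` costs no more than the orthogonal one. -/
theorem norm_sub_le_two_mul_of_projection {H : Type*} [NormedAddCommGroup H]
    [InnerProductSpace ℂ H] [CompleteSpace H] {P : H →L[ℂ] H} (hP : IsSelfAdjoint P)
    (hPP : P * P = P) {α β : H} (hα : P α = α) (hrange : ∃ z : ℂ, P β = z • α) (hα1 : ‖α‖ = 1)
    (hβ1 : ‖β‖ = 1) (hre : 0 ≤ (⟪α, β⟫_ℂ).re) (him : (⟪α, β⟫_ℂ).im = 0) :
    ‖β - α‖ ≤ 2 * ‖β - P β‖ := by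
  obtain ⟨z, hz⟩ := hrange
  have h1 : ⟪α, β⟫_ℂ = z := by
    rw [← hα, inner_of_isSelfAdjoint hP, hz, inner_smul_right, inner_self_eq_norm_sq_to_K, hα1]
    simp
  set s := z.re with hs
  have hzs : z = (s : ℂ) := Complex.ext rfl (by rw [← h1]; simpa using him)
  have hs0 : 0 ≤ s := by rw [hs, ← h1]; exact hre
  have hPn : ‖P β‖ = s := by
    rw [hz, hzs, norm_smul, hα1, mul_one, Complex.norm_real, Real.norm_of_nonneg hs0]
  have h2 := norm_sq_eq_add hP hPP β
  rw [hβ1, hPn] at h2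
  have hs1 : s ≤ 1 := by nlinarith [sq_nonneg ‖β - P β‖]
  have h3 : β - α = (β - P β) - ((1 - s : ℝ) : ℂ) • α := by
    rw [hz, hzs]; push_cast; module
  rw [h3]
  refine (norm_sub_le _ _).trans ?_
  rw [norm_smul, hα1, mul_one, Complex.norm_real, Real.norm_of_nonneg (sub_nonneg.2 hs1)]
  have h4 : ‖β - P β‖ ≤ 1 := by nlinarith [norm_nonneg (β - P β)]
  nlinarith [norm_nonneg (β - P β)]

variable {T μ : ℝ} {V : R3 → ℝ}

/-- The weighted energy estimate pairs `p²u` with `g`, so quadratic decay of `u` gives linear decay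
of its gradient. -/
theorem HasMagLaplacian.exists_weighted_grad {a : R3 → R3} (ha : Continuous a) {u g u₂ : L2}
    {χ : Fin 3 → L2} (h : HasMagLaplacian a u χ g)
    (hu₂ : (u, u₂) ∈ mulGraph fun x => 1 + ‖x‖ ^ 2) (j : Fin 3) :
    ∃ v, (χ j, v) ∈ mulGraph (fun x => ‖x‖) ∧ ‖v‖ ≤ 2 * ‖u₂‖ * ‖g‖ + 12 * ‖u‖ ^ 2 + 1 := by
  refine exists_mulGraph_norm fun ε hε => ?_
  have h1 := (isWeight_polyWeight hε).sum_norm_sq_grad_le ha h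
  have h2 := Finset.single_le_sum (f := fun j => ‖mulB (polyWeight ε) (χ j)‖ ^ 2)
    (fun j _ => sq_nonneg _) (Finset.mem_univ j)
  have h3 : ‖⟪mulB (fun x => polyWeight ε x ^ 2) u, g⟫_ℂ‖ ≤ ‖u₂‖ * ‖g‖ :=
    (norm_inner_le_norm _ _).trans
      (mul_le_mul_of_nonneg_right (norm_polyWeight_sq_le hε hu₂) (norm_nonneg _))
  nlinarith [sq_nonneg (‖mulB (polyWeight ε) (χ j)‖ - 1)]

-- With `f₀ = Vα + lα` and `f₁ = Vβ + l'β`, the equations are `α = B_0 f₀` and `β = B_h f₁`, where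
-- `B` is the inverse of `K`. Hence `β - α = B_h(f₁-f₀) - (B_0-B_h)f₀`. Both terms lie in the range
-- of `magRes (a h)` with preimages of order `h²`. The weighted bound on `β - α` is only O(1), which
-- suffices because it is later multiplied by a Lipschitz constant of order `h²`.
set_option maxHeartbeats 800000 in
theorem exists_bound_of_near_eigenfunction (hT : 0 < T) (hV : IsBdd V)
    (hV' : IsBdd fun x => (1 + ‖x‖ ^ 2) * V x) {a : ℝ → R3 → R3} {L : ℝ} (hL : 0 < L)
    (ha : ∀ h, 0 < h → IsLipPotential (a h) (L * h ^ 2)) {l : ℝ} (hls : l < symbolMin T μ) {α : L2}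
    (hα : α ∈ opEigenspace (bcsOperator T μ 0 V) (l : ℂ)) (hα1 : ‖α‖ = 1) {D : ℝ} (hD : 0 < D) :
    ∃ h₀ C, 0 < h₀ ∧ 0 < C ∧ h₀ ≤ 1 ∧ ∀ h, 0 < h → h ≤ h₀ → ∀ (l' : ℝ) (β : L2),
      |l' - l| ≤ D * h ^ 2 → β ∈ opEigenspace (bcsOperator T μ (a h) V) (l' : ℂ) → ‖β‖ = 1 →
      ‖β - α‖ ≤ D * h ^ 2 → (∃ Φ, β - α = magRes (a h) Φ ∧ ‖Φ‖ ≤ C * h ^ 2) ∧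
        ∃ u₂, (β - α, u₂) ∈ mulGraph (fun x => 1 + ‖x‖ ^ 2) ∧ ‖u₂‖ ≤ C := by
  set W := mulB V with hW
  set W₂ := mulB fun x => (1 + ‖x‖ ^ 2) * V x with hW₂
  have hs0 := symbolMin_pos (μ := μ) hT
  set l₁ := (l + symbolMin T μ) / 2 with hl₁
  have hl₁s : l₁ < symbolMin T μ := by rw [hl₁]; linarith
  obtain ⟨C₁, hC₁, hquad⟩ := exists_kinRes_quadratic hT μ (M := |l| + 1) hl₁s
  obtain ⟨C₂, hC₂, hsub⟩ := exists_kinRes_sub hT μ L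
  obtain ⟨C₃, hC₃, hquot⟩ := exists_norm_kinQuot_le (H := L2) (T := T) (μ := μ) hT (e := 0) hs0
  have hαX := (eq_kinRes_of_mem_opEigenspace hT hV continuous_zero hls).1 hα
  obtain ⟨α₂, hα₂, hα₂n⟩ := hquad 0 continuous_zero l (by linarith [neg_abs_le l])
    (by rw [hl₁]; linarith) _ _ (mem_mulGraph_weighted_potential hV hV' α)
  rw [← hαX] at hα₂
  have hW₂α : ‖W₂ α‖ ≤ ‖W₂‖ := by simpa [hα1] using W₂.le_opNorm α
  have hα₂n' : ‖α₂‖ ≤ C₁ * ‖W₂‖ := hα₂n.trans (mul_le_mul_of_nonneg_left hW₂α hC₁.le)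
  set F := ‖W₂‖ + |l| * (C₁ * ‖W₂‖) with hF
  have hF0 : 0 ≤ F := by positivity
  set C := C₃ * ((‖W‖ + |l| + 1) * D + D) + C₂ * L * F + 2 * (C₁ * ‖W₂‖) with hC
  have hCp : 0 < C := by
    have : 0 < C₃ * ((‖W‖ + |l| + 1) * D + D) := by positivity
    have : 0 ≤ C₂ * L * F := by positivity
    have : 0 ≤ 2 * (C₁ * ‖W₂‖) := by positivity
    linarith
  refine ⟨min 1 (min (1 / D) ((symbolMin T μ - l) / (2 * D))), C,
    lt_min one_pos (lt_min (by positivity) (div_pos (sub_pos.2 hls) (by positivity))), hCp,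
    min_le_left _ _, ?_⟩
  intro h hh hle l' β hl' hβ hβ1 hβα
  have h1 : h ≤ 1 := hle.trans (min_le_left _ _)
  have hsq : h ^ 2 ≤ h := by nlinarith
  have h2 : D * h ^ 2 ≤ 1 := by
    have := hle.trans ((min_le_right _ _).trans (min_le_left _ _))
    rw [le_div_iff₀ hD] at this
    nlinarith
  have h3 : D * h ^ 2 ≤ l₁ - l := by
    have := hle.trans ((min_le_right _ _).trans (min_le_right _ _))
    rw [le_div_iff₀ (by positivity)] at this
    rw [hl₁]; nlinarith
  have hl'1 : l' ≤ l₁ := by linarith [(abs_le.1 hl').2]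
  have hl'2 : -(|l| + 1) ≤ l' := by linarith [(abs_le.1 hl').1, neg_abs_le l]
  have hl's : l' < symbolMin T μ := hl'1.trans_lt hl₁s
  have hl'abs : |l'| ≤ |l| + 1 := by
    have := abs_add_le (l' - l) l
    rw [sub_add_cancel] at this
    linarith
  have hah := ha h hh
  have hβX := (eq_kinRes_of_mem_opEigenspace hT hV hah.cont hl's).1 hβ
  refine ⟨?_, ?_⟩
  · have eα : α = kinRes T μ 0 (magRes 0) (W α + (l : ℂ) • α) := by
      have := (kinRes_apply_eq (μ := μ) hT hls (spectrum_magRes 0) (W α)).1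
      rwa [← hαX] at this
    have eβ : β = kinRes T μ 0 (magRes (a h)) (W β + (l' : ℂ) • β) := by
      have := (kinRes_apply_eq (μ := μ) hT hl's (spectrum_magRes (a h)) (W β)).1
      rwa [← hβX] at this
    set f₀ := W α + (l : ℂ) • α with hf₀
    set f₁ := W β + (l' : ℂ) • β with hf₁
    have hf₂ : (f₀, W₂ α + (l : ℂ) • α₂) ∈ mulGraph fun x => 1 + ‖x‖ ^ 2 :=
      mulGraph_add (mem_mulGraph_weighted_potential hV hV' α) (mulGraph_smul _ hα₂)
    have hf₂n : ‖W₂ α + (l : ℂ) • α₂‖ ≤ F := by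
      refine (norm_add_le _ _).trans (add_le_add hW₂α ?_)
      rw [norm_smul, Complex.norm_real, Real.norm_eq_abs]
      exact mul_le_mul_of_nonneg_left hα₂n' (abs_nonneg l)
    obtain ⟨Ψ, hΨ, hΨn⟩ := hsub (a h) (L * h ^ 2) hah
      (mul_le_of_le_one_right hL.le (hsq.trans h1)) _ _ hf₂
    have hff : ‖f₁ - f₀‖ ≤ ((‖W‖ + |l| + 1) * D + D) * h ^ 2 := by
      have e : f₁ - f₀ = W (β - α) + (l' : ℂ) • (β - α) + ((l' - l : ℝ) : ℂ) • α := by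
        rw [hf₁, hf₀, map_sub]; push_cast; module
      rw [e]
      have n1 : ‖W (β - α)‖ ≤ ‖W‖ * (D * h ^ 2) :=
        (W.le_opNorm _).trans (mul_le_mul_of_nonneg_left hβα (norm_nonneg _))
      have n2 : ‖(l' : ℂ) • (β - α)‖ ≤ (|l| + 1) * (D * h ^ 2) := by
        rw [norm_smul, Complex.norm_real, Real.norm_eq_abs]
        exact mul_le_mul hl'abs hβα (norm_nonneg _) (by positivity)
      have n3 : ‖((l' - l : ℝ) : ℂ) • α‖ ≤ D * h ^ 2 := by
        rw [norm_smul, hα1, mul_one, Complex.norm_real, Real.norm_eq_abs]; exact hl'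
      refine (norm_add_le _ _).trans ((add_le_add ((norm_add_le _ _).trans (add_le_add n1 n2))
        n3).trans (le_of_eq ?_))
      ring
    have hB : ∀ f, kinRes T μ 0 (magRes (a h)) f = magRes (a h) (kinQuot T μ 0 (magRes (a h)) f) :=
      fun f => DFunLike.congr_fun
        (kinRes_eq_mul hT hs0 (magRes_isSelfAdjoint (a h)) (spectrum_magRes (a h))) f
    refine ⟨kinQuot T μ 0 (magRes (a h)) (f₁ - f₀) - Ψ, ?_, ?_⟩
    · rw [map_sub, ← hB, ← hΨ, map_sub]
      nth_rewrite 1 [eα]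
      nth_rewrite 1 [eβ]
      abel
    · have n1 := (kinQuot T μ 0 (magRes (a h))).le_of_opNorm_le
        (hquot _ (spectrum_magRes (a h))) (f₁ - f₀)
      have n2 := mul_le_mul_of_nonneg_left hff hC₃.le
      have n3 := mul_le_mul_of_nonneg_left hf₂n (by positivity : 0 ≤ C₂ * (L * h ^ 2))
      have n4 : 0 ≤ 2 * (C₁ * ‖W₂‖) * h ^ 2 := by positivity
      have n5 := norm_sub_le (kinQuot T μ 0 (magRes (a h)) (f₁ - f₀)) Ψ
      have e : C * h ^ 2 = C₃ * (((‖W‖ + |l| + 1) * D + D) * h ^ 2) + C₂ * (L * h ^ 2) * F +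
          2 * (C₁ * ‖W₂‖) * h ^ 2 := by rw [hC]; ring
      rw [e]
      linarith
  · obtain ⟨β₂, hβ₂, hβ₂n⟩ := hquad (a h) hah.cont l' hl'2 hl'1 _ _
      (mem_mulGraph_weighted_potential hV hV' β)
    rw [← hβX] at hβ₂
    have hW₂β : ‖W₂ β‖ ≤ ‖W₂‖ := by simpa [hβ1] using W₂.le_opNorm β
    have hβ₂n' : ‖β₂‖ ≤ C₁ * ‖W₂‖ := hβ₂n.trans (mul_le_mul_of_nonneg_left hW₂β hC₁.le)
    refine ⟨β₂ - α₂, Submodule.sub_mem _ hβ₂ hα₂, (norm_sub_le _ _).trans ?_⟩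
    have : 0 < C₃ * ((‖W‖ + |l| + 1) * D + D) := by positivity
    have : 0 ≤ C₂ * L * F := by positivity
    rw [hC]; linarith

/-- Regularity of a small difference with respect to a nearby vector potential. -/
theorem exists_norm_add_magneticLaplacian_le {a a' : R3 → R3} (ha : Continuous a)
    (ha' : Continuous a') {L h C κ : ℝ} (hL : 0 ≤ L) (hC : 0 ≤ C) (hh : h ^ 2 ≤ 1) (hκ : 0 ≤ κ)
    (hLip : ∀ j x y, |(a' x j - a x j) - (a' y j - a y j)| ≤ L * h ^ 2 * ‖x - y‖)
    (hb : ∀ j x, |a' x j - a x j| ≤ L * h ^ 2 * ‖x‖) (hgr : ∀ j x, |a x j| ≤ κ * (1 + ‖x‖))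
    {u Φ u₂ : L2} (hu : u = magRes a Φ) (hΦ : ‖Φ‖ ≤ C * h ^ 2)
    (hu₂ : (u, u₂) ∈ mulGraph fun x => 1 + ‖x‖ ^ 2) (hu₂C : ‖u₂‖ ≤ C) :
    ∃ hd : u ∈ (magneticLaplacian a').domain, ‖u + magneticLaplacian a' ⟨u, hd⟩‖ ≤
      (C + 6 * L * (4 * C ^ 2 + 12 * C ^ 2 + 1) + 3 * L ^ 2 * C + 3 * L * C) * h ^ 2 := by
  have hh0 := sq_nonneg h
  obtain ⟨χ, hχ⟩ : ∃ χ, HasMagLaplacian a u χ (Φ - u) := by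
    rw [hasMagLaplacian_iff, sub_add_cancel]; exact hu
  have hun : ‖u‖ ≤ C * h ^ 2 := by
    rw [hu]
    refine le_trans ?_ hΦ
    simpa using (magRes a).le_of_opNorm_le (norm_magRes_le a) Φ
  have hCh : C * h ^ 2 ≤ C := mul_le_of_le_one_right hC hh
  have hgn : ‖Φ - u‖ ≤ 2 * C := (norm_sub_le _ _).trans (by linarith)
  choose χ₁ hχ₁ hχ₁n using hχ.exists_weighted_grad ha hu₂
  have hχ₁b : ∀ j, ‖χ₁ j‖ ≤ 4 * C ^ 2 + 12 * C ^ 2 + 1 := fun j => by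
    have n1 : ‖u₂‖ * ‖Φ - u‖ ≤ C * (2 * C) := mul_le_mul hu₂C hgn (norm_nonneg _) hC
    have n2 : ‖u‖ ^ 2 ≤ C ^ 2 := pow_le_pow_left₀ (norm_nonneg _) (hun.trans hCh) 2
    have := hχ₁n j
    nlinarith
  obtain ⟨χ', g', hg', hgg⟩ := hχ.change ha ha' (mul_nonneg hL hh0) hκ hLip hb hgr hu₂ hχ₁
  have hmem : (u, g') ∈ (magneticLaplacian a').graph := by
    rw [mem_graph_magneticLaplacian ha', ← hasMagLaplacian_iff]
    exact ⟨χ', hg'⟩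
  have hd : u ∈ (magneticLaplacian a').domain := LinearPMap.mem_domain_iff.2 ⟨g', hmem⟩
  have hval : magneticLaplacian a' ⟨u, hd⟩ = g' :=
    LinearPMap.mem_graph_snd_inj _ (LinearPMap.mem_graph _ ⟨u, hd⟩) hmem rfl
  refine ⟨hd, ?_⟩
  rw [hval]
  -- The graph norm for `a'` is that for `a`, which is `Φ`, plus the cost of changing the potential.
  have e : u + g' = Φ + (g' - (Φ - u)) := by abel
  rw [e]
  have hsum : ∑ j, ‖χ₁ j‖ ≤ 3 * (4 * C ^ 2 + 12 * C ^ 2 + 1) := by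
    refine (Finset.sum_le_sum fun j _ => hχ₁b j).trans (le_of_eq ?_)
    simp; ring
  have n1 := mul_le_mul_of_nonneg_left hsum (by positivity : 0 ≤ 2 * (L * h ^ 2))
  have n2 := mul_le_mul_of_nonneg_left hu₂C (by positivity : 0 ≤ 3 * (L * h ^ 2) ^ 2)
  have n3 := mul_le_mul_of_nonneg_left (hun.trans hCh) (by positivity : 0 ≤ 3 * (L * h ^ 2))
  have n4 : 3 * (L * h ^ 2) ^ 2 * C ≤ 3 * L ^ 2 * C * h ^ 2 := by
    have := mul_le_mul_of_nonneg_left hh (by positivity : 0 ≤ 3 * L ^ 2 * C * h ^ 2)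
    nlinarith
  refine (norm_add_le _ _).trans ?_
  nlinarith

end Eigenfunction

end MagneticBCS

namespace MagneticBCS

/-! ### The lowest eigenvalue in a weak magnetic field -/

section LowestEigenvalue

theorem IsEigenvalue.mem_opSpectrum {H : Type*} [NormedAddCommGroup H] [InnerProductSpace ℂ H]
    {S : H →ₗ.[ℂ] H} {l : ℝ} (h : IsEigenvalue S l) : (l : ℂ) ∈ opSpectrum S := by
  rintro ⟨R, hR, -⟩
  obtain ⟨ψ, hψ, h0⟩ := Submodule.exists_mem_ne_zero_of_ne_bot h
  obtain ⟨hd, he⟩ := mem_opEigenspace.1 hψ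
  have h1 : scalarSub (l : ℂ) S ⟨ψ, hd⟩ = 0 := by
    have h2 : scalarSub (l : ℂ) S ⟨ψ, hd⟩ = (l : ℂ) • ψ + -(S ⟨ψ, hd⟩) := rfl
    rw [h2, he, add_neg_cancel]
  have h3 := hR ⟨ψ, hd⟩
  rw [h1, map_zero] at h3
  exact h0 h3.symm

theorem spectralProjection_apply_of_mem {H : Type*} [NormedAddCommGroup H] [InnerProductSpace ℂ H]
    [CompleteSpace H] {S : H →ₗ.[ℂ] H} {Λ : Set ℝ} {l : ℝ} (hl : l ∈ Λ) {ψ : H}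
    (hψ : ψ ∈ opEigenspace S (l : ℂ)) : spectralProjection S Λ ψ = ψ :=
  Submodule.starProjection_eq_self_iff.2 (Submodule.le_topologicalClosure _
    (Submodule.mem_iSup_of_mem l (Submodule.mem_iSup_of_mem hl hψ)))

/-- A line contains a unit vector having nonnegative inner product with a given vector. -/
theorem exists_unit_inner_nonneg {H : Type*} [NormedAddCommGroup H] [InnerProductSpace ℂ H]
    {K : Submodule ℂ H} (hK : K ≠ ⊥) (α : H) :
    ∃ β ∈ K, ‖β‖ = 1 ∧ 0 ≤ (⟪α, β⟫_ℂ).re ∧ (⟪α, β⟫_ℂ).im = 0 := by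
  obtain ⟨ψ, hψ, h0⟩ := Submodule.exists_mem_ne_zero_of_ne_bot hK
  have hn : ‖ψ‖ ≠ 0 := norm_ne_zero_iff.2 h0
  by_cases hz : ⟪α, ψ⟫_ℂ = 0
  · refine ⟨((‖ψ‖⁻¹ : ℝ) : ℂ) • ψ, K.smul_mem _ hψ, ?_, ?_, ?_⟩
    · rw [norm_smul, Complex.norm_real, norm_inv, norm_norm, inv_mul_cancel₀ hn]
    · rw [inner_smul_right, hz, mul_zero, Complex.zero_re]
    · rw [inner_smul_right, hz, mul_zero, Complex.zero_im]
  · set w := ⟪α, ψ⟫_ℂ with hw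
    have hwn : ‖w‖ ≠ 0 := norm_ne_zero_iff.2 hz
    have h1 : ⟪α, ((‖ψ‖⁻¹ * ‖w‖⁻¹ : ℝ) * (starRingEnd ℂ) w : ℂ) • ψ⟫_ℂ =
        ((‖ψ‖⁻¹ * ‖w‖ : ℝ) : ℂ) := by
      rw [inner_smul_right, ← hw, mul_assoc, mul_comm (starRingEnd ℂ w), Complex.mul_conj,
        Complex.normSq_eq_norm_sq, ← Complex.ofReal_mul]
      congr 1
      field_simp
    refine ⟨_, K.smul_mem ((‖ψ‖⁻¹ * ‖w‖⁻¹ : ℝ) * (starRingEnd ℂ) w : ℂ) hψ, ?_, ?_, ?_⟩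
    · rw [norm_smul, norm_mul, Complex.norm_real, RCLike.norm_conj, norm_mul, norm_inv, norm_inv,
        norm_norm, norm_norm]
      field_simp
    · rw [h1, Complex.ofReal_re]; positivity
    · rw [h1, Complex.ofReal_im]

variable {T μ : ℝ} {V : R3 → ℝ}

/-- Part (a) with `m = 1` leaves one simple eigenvalue within `ε` of `l`, and nothing lies below the
window. For an eigenfunction, `β - Pβ = (P_h - P)β`, so the projection estimate becomes an estimate
of `β - α`. -/
theorem exists_lowest_eigenvalue_weak_field (hT : 0 < T) (hV : IsBdd V)
    (hV' : IsBdd fun x => (1 + ‖x‖ ^ 2) * V x) (hV2 : MemLp (fun x => (V x : ℂ)) 2 volume)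
    {a : ℝ → R3 → R3} {L : ℝ} (hL : 0 < L)
    (ha : ∀ h, 0 < h → IsLipPotential (a h) (L * h ^ 2)) {l : ℝ} {α : L2}
    (hlow : IsLowestEigenvalue (bcsOperator T μ 0 V) l)
    (hl : IsIsolatedEigenvalue (bcsOperator T μ 0 V) l)
    (hl1 : Module.finrank ℂ (opEigenspace (bcsOperator T μ 0 V) (l : ℂ)) = 1)
    (hα : α ∈ opEigenspace (bcsOperator T μ 0 V) (l : ℂ)) (hα1 : ‖α‖ = 1) :
    ∃ h₀ C : ℝ, 0 < h₀ ∧ 0 < C ∧ ∀ h : ℝ, 0 < h → h ≤ h₀ → ∃ lh : ℝ,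
      IsLowestEigenvalue (bcsOperator T μ (a h) V) lh ∧
      Module.finrank ℂ (opEigenspace (bcsOperator T μ (a h) V) (lh : ℂ)) = 1 ∧
      |lh - l| ≤ C * h ^ 2 ∧
      ∀ β ∈ opEigenspace (bcsOperator T μ (a h) V) (lh : ℂ), ‖β‖ = 1 → 0 ≤ (⟪α, β⟫_ℂ).re →
        (⟪α, β⟫_ℂ).im = 0 → ‖β - α‖ ≤ C * h ^ 2 := by
  have hls : l < symbolMin T μ := by
    obtain ⟨-, ε₀, hε₀, hiso⟩ := hl
    exact lt_symbolMin_of_isolated hT hV hV' hε₀ hiso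
  obtain ⟨ε, h₁, C, hε, hh₁, hC, H⟩ := exists_eigenvalues_weak_field hT hV hV' hL ha one_pos hl hl1
  obtain ⟨h₂, hh₂, H₂⟩ := lt_of_isEigenvalue_weak_field hT hV hV' hV2 hL ha hlow hls hε
  refine ⟨min h₁ h₂, 2 * C, lt_min hh₁ hh₂, by positivity, fun h hh hle => ?_⟩
  obtain ⟨lam, hmult, hspec, hdist, hproj⟩ := H h hh (hle.trans (min_le_left _ _))
  have hrange : ∀ t : ℝ, (t : ℂ) ∈ Set.range (fun i => (lam i : ℂ)) → t = lam 0 := by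
    rintro t ⟨i, hi⟩
    rw [Subsingleton.elim 0 i]
    exact (Complex.ofReal_injective hi).symm
  have hone : Module.finrank ℂ (opEigenspace (bcsOperator T μ (a h) V) (lam 0 : ℂ)) = 1 := by
    rw [hmult 0, Finset.filter_true_of_mem fun j _ => by rw [Subsingleton.elim j 0]]; rfl
  have hnear : |lam 0 - l| < ε := by
    have h1 : (lam 0 : ℂ) ∈ Metric.ball (l : ℂ) ε :=
      (hspec.symm.subset (Set.mem_range_self (f := fun i => (lam i : ℂ)) 0)).2
    rwa [mem_ball_iff_norm, ← Complex.ofReal_sub, Complex.norm_real, Real.norm_eq_abs] at h1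
  refine ⟨lam 0, ⟨fun h0 => ?_, fun l' hl' => ?_⟩, hone, ?_, fun β hβ hβ1 hre him => ?_⟩
  · rw [h0, finrank_bot] at hone
    exact zero_ne_one hone
  · have h1 := H₂ h hh (hle.trans (min_le_right _ _)) l' hl'
    rcases lt_or_ge l' (l + ε) with h2 | h2
    · refine (hrange l' (hspec.subset ⟨hl'.mem_opSpectrum, ?_⟩)).ge
      rw [mem_ball_iff_norm, ← Complex.ofReal_sub, Complex.norm_real, Real.norm_eq_abs, abs_lt]
      constructor <;> linarith
    · linarith [(abs_lt.1 hnear).2]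
  · refine (hdist 0).trans ?_
    nlinarith [sq_nonneg h]
  · set K := opEigenspace (bcsOperator T μ 0 V) (l : ℂ) with hK
    have hfin : FiniteDimensional ℂ K := FiniteDimensional.of_finrank_pos (by rw [hl1]; exact one_pos)
    have hr : LinearMap.range (K.starProjection : L2 →ₗ[ℂ] L2) = K :=
      Submodule.range_starProjection K
    have : FiniteDimensional ℂ (LinearMap.range (K.starProjection : L2 →ₗ[ℂ] L2)) := by
      rw [hr]; exact hfin
    have hP : spectralProjection (bcsOperator T μ 0 V) {l} = K.starProjection :=
      spectralProjection_eq (isSelfAdjoint_starProjection K) K.isIdempotentElem_starProjection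
        (by rw [hr]; simp [hK])
    have hα0 : (⟨α, hα⟩ : K) ≠ 0 := fun h0 => by
      have : α = 0 := congrArg Subtype.val h0
      rw [this, norm_zero] at hα1
      exact zero_ne_one hα1
    obtain ⟨z, hz⟩ := (finrank_eq_one_iff_of_nonzero' _ hα0).1 hl1
      ⟨K.starProjection β, Submodule.starProjection_apply_mem K β⟩
    have h1 := norm_sub_le_two_mul_of_projection (isSelfAdjoint_starProjection K)
      K.isIdempotentElem_starProjection (Submodule.starProjection_eq_self_iff.2 hα)
      ⟨z, (congrArg Subtype.val hz).symm⟩ hα1 hβ1 hre him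
    have h2 := ContinuousLinearMap.le_of_opNorm_le _ hproj β
    rw [sub_apply, spectralProjection_apply_of_mem (Set.mem_range_self 0) hβ, hP, hβ1,
      mul_one] at h2
    linarith

theorem memLp_of_weighted (hV : IsBdd V)
    (hV2 : MemLp (fun x => (1 + ‖x‖ ^ 2) * V x) 2 volume) : MemLp (fun x => (V x : ℂ)) 2 volume := by
  refine (hV2.ofReal (K := ℂ)).mono hV.1 (Filter.Eventually.of_forall fun x => ?_)
  rw [Complex.norm_real, RCLike.norm_ofReal, abs_mul, ← Real.norm_eq_abs (V x),
    abs_of_nonneg (by positivity : 0 ≤ 1 + ‖x‖ ^ 2)]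
  nlinarith [norm_nonneg (V x), mul_nonneg (sq_nonneg ‖x‖) (norm_nonneg (V x))]

end LowestEigenvalue

end MagneticBCS

/-! ### Assembly of the two parts. -/

theorem mainTheorem5 (T μ : ℝ) (hT : 0 < T)
    (V : R3 → ℝ)
    (hV2 : MemLp (fun x => (1 + ‖x‖ ^ 2) * V x) 2 volume)
    (hVinf : MemLp (fun x => (1 + ‖x‖ ^ 2) * V x) ∞ volume)
    (A : R3 → R3) (hAcont : Continuous A) (hA0 : A 0 = 0)
    (hA : ∀ j : Fin 3, MemSobolevInfty 3 (fun x => A x j)) :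
    -- part (a)
    (∀ (l : ℝ) (m : ℕ), 0 < m →
      IsIsolatedEigenvalue (bcsOperator T μ 0 V) l →
      Module.finrank ℂ (opEigenspace (bcsOperator T μ 0 V) (l : ℂ)) = m →
      ∃ ε h₀ C : ℝ, 0 < ε ∧ 0 < h₀ ∧ 0 < C ∧ ∀ h : ℝ, 0 < h → h ≤ h₀ →
        ∃ lam : Fin m → ℝ,
          (∀ i, Module.finrank ℂ
              (opEigenspace (bcsOperator T μ (fullPotential A h) V) (lam i : ℂ)) =
            (Finset.univ.filter fun j => lam j = lam i).card) ∧
          opSpectrum (bcsOperator T μ (fullPotential A h) V) ∩ Metric.ball (l : ℂ) ε =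
            Set.range (fun i => (lam i : ℂ)) ∧
          (∀ i, |lam i - l| ≤ C * h ^ 2) ∧
          ‖spectralProjection (bcsOperator T μ (fullPotential A h) V) (Set.range lam) -
            spectralProjection (bcsOperator T μ 0 V) {l}‖ ≤ C * h ^ 2) ∧
    -- part (b)
    (∀ (l : ℝ) (α : L2),
      IsLowestEigenvalue (bcsOperator T μ 0 V) l →
      IsIsolatedEigenvalue (bcsOperator T μ 0 V) l →
      Module.finrank ℂ (opEigenspace (bcsOperator T μ 0 V) (l : ℂ)) = 1 →
      α ∈ opEigenspace (bcsOperator T μ 0 V) (l : ℂ) → ‖α‖ = 1 →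
      ∃ h₀ C : ℝ, 0 < h₀ ∧ 0 < C ∧ ∀ h : ℝ, 0 < h → h ≤ h₀ →
        ∃ lh : ℝ,
          IsLowestEigenvalue (bcsOperator T μ (fullPotential A h) V) lh ∧
          Module.finrank ℂ
            (opEigenspace (bcsOperator T μ (fullPotential A h) V) (lh : ℂ)) = 1 ∧
          (∃ β ∈ opEigenspace (bcsOperator T μ (fullPotential A h) V) (lh : ℂ),
            ‖β‖ = 1 ∧ 0 ≤ (⟪α, β⟫_ℂ).re ∧ (⟪α, β⟫_ℂ).im = 0) ∧
          ∀ β ∈ opEigenspace (bcsOperator T μ (fullPotential A h) V) (lh : ℂ),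
            ‖β‖ = 1 → 0 ≤ (⟪α, β⟫_ℂ).re → (⟪α, β⟫_ℂ).im = 0 →
            ∃ hd : β - α ∈ (piSq h).domain,
              ‖(β - α) + piSq h ⟨β - α, hd⟩‖ ≤ C * h ^ 2) := by
  obtain ⟨hV, hV'⟩ := isBdd_of_weighted hVinf
  have hVc := memLp_of_weighted hV hV2
  obtain ⟨L, hL, ha, ha'⟩ := exists_isLipPotential hAcont hA0 hA
  refine ⟨fun l m hm hl hlm => exists_eigenvalues_weak_field hT hV hV' hL ha hm hl hlm,
    fun l α hlow hl hl1 hα hα1 => ?_⟩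
  have hls : l < symbolMin T μ := by
    obtain ⟨-, ε₀, hε₀, hiso⟩ := hl
    exact lt_symbolMin_of_isolated hT hV hV' hε₀ hiso
  obtain ⟨h₁, D, hh₁, hD, H₁⟩ :=
    exists_lowest_eigenvalue_weak_field hT hV hV' hVc hL ha hlow hl hl1 hα hα1
  obtain ⟨h₂, C, hh₂, hC, hh₂1, H₂⟩ :=
    exists_bound_of_near_eigenfunction hT hV hV' hL ha hls hα hα1 hD
  refine ⟨min h₁ h₂, C + 6 * L * (4 * C ^ 2 + 12 * C ^ 2 + 1) + 3 * L ^ 2 * C + 3 * L * C,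
    lt_min hh₁ hh₂, by positivity, fun h hh hle => ?_⟩
  obtain ⟨lh, hlh, hone, hdist, hβα⟩ := H₁ h hh (hle.trans (min_le_left _ _))
  refine ⟨lh, hlh, hone, exists_unit_inner_nonneg hlh.1 α, fun β hβ hβ1 hre him => ?_⟩
  obtain ⟨⟨Φ, hΦ, hΦn⟩, u₂, hu₂, hu₂n⟩ := H₂ h hh (hle.trans (min_le_right _ _)) lh β hdist hβ hβ1
    (hβα β hβ hβ1 hre him)
  have hsq : h ^ 2 ≤ 1 := by
    have := (hle.trans (min_le_right _ _)).trans hh₂1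
    nlinarith
  obtain ⟨hcont, hLip, hb⟩ := ha' h hh
  -- The potential is changed from `𝐀_h` to that of the constant field. Their difference comes from
  -- `A` alone and is Lipschitz with constant O(h²).
  refine exists_norm_add_magneticLaplacian_le (ha h hh).cont hcont hL.le hC.le hsq hL.le hLip hb
    (fun j x => ((ha h hh).le j x).trans ?_) hΦ hΦn hu₂ hu₂n
  have h1 := mul_le_mul_of_nonneg_left hsq hL.le
  have h2 := mul_le_mul_of_nonneg_right h1 (norm_nonneg x)
  linarith
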